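/- \textbf{Theorem.} Let $\mathbb K=\mathbb Q(q,t)$. Throughout, "graded" means $\mathbb Z_{\ge 0}$-graded. \emph{Algebras.} For $n\ge1$ let $\mathscr D_n^+$ be the positive double affine Hecke algebra of type $GL_n$: the $\mathbb K$-algebra generated by $T_1,\dots,T_{n-1}$, $X_1,\dots,X_n$, $Y_1,\dots,Y_n$ with relations $(T_i-1)(T_i+q)=0$; $T_iT_{i+1}T_i=T_{i+1}T_iT_{i+1}$; $T_iT_j=T_jT_i$ for $|i-j|>1$; $T_i^{-1}X_iT_i^{-1}=q^{-1}X_{i+1}$; $T_iY_iT_i=qY_{i+1}$; $T_iX_j=X_jT_i$ and $T_iY_j=Y_jT_i$ for $j\notin\{i,i+1\}$; $X_iX_j=X_jX_i$; $Y_iY_j=Y_jY_i$; $Y_1T_1X_1=X_2Y_1T_1$ (if $n\geq 2$); $Y_1X_1\cdots X_n=tX_1\cdots X_nY_1$; and $\pi X_n=tX_1\pi$, where $\pi=\pi^{(n)}:=q^{-n}Y_1T_1\cdots T_{n-1}$. It is graded by $\deg T_i=\deg Y_i=0$, $\deg X_i=1$. Let $\mathscr A_n$, $\mathscr A^X_n$,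 $\mathscr H_n$ be the subalgebras generated by all $T_i,Y_i$, by all $T_i,X_i$, and by all $T_i$, and let $\rho_n:\mathscr A_n\to\mathscr H_n$ be the algebra homomorphism with $\rho_n(T_i)=T_i$, $\rho_n(\pi)=T_1^{-1}\cdots T_{n-1}^{-1}$. For $0\le k\le n$ let $$\epsilon_k=\frac1{[n-k]_q!}\sum_{\sigma}q^{\binom{n-k}2-\ell(\sigma)}T_\sigma,\qquad [m]_q!=\prod_{i=1}^m\tfrac{1-q^i}{1-q},$$ the sum being over the permutations $\sigma\in\mathfrak S_n$ that fix $1,\dots,k$. Let $\mathbb B_{q,t}$ be the path algebra with vertices $k\in\mathbb Z_{\ge0}$ (whose vertex idempotents are orthogonal), arrows $d_+:k\to k+1$, $d_-:k+1\to k$ and loops $T_1,\dots,T_{k-1},z_1,\dots,z_k$ at $k$, modulo the following relations, imposed on paths that start at the vertex $k$, whenever they make sense: $(T_i-1)(T_i+q)=0$; $T_iT_{i+1}T_i=T_{i+1}T_iT_{i+1}$; $T_iT_j=T_jT_i$ for $|i-j|>1$; $T_i^{-1}z_{i+1}T_i^{-1}=q^{-1}z_i$; $z_iT_j=T_jz_i$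 for $i\notin\{j,j+1\}$; $z_iz_j=z_jz_i$; $d_-^2T_{k-1}=d_-^2$ ($k\ge2$); $d_-T_i=T_id_-$ ($1\le i\le k-2$); $T_1d_+^2=d_+^2$; $d_+T_i=T_{i+1}d_+$ ($1\le i\le k-1$); $q\varphi d_-=d_-\varphi T_{k-1}$ ($k\ge2$); $T_1\varphi d_+=qd_+\varphi$ ($k\ge1$); $z_id_-=d_-z_i$ ($1\le i\le k-1$); $d_+z_i=z_{i+1}d_+$ ($1\le i\le k$); $z_1(qd_+d_--d_-d_+)=qt(d_+d_--d_-d_+)z_k$ ($k\ge1$); here $\varphi=\frac1{q-1}(d_+d_--d_-d_+)$. It is graded by $\deg d_+=1$, $\deg T_i=\deg z_i=\deg d_-=0$. \emph{Sequences.} A family $((U^{(n)})_{n\ge n_0},(\kappa^{(n)}:U^{(n+1)}\to U^{(n)})_{n\ge n_0})$ with $n_0\ge1$ is \emph{pre-compatible} if each $U^{(n)}$ is a graded $\mathscr A_n$-module ($\mathscr A_n$ being in degree $0$) and each $\kappa^{(n)}$ is a degree-preserving $\mathscr H_n$-module map with $\kappa^{(n)}\pi^{(n+1)}T_n=\pi^{(n)}\kappa^{(n)}$.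 A family $D=((V^{(n)})_{n\ge n_1},(\Pi^{(n)}:V^{(n+1)}\to V^{(n)})_{n\ge n_1})$ with $n_1\ge 1$ is \emph{compatible} if each $V^{(n)}$ is a graded $\mathscr D_n^+$-module and each $\Pi^{(n)}$ is a degree-preserving $\mathscr A_n^X$-module map with $\Pi^{(n)}X_{n+1}=0$ and $\Pi^{(n)}\pi^{(n+1)}T_n=\pi^{(n)}\Pi^{(n)}$. For such $D$ put $L_k(V^{(n)})=X_1\cdots X_k\epsilon_k(V^{(n)})$ for $k\le n$ and $L_k(V^{(n)})=0$ for $k>n$; let $\mathfrak L_k(D)=\bigoplus_{d\ge0}\mathfrak L_k(D)(d)$, where $\mathfrak L_k(D)(d)$ is the space of sequences $(v_n)_{n\ge n_1}$ with $v_n\in L_k(V^{(n)})$ homogeneous of degree $d$ and $\Pi^{(n)}(v_{n+1})=v_n$ for all $n$, and let $\mathfrak L_\bullet(D)=\bigoplus_{k\ge0}\mathfrak L_k(D)$. \emph{The sequence $C_\lambda$.} For a partition $\mu$ of $n$ let $S_\mu$ be Young's seminormal $\mathscr H_n$-module: it has a basis $e_\tau$ indexed by the standard Young tableaux $\tau$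 of shape $\mu$, and, writing $c_\tau(i)$ for the content (column minus row) of the box of $\tau$ that contains $i$, $c=c_\tau(i)$, $c'=c_\tau(i+1)$, and $s_i(\tau)$ for $\tau$ with $i$ and $i+1$ exchanged, $T_ie_\tau$ is: $e_\tau$ if $i,i+1$ are in the same row of $\tau$; $-qe_\tau$ if they are in the same column; $e_{s_i(\tau)}+\frac{(1-q)q^c}{q^c-q^{c'}}e_\tau$ if $c-c'>1$; and $-\frac{(q^{c'+1}-q^c)(q^{c+1}-q^{c'})}{(q^{c'}-q^c)^2}e_{s_i(\tau)}+\frac{(1-q)q^c}{q^c-q^{c'}}e_\tau$ if $c'-c>1$. Let $\lambda$ be any partition, $n_\lambda=\max(1,|\lambda|+\lambda_1)$, and for $n\ge n_\lambda$ let $\lambda^{(n)}=(n-|\lambda|,\lambda)$. Let $U_\lambda^{(n)}=\rho_n^*(S_{\lambda^{(n)}})$, in degree $0$, and let $\kappa_\lambda^{(n)}:U_\lambda^{(n+1)}\to U_\lambda^{(n)}$ send $e_\tau$ to $e_{\tau|_{\lambda^{(n)}}}$ if the box of $\lambda^{(n+1)}/\lambda^{(n)}$ has the entry $n+1$ in $\tau$,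 and to $0$ otherwise. Let $C_\lambda=((U_\lambda^{(n)})_{n\ge n_\lambda},(\kappa_\lambda^{(n)})_{n\ge n_\lambda})$. Then: (1) $C_\lambda$ is pre-compatible. (2) For every $n\ge n_\lambda$ there is a unique linear map $\Pi^{(n)}:\mathscr D_{n+1}^+\otimes_{\mathscr A_{n+1}}U_\lambda^{(n+1)}\to\mathscr D_n^+\otimes_{\mathscr A_n}U_\lambda^{(n)}$ with $\Pi^{(n)}(X_1^{\alpha_1}\cdots X_{n+1}^{\alpha_{n+1}}\otimes u)=X_1^{\alpha_1}\cdots X_n^{\alpha_n}\otimes\kappa_\lambda^{(n)}(u)$ if $\alpha_{n+1}=0$ and $=0$ if $\alpha_{n+1}>0$. The family $\mathrm{Ind}(C_\lambda)$ of the modules $\mathscr D_n^+\otimes_{\mathscr A_n}U_\lambda^{(n)}$, graded by $\deg(X^\alpha\otimes u)=|\alpha|$, with these maps, is compatible. (3) There is a unique graded $\mathbb B_{q,t}$-module structure on $\mathfrak L_\bullet(\mathrm{Ind}(C_\lambda))$ in which the $k$-th idempotent projects onto $\mathfrak L_k$ and the generators act on $(v_n)_n\in\mathfrak L_k$ componentwise: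 $T_i$ by $T_i$, $z_i$ by $(qt)^{-1}Y_i$, $d_+$ by $q^kX_1T_1^{-1}\cdots T_k^{-1}$ for $n\ge k+1$ (and by $0$ for $n\leq k$), and $d_-$ by $(q-1)(1+qT_k^{-1}+\cdots+q^{n-k}T_{n-1}^{-1}\cdots T_k^{-1})$ for $n\ge k$ (and by $0$ for $n<k$). (4) $\mathfrak L_\bullet(\mathrm{Ind}(C_\lambda))\neq0$. -/

import Mathlib

open scoped TensorProduct DirectSum

noncomputable section

namespace MurnaghanB

/-! ### The base field `ℚ(q,t)` -/

/-- The field `ℚ(q,t)` of rational functions in two algebraically independent variables. -/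
abbrev Kqt : Type := FractionRing (MvPolynomial (Fin 2) ℚ)

/-- The variable `q`. -/
def q : Kqt := algebraMap (MvPolynomial (Fin 2) ℚ) Kqt (MvPolynomial.X 0)

/-- The variable `t`. -/
def t : Kqt := algebraMap (MvPolynomial (Fin 2) ℚ) Kqt (MvPolynomial.X 1)

theorem q_ne_zero : q ≠ 0 := by
  unfold q
  intro h
  have := (IsFractionRing.injective (MvPolynomial (Fin 2) ℚ) Kqt) (h.trans (map_zero _).symm)
  exact MvPolynomial.X_ne_zero (R := ℚ) (0 : Fin 2) this

theorem q_pow_ne_one (m : ℕ) (hm : m ≠ 0) : q ^ m ≠ 1 := by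
  unfold q
  intro h
  rw [← map_pow] at h
  have h2 := (IsFractionRing.injective (MvPolynomial (Fin 2) ℚ) Kqt) (h.trans (map_one _).symm)
  have h3 := congrArg (MvPolynomial.eval (fun _ => (0 : ℚ))) h2
  simp [hm] at h3

theorem q_zpow_injective : Function.Injective (fun c : ℤ => q ^ c) := by
  have key : ∀ a b : ℤ, a < b → q ^ a ≠ q ^ b := by
    intro a b hab h
    obtain ⟨m, hm⟩ := Int.eq_ofNat_of_zero_le (sub_nonneg.mpr hab.le)
    have h1 : q ^ (b - a) = 1 := by
      rw [zpow_sub₀ q_ne_zero, h, div_self (zpow_ne_zero _ q_ne_zero)]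
    rw [hm, zpow_natCast] at h1
    exact q_pow_ne_one m (by omega) h1
  intro a b h
  rcases lt_trichotomy a b with h1 | h1 | h1
  · exact absurd h (key a b h1)
  · exact h1
  · exact absurd h.symm (key b a h1)

/-! ### Ordered products -/

/-- `f 1 * f 2 * ⋯ * f k`. -/
def prodUpTo {R : Type*} [Monoid R] (f : ℕ → R) : ℕ → R
  | 0 => 1
  | k + 1 => prodUpTo f k * f (k + 1)

/-- `f (k + j - 1) * ⋯ * f (k + 1) * f k`, with `j` factors. -/
def prodDown {R : Type*} [Monoid R] (f : ℕ → R) (k : ℕ) : ℕ → R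
  | 0 => 1
  | j + 1 => f (k + j) * prodDown f k j

theorem map_prodUpTo {R S F : Type*} [Monoid R] [Monoid S] [FunLike F R S] [MonoidHomClass F R S]
    (φ : F) (f : ℕ → R) (k : ℕ) : φ (prodUpTo f k) = prodUpTo (fun i => φ (f i)) k := by
  induction k with
  | zero => simp [prodUpTo]
  | succ k ih => simp [prodUpTo, ih]

theorem prodUpTo_congr {R : Type*} [Monoid R] {f g : ℕ → R} (k : ℕ)
    (h : ∀ i, 1 ≤ i → i ≤ k → f i = g i) : prodUpTo f k = prodUpTo g k := by
  induction k with
  | zero => rfl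
  | succ k ih =>
    simp only [prodUpTo]
    rw [ih (fun i h1 h2 => h i h1 (by omega)), h (k + 1) (by omega) le_rfl]

theorem prodUpTo_mem {R : Type*} [Ring R] [Algebra Kqt R] (S : Subalgebra Kqt R) {f : ℕ → R}
    (k : ℕ) (h : ∀ i, f i ∈ S) : prodUpTo f k ∈ S := by
  induction k with
  | zero => exact S.one_mem
  | succ k ih => exact S.mul_mem ih (h _)

/-! ### The positive double affine Hecke algebra -/

/-- Names of the generators; only `T i` with `1 ≤ i ≤ n - 1` and `X i`, `Y i` with `1 ≤ i ≤ n`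
are generators in rank `n`, the other names are set to zero. -/
inductive DGen : Type
  | T (i : ℕ)
  | X (i : ℕ)
  | Y (i : ℕ)

/-- The free algebra on the names. -/
abbrev DFree : Type := FreeAlgebra Kqt DGen

/-- The free generator `T_i`. -/
def fT (i : ℕ) : DFree := FreeAlgebra.ι Kqt (DGen.T i)
/-- The free generator `X_i`. -/
def fX (i : ℕ) : DFree := FreeAlgebra.ι Kqt (DGen.X i)
/-- The free generator `Y_i`. -/
def fY (i : ℕ) : DFree := FreeAlgebra.ι Kqt (DGen.Y i)

/-- Defining relations of the positive double affine Hecke algebra of type `GL_n`. The relation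
`T_i X_{i+1} T_i = q X_i` is `T_i⁻¹ X_i T_i⁻¹ = q⁻¹ X_{i+1}` cleared of inverses.
In the double affine Hecke algebra, where the `X_i` are invertible, the relations `Y_X` and `pi_X`
are equivalent given the others; in the algebra generated by the `X_i` without inverses `pi_X`
is the stronger one: it is `π X_n = t X_1 π` for `π = q⁻ⁿ Y_1 T_1 ⋯ T_{n-1}`. -/
inductive DRel (n : ℕ) : DFree → DFree → Prop
  | T_out (i : ℕ) (h : ¬ (1 ≤ i ∧ i < n)) : DRel n (fT i) 0
  | X_out (i : ℕ) (h : ¬ (1 ≤ i ∧ i ≤ n)) : DRel n (fX i) 0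
  | Y_out (i : ℕ) (h : ¬ (1 ≤ i ∧ i ≤ n)) : DRel n (fY i) 0
  | quad (i : ℕ) (h1 : 1 ≤ i) (h2 : i < n) :
      DRel n ((fT i - 1) * (fT i + algebraMap Kqt DFree q)) 0
  | braid (i : ℕ) (h1 : 1 ≤ i) (h2 : i + 1 < n) :
      DRel n (fT i * fT (i + 1) * fT i) (fT (i + 1) * fT i * fT (i + 1))
  | T_T (i j : ℕ) (h1 : 1 ≤ i) (h2 : i + 1 < j) (h3 : j < n) :
      DRel n (fT i * fT j) (fT j * fT i)
  | T_X_T (i : ℕ) (h1 : 1 ≤ i) (h2 : i < n) : DRel n (fT i * fX (i + 1) * fT i) (q • fX i)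
  | T_X (i j : ℕ) (h1 : 1 ≤ i) (h2 : i < n) (h3 : 1 ≤ j) (h4 : j ≤ n) (h5 : j ≠ i)
      (h6 : j ≠ i + 1) : DRel n (fT i * fX j) (fX j * fT i)
  | X_X (i j : ℕ) (h1 : 1 ≤ i) (h2 : i ≤ n) (h3 : 1 ≤ j) (h4 : j ≤ n) :
      DRel n (fX i * fX j) (fX j * fX i)
  | T_Y_T (i : ℕ) (h1 : 1 ≤ i) (h2 : i < n) : DRel n (fT i * fY i * fT i) (q • fY (i + 1))
  | T_Y (i j : ℕ) (h1 : 1 ≤ i) (h2 : i < n) (h3 : 1 ≤ j) (h4 : j ≤ n) (h5 : j ≠ i)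
      (h6 : j ≠ i + 1) : DRel n (fT i * fY j) (fY j * fT i)
  | Y_Y (i j : ℕ) (h1 : 1 ≤ i) (h2 : i ≤ n) (h3 : 1 ≤ j) (h4 : j ≤ n) :
      DRel n (fY i * fY j) (fY j * fY i)
  | Y_T_X (h : 2 ≤ n) : DRel n (fY 1 * fT 1 * fX 1) (fX 2 * fY 1 * fT 1)
  | Y_X (h : 1 ≤ n) : DRel n (fY 1 * prodUpTo fX n) (t • (prodUpTo fX n * fY 1))
  | pi_X (h : 1 ≤ n) : DRel n (fY 1 * prodUpTo fT (n - 1) * fX n)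
      (t • (fX 1 * (fY 1 * prodUpTo fT (n - 1))))

/-- The positive double affine Hecke algebra `𝒟_n⁺` of type `GL_n` over `ℚ(q,t)`. -/
def DAHA (n : ℕ) : Type := RingQuot (DRel n)

instance (n : ℕ) : Ring (DAHA n) := inferInstanceAs (Ring (RingQuot (DRel n)))

instance (n : ℕ) : Algebra Kqt (DAHA n) := inferInstanceAs (Algebra Kqt (RingQuot (DRel n)))

/-- The quotient map from the free algebra. -/
def dMk (n : ℕ) : DFree →ₐ[Kqt] DAHA n := RingQuot.mkAlgHom Kqt (DRel n)

theorem dMk_rel {n : ℕ} {x y : DFree} (h : DRel n x y) : dMk n x = dMk n y :=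
  RingQuot.mkAlgHom_rel Kqt h

/-- The generator `T_i` of `𝒟_n⁺` (zero unless `1 ≤ i ≤ n - 1`). -/
def dT (n i : ℕ) : DAHA n := dMk n (fT i)
/-- The generator `X_i` of `𝒟_n⁺` (zero unless `1 ≤ i ≤ n`). -/
def dX (n i : ℕ) : DAHA n := dMk n (fX i)
/-- The generator `Y_i` of `𝒟_n⁺` (zero unless `1 ≤ i ≤ n`). -/
def dY (n i : ℕ) : DAHA n := dMk n (fY i)

/-- In a `ℚ(q,t)`-algebra with `(T - 1)(T + q) = 0` this is the inverse `q⁻¹ (T + q - 1)` of `T`,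
see `mul_heckeInv` and `heckeInv_mul`. -/
def heckeInv {R : Type*} [Ring R] [Algebra Kqt R] (x : R) : R :=
  q⁻¹ • (x + algebraMap Kqt R (q - 1))

theorem mul_heckeInv {R : Type*} [Ring R] [Algebra Kqt R] {x : R}
    (h : (x - 1) * (x + algebraMap Kqt R q) = 0) : x * heckeInv x = 1 := by
  have h' : x * (x + algebraMap Kqt R (q - 1)) = algebraMap Kqt R q := by
    rw [map_sub, map_one]
    have : x * (x + (algebraMap Kqt R q - 1)) =
        (x - 1) * (x + algebraMap Kqt R q) + algebraMap Kqt R q := by noncomm_ring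
    rw [this, h, zero_add]
  rw [heckeInv, mul_smul_comm, h', Algebra.algebraMap_eq_smul_one, smul_smul,
    inv_mul_cancel₀ q_ne_zero, one_smul]

theorem heckeInv_mul {R : Type*} [Ring R] [Algebra Kqt R] {x : R}
    (h : (x - 1) * (x + algebraMap Kqt R q) = 0) : heckeInv x * x = 1 := by
  have h2 := mul_heckeInv h
  have hc : Commute x (heckeInv x) := by
    unfold heckeInv
    exact ((Commute.refl x).add_right (Algebra.commutes (q - 1) x).symm).smul_right _
  rw [← hc.eq, h2]

/-- The inverse `T_i⁻¹` in `𝒟_n⁺`, for `1 ≤ i ≤ n - 1`. -/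
def dTinv (n i : ℕ) : DAHA n := heckeInv (dT n i)

/-- `π = q⁻ⁿ Y_1 T_1 ⋯ T_{n-1}`. -/
def dPi (n : ℕ) : DAHA n := (q⁻¹ ^ n) • (dY n 1 * prodUpTo (dT n) (n - 1))

/-- The affine Hecke algebra `𝒜_n ⊆ 𝒟_n⁺`, generated by the `T_i` and `Y_i`. -/
def AHA (n : ℕ) : Subalgebra Kqt (DAHA n) :=
  Algebra.adjoin Kqt (Set.range (dT n) ∪ Set.range (dY n))

/-- The finite Hecke algebra `ℋ_n ⊆ 𝒟_n⁺`, generated by the `T_i`. -/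
def Hecke (n : ℕ) : Subalgebra Kqt (DAHA n) := Algebra.adjoin Kqt (Set.range (dT n))

theorem dT_mem_Hecke (n i : ℕ) : dT n i ∈ Hecke n := Algebra.subset_adjoin ⟨i, rfl⟩

theorem dT_mem_AHA (n i : ℕ) : dT n i ∈ AHA n := Algebra.subset_adjoin (Or.inl ⟨i, rfl⟩)

theorem dY_mem_AHA (n i : ℕ) : dY n i ∈ AHA n := Algebra.subset_adjoin (Or.inr ⟨i, rfl⟩)

/-- `T_i` as an element of `𝒜_n`. -/
def aT (n i : ℕ) : AHA n := ⟨dT n i, dT_mem_AHA n i⟩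

/-- `Y_i` as an element of `𝒜_n`. -/
def aY (n i : ℕ) : AHA n := ⟨dY n i, dY_mem_AHA n i⟩

/-- `π` as an element of `𝒜_n`. -/
def aPi (n : ℕ) : AHA n :=
  ⟨dPi n, (AHA n).smul_mem
    ((AHA n).mul_mem (dY_mem_AHA n 1) (prodUpTo_mem _ _ (dT_mem_AHA n))) _⟩

/-! ### Partial symmetrizers -/

/-- The simple transposition `s_i` exchanging `i` and `i + 1`, for `1 ≤ i ≤ n - 1`
(the point `j : Fin n` stands for `j + 1`). -/
def simpleTransp (n i : ℕ) : Equiv.Perm (Fin n) :=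
  if h : 1 ≤ i ∧ i < n then Equiv.swap ⟨i - 1, by omega⟩ ⟨i, h.2⟩ else 1

/-- The length `ℓ(σ)`, the number of inversions. -/
def permLength {n : ℕ} (σ : Equiv.Perm (Fin n)) : ℕ :=
  (Finset.univ.filter fun p : Fin n × Fin n => p.1 < p.2 ∧ σ p.2 < σ p.1).card

/-- `w = [i_1, …, i_r]` is a reduced expression `σ = s_{i_1} ⋯ s_{i_r}`. -/
def IsReducedWord {n : ℕ} (σ : Equiv.Perm (Fin n)) (w : List ℕ) : Prop :=
  (∀ i ∈ w, 1 ≤ i ∧ i < n) ∧ (w.map (simpleTransp n)).prod = σ ∧ w.length = permLength σ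

/-- `T_σ = T_{i_1} ⋯ T_{i_r}` for a reduced expression `σ = s_{i_1} ⋯ s_{i_r}`. -/
def dTperm {n : ℕ} (σ : Equiv.Perm (Fin n)) : DAHA n :=
  ((Classical.epsilon (IsReducedWord σ)).map (dT n)).prod

/-- `[m]_q! = ∏_{i=1}^m (1 - q^i) / (1 - q)`. -/
def qFactorial (m : ℕ) : Kqt := ∏ i ∈ Finset.Icc 1 m, (1 - q ^ i) / (1 - q)

open Classical in
/-- The partial trivial idempotent `ε_k` of `𝒟_n⁺`, for `0 ≤ k ≤ n`. The sum is over the Young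
subgroup of type `(1^k, n - k)`, that is, over the permutations that fix `1, …, k`. -/
def dEps (n k : ℕ) : DAHA n :=
  (qFactorial (n - k))⁻¹ •
    ∑ σ ∈ Finset.univ.filter (fun σ : Equiv.Perm (Fin n) => ∀ j : Fin n, j.val < k → σ j = j),
      q ^ (((n - k).choose 2 : ℤ) - (permLength σ : ℤ)) • dTperm σ

/-! ### Jucys–Murphy elements and the homomorphism `ρ_n : 𝒜_n → ℋ_n` -/

/-- Elements `T_1, …, T_{n-1}` that satisfy the relations of the finite Hecke algebra. -/
structure HeckeRelations {R : Type*} [Ring R] [Algebra Kqt R] (n : ℕ) (T : ℕ → R) : Prop where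
  quad : ∀ i, 1 ≤ i → i < n → (T i - 1) * (T i + algebraMap Kqt R q) = 0
  braid : ∀ i, 1 ≤ i → i + 1 < n → T i * T (i + 1) * T i = T (i + 1) * T i * T (i + 1)
  comm : ∀ i j, 1 ≤ i → i + 1 < j → j < n → T i * T j = T j * T i

/-- `jmAux n T m` is the Jucys–Murphy element of index `n - m`. -/
def jmAux {R : Type*} [Ring R] [Algebra Kqt R] (n : ℕ) (T : ℕ → R) : ℕ → R
  | 0 => algebraMap Kqt R q
  | m + 1 => q • (heckeInv (T (n - (m + 1))) * jmAux n T m * heckeInv (T (n - (m + 1))))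

/-- `J_i = q^{n-i+1} T_i⁻¹ ⋯ T_{n-1}⁻¹ T_{n-1}⁻¹ ⋯ T_i⁻¹`. -/
def jm {R : Type*} [Ring R] [Algebra Kqt R] (n : ℕ) (T : ℕ → R) (i : ℕ) : R := jmAux n T (n - i)

theorem commute_braid_aux {R : Type*} [Ring R] {a b a' b' J : R} (ha : a * a' = 1) (ha' : a' * a = 1)
    (hb : b * b' = 1) (hb' : b' * b = 1) (hab : a * b * a = b * a * b) (hJ : a * J = J * a) :
    b * (a' * (b' * J * b') * a') = (a' * (b' * J * b') * a') * b := by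
  have h1 : b * a' * b' = a' * b' * a := by
    calc b * a' * b' = (a' * b' * (b * a)) * (b * a' * b') := by
            rw [show a' * b' * (b * a) = a' * (b' * b) * a by noncomm_ring, hb', mul_one, ha',
              one_mul]
      _ = a' * b' * (b * a * b) * a' * b' := by noncomm_ring
      _ = a' * b' * (a * b * (a * a') * b') := by rw [← hab]; noncomm_ring
      _ = a' * b' * a := by rw [ha, mul_one, mul_assoc a b b', hb, mul_one]
  have h2 : a * b' * a' = b' * a' * b := by
    calc a * b' * a' = b' * a' * (a * b * a) * b' * a' := by
            rw [show b' * a' * (a * b * a) * b' * a' = b' * (a' * a) * b * a * b' * a' by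
              noncomm_ring, ha', mul_one, hb', one_mul]
      _ = b' * a' * (b * a * (b * b') * a') := by rw [hab]; noncomm_ring
      _ = b' * a' * b := by rw [hb, mul_one, mul_assoc b a a', ha, mul_one]
  calc b * (a' * (b' * J * b') * a') = (b * a' * b') * J * b' * a' := by noncomm_ring
    _ = a' * b' * (a * J) * b' * a' := by rw [h1]; noncomm_ring
    _ = a' * b' * J * (a * b' * a') := by rw [hJ]; noncomm_ring
    _ = _ := by rw [h2]; noncomm_ring

section JM

variable {R : Type*} [Ring R] [Algebra Kqt R] {n : ℕ} {T : ℕ → R}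

theorem commute_heckeInv {a x : R} (h : Commute a x) : Commute a (heckeInv x) := by
  unfold heckeInv
  exact (h.add_right (Algebra.commutes (q - 1) a).symm).smul_right _

theorem jm_last : jm n T n = algebraMap Kqt R q := by simp [jm, jmAux]

theorem jm_step (i : ℕ) (h2 : i < n) :
    jm n T i = q • (heckeInv (T i) * jm n T (i + 1) * heckeInv (T i)) := by
  have h : n - i = (n - (i + 1)) + 1 := by omega
  have h' : n - ((n - (i + 1)) + 1) = i := by omega
  unfold jm
  rw [h, jmAux, h']

theorem commute_jm_of (a : R) (m : ℕ) : ∀ j, n - j = m → j ≤ n →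
    (∀ i, j ≤ i → i < n → Commute a (T i)) → Commute a (jm n T j) := by
  induction m with
  | zero =>
    intro j hj hjn _
    obtain rfl : j = n := by omega
    rw [jm_last]
    exact (Algebra.commutes q a).symm
  | succ m ih =>
    intro j hj hjn h
    rw [jm_step j (by omega)]
    have hT := commute_heckeInv (h j le_rfl (by omega))
    exact ((hT.mul_right (ih (j + 1) (by omega) (by omega)
      (fun i h1 h2 => h i (by omega) h2))).mul_right hT).smul_right _

theorem HeckeRelations.commute (hT : HeckeRelations n T) (i j : ℕ) (hi : 1 ≤ i) (hin : i < n)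
    (hj : 1 ≤ j) (hjn : j < n) (h : i + 1 < j ∨ j + 1 < i) : Commute (T i) (T j) := by
  rcases h with h | h
  · exact hT.comm i j hi h hjn
  · exact (hT.comm j i hj h hin).symm

theorem commute_T_jm_upper (hT : HeckeRelations n T) (m : ℕ) : ∀ j i, n - j = m → 1 ≤ j → j < i →
    i < n → Commute (T i) (jm n T j) := by
  induction m with
  | zero => intro j i h1 h2 h3 h4; omega
  | succ m ih =>
    intro j i hm hj hji hin
    rw [jm_step j (by omega)]
    refine Commute.smul_right ?_ _
    by_cases h : i = j + 1
    · subst h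
      rw [jm_step (j + 1) hin]
      have hJ : Commute (T j) (jm n T (j + 2)) := commute_jm_of _ _ (j + 2) rfl (by omega)
        (fun i h1 h2 => hT.commute j i hj (by omega) (by omega) h2 (Or.inl (by omega)))
      have hqj := hT.quad j hj (by omega)
      have hqj' := hT.quad (j + 1) (by omega) hin
      have := commute_braid_aux (mul_heckeInv hqj) (heckeInv_mul hqj) (mul_heckeInv hqj')
        (heckeInv_mul hqj') (hT.braid j hj hin) hJ
      rw [mul_smul_comm, smul_mul_assoc]
      exact Commute.smul_right this q
    · have h1 := commute_heckeInv
        (hT.commute i j (by omega) hin hj (by omega) (Or.inr (by omega)))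
      exact (h1.mul_right (ih (j + 1) i (by omega) (by omega) (by omega) hin)).mul_right h1

theorem commute_T_jm (hT : HeckeRelations n T) (i j : ℕ) (hi : 1 ≤ i) (hin : i < n) (hj : 1 ≤ j)
    (hjn : j ≤ n) (h1 : j ≠ i) (h2 : j ≠ i + 1) : Commute (T i) (jm n T j) := by
  rcases lt_or_gt_of_ne h1 with h | h
  · exact commute_T_jm_upper hT _ j i rfl hj h hin
  · exact commute_jm_of _ _ j rfl hjn
      (fun k hk hkn => hT.commute i k hi hin (by omega) hkn (Or.inl (by omega)))

theorem commute_jm_jm (hT : HeckeRelations n T) (i j : ℕ) (hi : 1 ≤ i) (hin : i ≤ n) (hj : 1 ≤ j)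
    (hjn : j ≤ n) : Commute (jm n T i) (jm n T j) := by
  have key : ∀ i j, 1 ≤ i → i < j → j ≤ n → Commute (jm n T i) (jm n T j) := by
    intro i j hi hij hjn
    exact commute_jm_of _ _ j rfl hjn
      (fun k hk hkn => (commute_T_jm_upper hT _ i k rfl hi (by omega) hkn).symm)
  rcases lt_trichotomy i j with h | h | h
  · exact key i j hi h hjn
  · rw [h]
  · exact (key j i hj h hin).symm

theorem T_jm_T (hT : HeckeRelations n T) (i : ℕ) (hi : 1 ≤ i) (hin : i < n) :
    T i * jm n T i * T i = q • jm n T (i + 1) := by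
  have hq := hT.quad i hi hin
  rw [jm_step i hin, mul_smul_comm, smul_mul_assoc]
  congr 1
  calc T i * (heckeInv (T i) * jm n T (i + 1) * heckeInv (T i)) * T i
      = (T i * heckeInv (T i)) * jm n T (i + 1) * (heckeInv (T i) * T i) := by noncomm_ring
    _ = _ := by rw [mul_heckeInv hq, heckeInv_mul hq, one_mul, mul_one]

theorem jm_one_mul (hT : HeckeRelations n T) (m : ℕ) (hm : m < n) :
    jm n T 1 * prodUpTo T m = q ^ m • (prodUpTo (fun i => heckeInv (T i)) m * jm n T (m + 1)) := by
  induction m with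
  | zero => simp [prodUpTo]
  | succ m ih =>
    have hq := hT.quad (m + 1) (by omega) hm
    simp only [prodUpTo]
    rw [← mul_assoc, ih (by omega), jm_step (m + 1) hm, pow_succ, mul_smul, smul_mul_assoc]
    congr 1
    simp only [mul_smul_comm, smul_mul_assoc]
    congr 1
    simp only [mul_assoc]
    rw [heckeInv_mul hq, mul_one]

/-- The values of the generators under `X_i ↦ 0`, `T_i ↦ T_i`, `Y_i ↦ J_i`. -/
def jmGen (n : ℕ) (T : ℕ → R) : DGen → R
  | DGen.T i => if 1 ≤ i ∧ i < n then T i else 0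
  | DGen.X _ => 0
  | DGen.Y i => if 1 ≤ i ∧ i ≤ n then jm n T i else 0

theorem jmGen_rel (hT : HeckeRelations n T) {x y : DFree} (h : DRel n x y) :
    FreeAlgebra.lift Kqt (jmGen n T) x = FreeAlgebra.lift Kqt (jmGen n T) y := by
  have lT : ∀ i, FreeAlgebra.lift Kqt (jmGen n T) (fT i) = if 1 ≤ i ∧ i < n then T i else 0 :=
    fun i => by simp [fT, jmGen]
  have lX : ∀ i, FreeAlgebra.lift Kqt (jmGen n T) (fX i) = 0 := fun i => by simp [fX, jmGen]
  have lY : ∀ i, FreeAlgebra.lift Kqt (jmGen n T) (fY i) = if 1 ≤ i ∧ i ≤ n then jm n T i else 0 :=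
    fun i => by simp [fY, jmGen]
  cases h with
  | T_out i h => rw [lT, if_neg h, map_zero]
  | X_out i h => rw [lX, map_zero]
  | Y_out i h => rw [lY, if_neg h, map_zero]
  | quad i h1 h2 =>
    rw [map_mul, map_sub, map_add, lT, if_pos ⟨h1, h2⟩, map_one, map_zero, AlgHom.commutes]
    exact hT.quad i h1 h2
  | braid i h1 h2 =>
    simp only [map_mul]
    rw [lT, lT, if_pos ⟨h1, by omega⟩, if_pos ⟨by omega, h2⟩]
    exact hT.braid i h1 h2
  | T_T i j h1 h2 h3 =>
    simp only [map_mul]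
    rw [lT, lT, if_pos ⟨h1, by omega⟩, if_pos ⟨by omega, h3⟩]
    exact hT.comm i j h1 h2 h3
  | T_X_T i h1 h2 => simp [lX]
  | T_X i j h1 h2 h3 h4 h5 h6 => simp [lX]
  | X_X i j h1 h2 h3 h4 => simp [lX]
  | T_Y_T i h1 h2 =>
    simp only [map_mul, map_smul]
    rw [lT, lY, lY, if_pos ⟨h1, h2⟩, if_pos ⟨h1, h2.le⟩, if_pos ⟨by omega, h2⟩]
    exact T_jm_T hT i h1 h2
  | T_Y i j h1 h2 h3 h4 h5 h6 =>
    simp only [map_mul]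
    rw [lT, lY, if_pos ⟨h1, h2⟩, if_pos ⟨h3, h4⟩]
    exact commute_T_jm hT i j h1 h2 h3 h4 h5 h6
  | Y_Y i j h1 h2 h3 h4 =>
    simp only [map_mul]
    rw [lY, lY, if_pos ⟨h1, h2⟩, if_pos ⟨h3, h4⟩]
    exact commute_jm_jm hT i j h1 h2 h3 h4
  | Y_T_X h => simp [lX]
  | Y_X h =>
    have : prodUpTo (fun i => FreeAlgebra.lift Kqt (jmGen n T) (fX i)) n = 0 := by
      obtain ⟨m, rfl⟩ : ∃ m, n = m + 1 := ⟨n - 1, by omega⟩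
      simp [prodUpTo, lX]
    simp only [map_mul, map_smul, map_prodUpTo, this]
    simp
  | pi_X h => simp [lX]

/-- Elements satisfying the Hecke relations define a homomorphism from `𝒟_n⁺` with
`T_i ↦ T_i`, `X_i ↦ 0` and `Y_i ↦ J_i`. -/
def jmHom (hT : HeckeRelations n T) : DAHA n →ₐ[Kqt] R :=
  RingQuot.liftAlgHom Kqt ⟨FreeAlgebra.lift Kqt (jmGen n T), fun _ _ h => jmGen_rel hT h⟩

theorem jmHom_dMk (hT : HeckeRelations n T) (x : DFree) :
    jmHom hT (dMk n x) = FreeAlgebra.lift Kqt (jmGen n T) x :=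
  RingQuot.liftAlgHom_mkAlgHom_apply Kqt _ (fun _ _ h => jmGen_rel hT h) x

theorem jmHom_T (hT : HeckeRelations n T) (i : ℕ) :
    jmHom hT (dT n i) = if 1 ≤ i ∧ i < n then T i else 0 := by
  rw [dT, jmHom_dMk]; simp [fT, jmGen]

theorem jmHom_Y (hT : HeckeRelations n T) (i : ℕ) :
    jmHom hT (dY n i) = if 1 ≤ i ∧ i ≤ n then jm n T i else 0 := by
  rw [dY, jmHom_dMk]; simp [fY, jmGen]

theorem jmHom_pi (hT : HeckeRelations n T) (hn : 1 ≤ n) :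
    jmHom hT (dPi n) = prodUpTo (fun i => heckeInv (T i)) (n - 1) := by
  have h1 : prodUpTo (fun i => jmHom hT (dT n i)) (n - 1) = prodUpTo T (n - 1) :=
    prodUpTo_congr _ (fun i h1 h2 => by rw [jmHom_T, if_pos ⟨h1, by omega⟩])
  rw [dPi, map_smul, map_mul, map_prodUpTo, h1, jmHom_Y, if_pos ⟨le_rfl, hn⟩,
    jm_one_mul hT (n - 1) (by omega), Nat.sub_add_cancel hn, jm_last,
    ← (Algebra.commutes q (prodUpTo (fun i => heckeInv (T i)) (n - 1))),
    ← Algebra.smul_def, smul_smul, smul_smul, mul_assoc, ← pow_succ, Nat.sub_add_cancel hn,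
    ← mul_pow, inv_mul_cancel₀ q_ne_zero, one_pow, one_smul]

end JM

theorem heckeRelations_dT (n : ℕ) : HeckeRelations n (dT n) where
  quad i h1 h2 := by
    have := dMk_rel (DRel.quad (n := n) i h1 h2)
    simpa [dT] using this
  braid i h1 h2 := by
    have := dMk_rel (DRel.braid (n := n) i h1 h2)
    simpa [dT] using this
  comm i j h1 h2 h3 := by
    have := dMk_rel (DRel.T_T (n := n) i j h1 h2 h3)
    simpa [dT] using this

theorem heckeInv_mem {R : Type*} [Ring R] [Algebra Kqt R] (S : Subalgebra Kqt R) {x : R}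
    (h : x ∈ S) : heckeInv x ∈ S :=
  S.smul_mem (S.add_mem h (S.algebraMap_mem _)) _

theorem jmAux_mem (n m : ℕ) : jmAux n (dT n) m ∈ Hecke n := by
  induction m with
  | zero => exact (Hecke n).algebraMap_mem _
  | succ m ih =>
    have h := heckeInv_mem (Hecke n) (dT_mem_Hecke n (n - (m + 1)))
    exact (Hecke n).smul_mem ((Hecke n).mul_mem ((Hecke n).mul_mem h ih) h) _

theorem jmHom_mem (n : ℕ) (a : AHA n) :
    ((jmHom (heckeRelations_dT n)).comp (AHA n).val) a ∈ Hecke n := by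
  obtain ⟨a, ha⟩ := a
  change jmHom (heckeRelations_dT n) a ∈ Hecke n
  have : AHA n ≤ (Hecke n).comap (jmHom (heckeRelations_dT n)) := by
    refine Algebra.adjoin_le ?_
    rintro x (⟨i, rfl⟩ | ⟨i, rfl⟩)
    · change jmHom (heckeRelations_dT n) (dT n i) ∈ Hecke n
      rw [jmHom_T]
      split_ifs
      · exact dT_mem_Hecke n i
      · exact (Hecke n).zero_mem
    · change jmHom (heckeRelations_dT n) (dY n i) ∈ Hecke n
      rw [jmHom_Y]
      split_ifs
      · exact jmAux_mem n _
      · exact (Hecke n).zero_mem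
  exact this ha

/-- The homomorphism `ρ_n : 𝒜_n → ℋ_n` with `T_i ↦ T_i` and `π ↦ T_1⁻¹ ⋯ T_{n-1}⁻¹`
(see `rho_T` and `rho_pi`). -/
def rho (n : ℕ) : AHA n →ₐ[Kqt] Hecke n :=
  ((jmHom (heckeRelations_dT n)).comp (AHA n).val).codRestrict (Hecke n) (jmHom_mem n)

theorem rho_T (n i : ℕ) (h1 : 1 ≤ i) (h2 : i < n) : (rho n (aT n i) : DAHA n) = dT n i :=
  (jmHom_T (heckeRelations_dT n) i).trans (if_pos ⟨h1, h2⟩)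

theorem rho_pi (n : ℕ) (hn : 1 ≤ n) :
    (rho n (aPi n) : DAHA n) = prodUpTo (dTinv n) (n - 1) :=
  jmHom_pi (heckeRelations_dT n) hn

/-! ### Standard Young tableaux and Young's seminormal modules -/

/-- A bijective filling of the boxes of `μ` with the numbers `1, …, n`. Boxes are pairs
(row, column), counted from `0`, in English notation. -/
abbrev Filling (μ : YoungDiagram) (n : ℕ) : Type :=
  {c : ℕ × ℕ // c ∈ μ.cells} ≃ {m : ℕ // m ∈ Finset.Icc 1 n}

/-- Standard Young tableaux of shape `μ` with entries `1, …, n`: entries increase along rows and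
down columns. There are none unless `n = |μ|`. -/
structure SYT (μ : YoungDiagram) (n : ℕ) : Type where
  /-- the entries of the tableau -/
  fill : Filling μ n
  /-- they increase weakly, hence strictly, for the product order on boxes -/
  mono : Monotone fill

/-- The box of the filling `f` with entry `i`, for `1 ≤ i ≤ n`. -/
def cellOf {μ : YoungDiagram} {n : ℕ} (f : Filling μ n) (i : ℕ) : ℕ × ℕ :=
  if h : i ∈ Finset.Icc 1 n then (f.symm ⟨i, h⟩).1 else (0, 0)

/-- The content `c_f(i)` of the box with entry `i`: its column minus its row. -/
def content {μ : YoungDiagram} {n : ℕ} (f : Filling μ n) (i : ℕ) : ℤ :=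
  ((cellOf f i).2 : ℤ) - ((cellOf f i).1 : ℤ)

/-- `s_i(f)`: the entries `i` and `i + 1` are exchanged, for `1 ≤ i ≤ n - 1`. -/
def swapFilling {μ : YoungDiagram} {n : ℕ} (i : ℕ) (f : Filling μ n) : Filling μ n :=
  if h : 1 ≤ i ∧ i < n then
    f.trans (Equiv.swap ⟨i, by simp; omega⟩ ⟨i + 1, by simp; omega⟩)
  else f

/-- The space `S_μ` with basis `e_τ` indexed by the standard tableaux of shape `μ` with entries
`1, …, n` (the zero space unless `n = |μ|`). -/
abbrev SpechtSpace (μ : YoungDiagram) (n : ℕ) : Type := SYT μ n →₀ Kqt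

open Classical in
/-- The basis vector `e_f` of a filling `f` that is a standard tableau (zero for the others). -/
def basisVec {μ : YoungDiagram} {n : ℕ} (f : Filling μ n) : SpechtSpace μ n :=
  if h : Monotone f then Finsupp.single (⟨f, h⟩ : SYT μ n) 1 else 0

/-- `(1 - q) q^c / (q^c - q^{c'})`. -/
def diagCoef (c c' : ℤ) : Kqt := (1 - q) * q ^ c / (q ^ c - q ^ c')

/-- `- (q^{c'+1} - q^c) (q^{c+1} - q^{c'}) / (q^{c'} - q^c)²`. -/
def downCoef (c c' : ℤ) : Kqt :=
  -((q ^ (c' + 1) - q ^ c) * (q ^ (c + 1) - q ^ c')) / (q ^ c' - q ^ c) ^ 2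

/-- The seminormal operator `T_i` on `S_μ`, for `1 ≤ i ≤ n - 1` (zero for other `i`). In the last
two cases `s_i(τ)` is a standard tableau; it is above `τ` in the third case, where
`c_τ(i) - c_τ(i+1) > 1`, and below `τ` in the last one. -/
def seminormalT (μ : YoungDiagram) (n i : ℕ) : SpechtSpace μ n →ₗ[Kqt] SpechtSpace μ n :=
  if 1 ≤ i ∧ i < n then
    Finsupp.linearCombination Kqt fun τ : SYT μ n =>
      if (cellOf τ.fill i).1 = (cellOf τ.fill (i + 1)).1 then basisVec τ.fill
      else if (cellOf τ.fill i).2 = (cellOf τ.fill (i + 1)).2 then (-q) • basisVec τ.fill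
      else if content τ.fill i - content τ.fill (i + 1) > 1 then
        basisVec (swapFilling i τ.fill) + diagCoef (content τ.fill i) (content τ.fill (i + 1)) • basisVec τ.fill
      else
        downCoef (content τ.fill i) (content τ.fill (i + 1)) • basisVec (swapFilling i τ.fill) +
          diagCoef (content τ.fill i) (content τ.fill (i + 1)) • basisVec τ.fill
  else 0

section Seminormal

variable {μ : YoungDiagram} {n : ℕ}

theorem cellOf_mem (f : Filling μ n) {i : ℕ} (h1 : 1 ≤ i) (h2 : i ≤ n) : cellOf f i ∈ μ.cells := by
  rw [cellOf, dif_pos (by simp; omega)]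
  exact Subtype.property _

theorem apply_cellOf (f : Filling μ n) {i : ℕ} (h1 : 1 ≤ i) (h2 : i ≤ n)
    (h : cellOf f i ∈ μ.cells) : (f ⟨cellOf f i, h⟩).1 = i := by
  have hi : i ∈ Finset.Icc 1 n := by simp; omega
  have : (⟨cellOf f i, h⟩ : {c : ℕ × ℕ // c ∈ μ.cells}) = f.symm ⟨i, hi⟩ := by
    apply Subtype.ext
    simp only [cellOf, dif_pos hi]
  rw [this, Equiv.apply_symm_apply]

theorem cellOf_apply (f : Filling μ n) (c : {c : ℕ × ℕ // c ∈ μ.cells}) :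
    cellOf f (f c).1 = c.1 := by
  rw [cellOf, dif_pos (f c).2]
  simp

theorem cellOf_inj (f : Filling μ n) {i j : ℕ} (h1 : 1 ≤ i) (h2 : i ≤ n) (h3 : 1 ≤ j) (h4 : j ≤ n)
    (h : cellOf f i = cellOf f j) : i = j := by
  have a := apply_cellOf f h1 h2 (cellOf_mem f h1 h2)
  have b := apply_cellOf f h3 h4 (cellOf_mem f h3 h4)
  rw [← a, ← b]
  congr 2
  exact Subtype.ext h

theorem le_entry {f : Filling μ n} (hf : Monotone f) {i : ℕ} (h1 : 1 ≤ i) (h2 : i ≤ n)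
    {c : ℕ × ℕ} (hc : c ∈ μ.cells) (h : cellOf f i ≤ c) (hne : cellOf f i ≠ c) :
    i < (f ⟨c, hc⟩).1 := by
  have hm := cellOf_mem f h1 h2
  have h3 : f ⟨cellOf f i, hm⟩ ≤ f ⟨c, hc⟩ := hf h
  have h4 : (f ⟨cellOf f i, hm⟩).1 ≤ (f ⟨c, hc⟩).1 := h3
  rw [apply_cellOf f h1 h2] at h4
  refine lt_of_le_of_ne h4 fun h5 => hne ?_
  have := cellOf_apply f ⟨c, hc⟩
  rw [← h5] at this
  exact this

theorem entry_le {f : Filling μ n} (hf : Monotone f) {i : ℕ} (h1 : 1 ≤ i) (h2 : i ≤ n)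
    {c : ℕ × ℕ} (hc : c ∈ μ.cells) (h : c ≤ cellOf f i) (hne : c ≠ cellOf f i) :
    (f ⟨c, hc⟩).1 < i := by
  have hm := cellOf_mem f h1 h2
  have h3 : f ⟨c, hc⟩ ≤ f ⟨cellOf f i, hm⟩ := hf h
  have h4 : (f ⟨c, hc⟩).1 ≤ (f ⟨cellOf f i, hm⟩).1 := h3
  rw [apply_cellOf f h1 h2] at h4
  refine lt_of_le_of_ne h4 fun h5 => hne ?_
  have := cellOf_apply f ⟨c, hc⟩
  rw [h5] at this
  exact this.symm

theorem mem_of_le {c d : ℕ × ℕ} (hd : d ∈ μ.cells) (h1 : c.1 ≤ d.1) (h2 : c.2 ≤ d.2) :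
    c ∈ μ.cells := μ.isLowerSet (Prod.le_def.mpr ⟨h1, h2⟩) hd

theorem not_cell_le {f : Filling μ n} (hf : Monotone f) {i j : ℕ} (h1 : 1 ≤ i) (h2 : i < j)
    (h3 : j ≤ n) : ¬ cellOf f j ≤ cellOf f i := by
  intro h
  have hm := cellOf_mem f (by omega : 1 ≤ i) (by omega)
  have := le_entry hf (by omega : 1 ≤ j) h3 hm h
    (fun h => by have := cellOf_inj f (by omega) h3 h1 (by omega) h; omega)
  rw [apply_cellOf f h1 (by omega)] at this
  omega

theorem no_between {f : Filling μ n} (hf : Monotone f) {i : ℕ} (h1 : 1 ≤ i) (h2 : i < n)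
    {c : ℕ × ℕ} (ha : cellOf f i ≤ c) (ha' : cellOf f i ≠ c) (hb : c ≤ cellOf f (i + 1))
    (hb' : c ≠ cellOf f (i + 1)) : False := by
  have hc : c ∈ μ.cells := μ.isLowerSet hb (cellOf_mem f (by omega) h2)
  have := le_entry hf h1 h2.le hc ha ha'
  have := entry_le hf (by omega) h2 hc hb hb'
  omega

theorem same_row {f : Filling μ n} (hf : Monotone f) {i : ℕ} (h1 : 1 ≤ i) (h2 : i < n)
    (h : (cellOf f i).1 = (cellOf f (i + 1)).1) : content f (i + 1) = content f i + 1 := by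
  have hle := not_cell_le hf h1 (Nat.lt_succ_self i) h2
  rw [Prod.le_def] at hle
  have hnb : ¬ ((cellOf f i).2 + 1 < (cellOf f (i + 1)).2) := by
    intro h3
    refine no_between hf h1 h2 (c := ((cellOf f i).1, (cellOf f i).2 + 1)) ?_ ?_ ?_ ?_
    · rw [Prod.le_def]; simp
    · intro h; have := congrArg Prod.snd h; simp at this
    · rw [Prod.le_def]; exact ⟨h.le, h3.le⟩
    · intro h; have := congrArg Prod.snd h; simp at this; omega
  simp only [content]
  simp only [Nat.succ_eq_add_one] at hle
  omega

theorem same_col {f : Filling μ n} (hf : Monotone f) {i : ℕ} (h1 : 1 ≤ i) (h2 : i < n)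
    (h : (cellOf f i).2 = (cellOf f (i + 1)).2) : content f (i + 1) = content f i - 1 := by
  have hle := not_cell_le hf h1 (Nat.lt_succ_self i) h2
  rw [Prod.le_def] at hle
  have hnb : ¬ ((cellOf f i).1 + 1 < (cellOf f (i + 1)).1) := by
    intro h3
    refine no_between hf h1 h2 (c := ((cellOf f i).1 + 1, (cellOf f i).2)) ?_ ?_ ?_ ?_
    · rw [Prod.le_def]; simp
    · intro h; have := congrArg Prod.fst h; simp at this
    · rw [Prod.le_def]; exact ⟨h3.le, h.le⟩
    · intro h; have := congrArg Prod.fst h; simp at this; omega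
  simp only [content]
  simp only [Nat.succ_eq_add_one] at hle
  omega

theorem incomparable {f : Filling μ n} (hf : Monotone f) {i : ℕ} (h1 : 1 ≤ i) (h2 : i < n)
    (hr : (cellOf f i).1 ≠ (cellOf f (i + 1)).1) (hc : (cellOf f i).2 ≠ (cellOf f (i + 1)).2) :
    ¬ cellOf f i ≤ cellOf f (i + 1) ∧
      (content f i - content f (i + 1) > 1 ∨ content f (i + 1) - content f i > 1) := by
  have hle := not_cell_le hf h1 (Nat.lt_succ_self i) h2
  have hle' : ¬ cellOf f i ≤ cellOf f (i + 1) := by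
    intro h
    rw [Prod.le_def] at h
    refine no_between hf h1 h2 (c := ((cellOf f i).1, (cellOf f (i + 1)).2)) ?_ ?_ ?_ ?_
    · rw [Prod.le_def]; exact ⟨le_rfl, h.2⟩
    · intro h; have := congrArg Prod.snd h; simp at this; omega
    · rw [Prod.le_def]; exact ⟨h.1, le_rfl⟩
    · intro h; have := congrArg Prod.fst h; simp at this; omega
  refine ⟨hle', ?_⟩
  rw [Prod.le_def] at hle hle'
  simp only [content]
  simp only [Nat.succ_eq_add_one] at hle
  omega

theorem content_ne {f : Filling μ n} (hf : Monotone f) {i : ℕ} (h1 : 1 ≤ i) (h2 : i < n) :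
    content f i ≠ content f (i + 1) := by
  by_cases hr : (cellOf f i).1 = (cellOf f (i + 1)).1
  · have := same_row hf h1 h2 hr; omega
  by_cases hc : (cellOf f i).2 = (cellOf f (i + 1)).2
  · have := same_col hf h1 h2 hc; omega
  have := (incomparable hf h1 h2 hr hc).2
  omega

theorem content_ne' {f : Filling μ n} (hf : Monotone f) {i : ℕ} (h1 : 1 ≤ i) (h2 : i + 1 < n) :
    content f i ≠ content f (i + 2) := by
  intro h
  have hle := not_cell_le hf h1 (by omega : i < i + 2) h2
  rw [Prod.le_def] at hle
  have hne : cellOf f i ≠ cellOf f (i + 2) := fun h => by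
    have := cellOf_inj f h1 (by omega) (by omega) h2 h; omega
  have hm := cellOf_mem f (by omega : 1 ≤ i + 2) h2
  simp only [content] at h
  have ha : (cellOf f i).1 < (cellOf f (i + 2)).1 := by omega
  have hb : (cellOf f i).2 < (cellOf f (i + 2)).2 := by omega
  have key : ∀ c : ℕ × ℕ, cellOf f i ≤ c → cellOf f i ≠ c → c ≤ cellOf f (i + 2) →
      c ≠ cellOf f (i + 2) → c = cellOf f (i + 1) := by
    intro c h3 h4 h5 h6
    have hc : c ∈ μ.cells := μ.isLowerSet h5 hm
    have e1 := le_entry hf h1 (by omega) hc h3 h4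
    have e2 := entry_le hf (by omega) h2 hc h5 h6
    have e3 : (f ⟨c, hc⟩).1 = i + 1 := by omega
    have := cellOf_apply f ⟨c, hc⟩
    rw [e3] at this
    exact this.symm
  have k1 := key ((cellOf f i).1, (cellOf f (i + 2)).2)
    (Prod.le_def.mpr ⟨le_rfl, hb.le⟩) (fun h => by have := congrArg Prod.snd h; simp at this; omega)
    (Prod.le_def.mpr ⟨ha.le, le_rfl⟩) (fun h => by have := congrArg Prod.fst h; simp at this; omega)
  have k2 := key ((cellOf f (i + 2)).1, (cellOf f i).2)
    (Prod.le_def.mpr ⟨ha.le, le_rfl⟩) (fun h => by have := congrArg Prod.fst h; simp at this; omega)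
    (Prod.le_def.mpr ⟨le_rfl, hb.le⟩) (fun h => by have := congrArg Prod.snd h; simp at this; omega)
  have := congrArg Prod.fst (k1.trans k2.symm)
  simp at this
  omega

theorem cellOf_swap_left (f : Filling μ n) {i : ℕ} (h1 : 1 ≤ i) (h2 : i < n) :
    cellOf (swapFilling i f) i = cellOf f (i + 1) := by
  have hi : i ∈ Finset.Icc 1 n := by simp; omega
  have hi' : i + 1 ∈ Finset.Icc 1 n := by simp; omega
  simp [cellOf, swapFilling, h1, h2, h2.le, Nat.succ_le_of_lt h2]

theorem cellOf_swap_right (f : Filling μ n) {i : ℕ} (h1 : 1 ≤ i) (h2 : i < n) :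
    cellOf (swapFilling i f) (i + 1) = cellOf f i := by
  simp [cellOf, swapFilling, h1, h2, h2.le, Nat.succ_le_of_lt h2]

theorem cellOf_swap_of_ne (f : Filling μ n) {i j : ℕ} (hj : j ≠ i) (hj' : j ≠ i + 1) :
    cellOf (swapFilling i f) j = cellOf f j := by
  unfold cellOf
  by_cases hjn : j ∈ Finset.Icc 1 n
  · rw [dif_pos hjn, dif_pos hjn]
    unfold swapFilling
    split_ifs with h
    · rw [Equiv.symm_trans_apply, Equiv.symm_swap, Equiv.swap_apply_of_ne_of_ne]
      · simpa using hj
      · simpa using hj'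
    · rfl
  · rw [dif_neg hjn, dif_neg hjn]

theorem content_swap_left (f : Filling μ n) {i : ℕ} (h1 : 1 ≤ i) (h2 : i < n) :
    content (swapFilling i f) i = content f (i + 1) := by
  rw [content, cellOf_swap_left f h1 h2, content]

theorem content_swap_right (f : Filling μ n) {i : ℕ} (h1 : 1 ≤ i) (h2 : i < n) :
    content (swapFilling i f) (i + 1) = content f i := by
  rw [content, cellOf_swap_right f h1 h2, content]

theorem content_swap_of_ne (f : Filling μ n) {i j : ℕ} (hj : j ≠ i) (hj' : j ≠ i + 1) :
    content (swapFilling i f) j = content f j := by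
  rw [content, cellOf_swap_of_ne f hj hj', content]

theorem filling_ext {f g : Filling μ n} (h : ∀ j, 1 ≤ j → j ≤ n → cellOf f j = cellOf g j) :
    f = g := by
  have : f.symm = g.symm := by
    ext1 ⟨j, hj⟩
    have hj' := Finset.mem_Icc.mp hj
    have := h j hj'.1 hj'.2
    simp only [cellOf, dif_pos hj] at this
    exact Subtype.ext this
  exact Equiv.symm_bijective.injective this

theorem swap_swap (f : Filling μ n) {i : ℕ} (h1 : 1 ≤ i) (h2 : i < n) :
    swapFilling i (swapFilling i f) = f := by
  refine filling_ext fun j _ _ => ?_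
  by_cases a : j = i
  · subst a; rw [cellOf_swap_left _ h1 h2, cellOf_swap_right _ h1 h2]
  by_cases b : j = i + 1
  · subst b; rw [cellOf_swap_right _ h1 h2, cellOf_swap_left _ h1 h2]
  rw [cellOf_swap_of_ne _ a b, cellOf_swap_of_ne _ a b]

theorem swap_comm (f : Filling μ n) {i j : ℕ} (h1 : 1 ≤ i) (h2 : i + 1 < j) (h3 : j < n) :
    swapFilling i (swapFilling j f) = swapFilling j (swapFilling i f) := by
  refine filling_ext fun k _ _ => ?_
  by_cases a : k = i
  · subst a
    rw [cellOf_swap_left _ h1 (by omega), cellOf_swap_of_ne _ (by omega) (by omega),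
      cellOf_swap_of_ne _ (by omega) (by omega), cellOf_swap_left _ h1 (by omega)]
  by_cases b : k = i + 1
  · subst b
    rw [cellOf_swap_right _ h1 (by omega), cellOf_swap_of_ne _ (by omega) (by omega),
      cellOf_swap_of_ne _ (by omega) (by omega), cellOf_swap_right _ h1 (by omega)]
  rw [cellOf_swap_of_ne _ a b]
  by_cases c : k = j
  · subst c
    rw [cellOf_swap_left _ (by omega) h3, cellOf_swap_left _ (by omega) h3,
      cellOf_swap_of_ne _ (by omega) (by omega)]
  by_cases d : k = j + 1
  · subst d
    rw [cellOf_swap_right _ (by omega) h3, cellOf_swap_right _ (by omega) h3,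
      cellOf_swap_of_ne _ (by omega) (by omega)]
  rw [cellOf_swap_of_ne _ c d, cellOf_swap_of_ne _ c d, cellOf_swap_of_ne _ a b]

theorem swap_braid (f : Filling μ n) {i : ℕ} (h1 : 1 ≤ i) (h2 : i + 1 < n) :
    swapFilling i (swapFilling (i + 1) (swapFilling i f)) =
      swapFilling (i + 1) (swapFilling i (swapFilling (i + 1) f)) := by
  refine filling_ext fun k _ _ => ?_
  have h2' : i < n := by omega
  have h1' : 1 ≤ i + 1 := by omega
  by_cases a : k = i
  · subst a
    rw [cellOf_swap_left _ h1 h2', cellOf_swap_left _ h1' h2,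
      cellOf_swap_of_ne _ (by omega) (by omega),
      cellOf_swap_of_ne (i := k + 1) (j := k) _ (by omega) (by omega),
      cellOf_swap_left _ h1 h2', cellOf_swap_left _ h1' h2]
  by_cases b : k = i + 1
  · subst b
    rw [cellOf_swap_right _ h1 h2', cellOf_swap_of_ne (j := i) _ (by omega) (by omega),
      cellOf_swap_left _ h1 h2', cellOf_swap_left _ h1' h2,
      cellOf_swap_of_ne (i := i) _ (by omega) (by omega), cellOf_swap_right _ h1' h2]
  by_cases c : k = i + 1 + 1
  · subst c
    rw [cellOf_swap_of_ne (i := i) _ (by omega) (by omega), cellOf_swap_right _ h1' h2,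
      cellOf_swap_right _ h1 h2', cellOf_swap_right _ h1' h2, cellOf_swap_right _ h1 h2',
      cellOf_swap_of_ne (i := i + 1) _ (by omega) (by omega)]
  rw [cellOf_swap_of_ne _ a b, cellOf_swap_of_ne _ b c, cellOf_swap_of_ne _ a b,
    cellOf_swap_of_ne _ b c, cellOf_swap_of_ne _ a b, cellOf_swap_of_ne _ b c]

theorem swap_monotone {f : Filling μ n} (hf : Monotone f) {i : ℕ} (h1 : 1 ≤ i) (h2 : i < n)
    (hr : (cellOf f i).1 ≠ (cellOf f (i + 1)).1) (hc : (cellOf f i).2 ≠ (cellOf f (i + 1)).2) :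
    Monotone (swapFilling i f) := by
  have hinc := (incomparable hf h1 h2 hr hc).1
  intro x y hxy
  have hi : i ∈ Finset.Icc 1 n := by simp; omega
  have hi' : i + 1 ∈ Finset.Icc 1 n := by simp; omega
  have hfxy : (f x).1 ≤ (f y).1 := hf hxy
  have hx := cellOf_apply f x
  have hy := cellOf_apply f y
  have hne : ¬ ((f x).1 = i ∧ (f y).1 = i + 1) := by
    rintro ⟨ha, hb⟩
    rw [ha] at hx
    rw [hb] at hy
    exact hinc (by rw [hx, hy]; exact hxy)
  have hval : ∀ z, (swapFilling i f z).1 =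
      if (f z).1 = i then i + 1 else if (f z).1 = i + 1 then i else (f z).1 := by
    intro z
    rw [swapFilling, dif_pos ⟨h1, h2⟩, Equiv.trans_apply, Equiv.swap_apply_def]
    simp only [Subtype.ext_iff]
    split_ifs <;> rfl
  change (swapFilling i f x).1 ≤ (swapFilling i f y).1
  rw [hval, hval]
  split_ifs <;> omega

/-- The coefficient of `e_{s_i τ}` in `T_i e_τ`, in all cases. -/
def offCoef (c c' : ℤ) : Kqt :=
  if c - c' = 1 ∨ c' - c = 1 then 0 else if c - c' > 1 then 1 else downCoef c c'

theorem seminormalT_basisVec (f : Filling μ n) {i : ℕ} (h1 : 1 ≤ i) (h2 : i < n) :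
    seminormalT μ n i (basisVec f) =
      diagCoef (content f i) (content f (i + 1)) • basisVec f +
        offCoef (content f i) (content f (i + 1)) • basisVec (swapFilling i f) := by
  by_cases hf : Monotone f
  · conv_lhs => rw [basisVec, dif_pos hf, seminormalT, if_pos ⟨h1, h2⟩,
      Finsupp.linearCombination_single, one_smul]
    have q1 : (1 : Kqt) - q ≠ 0 := sub_ne_zero.mpr (fun h => q_pow_ne_one 1 one_ne_zero
      (by rw [pow_one]; exact h.symm))
    have hq := q_ne_zero
    have hz : q ^ (content f i) ≠ 0 := zpow_ne_zero _ q_ne_zero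
    by_cases hr : (cellOf f i).1 = (cellOf f (i + 1)).1
    · have hcont := same_row hf h1 h2 hr
      rw [if_pos hr, hcont]
      have e1 : offCoef (content f i) (content f i + 1) = 0 := by
        rw [offCoef, if_pos (Or.inr (by omega))]
      have e2 : diagCoef (content f i) (content f i + 1) = 1 := by
        rw [diagCoef, zpow_add₀ hq, zpow_one, div_eq_one_iff_eq]
        · ring
        · rw [show q ^ content f i - q ^ content f i * q = q ^ content f i * (1 - q) by ring]
          exact mul_ne_zero hz q1
      rw [e1, e2, one_smul, zero_smul, add_zero]
    rw [if_neg hr]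
    by_cases hc : (cellOf f i).2 = (cellOf f (i + 1)).2
    · have hcont := same_col hf h1 h2 hc
      rw [if_pos hc, hcont]
      have e1 : offCoef (content f i) (content f i - 1) = 0 := by
        rw [offCoef, if_pos (Or.inl (by omega))]
      have e2 : diagCoef (content f i) (content f i - 1) = -q := by
        rw [diagCoef, zpow_sub₀ hq, zpow_one]
        rw [show q ^ content f i - q ^ content f i / q = -(q ^ content f i * (1 - q)) / q by
          field_simp; ring]
        field_simp
      rw [e1, e2, zero_smul, add_zero]
    rw [if_neg hc]
    have hinc := (incomparable hf h1 h2 hr hc).2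
    by_cases hup : content f i - content f (i + 1) > 1
    · rw [if_pos hup, offCoef, if_neg (by omega), if_pos hup, one_smul, add_comm]
    · rw [if_neg hup, offCoef, if_neg (by omega), if_neg hup, add_comm]
  · have h0 : basisVec f = 0 := by rw [basisVec, dif_neg hf]
    rw [h0, map_zero, smul_zero, zero_add]
    by_cases hs : Monotone (swapFilling i f)
    · have hff := swap_swap f h1 h2
      have hcol : ¬ ((cellOf (swapFilling i f) i).1 ≠ (cellOf (swapFilling i f) (i + 1)).1 ∧
          (cellOf (swapFilling i f) i).2 ≠ (cellOf (swapFilling i f) (i + 1)).2) := by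
        rintro ⟨ha, hb⟩
        have := swap_monotone hs h1 h2 ha hb
        rw [hff] at this
        exact hf this
      have hcont : content f i - content f (i + 1) = 1 ∨
          content f (i + 1) - content f i = 1 := by
        by_cases hr : (cellOf (swapFilling i f) i).1 = (cellOf (swapFilling i f) (i + 1)).1
        · have := same_row hs h1 h2 hr
          rw [content_swap_left _ h1 h2, content_swap_right _ h1 h2] at this
          omega
        · have hc : (cellOf (swapFilling i f) i).2 = (cellOf (swapFilling i f) (i + 1)).2 := by
            by_contra hc
            exact hcol ⟨hr, hc⟩
          have := same_col hs h1 h2 hc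
          rw [content_swap_left _ h1 h2, content_swap_right _ h1 h2] at this
          omega
      rw [offCoef, if_pos hcont, zero_smul]
    · rw [basisVec, dif_neg hs, smul_zero]

theorem offCoef_mul {c c' : ℤ} (h : c ≠ c') : offCoef c c' * offCoef c' c =
    -((q * q ^ c' - q ^ c) * (q * q ^ c - q ^ c')) / (q ^ c - q ^ c') ^ 2 := by
  have hq := q_ne_zero
  by_cases h1 : c - c' = 1 ∨ c' - c = 1
  · rw [offCoef, if_pos h1, zero_mul]
    rcases h1 with h1 | h1
    · have : q * q ^ c' - q ^ c = 0 := by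
        rw [show c = c' + 1 by omega, zpow_add₀ hq, zpow_one]; ring
      rw [this]; simp
    · have : q * q ^ c - q ^ c' = 0 := by
        rw [show c' = c + 1 by omega, zpow_add₀ hq, zpow_one]; ring
      rw [this]; simp
  · have h1' : ¬ (c' - c = 1 ∨ c - c' = 1) := fun h => h1 h.symm
    simp only [offCoef, if_neg h1, if_neg h1']
    by_cases h2 : c - c' > 1
    · have h3 : ¬ (c' - c > 1) := by omega
      rw [if_pos h2, if_neg h3, one_mul, downCoef, zpow_add₀ hq, zpow_add₀ hq, zpow_one]
      ring_nf
    · have h3 : c' - c > 1 := by omega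
      rw [if_neg h2, if_pos h3, mul_one, downCoef, zpow_add₀ hq, zpow_add₀ hq, zpow_one,
        show (q ^ c' - q ^ c) ^ 2 = (q ^ c - q ^ c') ^ 2 by ring]
      ring_nf

theorem scalar_quad {F : Type*} [Field F] (u A B : F) (h : A - B ≠ 0) :
    ((1 - u) * A / (A - B)) ^ 2 + (-((u * B - A) * (u * A - B)) / (A - B) ^ 2) =
      (1 - u) * ((1 - u) * A / (A - B)) + u := by
  field_simp
  ring

theorem scalar_add {F : Type*} [Field F] (u A B : F) (h : A - B ≠ 0) :
    (1 - u) * A / (A - B) + (1 - u) * B / (B - A) = 1 - u := by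
  rw [← neg_sub A B, div_neg]
  field_simp
  ring

theorem scalar_braid_one {F : Type*} [Field F] (u A B C : F) (h1 : A - B ≠ 0) (h2 : B - C ≠ 0)
    (h3 : A - C ≠ 0) :
    ((1 - u) * A / (A - B)) * ((1 - u) * B / (B - C)) + ((1 - u) * A / (A - C)) *
      (-((1 - u) * B / (A - B))) = ((1 - u) * B / (B - C)) * ((1 - u) * A / (A - C)) := by
  field_simp
  ring

theorem scalar_braid_two {F : Type*} [Field F] (u A B C : F) (h1 : A - B ≠ 0) (h2 : B - C ≠ 0)
    (h3 : A - C ≠ 0) :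
    ((1 - u) * A / (A - B)) ^ 2 * ((1 - u) * B / (B - C)) +
        (-((u * B - A) * (u * A - B)) / (A - B) ^ 2) * ((1 - u) * A / (A - C)) =
      ((1 - u) * B / (B - C)) ^ 2 * ((1 - u) * A / (A - B)) +
        (-((u * C - B) * (u * B - C)) / (B - C) ^ 2) * ((1 - u) * A / (A - C)) := by
  field_simp
  ring

section Abstract

variable {F V : Type*} [Field F] [AddCommGroup V] [Module F V]

theorem vec_quad {u a a' b b' : F} {v w : V} (e1 : a ^ 2 + b * b' = (1 - u) * a + u)
    (e2 : a + a' = 1 - u) :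
    a • (a • v + b • w) + b • (a' • w + b' • v) + u • (a • v + b • w) -
      (a • v + b • w + u • v) = 0 := by
  linear_combination (norm := module) e1 • v + (b * e2) • w

theorem vec_comm {a b c d : F} {v w x y : V} :
    c • (a • v + b • w) + d • (a • x + b • y) = a • (c • v + d • x) + b • (c • w + d • y) := by
  module

theorem vec_braid {a12 a13 a23 a21 a32 b12 b13 b23 b21 b32 : F} {v0 v1 v2 v12 v21 v121 : V}
    (e0 : a12 ^ 2 * a23 + b12 * b21 * a13 = a23 ^ 2 * a12 + b23 * b32 * a13)
    (e1 : a12 * a23 + a13 * a21 = a23 * a13) (e2 : a12 * a13 = a23 * a12 + a13 * a32) :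
    a12 • (a23 • (a12 • v0 + b12 • v1) + b23 • (a13 • v2 + b13 • v12)) +
        b12 • (a13 • (a21 • v1 + b21 • v0) + b13 • (a23 • v21 + b23 • v121)) =
      a23 • (a12 • (a23 • v0 + b23 • v2) + b12 • (a13 • v1 + b13 • v21)) +
        b23 • (a13 • (a32 • v2 + b32 • v0) + b13 • (a12 • v12 + b12 • v121)) := by
  linear_combination (norm := module) e0 • v0 + (b12 * e1) • v1 + (b23 * e2) • v2

end Abstract

theorem q_zpow_sub_ne {c c' : ℤ} (h : c ≠ c') : q ^ c - q ^ c' ≠ 0 :=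
  sub_ne_zero.mpr (fun h' => h (q_zpow_injective h'))

theorem diagCoef_swap (c c' : ℤ) :
    diagCoef c' c = -((1 - q) * q ^ c' / (q ^ c - q ^ c')) := by
  rw [diagCoef, ← neg_sub (q ^ c) (q ^ c'), div_neg]

theorem ext_basisVec {φ ψ : SpechtSpace μ n →ₗ[Kqt] SpechtSpace μ n}
    (h : ∀ f : Filling μ n, Monotone f → φ (basisVec f) = ψ (basisVec f)) : φ = ψ := by
  refine Finsupp.lhom_ext' fun τ => LinearMap.ext_ring ?_
  have := h τ.fill τ.mono
  rw [basisVec, dif_pos τ.mono] at this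
  exact this

theorem seminormal_quad (i : ℕ) (h1 : 1 ≤ i) (h2 : i < n) :
    (seminormalT μ n i - 1) * (seminormalT μ n i +
      algebraMap Kqt (Module.End Kqt (SpechtSpace μ n)) q) = 0 := by
  refine ext_basisVec fun f hf => ?_
  have hne := content_ne hf h1 h2
  have hsub := q_zpow_sub_ne hne
  have e1 := scalar_quad q _ _ hsub
  have e2 := scalar_add q _ _ hsub
  rw [← offCoef_mul hne] at e1
  change seminormalT μ n i (seminormalT μ n i (basisVec f) + q • basisVec f) -
    (seminormalT μ n i (basisVec f) + q • basisVec f) = 0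
  rw [seminormalT_basisVec f h1 h2]
  simp only [map_add, map_smul]
  rw [seminormalT_basisVec f h1 h2, seminormalT_basisVec _ h1 h2, swap_swap f h1 h2,
    content_swap_left f h1 h2, content_swap_right f h1 h2]
  change diagCoef _ _ ^ 2 + _ = (1 - q) * diagCoef _ _ + q at e1
  change diagCoef _ _ + diagCoef _ _ = 1 - q at e2
  exact vec_quad e1 e2

theorem seminormal_comm (i j : ℕ) (h1 : 1 ≤ i) (h2 : i + 1 < j) (h3 : j < n) :
    seminormalT μ n i * seminormalT μ n j = seminormalT μ n j * seminormalT μ n i := by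
  refine ext_basisVec fun f hf => ?_
  have hi : i < n := by omega
  have hj : 1 ≤ j := by omega
  change seminormalT μ n i (seminormalT μ n j (basisVec f)) =
    seminormalT μ n j (seminormalT μ n i (basisVec f))
  rw [seminormalT_basisVec f h1 hi, seminormalT_basisVec f hj h3]
  simp only [map_add, map_smul]
  rw [seminormalT_basisVec f h1 hi, seminormalT_basisVec f hj h3, seminormalT_basisVec _ h1 hi,
    seminormalT_basisVec _ hj h3, swap_comm f h1 h2 h3,
    content_swap_of_ne f (i := j) (j := i) (by omega) (by omega),
    content_swap_of_ne f (i := j) (j := i + 1) (by omega) (by omega),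
    content_swap_of_ne f (i := i) (j := j) (by omega) (by omega),
    content_swap_of_ne f (i := i) (j := j + 1) (by omega) (by omega)]
  exact vec_comm

theorem seminormal_braid (i : ℕ) (h1 : 1 ≤ i) (h2 : i + 1 < n) :
    seminormalT μ n i * seminormalT μ n (i + 1) * seminormalT μ n i =
      seminormalT μ n (i + 1) * seminormalT μ n i * seminormalT μ n (i + 1) := by
  refine ext_basisVec fun f hf => ?_
  have hi : i < n := by omega
  have hj : 1 ≤ i + 1 := by omega
  have n12 := content_ne hf h1 hi
  have n23 := content_ne hf hj h2
  have n13 := content_ne' hf h1 h2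
  have s12 := q_zpow_sub_ne n12
  have s23 := q_zpow_sub_ne n23
  have s13 := q_zpow_sub_ne n13
  have cne : ∀ g : Filling μ n, content (swapFilling i g) (i + 1 + 1) = content g (i + 1 + 1) :=
    fun g => content_swap_of_ne g (by omega) (by omega)
  have cne' : ∀ g : Filling μ n, content (swapFilling (i + 1) g) i = content g i :=
    fun g => content_swap_of_ne g (by omega) (by omega)
  have cl : ∀ g : Filling μ n, content (swapFilling i g) i = content g (i + 1) :=
    fun g => content_swap_left g h1 hi
  have cr : ∀ g : Filling μ n, content (swapFilling i g) (i + 1) = content g i :=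
    fun g => content_swap_right g h1 hi
  have cl' : ∀ g : Filling μ n, content (swapFilling (i + 1) g) (i + 1) = content g (i + 1 + 1) :=
    fun g => content_swap_left g hj h2
  have cr' : ∀ g : Filling μ n, content (swapFilling (i + 1) g) (i + 1 + 1) = content g (i + 1) :=
    fun g => content_swap_right g hj h2
  change seminormalT μ n i (seminormalT μ n (i + 1) (seminormalT μ n i (basisVec f))) =
    seminormalT μ n (i + 1) (seminormalT μ n i (seminormalT μ n (i + 1) (basisVec f)))
  have A : ∀ g : Filling μ n, seminormalT μ n i (basisVec g) = _ :=
    fun g => seminormalT_basisVec g h1 hi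
  have B : ∀ g : Filling μ n, seminormalT μ n (i + 1) (basisVec g) = _ :=
    fun g => seminormalT_basisVec g hj h2
  simp only [A, B, map_add, map_smul, cne, cne', cl, cr, cl', cr', swap_swap _ h1 hi,
    swap_swap _ hj h2, swap_braid f h1 h2]
  have e0 := scalar_braid_two q _ _ _ s12 s23 s13
  rw [← offCoef_mul n12, ← offCoef_mul n23] at e0
  have e1 := scalar_braid_one q _ _ _ s12 s23 s13
  rw [← diagCoef_swap] at e1
  change diagCoef _ _ ^ 2 * diagCoef _ _ + _ * diagCoef _ _ =
    diagCoef _ _ ^ 2 * diagCoef _ _ + _ * diagCoef _ _ at e0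
  change diagCoef _ _ * diagCoef _ _ + diagCoef _ _ * _ = diagCoef _ _ * diagCoef _ _ at e1
  have e2 : diagCoef (content f i) (content f (i + 1)) *
        diagCoef (content f i) (content f (i + 1 + 1)) =
      diagCoef (content f (i + 1)) (content f (i + 1 + 1)) *
        diagCoef (content f i) (content f (i + 1)) +
      diagCoef (content f i) (content f (i + 1 + 1)) *
        diagCoef (content f (i + 1 + 1)) (content f (i + 1)) := by
    have := scalar_add q _ _ s23
    change diagCoef _ _ + diagCoef _ _ = 1 - q at this
    have h23 : diagCoef (content f (i + 1 + 1)) (content f (i + 1)) =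
        1 - q - diagCoef (content f (i + 1)) (content f (i + 1 + 1)) := by rw [← this]; ring
    have := scalar_add q _ _ s12
    change diagCoef _ _ + diagCoef _ _ = 1 - q at this
    have h12 : diagCoef (content f (i + 1)) (content f i) =
        1 - q - diagCoef (content f i) (content f (i + 1)) := by rw [← this]; ring
    rw [h12] at e1
    rw [h23]
    linear_combination -e1
  exact vec_braid e0 e1 e2

theorem heckeRelations_seminormal (μ : YoungDiagram) (n : ℕ) :
    HeckeRelations n (fun i => (seminormalT μ n i : Module.End Kqt (SpechtSpace μ n))) where
  quad i h1 h2 := seminormal_quad i h1 h2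
  braid i h1 h2 := seminormal_braid i h1 h2
  comm i j h1 h2 h3 := seminormal_comm i j h1 h2 h3

end Seminormal

/-- The `ℋ_n`-module `S_μ` (for `n = |μ|`): the action with `T_i ↦ seminormalT μ n i`,
see `spechtAct_T`. -/
def spechtAct (μ : YoungDiagram) (n : ℕ) : Hecke n →ₐ[Kqt] Module.End Kqt (SpechtSpace μ n) :=
  (jmHom (heckeRelations_seminormal μ n)).comp (Hecke n).val

theorem spechtAct_T (μ : YoungDiagram) (n i : ℕ) :
    spechtAct μ n ⟨dT n i, dT_mem_Hecke n i⟩ = seminormalT μ n i := by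
  refine (jmHom_T (heckeRelations_seminormal μ n) i).trans ?_
  by_cases h : 1 ≤ i ∧ i < n
  · rw [if_pos h]
  · rw [if_neg h, seminormalT, if_neg h]

/-! ### Pre-compatible sequences of affine Hecke modules -/

/-- A sequence of spaces `U^(n)` with actions of `𝒜_n`, gradings and connecting maps
`κ^(n) : U^(n+1) → U^(n)`. Only the indices `n ≥ n₀` are relevant. -/
structure AHASequence where
  /-- the first index -/
  n₀ : ℕ
  /-- the spaces `U^(n)` -/
  U : ℕ → Type
  [addCommGroup : ∀ n, AddCommGroup (U n)]
  [module : ∀ n, Module Kqt (U n)]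
  /-- the action of `𝒜_n` on `U^(n)` -/
  act : ∀ n, AHA n →ₐ[Kqt] Module.End Kqt (U n)
  /-- the homogeneous components `U^(n)(d)` -/
  gr : ∀ n, ℕ → Submodule Kqt (U n)
  /-- the connecting maps -/
  κ : ∀ n, U (n + 1) →ₗ[Kqt] U n

attribute [instance] AHASequence.addCommGroup AHASequence.module

/-- Pre-compatible sequences. -/
structure AHASequence.IsPreCompatible (C : AHASequence) : Prop where
  one_le : 1 ≤ C.n₀
  /-- each `U^(n)` is a graded vector space -/
  internal : ∀ n, C.n₀ ≤ n → DirectSum.IsInternal (C.gr n)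
  /-- and a graded `𝒜_n`-module (`𝒜_n` is concentrated in degree `0`) -/
  act_mem : ∀ n, C.n₀ ≤ n → ∀ (a : AHA n) (d : ℕ), ∀ u ∈ C.gr n d, C.act n a u ∈ C.gr n d
  /-- the maps are degree preserving -/
  κ_mem : ∀ n, C.n₀ ≤ n → ∀ d, ∀ u ∈ C.gr (n + 1) d, C.κ n u ∈ C.gr n d
  /-- the maps are `ℋ_n`-linear -/
  κ_T : ∀ n, C.n₀ ≤ n → ∀ i, 1 ≤ i → i < n → ∀ u,
    C.κ n (C.act (n + 1) (aT (n + 1) i) u) = C.act n (aT n i) (C.κ n u)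
  /-- `κ^(n) π^(n+1) T_n = π^(n) κ^(n)` -/
  κ_pi : ∀ n, C.n₀ ≤ n → ∀ u,
    C.κ n (C.act (n + 1) (aPi (n + 1) * aT (n + 1) n) u) = C.act n (aPi n) (C.κ n u)

/-! ### Compatible sequences of positive DAHA modules -/

/-- A sequence of spaces `V^(n)` with actions of `𝒟_n⁺`, gradings and connecting maps
`Π^(n) : V^(n+1) → V^(n)`. Only the indices `n ≥ n₁` are relevant. -/
structure DAHASequence where
  /-- the first index -/
  n₁ : ℕ
  /-- the spaces `V^(n)` -/
  V : ℕ → Type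
  [addCommGroup : ∀ n, AddCommGroup (V n)]
  [module : ∀ n, Module Kqt (V n)]
  /-- the action of `𝒟_n⁺` on `V^(n)` -/
  act : ∀ n, DAHA n →ₐ[Kqt] Module.End Kqt (V n)
  /-- the homogeneous components `V^(n)(d)` -/
  gr : ∀ n, ℕ → Submodule Kqt (V n)
  /-- the connecting maps -/
  proj : ∀ n, V (n + 1) →ₗ[Kqt] V n

attribute [instance] DAHASequence.addCommGroup DAHASequence.module

/-- Compatible sequences. -/
structure DAHASequence.IsCompatible (D : DAHASequence) : Prop where
  one_le : 1 ≤ D.n₁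
  /-- each `V^(n)` is a graded vector space -/
  internal : ∀ n, D.n₁ ≤ n → DirectSum.IsInternal (D.gr n)
  /-- and a graded `𝒟_n⁺`-module, where `deg T_i = deg Y_i = 0` and `deg X_i = 1` -/
  T_mem : ∀ n, D.n₁ ≤ n → ∀ i d, ∀ v ∈ D.gr n d, D.act n (dT n i) v ∈ D.gr n d
  Y_mem : ∀ n, D.n₁ ≤ n → ∀ i d, ∀ v ∈ D.gr n d, D.act n (dY n i) v ∈ D.gr n d
  X_mem : ∀ n, D.n₁ ≤ n → ∀ i d, ∀ v ∈ D.gr n d, D.act n (dX n i) v ∈ D.gr n (d + 1)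
  /-- the maps are degree preserving -/
  proj_mem : ∀ n, D.n₁ ≤ n → ∀ d, ∀ v ∈ D.gr (n + 1) d, D.proj n v ∈ D.gr n d
  /-- the maps are linear over the subalgebra generated by `T_1, …, T_{n-1}, X_1, …, X_n` -/
  proj_T : ∀ n, D.n₁ ≤ n → ∀ i, 1 ≤ i → i < n → ∀ v,
    D.proj n (D.act (n + 1) (dT (n + 1) i) v) = D.act n (dT n i) (D.proj n v)
  proj_X : ∀ n, D.n₁ ≤ n → ∀ i, 1 ≤ i → i ≤ n → ∀ v,
    D.proj n (D.act (n + 1) (dX (n + 1) i) v) = D.act n (dX n i) (D.proj n v)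
  /-- `Π^(n) X_{n+1} = 0` -/
  proj_X_last : ∀ n, D.n₁ ≤ n → ∀ v, D.proj n (D.act (n + 1) (dX (n + 1) (n + 1)) v) = 0
  /-- `Π^(n) π^(n+1) T_n = π^(n) Π^(n)` -/
  proj_pi : ∀ n, D.n₁ ≤ n → ∀ v,
    D.proj n (D.act (n + 1) (dPi (n + 1) * dT (n + 1) n) v) = D.act n (dPi n) (D.proj n v)

/-! ### Induction from `𝒜_n` to `𝒟_n⁺` -/

/-- The relations `d a ⊗ u = d ⊗ a u`, with `a ∈ 𝒜_n`, that define `𝒟_n⁺ ⊗_{𝒜_n} U`. -/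
def indRel (n : ℕ) {U : Type} [AddCommGroup U] [Module Kqt U]
    (act : AHA n →ₐ[Kqt] Module.End Kqt U) : Submodule (DAHA n) (DAHA n ⊗[Kqt] U) :=
  Submodule.span (DAHA n)
    {x | ∃ (d : DAHA n) (a : AHA n) (u : U), x = (d * (a : DAHA n)) ⊗ₜ[Kqt] u - d ⊗ₜ[Kqt] act a u}

/-- The induced `𝒟_n⁺`-module `𝒟_n⁺ ⊗_{𝒜_n} U`. -/
abbrev IndSpace (n : ℕ) {U : Type} [AddCommGroup U] [Module Kqt U]
    (act : AHA n →ₐ[Kqt] Module.End Kqt U) : Type :=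
  (DAHA n ⊗[Kqt] U) ⧸ indRel n act

/-- The element `d ⊗ u` of `𝒟_n⁺ ⊗_{𝒜_n} U`. -/
def indTensor {n : ℕ} {U : Type} [AddCommGroup U] [Module Kqt U]
    (act : AHA n →ₐ[Kqt] Module.End Kqt U) (d : DAHA n) (u : U) : IndSpace n act :=
  Submodule.Quotient.mk (d ⊗ₜ[Kqt] u)

/-- The monomial `X^α = X_1^{α_1} ⋯ X_n^{α_n}` in `𝒟_n⁺`. -/
def dMonomial (n : ℕ) (α : ℕ → ℕ) : DAHA n := prodUpTo (fun i => dX n i ^ α i) n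

/-- The family `p` consists of the connecting maps
`Π_C^(n) (X^α ⊗ u) = 1(α_{n+1} = 0) X^α ⊗ κ^(n)(u)` of `Ind(C)`. -/
def AHASequence.IsIndMap (C : AHASequence) (n : ℕ)
    (p : IndSpace (n + 1) (C.act (n + 1)) →ₗ[Kqt] IndSpace n (C.act n)) : Prop :=
  ∀ (α : ℕ → ℕ) (u : C.U (n + 1)),
    p (indTensor (C.act (n + 1)) (dMonomial (n + 1) α) u) =
      if α (n + 1) = 0 then indTensor (C.act n) (dMonomial n α) (C.κ n u) else 0

/-- The sequence `Ind(C)` of induced modules, with connecting maps `p`. The component of degree `d`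
is spanned by the `X^α ⊗ u` with `u` homogeneous and `|α| + deg u = d`. -/
def AHASequence.ind (C : AHASequence)
    (p : ∀ n, IndSpace (n + 1) (C.act (n + 1)) →ₗ[Kqt] IndSpace n (C.act n)) : DAHASequence where
  n₁ := C.n₀
  V n := IndSpace n (C.act n)
  act n := Algebra.lsmul Kqt Kqt (IndSpace n (C.act n))
  gr n d := Submodule.span Kqt
    {x | ∃ (α : ℕ → ℕ) (e : ℕ) (u : C.U n), u ∈ C.gr n e ∧ (∑ i ∈ Finset.Icc 1 n, α i) + e = d ∧
      x = indTensor (C.act n) (dMonomial n α) u}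
  proj := p

/-! ### The sequence `C_λ` -/

/-- The diagram `λ^(n) = (n - |λ|, λ)`, for `n ≥ n_λ = |λ| + λ_1`. (For smaller `n` its first row
is given the length `λ_1`.) -/
def lamDiagram (lam : YoungDiagram) (n : ℕ) : YoungDiagram where
  cells := (Finset.range (max (n - lam.card) (lam.rowLen 0))).image (fun j => (0, j)) ∪
    lam.cells.image (fun c => (c.1 + 1, c.2))
  isLowerSet := by
    rintro ⟨a, b⟩ ⟨i, j⟩ hle hmem
    obtain ⟨h1, h2⟩ := Prod.le_def.mp hle
    simp only at h1 h2
    simp only [Finset.coe_union, Finset.coe_image, Set.mem_union, Set.mem_image, Finset.mem_coe,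
      Finset.mem_range, Prod.mk.injEq] at hmem ⊢
    rcases hmem with ⟨j', hj', ha, hb⟩ | ⟨⟨i', j'⟩, hc, ha, hb⟩
    · exact Or.inl ⟨j, by omega, by omega, rfl⟩
    · simp only at ha hb
      rcases Nat.eq_zero_or_pos i with h0 | h0
      · have hc' : (0, j) ∈ lam :=
          lam.isLowerSet (Prod.le_def.mpr ⟨Nat.zero_le _, hb ▸ h2⟩) hc
        have := YoungDiagram.mem_iff_lt_rowLen.mp hc'
        exact Or.inl ⟨j, by omega, h0.symm, rfl⟩
      · refine Or.inr ⟨(i - 1, j), ?_, by simp only; omega, rfl⟩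
        exact lam.isLowerSet (Prod.le_def.mpr ⟨by simp only; omega, by simp only; omega⟩) hc

/-- `σ` is the restriction of the tableau `τ` to its boxes with entries at most `n`. -/
def IsRestriction {μ' μ : YoungDiagram} {n' n : ℕ} (τ : SYT μ' n') (σ : SYT μ n) : Prop :=
  ∀ i, 1 ≤ i → i ≤ n → cellOf σ.fill i = cellOf τ.fill i

theorem mem_lamDiagram (lam : YoungDiagram) (n : ℕ) (c : ℕ × ℕ) :
    c ∈ (lamDiagram lam n).cells ↔ (c.1 = 0 ∧ c.2 < max (n - lam.card) (lam.rowLen 0)) ∨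
      (1 ≤ c.1 ∧ (c.1 - 1, c.2) ∈ lam.cells) := by
  obtain ⟨a, b⟩ := c
  simp only [lamDiagram, Finset.mem_union, Finset.mem_image, Finset.mem_range, Prod.mk.injEq]
  constructor
  · rintro (⟨j, hj, ha, hb⟩ | ⟨⟨i, j⟩, hc, ha, hb⟩)
    · left; exact ⟨ha.symm, hb ▸ hj⟩
    · right
      simp only at ha hb
      subst ha hb
      exact ⟨by omega, by simpa using hc⟩
  · rintro (⟨ha, hb⟩ | ⟨ha, hb⟩)
    · exact Or.inl ⟨b, hb, ha.symm, rfl⟩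
    · exact Or.inr ⟨(a - 1, b), hb, by simp only; omega, rfl⟩

/-- If `τ` has the entry `n + 1` in `□₀`, then the restriction of `τ` to `λ^(n)` is a standard
tableau. -/
theorem exists_restriction (lam : YoungDiagram) (n : ℕ) (hn : lam.card + lam.rowLen 0 ≤ n)
    (τ : SYT (lamDiagram lam (n + 1)) (n + 1))
    (h : cellOf τ.fill (n + 1) = (0, n - lam.card)) :
    ∃ σ : SYT (lamDiagram lam n) n, IsRestriction τ σ := by
  have h0 : (0, n - lam.card) ∉ (lamDiagram lam n).cells := by
    rw [mem_lamDiagram]; simp only; omega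
  have h1 : ∀ c, c ∈ (lamDiagram lam n).cells → c ∈ (lamDiagram lam (n + 1)).cells := by
    intro c hc
    rw [mem_lamDiagram] at hc ⊢
    rcases hc with hc | hc
    · left; omega
    · exact Or.inr hc
  have h2 : ∀ c, c ∈ (lamDiagram lam (n + 1)).cells → c ≠ (0, n - lam.card) →
      c ∈ (lamDiagram lam n).cells := by
    rintro ⟨a, b⟩ hc hne
    rw [mem_lamDiagram] at hc ⊢
    rcases hc with hc | hc
    · simp only [ne_eq, Prod.mk.injEq] at hc hne ⊢
      left; omega
    · exact Or.inr hc
  have hval : ∀ c (hc : c ∈ (lamDiagram lam n).cells),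
      (τ.fill ⟨c, h1 c hc⟩).1 ∈ Finset.Icc 1 n := by
    intro c hc
    have hmem := Finset.mem_Icc.mp (τ.fill ⟨c, h1 c hc⟩).2
    refine Finset.mem_Icc.mpr ⟨hmem.1, ?_⟩
    by_contra hlt
    have hcell := cellOf_apply τ.fill ⟨c, h1 c hc⟩
    rw [show (τ.fill ⟨c, h1 c hc⟩).1 = n + 1 by omega, h] at hcell
    exact h0 (hcell ▸ hc)
  have hcell : ∀ i, i ∈ Finset.Icc 1 n → cellOf τ.fill i ∈ (lamDiagram lam n).cells := by
    intro i hi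
    have hi' := Finset.mem_Icc.mp hi
    refine h2 _ (cellOf_mem _ hi'.1 (by omega)) fun heq => ?_
    have := cellOf_inj τ.fill hi'.1 (by omega) (by omega : 1 ≤ n + 1) le_rfl (heq.trans h.symm)
    omega
  let f : Filling (lamDiagram lam n) n :=
    { toFun := fun c => ⟨(τ.fill ⟨c.1, h1 c.1 c.2⟩).1, hval c.1 c.2⟩
      invFun := fun i => ⟨cellOf τ.fill i.1, hcell i.1 i.2⟩
      left_inv := fun c => Subtype.ext (cellOf_apply τ.fill ⟨c.1, h1 c.1 c.2⟩)
      right_inv := fun i => Subtype.ext (by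
        have hi := Finset.mem_Icc.mp i.2
        exact apply_cellOf τ.fill hi.1 (by omega) _) }
  refine ⟨⟨f, fun x y hxy => ?_⟩, fun i hi1 hi2 => ?_⟩
  · exact (τ.mono (show (⟨x.1, h1 x.1 x.2⟩ :
      {c : ℕ × ℕ // c ∈ (lamDiagram lam (n + 1)).cells}) ≤ ⟨y.1, h1 y.1 y.2⟩ from hxy) :
      τ.fill _ ≤ τ.fill _)
  · change cellOf f i = _
    rw [cellOf, dif_pos (Finset.mem_Icc.mpr ⟨hi1, hi2⟩)]
    rfl

open Classical in
/-- The map `κ_λ^(n)`: the basis vector `e_τ` is sent to `e_{τ|λ^(n)}` if `τ` has the entry `n + 1`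
in the box `□₀ = (0, n - |λ|)` of `λ^(n+1) / λ^(n)`, and to zero otherwise. (The restriction then
exists by `exists_restriction`, if `n ≥ |λ| + λ_1`.) -/
def kappaLam (lam : YoungDiagram) (n : ℕ) :
    SpechtSpace (lamDiagram lam (n + 1)) (n + 1) →ₗ[Kqt] SpechtSpace (lamDiagram lam n) n :=
  Finsupp.linearCombination Kqt fun τ =>
    if h : cellOf τ.fill (n + 1) = (0, n - lam.card) ∧
        ∃ σ : SYT (lamDiagram lam n) n, IsRestriction τ σ then
      Finsupp.single h.2.choose 1
    else 0

/-- The sequence `C_λ`: the modules `U_λ^(n) = ρ_n^*(S_{λ^(n)})`, concentrated in degree `0`, with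
the maps `κ_λ^(n)`, for `n ≥ max(1, |λ| + λ_1)`. -/
def seqLam (lam : YoungDiagram) : AHASequence where
  n₀ := max 1 (lam.card + lam.rowLen 0)
  U n := SpechtSpace (lamDiagram lam n) n
  act n := (spechtAct (lamDiagram lam n) n).comp (rho n)
  gr _ d := if d = 0 then ⊤ else ⊥
  κ n := kappaLam lam n

/-! ### The algebra `𝔹_{q,t}` -/

/-- Names of the arrows of the quiver with vertices `k = 0, 1, 2, …`: the idempotents `e k`,
`dp k : k → k + 1` for `d_+`, `dm k : k + 1 → k` for `d_-`, and the loops `T k i`, `z k i` at `k`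
(`1 ≤ i ≤ k - 1` and `1 ≤ i ≤ k` respectively; the other names are set to zero). -/
inductive BGen : Type
  | e (k : ℕ)
  | dp (k : ℕ)
  | dm (k : ℕ)
  | T (k i : ℕ)
  | z (k i : ℕ)

/-- The free algebra on the names. -/
abbrev BFree : Type := FreeAlgebra Kqt BGen

/-- The idempotent at the vertex `k`. -/
def be (k : ℕ) : BFree := FreeAlgebra.ι Kqt (BGen.e k)
/-- `d_+` from the vertex `k` to `k + 1`. -/
def bp (k : ℕ) : BFree := FreeAlgebra.ι Kqt (BGen.dp k)
/-- `d_-` from the vertex `k + 1` to `k`. -/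
def bm (k : ℕ) : BFree := FreeAlgebra.ι Kqt (BGen.dm k)
/-- `T_i` at the vertex `k`. -/
def bT (k i : ℕ) : BFree := FreeAlgebra.ι Kqt (BGen.T k i)
/-- `z_i` at the vertex `k`. -/
def bz (k i : ℕ) : BFree := FreeAlgebra.ι Kqt (BGen.z k i)

/-- `φ = (q - 1)⁻¹ [d_+, d_-]` at the vertex `k + 1`. -/
def bphi (k : ℕ) : BFree := (q - 1)⁻¹ • (bp k * bm k - bm (k + 1) * bp (k + 1))

/-- Defining relations of `𝔹_{q,t}`; products are composed from right to left. The relation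
`T_i z_i T_i = q z_{i+1}` is `T_i⁻¹ z_{i+1} T_i⁻¹ = q⁻¹ z_i` cleared of inverses. -/
inductive BRel : BFree → BFree → Prop
  | e_e (k : ℕ) : BRel (be k * be k) (be k)
  | e_ne (j k : ℕ) (h : j ≠ k) : BRel (be j * be k) 0
  | dp_left (k : ℕ) : BRel (be (k + 1) * bp k) (bp k)
  | dp_right (k : ℕ) : BRel (bp k * be k) (bp k)
  | dm_left (k : ℕ) : BRel (be k * bm k) (bm k)
  | dm_right (k : ℕ) : BRel (bm k * be (k + 1)) (bm k)
  | T_left (k i : ℕ) : BRel (be k * bT k i) (bT k i)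
  | T_right (k i : ℕ) : BRel (bT k i * be k) (bT k i)
  | z_left (k i : ℕ) : BRel (be k * bz k i) (bz k i)
  | z_right (k i : ℕ) : BRel (bz k i * be k) (bz k i)
  | T_out (k i : ℕ) (h : ¬ (1 ≤ i ∧ i < k)) : BRel (bT k i) 0
  | z_out (k i : ℕ) (h : ¬ (1 ≤ i ∧ i ≤ k)) : BRel (bz k i) 0
  | quad (k i : ℕ) (h1 : 1 ≤ i) (h2 : i < k) :
      BRel ((bT k i - be k) * (bT k i + q • be k)) 0
  | braid (k i : ℕ) (h1 : 1 ≤ i) (h2 : i + 1 < k) :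
      BRel (bT k i * bT k (i + 1) * bT k i) (bT k (i + 1) * bT k i * bT k (i + 1))
  | T_T (k i j : ℕ) (h1 : 1 ≤ i) (h2 : i + 1 < j) (h3 : j < k) :
      BRel (bT k i * bT k j) (bT k j * bT k i)
  | T_z_T (k i : ℕ) (h1 : 1 ≤ i) (h2 : i < k) :
      BRel (bT k i * bz k i * bT k i) (q • bz k (i + 1))
  | z_T (k i j : ℕ) (h1 : 1 ≤ i) (h2 : i ≤ k) (h3 : 1 ≤ j) (h4 : j < k) (h5 : i ≠ j)
      (h6 : i ≠ j + 1) : BRel (bz k i * bT k j) (bT k j * bz k i)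
  | z_z (k i j : ℕ) (h1 : 1 ≤ i) (h2 : i ≤ k) (h3 : 1 ≤ j) (h4 : j ≤ k) :
      BRel (bz k i * bz k j) (bz k j * bz k i)
  | dm_dm_T (k : ℕ) : BRel (bm k * bm (k + 1) * bT (k + 2) (k + 1)) (bm k * bm (k + 1))
  | dm_T (k i : ℕ) (h1 : 1 ≤ i) (h2 : i < k) : BRel (bm k * bT (k + 1) i) (bT k i * bm k)
  | T_dp_dp (k : ℕ) : BRel (bT (k + 2) 1 * bp (k + 1) * bp k) (bp (k + 1) * bp k)
  | dp_T (k i : ℕ) (h1 : 1 ≤ i) (h2 : i < k) :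
      BRel (bp k * bT k i) (bT (k + 1) (i + 1) * bp k)
  | phi_dm (k : ℕ) :
      BRel (q • (bphi k * bm (k + 1))) (bm (k + 1) * bphi (k + 1) * bT (k + 2) (k + 1))
  | phi_dp (k : ℕ) :
      BRel (bT (k + 2) 1 * bphi (k + 1) * bp (k + 1)) (q • (bp (k + 1) * bphi k))
  | z_dm (k i : ℕ) (h1 : 1 ≤ i) (h2 : i ≤ k) : BRel (bz k i * bm k) (bm k * bz (k + 1) i)
  | dp_z (k i : ℕ) (h1 : 1 ≤ i) (h2 : i ≤ k) : BRel (bp k * bz k i) (bz (k + 1) (i + 1) * bp k)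
  | z_one (k : ℕ) :
      BRel (bz (k + 1) 1 * (q • (bp k * bm k) - bm (k + 1) * bp (k + 1)))
        ((q * t) • ((bp k * bm k - bm (k + 1) * bp (k + 1)) * bz (k + 1) (k + 1)))

/-- The path algebra `𝔹_{q,t}`, with a unit adjoined (it has infinitely many orthogonal
idempotents). Its modules are the modules of this algebra that are the sum of the images of the
idempotents. -/
def Bqt : Type := RingQuot BRel

instance : Ring Bqt := inferInstanceAs (Ring (RingQuot BRel))

instance : Algebra Kqt Bqt := inferInstanceAs (Algebra Kqt (RingQuot BRel))

/-- The quotient map from the free algebra. -/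
def bMk : BFree →ₐ[Kqt] Bqt := RingQuot.mkAlgHom Kqt BRel

/-! ### The space `𝔏_•` and the action of `𝔹_{q,t}` -/

namespace DAHASequence

variable (D : DAHASequence)

/-- `L_k(V^(n)) = X_1 ⋯ X_k ε_k (V^(n))` for `0 ≤ k ≤ n` (and zero for `k > n`). -/
def finiteL (n k : ℕ) : Submodule Kqt (D.V n) :=
  if k ≤ n then LinearMap.range (D.act n (prodUpTo (dX n) k * dEps n k)) else ⊥

/-- The component of degree `d` of `𝔏_k`: the sequences `(v_n)_{n ≥ n₁}` with `v_n ∈ L_k(V^(n))`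
homogeneous of degree `d` and `Π^(n)(v_{n+1}) = v_n`. -/
def stableL (k d : ℕ) : Submodule Kqt (∀ n : {n : ℕ // D.n₁ ≤ n}, D.V n.1) where
  carrier := {v | (∀ n, v n ∈ D.finiteL n.1 k ∧ v n ∈ D.gr n.1 d) ∧
    ∀ (n : ℕ) (h : D.n₁ ≤ n), D.proj n (v ⟨n + 1, h.trans n.le_succ⟩) = v ⟨n, h⟩}
  add_mem' := by
    rintro a b ⟨ha, ha'⟩ ⟨hb, hb'⟩
    refine ⟨fun n => ⟨(D.finiteL n.1 k).add_mem (ha n).1 (hb n).1,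
      (D.gr n.1 d).add_mem (ha n).2 (hb n).2⟩, fun n h => ?_⟩
    simp only [Pi.add_apply, map_add, ha' n h, hb' n h]
  zero_mem' :=
    ⟨fun n => ⟨(D.finiteL n.1 k).zero_mem, (D.gr n.1 d).zero_mem⟩, fun n h => by simp⟩
  smul_mem' := by
    rintro c a ⟨ha, ha'⟩
    refine ⟨fun n => ⟨(D.finiteL n.1 k).smul_mem c (ha n).1,
      (D.gr n.1 d).smul_mem c (ha n).2⟩, fun n h => ?_⟩
    simp only [Pi.smul_apply, map_smul, ha' n h]

/-- `𝔏_• = ⨁_k 𝔏_k = ⨁_k ⨁_d 𝔏_k(d)`. -/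
abbrev stableSpace : Type := ⨁ p : ℕ × ℕ, D.stableL p.1 p.2

/-- The element of `𝔏_•` given by an element of `𝔏_k(d)`. -/
def stableOf (k d : ℕ) (v : D.stableL k d) : D.stableSpace :=
  DirectSum.lof Kqt (ℕ × ℕ) (fun p : ℕ × ℕ => D.stableL p.1 p.2) (k, d) v

/-- The operator `d_+ = q^k X_1 T_1⁻¹ ⋯ T_k⁻¹ : L_k → L_{k+1}`, for `k + 1 ≤ n`
(zero for larger `k`). -/
def opPlus (n k : ℕ) : DAHA n :=
  if k + 1 ≤ n then q ^ k • (dX n 1 * prodUpTo (dTinv n) k) else 0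

/-- The operator `d_- = (q - 1) (1 + q T_k⁻¹ + ⋯ + q^{n-k} T_{n-1}⁻¹ ⋯ T_k⁻¹) : L_k → L_{k-1}`, for
`1 ≤ k ≤ n` (zero for larger `k`). -/
def opMinus (n k : ℕ) : DAHA n :=
  if k ≤ n then (q - 1) • ∑ j ∈ Finset.range (n - k + 1), q ^ j • prodDown (dTinv n) k j else 0

/-- `ρ` is an action of `𝔹_{q,t}` on `𝔏_•` as a graded module with `deg d_+ = 1` and
`deg T_i = deg z_i = deg d_- = 0`, such that the idempotent with label `k` projects onto `𝔏_k` and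
the generators act componentwise, by `T_i`, by `z_i = (qt)⁻¹ Y_i` and by the operators `d_+`, `d_-`
on the spaces `L_k(V^(n))`. -/
structure IsBAction (ρ : Bqt →ₐ[Kqt] Module.End Kqt D.stableSpace) : Prop where
  e_self : ∀ k d (v : D.stableL k d), ρ (bMk (be k)) (D.stableOf k d v) = D.stableOf k d v
  e_ne : ∀ j k d (v : D.stableL k d), j ≠ k → ρ (bMk (be j)) (D.stableOf k d v) = 0
  T : ∀ k d (v : D.stableL k d) i, 1 ≤ i → i < k → ∃ w : D.stableL k d,
    (∀ n, w.1 n = D.act n.1 (dT n.1 i) (v.1 n)) ∧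
      ρ (bMk (bT k i)) (D.stableOf k d v) = D.stableOf k d w
  z : ∀ k d (v : D.stableL k d) i, 1 ≤ i → i ≤ k → ∃ w : D.stableL k d,
    (∀ n, w.1 n = (q * t)⁻¹ • D.act n.1 (dY n.1 i) (v.1 n)) ∧
      ρ (bMk (bz k i)) (D.stableOf k d v) = D.stableOf k d w
  dp : ∀ k d (v : D.stableL k d), ∃ w : D.stableL (k + 1) (d + 1),
    (∀ n, w.1 n = D.act n.1 (opPlus n.1 k) (v.1 n)) ∧
      ρ (bMk (bp k)) (D.stableOf k d v) = D.stableOf (k + 1) (d + 1) w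
  dm : ∀ k d (v : D.stableL (k + 1) d), ∃ w : D.stableL k d,
    (∀ n, w.1 n = D.act n.1 (opMinus n.1 (k + 1)) (v.1 n)) ∧
      ρ (bMk (bm k)) (D.stableOf (k + 1) d v) = D.stableOf k d w

end DAHASequence

end MurnaghanB

end

open MurnaghanB

open scoped TensorProduct DirectSum

noncomputable section

namespace MurnaghanB

/-! The proof has three pieces, which meet only at the end.

The action of 𝔹_{q,t}, for an arbitrary compatible sequence. The image of ε_k is the space of
vectors fixed by T_{k+1}, …, T_{n-1} (`range_dEps`), so L_k is X_1⋯X_k times these invariants. Up to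
the factor q - 1, d_- is a sum over coset representatives, which makes such vectors invariant under
one more generator (`HeckeRelations.cosetSum_mem`). The commutator of d_+ and d_- telescopes: at the
vertex k + 1, φ is given by the same element q^k X_1 T_1⁻¹⋯T_k⁻¹ as d_+ at the vertex k
(`opPlus_opMinus_comm`). With this, most relations of 𝔹_{q,t} become braid manipulations in 𝒟_n⁺.
The last relation turns into Y_1 d_+ (d_- + 1) = qt d_+ Y_{k+1} on invariants
(`dY_one_opPlus_apply`). The operators pass to stable sequences because on L_k they are compatible
with Π: on multiples of X_1, the element Y_1 is an expression in X_1, the T_i and π T_n, and every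
surplus term in rank n + 1 carries a factor X_{n+1}, which Π kills. Uniqueness holds because each
generator x with source k satisfies x = x e_k, so that it is determined by its values on 𝔏_k.

Induction. What is needed is that the X^α ⊗ u behave like monomials with coefficients in U. They are
mapped to the space of polynomials tensored with U, on which T_i acts by Demazure–Lusztig operators
and π by a cyclic substitution of variables. A homomorphism out of 𝒟_n⁺ may be given by images of
T_i, X_i and π subject to relations without any Y_i (`DoubleAffineRelations.hom`), and each of these
relations is checked on 1 ⊗ U and then carried across multiplication by X_j. This yields the maps Π,
their uniqueness and the grading. Compatibility of Ind(C) is again checked on 1 ⊗ u and carried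
across the X_j.

The sequence C_λ. For i < n the operator T_i does not move the entry n + 1, and its seminormal
coefficients depend only on contents, so κ is ℋ_n-linear. Under ρ the element π^(n+1) T_n becomes
T_1⁻¹⋯T_{n-1}⁻¹, since the last inverse cancels, and the condition on π follows from ℋ_n-linearity.
For the nonvanishing put N = n_λ and take tableaux τ_n, compatible under restriction, whose entries
beyond N all lie in the first row. Then T_j with j > N fixes e_{τ_n}, so the X_1⋯X_N ⊗ e_{τ_n} form
a stable sequence in L_N, and it is nonzero by the monomial structure. -/

instance natAlgebraKqt : Algebra ℕ Kqt := Semiring.toNatAlgebra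

instance intAlgebraKqt : Algebra ℤ Kqt := Ring.toIntAlgebra _

/-! ### Ordered products in families with braid relations -/

section Products

variable {M : Type*} [Monoid M]

theorem commute_prodUpTo {x : M} {a : ℕ → M} (m : ℕ)
    (h : ∀ i, 1 ≤ i → i ≤ m → Commute x (a i)) : Commute x (prodUpTo a m) := by
  induction m with
  | zero => exact Commute.one_right x
  | succ m ih =>
    exact (ih fun i h1 h2 => h i h1 (by omega)).mul_right (h (m + 1) (by omega) le_rfl)

theorem commute_prodDown {x : M} {a : ℕ → M} (k j : ℕ)
    (h : ∀ i, k ≤ i → i < k + j → Commute x (a i)) : Commute x (prodDown a k j) := by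
  induction j with
  | zero => exact Commute.one_right x
  | succ j ih =>
    exact (h (k + j) (by omega) (by omega)).mul_right (ih fun i h1 h2 => h i h1 (by omega))

theorem prodDown_succ_right (a : ℕ → M) (k j : ℕ) :
    prodDown a k (j + 1) = prodDown a (k + 1) j * a k := by
  induction j with
  | zero => simp [prodDown]
  | succ j ih =>
    rw [prodDown, ih, prodDown, mul_assoc, show k + 1 + j = k + (j + 1) by omega]

theorem prodUpTo_succ_left (a : ℕ → M) (m : ℕ) :
    prodUpTo a (m + 1) = a 1 * prodUpTo (fun i => a (i + 1)) m := by
  induction m with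
  | zero => simp [prodUpTo]
  | succ m ih => rw [prodUpTo, ih, prodUpTo, mul_assoc]

theorem prodDown_mul_prodUpTo {a b : ℕ → M} (m : ℕ)
    (h : ∀ i, 1 ≤ i → i ≤ m → b i * a i = 1) : prodDown b 1 m * prodUpTo a m = 1 := by
  have key : ∀ m' ≤ m, prodUpTo a m = prodUpTo a m → prodDown b 1 m' * prodUpTo a m' = 1 := by
    intro m' hm' _
    induction m' with
    | zero => simp [prodDown, prodUpTo]
    | succ j ih =>
      have h1 := h (j + 1) (by omega) hm'
      rw [prodDown, prodUpTo, ← mul_assoc, mul_assoc (b (1 + j)), ih (by omega), mul_one,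
        add_comm 1 j, h1]
  exact key m le_rfl rfl

theorem prodUpTo_mul_prodDown {a b : ℕ → M} (m : ℕ)
    (h : ∀ i, 1 ≤ i → i ≤ m → a i * b i = 1) : prodUpTo a m * prodDown b 1 m = 1 := by
  induction m with
  | zero => simp [prodDown, prodUpTo]
  | succ j ih =>
    have h1 := h (j + 1) (by omega) le_rfl
    rw [prodDown, prodUpTo, ← mul_assoc, mul_assoc (prodUpTo a j), add_comm 1 j, h1, mul_one,
      ih fun i h2 h3 => h i h2 (by omega)]

/-- Elements `a_1, …, a_{n-1}` that satisfy the braid relations. -/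
structure BraidRelations (n : ℕ) (a : ℕ → M) : Prop where
  braid : ∀ i, 1 ≤ i → i + 1 < n → a i * a (i + 1) * a i = a (i + 1) * a i * a (i + 1)
  comm : ∀ i j, 1 ≤ i → i + 1 < j → j < n → Commute (a i) (a j)

variable {n : ℕ} {a : ℕ → M}

/-- Only the factors a_i a_{i+1} interact with a_i: the later ones commute with it, the braid
relation turns it into a_{i+1}, and this commutes with the earlier factors. -/
theorem BraidRelations.prodUpTo_mul (h : BraidRelations n a) {i m : ℕ} (h1 : 1 ≤ i) (h2 : i < m)
    (h3 : m < n) : prodUpTo a m * a i = a (i + 1) * prodUpTo a m := by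
  induction m with
  | zero => omega
  | succ m ih =>
    rcases Nat.lt_or_ge i m with h4 | h4
    · rw [prodUpTo, mul_assoc, (h.comm i (m + 1) h1 (by omega) h3).eq.symm, ← mul_assoc,
        ih h4 (by omega), mul_assoc]
    · obtain rfl : i = m := by omega
      obtain ⟨l, rfl⟩ : ∃ l, i = l + 1 := ⟨i - 1, by omega⟩
      have hc : Commute (a (l + 1 + 1)) (prodUpTo a l) :=
        commute_prodUpTo l fun j h5 h6 => (h.comm j (l + 1 + 1) h5 (by omega) h3).symm
      have hb := h.braid (l + 1) h1 h3
      calc prodUpTo a l * a (l + 1) * a (l + 1 + 1) * a (l + 1)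
          = prodUpTo a l * (a (l + 1) * a (l + 1 + 1) * a (l + 1)) := by simp only [mul_assoc]
        _ = (prodUpTo a l * a (l + 1 + 1)) * a (l + 1) * a (l + 1 + 1) := by
            rw [hb]; simp only [mul_assoc]
        _ = _ := by rw [← hc.eq]; simp only [mul_assoc, prodUpTo]

theorem BraidRelations.mul_prodDown (h : BraidRelations n a) {i k j : ℕ} (h1 : 1 ≤ k) (h2 : k ≤ i)
    (h3 : i + 1 < k + j) (h4 : k + j ≤ n) :
    a i * prodDown a k j = prodDown a k j * a (i + 1) := by
  induction j with
  | zero => omega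
  | succ j ih =>
    rcases Nat.lt_or_ge (i + 1) (k + j) with h5 | h5
    · rw [prodDown, ← mul_assoc, (h.comm i (k + j) (by omega) h5 (by omega)).eq, mul_assoc,
        ih h5 (by omega), mul_assoc]
    · obtain ⟨l, rfl⟩ : ∃ l, j = l + 1 := ⟨j - 1, by omega⟩
      obtain rfl : i = k + l := by omega
      have hc : Commute (a (k + l + 1)) (prodDown a k l) := commute_prodDown k l fun j h6 h7 =>
        (h.comm j (k + l + 1) (by omega) (by omega) (by omega)).symm
      have hb := h.braid (k + l) (by omega) (by omega)
      calc a (k + l) * (a (k + l + 1) * (a (k + l) * prodDown a k l))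
          = (a (k + l) * a (k + l + 1) * a (k + l)) * prodDown a k l := by simp only [mul_assoc]
        _ = a (k + l + 1) * (a (k + l) * (a (k + l + 1) * prodDown a k l)) := by
            rw [hb]; simp only [mul_assoc]
        _ = _ := by rw [hc.eq]; simp only [mul_assoc, prodDown, add_assoc]

end Products

/-! ### Identities in finite Hecke algebras -/

section HeckeInv

variable {R : Type*} [Ring R] [Algebra Kqt R]

theorem q_smul_heckeInv (x : R) : q • heckeInv x = x + (q - 1) • (1 : R) := by
  rw [heckeInv, smul_smul, mul_inv_cancel₀ q_ne_zero, one_smul, Algebra.algebraMap_eq_smul_one]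

theorem eq_q_smul_heckeInv_sub (x : R) : x = q • heckeInv x - (q - 1) • (1 : R) := by
  rw [q_smul_heckeInv]; abel

/-- `heckeInv x` is affine in `x` with central coefficients, so no invertibility is needed. -/
theorem SemiconjBy.heckeInv {a x y : R} (h : SemiconjBy a x y) :
    SemiconjBy a (heckeInv x) (heckeInv y) := by
  simp only [SemiconjBy, MurnaghanB.heckeInv, mul_smul_comm, smul_mul_assoc, mul_add, add_mul,
    h.eq, ← Algebra.commutes]

theorem SemiconjBy.of_heckeInv {a x y : R}
    (h : SemiconjBy a (MurnaghanB.heckeInv x) (MurnaghanB.heckeInv y)) : SemiconjBy a x y := by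
  rw [SemiconjBy, eq_q_smul_heckeInv_sub x, eq_q_smul_heckeInv_sub y]
  simp only [mul_sub, sub_mul, mul_smul_comm, smul_mul_assoc, h.eq, mul_one, one_mul]

theorem hecke_mul_self {x : R} (h : (x - 1) * (x + algebraMap Kqt R q) = 0) :
    x * x = (1 - q) • x + q • (1 : R) := by
  rw [Algebra.algebraMap_eq_smul_one] at h
  have : x * x - ((1 - q) • x + q • (1 : R)) = (x - 1) * (x + q • (1 : R)) := by
    simp only [sub_mul, mul_add, mul_smul_comm, mul_one, one_mul, sub_smul, one_smul, smul_sub]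
    abel
  rw [← sub_eq_zero, this, h]

theorem map_heckeInv {S : Type*} [Ring S] [Algebra Kqt S] (φ : R →ₐ[Kqt] S) (x : R) :
    φ (heckeInv x) = heckeInv (φ x) := by
  simp [heckeInv]

namespace HeckeRelations

variable {n : ℕ} {T : ℕ → R}

theorem mul_inv (hT : HeckeRelations n T) {i : ℕ} (h1 : 1 ≤ i) (h2 : i < n) :
    T i * heckeInv (T i) = 1 := mul_heckeInv (hT.quad i h1 h2)

theorem inv_mul (hT : HeckeRelations n T) {i : ℕ} (h1 : 1 ≤ i) (h2 : i < n) :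
    heckeInv (T i) * T i = 1 := heckeInv_mul (hT.quad i h1 h2)

theorem mul_self (hT : HeckeRelations n T) {i : ℕ} (h1 : 1 ≤ i) (h2 : i < n) :
    T i * T i = (1 - q) • T i + q • (1 : R) := hecke_mul_self (hT.quad i h1 h2)

theorem braidRelations (hT : HeckeRelations n T) : BraidRelations n T :=
  ⟨hT.braid, hT.comm⟩

/-- `T_i T_{i+1}` conjugates `T_i` into `T_{i+1}`. -/
theorem semiconj_up (hT : HeckeRelations n T) {i : ℕ} (h1 : 1 ≤ i) (h2 : i + 1 < n) :
    SemiconjBy (T i * T (i + 1)) (T i) (T (i + 1)) := by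
  rw [SemiconjBy, hT.braid i h1 h2, mul_assoc]

/-- `T_{i+1}⁻¹ T_i⁻¹` conjugates `T_{i+1}` into `T_i`. -/
theorem semiconj_inv (hT : HeckeRelations n T) {i : ℕ} (h1 : 1 ≤ i) (h2 : i + 1 < n) :
    SemiconjBy (heckeInv (T (i + 1)) * heckeInv (T i)) (T (i + 1)) (T i) := by
  have a1 := hT.mul_inv h1 (by omega : i < n)
  have a2 := hT.inv_mul h1 (by omega : i < n)
  have b1 := hT.mul_inv (by omega : 1 ≤ i + 1) h2
  have b2 := hT.inv_mul (by omega : 1 ≤ i + 1) h2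
  have h := (hT.semiconj_up h1 h2).eq
  set A := T i
  set B := T (i + 1)
  set A' := heckeInv A
  set B' := heckeInv B
  calc B' * A' * B = B' * A' * B * (A * (B * B') * A') := by rw [b1, mul_one, a1, mul_one]
    _ = B' * A' * (B * (A * B)) * B' * A' := by simp only [mul_assoc]
    _ = B' * (A' * A) * B * A * B' * A' := by rw [← h]; simp only [mul_assoc]
    _ = A * (B' * A') := by rw [a2, mul_one, b2, one_mul, mul_assoc]

theorem braidRelations_inv (hT : HeckeRelations n T) :
    BraidRelations n fun i => heckeInv (T i) where
  braid i h1 h2 := by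
    have := (SemiconjBy.heckeInv (hT.semiconj_inv h1 h2)).eq
    rw [this, mul_assoc]
  comm i j h1 h2 h3 := commute_heckeInv (commute_heckeInv (hT.comm i j h1 h2 h3 :
    Commute (T i) (T j)).symm).symm

/-- The conjugations `T_1⁻¹ ⋯ T_m⁻¹ T_i = T_{i+1} T_1⁻¹ ⋯ T_m⁻¹`. -/
theorem prodUpTo_inv_mul (hT : HeckeRelations n T) {i m : ℕ} (h1 : 1 ≤ i) (h2 : i < m)
    (h3 : m < n) : prodUpTo (fun i => heckeInv (T i)) m * T i =
      T (i + 1) * prodUpTo (fun i => heckeInv (T i)) m :=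
  (SemiconjBy.of_heckeInv (hT.braidRelations_inv.prodUpTo_mul h1 h2 h3 :
    SemiconjBy _ (heckeInv (T i)) (heckeInv (T (i + 1))))).eq

theorem mul_prodDown_inv (hT : HeckeRelations n T) {i k j : ℕ} (h1 : 1 ≤ k) (h2 : k ≤ i)
    (h3 : i + 1 < k + j) (h4 : k + j ≤ n) :
    T i * prodDown (fun i => heckeInv (T i)) k j =
      prodDown (fun i => heckeInv (T i)) k j * T (i + 1) :=
  (SemiconjBy.of_heckeInv (hT.braidRelations_inv.mul_prodDown h1 h2 h3 h4).symm :
    SemiconjBy _ (T (i + 1)) (T i)).eq.symm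

end HeckeRelations

end HeckeInv

/-! ### Coset sums -/

section CosetSum

variable {R : Type*} [Ring R] [Algebra Kqt R]

/-- The sum `1 + q T_k⁻¹ + ⋯ + q^{n-k} T_{n-1}⁻¹ ⋯ T_k⁻¹`, for `k ≤ n`. -/
def cosetSum (n : ℕ) (T : ℕ → R) (k : ℕ) : R :=
  if k ≤ n then ∑ j ∈ Finset.range (n - k + 1), q ^ j • prodDown (fun i => heckeInv (T i)) k j
  else 0

variable {n : ℕ} {T : ℕ → R}

theorem cosetSum_of_lt {k : ℕ} (h : n < k) : cosetSum n T k = 0 := if_neg (by omega)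

theorem cosetSum_self : cosetSum n T n = 1 := by simp [cosetSum, prodDown]

/-- All terms but the first end in T_k⁻¹ on the right; removing that factor and one power of q
leaves the terms of the next coset sum. For k = n the next sum is zero by convention. -/
theorem cosetSum_eq {k : ℕ} (h : k ≤ n) :
    cosetSum n T k = 1 + q • (cosetSum n T (k + 1) * heckeInv (T k)) := by
  rcases h.lt_or_eq with h1 | rfl
  · rw [cosetSum, if_pos h, cosetSum, if_pos (by omega), Finset.sum_range_succ', add_comm,
      show n - k = n - (k + 1) + 1 by omega]
    simp only [pow_zero, one_smul, prodDown, Finset.sum_mul, Finset.smul_sum]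
    congr 1
    refine Finset.sum_congr rfl fun j _ => ?_
    have := prodDown_succ_right (fun i => heckeInv (T i)) k j
    rw [prodDown] at this
    rw [this, smul_mul_assoc, smul_smul, pow_succ']
  · rw [cosetSum_self, cosetSum_of_lt (by omega), zero_mul, smul_zero, add_zero]

theorem commute_cosetSum {x : R} {k : ℕ} (h : ∀ i, k ≤ i → i < n → Commute x (T i)) :
    Commute x (cosetSum n T k) := by
  unfold cosetSum
  split_ifs
  · refine Commute.sum_right _ _ _ fun j hj => Commute.smul_right (commute_prodDown k j ?_) _
    intro i h1 h2
    have := Finset.mem_range.mp hj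
    exact commute_heckeInv (h i h1 (by omega))
  · exact Commute.zero_right x

/-- The factor 1 + q x⁻¹ equals x + q, which x - 1 annihilates by the quadratic relation. -/
theorem one_add_q_smul_heckeInv_mul {x : R} (h : (x - 1) * (x + algebraMap Kqt R q) = 0) :
    (1 + q • heckeInv x) * x = 1 + q • heckeInv x := by
  rw [add_mul, smul_mul_assoc, heckeInv_mul h, one_mul, q_smul_heckeInv, sub_smul, one_smul]
  abel

/-- Write C_k for the coset sums. Two uses of the recursion give C_k C_{k+1} = C_{k+1}(1 + q T_k⁻¹)
+ q² C_{k+1} C_{k+2} T_k⁻¹ T_{k+1}⁻¹. The first summand absorbs T_k directly; in the second T_k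
moves to the left of T_k⁻¹ T_{k+1}⁻¹ as T_{k+1} and is absorbed by the same statement for k + 1. -/
theorem HeckeRelations.cosetSum_mul_cosetSum (hT : HeckeRelations n T) {k : ℕ} (h1 : 1 ≤ k)
    (h2 : k < n) :
    cosetSum n T k * cosetSum n T (k + 1) * T k = cosetSum n T k * cosetSum n T (k + 1) := by
  obtain ⟨m, hm⟩ : ∃ m, n = k + 1 + m := ⟨n - (k + 1), by omega⟩
  induction m generalizing k with
  | zero =>
    obtain rfl : n = k + 1 := hm
    rw [cosetSum_self, mul_one, cosetSum_eq (by omega), cosetSum_self, one_mul,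
      one_add_q_smul_heckeInv_mul (hT.quad k h1 h2)]
  | succ m ih =>
    have ih' := ih (k := k + 1) (by omega) (by omega) (by omega)
    have hc : Commute (heckeInv (T k)) (cosetSum n T (k + 1 + 1)) := by
      refine commute_cosetSum fun i h3 h4 => (commute_heckeInv ?_).symm
      exact (hT.commute k i h1 h2 (by omega) h4 (Or.inl (by omega))).symm
    have hb : heckeInv (T k) * heckeInv (T (k + 1)) * T k =
        T (k + 1) * (heckeInv (T k) * heckeInv (T (k + 1))) := by
      have e1 := (SemiconjBy.of_heckeInv (show SemiconjBy
        (heckeInv (T k) * heckeInv (T (k + 1))) (heckeInv (T k)) (heckeInv (T (k + 1))) by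
          rw [SemiconjBy, hT.braidRelations_inv.braid k h1 (by omega), mul_assoc])).eq
      exact e1
    have e : cosetSum n T k * cosetSum n T (k + 1) =
        cosetSum n T (k + 1) * (1 + q • heckeInv (T k)) +
          (q * q) • (cosetSum n T (k + 1) * cosetSum n T (k + 1 + 1) *
            (heckeInv (T k) * heckeInv (T (k + 1)))) := by
      calc cosetSum n T k * cosetSum n T (k + 1)
          = cosetSum n T (k + 1) +
            q • (cosetSum n T (k + 1) * heckeInv (T k) * cosetSum n T (k + 1)) := by
            rw [cosetSum_eq (by omega : k ≤ n), add_mul, one_mul, smul_mul_assoc]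
        _ = cosetSum n T (k + 1) + q • (cosetSum n T (k + 1) * heckeInv (T k) *
              (1 + q • (cosetSum n T (k + 1 + 1) * heckeInv (T (k + 1))))) := by
            conv_lhs => rw [cosetSum_eq (k := k + 1) (by omega)]
            conv_rhs => rw [cosetSum_eq (k := k + 1) (by omega)]
        _ = _ := by
            simp only [mul_add, mul_one, mul_smul_comm, smul_add, smul_smul]
            rw [mul_assoc (cosetSum n T (k + 1)) (heckeInv (T k)), ← mul_assoc (heckeInv (T k)),
              hc.eq]
            simp only [mul_assoc]
            abel
    rw [e, add_mul, mul_assoc, one_add_q_smul_heckeInv_mul (hT.quad k h1 h2), smul_mul_assoc,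
      mul_assoc _ _ (T k), hb, ← mul_assoc, ih']

end CosetSum

/-! ### Vectors invariant under part of a Hecke algebra -/

section Invariants

variable {R : Type*} [Ring R] [Algebra Kqt R] {V : Type*} [AddCommGroup V] [Module Kqt V]

/-- The vectors fixed by `T_{k+1}, …, T_{n-1}`. -/
def heckeInvariants (φ : R →ₐ[Kqt] Module.End Kqt V) (n : ℕ) (T : ℕ → R) (k : ℕ) :
    Submodule Kqt V where
  carrier := {v | ∀ j, k < j → j < n → φ (T j) v = v}
  add_mem' ha hb j h1 h2 := by rw [map_add, ha j h1 h2, hb j h1 h2]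
  zero_mem' j _ _ := map_zero _
  smul_mem' c v hv j h1 h2 := by rw [map_smul, hv j h1 h2]

variable {φ : R →ₐ[Kqt] Module.End Kqt V} {n : ℕ} {T : ℕ → R}

theorem heckeInvariants_mono {k l : ℕ} (h : k ≤ l) :
    heckeInvariants φ n T k ≤ heckeInvariants φ n T l := fun _ hv j h1 h2 => hv j (by omega) h2

theorem heckeInvariants_of_commute {x : R} {k : ℕ}
    (h : ∀ j, k < j → j < n → Commute (T j) x) {v : V} (hv : v ∈ heckeInvariants φ n T k) :
    φ x v ∈ heckeInvariants φ n T k := fun j h1 h2 => by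
  rw [← Module.End.mul_apply, ← map_mul, (h j h1 h2).eq, map_mul, Module.End.mul_apply,
    hv j h1 h2]

theorem apply_heckeInv (x : R) (v : V) :
    q • φ (heckeInv x) v = φ x v + (q - 1) • v := by
  have := congrArg (fun y => φ y v) (q_smul_heckeInv x)
  simpa using this

namespace HeckeRelations

/-- Descending induction on k, through C_k v = v + q C_{k+1} T_k⁻¹ v. The vector T_k⁻¹ v is fixed by
T_j for j > k + 1, so the induction hypothesis applies to it and handles the generators above T_k;
only T_k itself needs an argument. -/
theorem cosetSum_mem (hT : HeckeRelations n T) {k : ℕ} (h1 : 1 ≤ k) (h2 : k ≤ n) {v : V}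
    (hv : v ∈ heckeInvariants φ n T k) :
    φ (cosetSum n T k) v ∈ heckeInvariants φ n T (k - 1) := by
  obtain ⟨m, hm⟩ : ∃ m, n = k + m := ⟨n - k, by omega⟩
  induction m generalizing k v with
  | zero => intro j h3 h4; omega
  | succ m ih =>
    have hk : k < n := by omega
    have hmem : φ (heckeInv (T k)) v ∈ heckeInvariants φ n T (k + 1) :=
      heckeInvariants_of_commute (fun j h3 h4 => commute_heckeInv
        (hT.commute j k (by omega) h4 h1 hk (Or.inr h3))) (heckeInvariants_mono (by omega) hv)
    have ih' := ih (by omega) (by omega) hmem (by omega)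
    have e : φ (cosetSum n T k) v = v + q • φ (cosetSum n T (k + 1)) (φ (heckeInv (T k)) v) := by
      rw [cosetSum_eq h2, map_add, map_smul, map_one, map_mul]
      rfl
    intro j h3 h4
    rcases (show j = k ∨ k < j by omega) with rfl | h5
    -- After a second expansion C_k v = (v + q T_k⁻¹ v) + q² C_{k+2} T_{k+1}⁻¹ T_k⁻¹ v. The bracket
    -- is (T_k + q) v, hence fixed by T_k; in the remaining term T_k slides to the right, becomes
    -- T_{k+1} and fixes v.
    · have e2 : φ (cosetSum n T (j + 1)) (φ (heckeInv (T j)) v) = φ (heckeInv (T j)) v +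
          q • φ (cosetSum n T (j + 1 + 1)) (φ (heckeInv (T (j + 1))) (φ (heckeInv (T j)) v)) := by
        rw [cosetSum_eq (k := j + 1) (by omega), map_add, map_smul, map_one, map_mul]
        rfl
      have e3 : φ (T j) (φ (cosetSum n T (j + 1 + 1))
          (φ (heckeInv (T (j + 1))) (φ (heckeInv (T j)) v))) =
          φ (cosetSum n T (j + 1 + 1)) (φ (heckeInv (T (j + 1))) (φ (heckeInv (T j)) v)) := by
        rcases Nat.lt_or_ge (j + 1) n with h6 | h6
        · have hc : Commute (T j) (cosetSum n T (j + 1 + 1)) := commute_cosetSum fun i h7 h8 =>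
            hT.commute j i h1 hk (by omega) h8 (Or.inl (by omega))
          have hs := (hT.semiconj_inv h1 h6).eq
          have : T j * (cosetSum n T (j + 1 + 1) * (heckeInv (T (j + 1)) * heckeInv (T j))) =
              cosetSum n T (j + 1 + 1) * (heckeInv (T (j + 1)) * heckeInv (T j)) * T (j + 1) := by
            rw [← mul_assoc, hc.eq, mul_assoc, ← hs, ← mul_assoc]
          have := congrArg (fun x => φ x v) this
          simp only [map_mul, Module.End.mul_apply] at this
          rw [this, hv (j + 1) (by omega) h6]
        · rw [cosetSum_of_lt (by omega)]
          simp
      have e4 : φ (T j) (φ (heckeInv (T j)) v) = v := by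
        rw [← Module.End.mul_apply, ← map_mul, hT.mul_inv h1 hk, map_one, Module.End.one_apply]
      rw [e, e2]
      simp only [map_add, map_smul, smul_add, e3, e4]
      rw [apply_heckeInv]
      module
    · rw [e, map_add, map_smul, hv j h5 h4, ih' j (by omega) h4]

/-- On vectors fixed by `T_{k+1}, …, T_{n-1}`, the product `T_{k+m-1} ⋯ T_k` in terms of the
products of inverses. -/
theorem prodDown_apply (hT : HeckeRelations n T) {k : ℕ} (h1 : 1 ≤ k) {v : V}
    (hv : v ∈ heckeInvariants φ n T k) (m : ℕ) (hm : k + m ≤ n) :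
    (q - 1) • ∑ j ∈ Finset.range m, q ^ j • φ (prodDown (fun i => heckeInv (T i)) k j) v +
      φ (prodDown T k m) v = q ^ m • φ (prodDown (fun i => heckeInv (T i)) k m) v := by
  induction m with
  | zero => simp [prodDown]
  | succ m ih =>
    have ih' := ih (by omega)
    -- The terms with j < m involve only T_i⁻¹ with i ≤ k + m - 2, so T_{k+m} passes through them
    -- and fixes v.
    have e1 : φ (T (k + m)) (∑ j ∈ Finset.range m,
        q ^ j • φ (prodDown (fun i => heckeInv (T i)) k j) v) =
        ∑ j ∈ Finset.range m, q ^ j • φ (prodDown (fun i => heckeInv (T i)) k j) v := by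
      rw [map_sum]
      refine Finset.sum_congr rfl fun j hj => ?_
      have hj' := Finset.mem_range.mp hj
      have hc : Commute (T (k + m)) (prodDown (fun i => heckeInv (T i)) k j) :=
        commute_prodDown k j fun i h2 h3 => commute_heckeInv
          (hT.commute (k + m) i (by omega) (by omega) (by omega) (by omega) (Or.inr (by omega)))
      rw [map_smul, ← Module.End.mul_apply, ← map_mul, hc.eq, map_mul, Module.End.mul_apply,
        hv (k + m) (by omega) (by omega)]
    have e2 := apply_heckeInv (φ := φ) (T (k + m))
      (φ (prodDown (fun i => heckeInv (T i)) k m) v)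
    have e3 : φ (prodDown (fun i => heckeInv (T i)) k (m + 1)) v =
        φ (heckeInv (T (k + m))) (φ (prodDown (fun i => heckeInv (T i)) k m) v) := by
      rw [prodDown, map_mul]; rfl
    have e4 : φ (prodDown T k (m + 1)) v = φ (T (k + m)) (φ (prodDown T k m) v) := by
      rw [prodDown, map_mul]; rfl
    rcases Nat.eq_zero_or_pos m with rfl | hpos
    · simp only [Finset.sum_range_succ, Finset.sum_range_zero, zero_add] at *
      rw [e3, e4, pow_succ, mul_smul, e2]
      simp [prodDown]
      module
    · have e5 := congrArg (φ (T (k + m))) ih'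
      rw [map_add, map_smul, map_smul, e1] at e5
      rw [Finset.sum_range_succ, e3, e4, pow_succ, mul_smul, e2]
      linear_combination (norm := module) e5

end HeckeRelations

end Invariants

/-! ### Reduced words in the symmetric group -/

section Words

variable {n : ℕ}

theorem simpleTransp_eq {i : ℕ} (h1 : 1 ≤ i) (h2 : i < n) :
    simpleTransp n i = Equiv.swap ⟨i - 1, by omega⟩ ⟨i, h2⟩ := dif_pos ⟨h1, h2⟩

theorem simpleTransp_mul_self (i : ℕ) : simpleTransp n i * simpleTransp n i = 1 := by
  unfold simpleTransp
  split_ifs <;> simp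

theorem simpleTransp_mul_cancel (i : ℕ) (σ : Equiv.Perm (Fin n)) :
    simpleTransp n i * (simpleTransp n i * σ) = σ := by
  rw [← mul_assoc, simpleTransp_mul_self, one_mul]

theorem simpleTransp_inv (i : ℕ) : (simpleTransp n i)⁻¹ = simpleTransp n i :=
  inv_eq_of_mul_eq_one_left (simpleTransp_mul_self i)

/-- `s_i` is a left descent of `σ`: the value `i + 1` occurs before the value `i`. -/
def IsDescent (σ : Equiv.Perm (Fin n)) (i : ℕ) : Prop :=
  ∃ (h1 : 1 ≤ i) (h2 : i < n), σ⁻¹ ⟨i, h2⟩ < σ⁻¹ ⟨i - 1, by omega⟩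

theorem simpleTransp_lt_iff {i : ℕ} (h1 : 1 ≤ i) (h2 : i < n) {u v : Fin n}
    (h3 : ¬ (u.1 = i - 1 ∧ v.1 = i)) (h4 : ¬ (u.1 = i ∧ v.1 = i - 1)) :
    simpleTransp n i u < simpleTransp n i v ↔ u < v := by
  rw [simpleTransp_eq h1 h2, Equiv.swap_apply_def, Equiv.swap_apply_def]
  simp only [Fin.ext_iff, Fin.lt_def]
  split_ifs <;> simp only [] <;> omega

/-- Exchanging two adjacent values affects only the pair of positions that hold them, and this pair
becomes a new inversion. -/
theorem permLength_simple_mul_of_lt {i : ℕ} (h1 : 1 ≤ i) (h2 : i < n) {σ : Equiv.Perm (Fin n)}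
    (h : σ⁻¹ ⟨i - 1, by omega⟩ < σ⁻¹ ⟨i, h2⟩) :
    permLength (simpleTransp n i * σ) = permLength σ + 1 := by
  unfold permLength
  have hb : simpleTransp n i ⟨i, h2⟩ = ⟨i - 1, by omega⟩ := by simp [simpleTransp_eq h1 h2]
  have ha : simpleTransp n i ⟨i - 1, by omega⟩ = ⟨i, h2⟩ := by simp [simpleTransp_eq h1 h2]
  rw [← Finset.card_insert_of_notMem
    (a := ((σ⁻¹ ⟨i - 1, by omega⟩, σ⁻¹ ⟨i, h2⟩) : Fin n × Fin n))]
  · congr 1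
    ext ⟨x, y⟩
    simp only [Finset.mem_filter, Finset.mem_univ, true_and, Finset.mem_insert, Prod.mk.injEq]
    simp only [Equiv.Perm.mul_apply, Equiv.Perm.eq_inv_iff_eq]
    by_cases c1 : σ x = ⟨i - 1, by omega⟩ ∧ σ y = ⟨i, h2⟩
    · have hx := Equiv.Perm.eq_inv_iff_eq.mpr c1.1
      have hy := Equiv.Perm.eq_inv_iff_eq.mpr c1.2
      have hxy : x < y := by rw [hx, hy]; exact h
      rw [c1.1, c1.2, ha, hb]
      simp only [hxy, Fin.lt_def]
      simp
      omega
    · by_cases c2 : σ x = ⟨i, h2⟩ ∧ σ y = ⟨i - 1, by omega⟩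
      · have hx := Equiv.Perm.eq_inv_iff_eq.mpr c2.1
        have hy := Equiv.Perm.eq_inv_iff_eq.mpr c2.2
        have : ¬ x < y := by rw [hx, hy]; exact h.asymm
        simp [this, c1]
      · rw [simpleTransp_lt_iff h1 h2]
        · simp [c1]
        · rintro ⟨e1, e2⟩; exact c2 ⟨Fin.ext e2, Fin.ext e1⟩
        · rintro ⟨e1, e2⟩; exact c1 ⟨Fin.ext e2, Fin.ext e1⟩
  · simp only [Finset.mem_filter, Finset.mem_univ, true_and, not_and]
    intro _
    simp [Fin.lt_def]

theorem permLength_simple_mul_of_not {i : ℕ} (h1 : 1 ≤ i) (h2 : i < n) {σ : Equiv.Perm (Fin n)}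
    (h : ¬ IsDescent σ i) : permLength (simpleTransp n i * σ) = permLength σ + 1 := by
  refine permLength_simple_mul_of_lt h1 h2 (lt_of_le_of_ne (not_lt.mp fun h' => h ⟨h1, h2, h'⟩) ?_)
  intro e
  have := congrArg Fin.val (σ⁻¹.injective e)
  simp at this
  omega

theorem isDescent_simple_mul {i : ℕ} (h1 : 1 ≤ i) (h2 : i < n) {σ : Equiv.Perm (Fin n)}
    (h : ¬ IsDescent σ i) : IsDescent (simpleTransp n i * σ) i := by
  refine ⟨h1, h2, ?_⟩
  rw [mul_inv_rev, simpleTransp_inv, Equiv.Perm.mul_apply, Equiv.Perm.mul_apply,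
    simpleTransp_eq h1 h2, Equiv.swap_apply_left, Equiv.swap_apply_right]
  refine lt_of_le_of_ne (not_lt.mp fun h' => h ⟨h1, h2, h'⟩) ?_
  intro e
  have := congrArg Fin.val (σ⁻¹.injective e)
  simp at this
  omega

theorem not_isDescent_simple_mul {i : ℕ} {σ : Equiv.Perm (Fin n)}
    (h : IsDescent σ i) : ¬ IsDescent (simpleTransp n i * σ) i := by
  obtain ⟨h1, h2, h3⟩ := h
  rintro ⟨_, _, h4⟩
  rw [mul_inv_rev, simpleTransp_inv, Equiv.Perm.mul_apply, Equiv.Perm.mul_apply,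
    simpleTransp_eq h1 h2, Equiv.swap_apply_left, Equiv.swap_apply_right] at h4
  exact h3.asymm h4

theorem permLength_of_isDescent {i : ℕ} {σ : Equiv.Perm (Fin n)} (h : IsDescent σ i) :
    permLength σ = permLength (simpleTransp n i * σ) + 1 := by
  have := permLength_simple_mul_of_not h.1 h.2.1 (not_isDescent_simple_mul h)
  rwa [simpleTransp_mul_cancel] at this

theorem permLength_one : permLength (1 : Equiv.Perm (Fin n)) = 0 := by
  rw [permLength, Finset.card_eq_zero, Finset.filter_eq_empty_iff]
  rintro ⟨x, y⟩ _ ⟨h1, h2⟩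
  exact h1.asymm h2

/-- Without descents σ⁻¹ is strictly increasing, and the identity is the only strictly increasing
map of `Fin n` onto itself. -/
theorem exists_isDescent {σ : Equiv.Perm (Fin n)} (h : σ ≠ 1) : ∃ i, IsDescent σ i := by
  by_contra! hc
  refine h (inv_eq_one.mp ?_)
  have hmono : StrictMono fun x => σ⁻¹ x := by
    cases n with
    | zero => intro a; exact a.elim0
    | succ n =>
      refine Fin.strictMono_iff_lt_succ.mpr fun i => ?_
      by_contra hlt
      refine hc (i.1 + 1) ⟨by omega, by omega, lt_of_le_of_ne (not_lt.mp hlt) fun e => ?_⟩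
      have := congrArg Fin.val (σ⁻¹.injective e)
      simp at this
  have h2 := hmono.range_inj (g := id) strictMono_id |>.mp
    (by rw [Set.range_id]; exact σ⁻¹.surjective.range_eq)
  ext x
  exact congrArg (fun f : Fin n → Fin n => (f x).1) h2

theorem isReducedWord_cons {σ : Equiv.Perm (Fin n)} {i : ℕ} (h : IsDescent σ i) {w : List ℕ}
    (hw : IsReducedWord (simpleTransp n i * σ) w) : IsReducedWord σ (i :: w) := by
  obtain ⟨a, b, c⟩ := hw
  refine ⟨?_, ?_, ?_⟩
  · rintro j hj
    rcases List.mem_cons.mp hj with rfl | hj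
    · exact ⟨h.1, h.2.1⟩
    · exact a j hj
  · rw [List.map_cons, List.prod_cons, b, simpleTransp_mul_cancel]
  · rw [List.length_cons, c, ← permLength_of_isDescent h]

theorem exists_isReducedWord (σ : Equiv.Perm (Fin n)) : ∃ w, IsReducedWord σ w := by
  induction hl : permLength σ generalizing σ with
  | zero =>
    by_cases h : σ = 1
    · exact ⟨[], by simp, by simp [h], by simp [hl]⟩
    · obtain ⟨i, hi⟩ := exists_isDescent h
      have := permLength_of_isDescent hi
      omega
  | succ l ih =>
    have h : σ ≠ 1 := by rintro rfl; rw [permLength_one] at hl; omega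
    obtain ⟨i, hi⟩ := exists_isDescent h
    have := permLength_of_isDescent hi
    obtain ⟨w, hw⟩ := ih (simpleTransp n i * σ) (by omega)
    exact ⟨i :: w, isReducedWord_cons hi hw⟩

theorem permLength_prod_le (w : List ℕ) :
    permLength (w.map (simpleTransp n)).prod ≤ w.length := by
  induction w with
  | nil => simp [permLength_one]
  | cons i w ih =>
    rw [List.map_cons, List.prod_cons, List.length_cons]
    by_cases hi : 1 ≤ i ∧ i < n
    · by_cases hd : IsDescent (w.map (simpleTransp n)).prod i
      · have := permLength_of_isDescent hd
        omega
      · rw [permLength_simple_mul_of_not hi.1 hi.2 hd]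
        omega
    · rw [simpleTransp, dif_neg hi, one_mul]
      omega

/-- If the first letter were not a descent, the tail, of length ℓ(σ) - 1, would represent a
permutation of length ℓ(σ) + 1, contrary to `permLength_prod_le`. -/
theorem IsReducedWord.tail {σ : Equiv.Perm (Fin n)} {i : ℕ} {w : List ℕ}
    (h : IsReducedWord σ (i :: w)) :
    IsDescent σ i ∧ IsReducedWord (simpleTransp n i * σ) w := by
  obtain ⟨a, b, c⟩ := h
  have hi := a i List.mem_cons_self
  rw [List.map_cons, List.prod_cons] at b
  have hp : (w.map (simpleTransp n)).prod = simpleTransp n i * σ := by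
    rw [← b, simpleTransp_mul_cancel]
  have hle := permLength_prod_le (n := n) w
  rw [hp] at hle
  rw [List.length_cons] at c
  have hd : IsDescent σ i := by
    by_contra hd
    rw [permLength_simple_mul_of_not hi.1 hi.2 hd] at hle
    omega
  have := permLength_of_isDescent hd
  exact ⟨hd, fun j hj => a j (List.mem_cons_of_mem _ hj), hp, by omega⟩

theorem simpleTransp_apply_of_ne {i : ℕ} {x : Fin n} (h3 : x.1 ≠ i - 1) (h4 : x.1 ≠ i) :
    simpleTransp n i x = x := by
  unfold simpleTransp
  split_ifs
  · exact Equiv.swap_apply_of_ne_of_ne (fun h => h3 (congrArg Fin.val h))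
      (fun h => h4 (congrArg Fin.val h))
  · rfl

theorem simpleTransp_apply_left {i : ℕ} (h1 : 1 ≤ i) (h2 : i < n) (h : i - 1 < n) :
    simpleTransp n i ⟨i - 1, h⟩ = ⟨i, h2⟩ := by
  rw [simpleTransp_eq h1 h2, Equiv.swap_apply_left]

theorem simpleTransp_apply_right {i : ℕ} (h1 : 1 ≤ i) (h2 : i < n) :
    simpleTransp n i ⟨i, h2⟩ = ⟨i - 1, by omega⟩ := by
  rw [simpleTransp_eq h1 h2, Equiv.swap_apply_right]

theorem inv_simple_mul_apply (σ : Equiv.Perm (Fin n)) (i : ℕ) (x : Fin n) :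
    (simpleTransp n i * σ)⁻¹ x = σ⁻¹ (simpleTransp n i x) := by
  rw [mul_inv_rev, simpleTransp_inv, Equiv.Perm.mul_apply]

theorem isDescent_of_far {σ : Equiv.Perm (Fin n)} {i j : ℕ} (hi : IsDescent σ i)
    (hj : IsDescent σ j) (h : i + 1 < j ∨ j + 1 < i) : IsDescent (simpleTransp n i * σ) j := by
  obtain ⟨h1, h2, h3⟩ := hi
  obtain ⟨h4, h5, h6⟩ := hj
  refine ⟨h4, h5, ?_⟩
  rw [inv_simple_mul_apply, inv_simple_mul_apply, simpleTransp_apply_of_ne (by simp; omega)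
    (by simp; omega), simpleTransp_apply_of_ne (by simp; omega) (by simp; omega)]
  exact h6

theorem simpleTransp_comm {i j : ℕ} (h1 : 1 ≤ i) (h2 : i + 1 < j) (h3 : j < n) :
    simpleTransp n i * simpleTransp n j = simpleTransp n j * simpleTransp n i := by
  rw [simpleTransp_eq h1 (by omega), simpleTransp_eq (by omega) h3]
  refine (Equiv.Perm.Disjoint.commute ?_).eq
  rw [Equiv.Perm.disjoint_iff_eq_or_eq]
  intro x
  by_cases h : x.1 = i - 1 ∨ x.1 = i
  · right
    exact Equiv.swap_apply_of_ne_of_ne (by simp [Fin.ext_iff]; omega)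
      (by simp [Fin.ext_iff]; omega)
  · left
    exact Equiv.swap_apply_of_ne_of_ne (by simp [Fin.ext_iff]; omega)
      (by simp [Fin.ext_iff]; omega)

theorem simpleTransp_braid {i : ℕ} (h1 : 1 ≤ i) (h2 : i + 1 < n) :
    simpleTransp n i * simpleTransp n (i + 1) * simpleTransp n i =
      simpleTransp n (i + 1) * simpleTransp n i * simpleTransp n (i + 1) := by
  rw [simpleTransp_eq h1 (by omega), simpleTransp_eq (by omega) h2]
  simp only [Nat.add_sub_cancel]
  set x : Fin n := ⟨i - 1, by omega⟩
  set y : Fin n := ⟨i, by omega⟩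
  set z : Fin n := ⟨i + 1, h2⟩
  have hxy : x ≠ y := by simp [x, y]; omega
  have hxz : x ≠ z := by simp [x, z]
  have hyz : y ≠ z := by simp [y, z]
  rw [Equiv.swap_mul_swap_mul_swap hxy hxz, Equiv.swap_comm x y, Equiv.swap_comm y z,
    Equiv.swap_mul_swap_mul_swap hyz.symm hxz.symm, Equiv.swap_comm]

/-- Matsumoto's theorem for the symmetric group: in a family with braid relations, the product
over a reduced word only depends on the permutation. -/
theorem BraidRelations.prod_eq_of_isReducedWord {M : Type*} [Monoid M] {a : ℕ → M}
    (ha : BraidRelations n a) {σ : Equiv.Perm (Fin n)} {w w' : List ℕ} (hw : IsReducedWord σ w)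
    (hw' : IsReducedWord σ w') : (w.map a).prod = (w'.map a).prod := by
  induction hl : permLength σ using Nat.strong_induction_on generalizing σ w w' with
  | _ l ih =>
  cases w with
  | nil =>
    have h1 := hw.2.2
    have h2 := hw'.2.2
    rw [← h1] at h2
    rw [List.eq_nil_of_length_eq_zero h2]
  | cons i w =>
  cases w' with
  | nil =>
    have h1 := hw.2.2
    have h2 := hw'.2.2
    rw [← h1] at h2
    simp at h2
  | cons j w' =>
  obtain ⟨hi, hw⟩ := hw.tail
  obtain ⟨hj, hw'⟩ := hw'.tail
  have li := permLength_of_isDescent hi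
  have lj := permLength_of_isDescent hj
  -- Two descents i < j allow a third reduced word of σ that begins with s_i s_j if they are far
  -- apart and with s_i s_{i+1} s_i if j = i + 1. The induction hypothesis, for the shorter
  -- permutations s_i σ and s_j σ, compares both given words with it, once in each of its two
  -- braid-equivalent forms.
  have key : ∀ i j w w', IsDescent σ i → IsDescent σ j →
      IsReducedWord (simpleTransp n i * σ) w → IsReducedWord (simpleTransp n j * σ) w' →
      permLength σ = permLength (simpleTransp n i * σ) + 1 →
      permLength σ = permLength (simpleTransp n j * σ) + 1 → i < j →
      a i * (w.map a).prod = a j * (w'.map a).prod := by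
    intro i j w w' hi hj hw hw' li lj hlt
    rcases Nat.lt_or_ge (i + 1) j with hij | hij
    · have hji := isDescent_of_far hi hj (Or.inl hij)
      have hij' := isDescent_of_far hj hi (Or.inr hij)
      obtain ⟨u, hu⟩ := exists_isReducedWord (simpleTransp n j * (simpleTransp n i * σ))
      have hu' : IsReducedWord (simpleTransp n i * (simpleTransp n j * σ)) u := by
        rwa [← mul_assoc, simpleTransp_comm hi.1 hij hj.2.1, mul_assoc]
      rw [ih _ (by omega) hw (isReducedWord_cons hji hu) rfl,
        ih _ (by omega) hw' (isReducedWord_cons hij' hu') rfl, List.map_cons, List.map_cons,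
        List.prod_cons, List.prod_cons, ← mul_assoc, ← mul_assoc,
        (ha.comm i j hi.1 hij hj.2.1).eq]
    · obtain rfl : j = i + 1 := by omega
      obtain ⟨h1, h2, h3⟩ := hi
      obtain ⟨h4, h5, h6⟩ := hj
      simp only [Nat.add_sub_cancel] at h6
      have r1 := simpleTransp_apply_right h1 h2
      have l1 := simpleTransp_apply_left h1 h2 (by omega)
      have r2 : simpleTransp n (i + 1) ⟨i + 1, h5⟩ = ⟨i, h2⟩ := simpleTransp_apply_right h4 h5
      have l2 : simpleTransp n (i + 1) ⟨i, h2⟩ = ⟨i + 1, h5⟩ :=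
        simpleTransp_apply_left h4 h5 (by omega)
      have n1 : simpleTransp n i ⟨i + 1, h5⟩ = ⟨i + 1, h5⟩ :=
        simpleTransp_apply_of_ne (by simp; omega) (by simp)
      have n2 : simpleTransp n (i + 1) ⟨i - 1, by omega⟩ = ⟨i - 1, by omega⟩ :=
        simpleTransp_apply_of_ne (by simp; omega) (by simp)
      have d1 : IsDescent (simpleTransp n i * σ) (i + 1) := by
        refine ⟨h4, h5, ?_⟩
        simp only [Nat.add_sub_cancel, inv_simple_mul_apply, r1, n1]
        exact h6.trans h3
      have d2 : IsDescent (simpleTransp n (i + 1) * (simpleTransp n i * σ)) i := by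
        refine ⟨h1, h2, ?_⟩
        simp only [inv_simple_mul_apply, l2, n2, n1, l1]
        exact h6
      have d3 : IsDescent (simpleTransp n (i + 1) * σ) i := by
        refine ⟨h1, h2, ?_⟩
        simp only [inv_simple_mul_apply, l2, n2]
        exact h6.trans h3
      have d4 : IsDescent (simpleTransp n i * (simpleTransp n (i + 1) * σ)) (i + 1) := by
        refine ⟨h4, h5, ?_⟩
        simp only [Nat.add_sub_cancel, inv_simple_mul_apply, r1, n1, n2, r2]
        exact h3
      obtain ⟨u, hu⟩ := exists_isReducedWord
        (simpleTransp n i * (simpleTransp n (i + 1) * (simpleTransp n i * σ)))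
      have hu' : IsReducedWord
          (simpleTransp n (i + 1) * (simpleTransp n i * (simpleTransp n (i + 1) * σ))) u := by
        have := simpleTransp_braid h1 h5
        rw [← mul_assoc, ← mul_assoc, ← this, mul_assoc, mul_assoc]
        exact hu
      rw [ih _ (by omega) hw (isReducedWord_cons d1 (isReducedWord_cons d2 hu)) rfl,
        ih _ (by omega) hw' (isReducedWord_cons d3 (isReducedWord_cons d4 hu')) rfl]
      simp only [List.map_cons, List.prod_cons, ← mul_assoc]
      rw [ha.braid i h1 h5]
  rw [List.map_cons, List.map_cons, List.prod_cons, List.prod_cons]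
  rcases lt_trichotomy i j with h | rfl | h
  · exact key i j w w' hi hj hw hw' li lj h
  · rw [ih _ (by omega) hw hw' rfl]
  · exact (key j i w' w hj hi hw' hw lj li h).symm

theorem isReducedWord_epsilon (σ : Equiv.Perm (Fin n)) :
    IsReducedWord σ (Classical.epsilon (IsReducedWord σ)) :=
  Classical.epsilon_spec (exists_isReducedWord σ)

theorem dTperm_eq {σ : Equiv.Perm (Fin n)} {w : List ℕ} (hw : IsReducedWord σ w) :
    dTperm σ = (w.map (dT n)).prod :=
  (heckeRelations_dT n).braidRelations.prod_eq_of_isReducedWord (isReducedWord_epsilon σ) hw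

/-- The word inside `dTperm` is an arbitrary choice; by Matsumoto's theorem it may be replaced by
one that starts with any prescribed descent. -/
theorem dTperm_of_isDescent {σ : Equiv.Perm (Fin n)} {i : ℕ} (h : IsDescent σ i) :
    dTperm σ = dT n i * dTperm (simpleTransp n i * σ) := by
  rw [dTperm_eq (isReducedWord_cons h (isReducedWord_epsilon _)), List.map_cons, List.prod_cons]
  rfl

/-- The permutation fixes `1, …, k`. -/
def FixesFirst (k : ℕ) (σ : Equiv.Perm (Fin n)) : Prop := ∀ j : Fin n, j.val < k → σ j = j

theorem FixesFirst.simple_mul {k i : ℕ} {σ : Equiv.Perm (Fin n)} (h : FixesFirst k σ)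
    (hi : k < i) : FixesFirst k (simpleTransp n i * σ) := fun j hj => by
  rw [Equiv.Perm.mul_apply, h j hj, simpleTransp_apply_of_ne (by omega) (by omega)]

/-- The inverse σ⁻¹ fixes the same points. A descent i ≤ k would send the point i below the fixed
point i - 1, hence to a point that is itself fixed, against injectivity. -/
theorem FixesFirst.lt_of_isDescent {k i : ℕ} {σ : Equiv.Perm (Fin n)} (h : FixesFirst k σ)
    (hi : IsDescent σ i) : k < i := by
  obtain ⟨h1, h2, h3⟩ := hi
  by_contra hc
  have e : ∀ j : Fin n, j.val < k → σ⁻¹ j = j := fun j hj => by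
    rw [Equiv.Perm.inv_eq_iff_eq, h j hj]
  rw [e ⟨i - 1, by omega⟩ (by simp; omega)] at h3
  have h4 := e _ (show (σ⁻¹ ⟨i, h2⟩).val < k by
    have := Fin.lt_def.mp h3
    have h5 : ((⟨i - 1, by omega⟩ : Fin n) : ℕ) = i - 1 := rfl
    omega)
  have := σ⁻¹.injective h4
  rw [this, Fin.lt_def] at h3
  simp at h3
  omega

theorem FixesFirst.lt_of_mem {k : ℕ} {σ : Equiv.Perm (Fin n)} (h : FixesFirst k σ) {w : List ℕ}
    (hw : IsReducedWord σ w) : ∀ i ∈ w, k < i := by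
  induction w generalizing σ with
  | nil => simp
  | cons j w ih =>
    obtain ⟨hd, hw⟩ := hw.tail
    have hj := h.lt_of_isDescent hd
    intro i hi
    rcases List.mem_cons.mp hi with rfl | hi
    · exact hj
    · exact ih (h.simple_mul hj) hw i hi

end Words

/-! ### Partial symmetrizers and invariants -/

theorem one_sub_q_ne_zero : (1 : Kqt) - q ≠ 0 :=
  sub_ne_zero.mpr fun h => q_pow_ne_one 1 one_ne_zero (by rw [pow_one]; exact h.symm)

theorem qFactorial_ne_zero (m : ℕ) : qFactorial m ≠ 0 := by
  refine Finset.prod_ne_zero_iff.mpr fun i hi => div_ne_zero ?_ one_sub_q_ne_zero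
  have := Finset.mem_Icc.mp hi
  exact sub_ne_zero.mpr (q_pow_ne_one i (by omega)).symm

/-- At q = t = 1 the underlying polynomial takes the value |s|, which is nonzero in ℚ. -/
theorem sum_q_pow_ne_zero {ι : Type*} {s : Finset ι} (hs : s.Nonempty) (a : ι → ℕ) :
    ∑ i ∈ s, q ^ a i ≠ 0 := by
  unfold q
  intro h
  simp only [← map_pow, ← map_sum] at h
  have h2 := (IsFractionRing.injective (MvPolynomial (Fin 2) ℚ) Kqt) (h.trans (map_zero _).symm)
  have h3 := congrArg (MvPolynomial.eval (fun _ => (1 : ℚ))) h2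
  simp at h3
  exact hs.ne_empty h3

theorem sum_q_zpow_ne_zero {ι : Type*} {s : Finset ι} (hs : s.Nonempty) (c : ℤ) (a : ι → ℕ) :
    ∑ i ∈ s, q ^ (c - (a i : ℤ)) ≠ 0 := by
  have hq := q_ne_zero
  obtain ⟨N, hN⟩ : ∃ N, ∀ i ∈ s, a i ≤ N := ⟨s.sup a, fun i hi => Finset.le_sup hi⟩
  have h : ∑ i ∈ s, q ^ (c - (a i : ℤ)) = q ^ (c - (N : ℤ)) * ∑ i ∈ s, q ^ (N - a i) := by
    rw [Finset.mul_sum]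
    refine Finset.sum_congr rfl fun i hi => ?_
    rw [← zpow_natCast, ← zpow_add₀ hq]
    congr 1
    rw [Nat.cast_sub (hN i hi)]
    ring
  rw [h]
  exact mul_ne_zero (zpow_ne_zero _ hq) (sum_q_pow_ne_zero hs _)

/-- Pair σ with s_j σ. If j is not a descent of σ, the two terms add up to a multiple of (q + T_j)
T_σ, which T_j fixes by the quadratic relation. The condition k < j keeps the pairing inside the
Young subgroup. -/
theorem dT_mul_dEps {n k j : ℕ} (h1 : k < j) (h2 : j < n) : dT n j * dEps n k = dEps n k := by
  classical
  have hj : 1 ≤ j := by omega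
  have hq := q_ne_zero
  have hT := heckeRelations_dT n
  rw [dEps, mul_smul_comm, ← sub_eq_zero, ← smul_sub, Finset.mul_sum, ← Finset.sum_sub_distrib]
  refine smul_eq_zero_of_right _ ?_
  set c : ℤ := ((n - k).choose 2 : ℤ)
  have key : ∀ σ : Equiv.Perm (Fin n), ¬ IsDescent σ j →
      (dT n j * q ^ (c - (permLength σ : ℤ)) • dTperm σ -
          q ^ (c - (permLength σ : ℤ)) • dTperm σ) +
        (dT n j * q ^ (c - (permLength (simpleTransp n j * σ) : ℤ)) •
            dTperm (simpleTransp n j * σ) -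
          q ^ (c - (permLength (simpleTransp n j * σ) : ℤ)) • dTperm (simpleTransp n j * σ)) =
      0 := by
    intro σ hσ
    rw [dTperm_of_isDescent (isDescent_simple_mul hj h2 hσ), simpleTransp_mul_cancel,
      permLength_simple_mul_of_not hj h2 hσ]
    have e : q ^ (c - (permLength σ : ℤ)) =
        q ^ (c - ((permLength σ + 1 : ℕ) : ℤ)) * q := by
      rw [← zpow_add_one₀ hq]
      congr 1
      push_cast
      ring
    rw [e, mul_smul_comm, mul_smul_comm, ← mul_assoc, hT.mul_self hj h2, add_mul, smul_mul_assoc,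
      smul_mul_assoc, one_mul]
    module
  refine Finset.sum_involution (fun σ _ => simpleTransp n j * σ) ?_ ?_ ?_ ?_
  · intro σ _
    by_cases hd : IsDescent σ j
    · have := key _ (not_isDescent_simple_mul hd)
      rw [simpleTransp_mul_cancel, add_comm] at this
      exact this
    · exact key σ hd
  · intro σ _ _ h
    have h' : simpleTransp n j = 1 := mul_eq_right.mp h
    have := congrArg (fun s : Equiv.Perm (Fin n) => (s ⟨j, h2⟩).val) h'
    simp only [simpleTransp_apply_right hj h2, Equiv.Perm.one_apply] at this
    omega
  · intro σ hσ
    have hσ' : FixesFirst k σ := (Finset.mem_filter.mp hσ).2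
    exact Finset.mem_filter.mpr ⟨Finset.mem_univ _, hσ'.simple_mul h1⟩
  · intro σ _
    exact simpleTransp_mul_cancel j σ

section Range

variable {V : Type*} [AddCommGroup V] [Module Kqt V] {n : ℕ} (φ : DAHA n →ₐ[Kqt] Module.End Kqt V)

/-- On these vectors every T_σ in the sum is the identity, so ε_k acts by a scalar. For the image of
ε_k it is enough that the scalar is nonzero; its exact value plays no role. -/
theorem exists_dEps_apply (k : ℕ) : ∃ c : Kqt, c ≠ 0 ∧
    ∀ v ∈ heckeInvariants φ n (dT n) k, φ (dEps n k) v = c • v := by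
  classical
  set s : Finset (Equiv.Perm (Fin n)) :=
    Finset.univ.filter fun σ => ∀ j : Fin n, j.val < k → σ j = j
  refine ⟨(qFactorial (n - k))⁻¹ *
    ∑ σ ∈ s, q ^ (((n - k).choose 2 : ℤ) - (permLength σ : ℤ)),
    mul_ne_zero (inv_ne_zero (qFactorial_ne_zero _)) (sum_q_zpow_ne_zero ⟨1, ?_⟩ _ _), ?_⟩
  · exact Finset.mem_filter.mpr ⟨Finset.mem_univ _, fun j _ => rfl⟩
  · intro v hv
    have hw : ∀ w : List ℕ, (∀ i ∈ w, k < i ∧ i < n) → φ (w.map (dT n)).prod v = v := by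
      intro w
      induction w with
      | nil => intro _; simp
      | cons i w ih =>
        intro h
        have hi := h i List.mem_cons_self
        rw [List.map_cons, List.prod_cons, map_mul, Module.End.mul_apply,
          ih fun j hj => h j (List.mem_cons_of_mem _ hj), hv i hi.1 hi.2]
    have hp : ∀ σ ∈ s, φ (dTperm σ) v = v := by
      intro σ hσ
      have hσ' : FixesFirst k σ := (Finset.mem_filter.mp hσ).2
      have hr := isReducedWord_epsilon σ
      exact hw _ fun i hi => ⟨hσ'.lt_of_mem hr i hi, (hr.1 i hi).2⟩
    rw [dEps, map_smul, map_sum, LinearMap.smul_apply, LinearMap.sum_apply, mul_smul,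
      Finset.sum_smul]
    congr 1
    refine Finset.sum_congr (by congr) fun σ hσ => ?_
    rw [map_smul, LinearMap.smul_apply, hp σ (by convert hσ)]

/-- This removes the symmetrizer from L_k: afterwards only invariance under T_{k+1}, …, T_{n-1} is
used. -/
theorem range_dEps (k : ℕ) :
    LinearMap.range (φ (dEps n k)) = heckeInvariants φ n (dT n) k := by
  refine le_antisymm ?_ fun v hv => ?_
  · rintro _ ⟨v, rfl⟩ j h1 h2
    rw [← Module.End.mul_apply, ← map_mul, dT_mul_dEps h1 h2]
  · obtain ⟨c, hc, h⟩ := exists_dEps_apply φ k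
    exact ⟨c⁻¹ • v, by rw [map_smul, h v hv, smul_smul, inv_mul_cancel₀ hc, one_smul]⟩

theorem mem_range_prod_mul_dEps (x : DAHA n) (k : ℕ) (v : V) :
    v ∈ LinearMap.range (φ (x * dEps n k)) ↔
      ∃ w ∈ heckeInvariants φ n (dT n) k, v = φ x w := by
  rw [← range_dEps]
  constructor
  · rintro ⟨w, rfl⟩
    exact ⟨φ (dEps n k) w, ⟨w, rfl⟩, by rw [map_mul]; rfl⟩
  · rintro ⟨_, ⟨w, rfl⟩, rfl⟩
    exact ⟨w, by rw [map_mul]; rfl⟩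

end Range

theorem prodDown_add {M : Type*} [Monoid M] (a : ℕ → M) (k i j : ℕ) :
    prodDown a k (i + j) = prodDown a (k + i) j * prodDown a k i := by
  induction j with
  | zero => simp [prodDown]
  | succ j ih => rw [← add_assoc, prodDown, ih, prodDown, mul_assoc, add_assoc]

/-! ### Relations in the positive double affine Hecke algebra -/

section DAHARelations

variable (n : ℕ)

theorem dT_out {i : ℕ} (h : ¬ (1 ≤ i ∧ i < n)) : dT n i = 0 := by
  have := dMk_rel (DRel.T_out (n := n) i h)
  rwa [map_zero] at this

theorem dX_out {i : ℕ} (h : ¬ (1 ≤ i ∧ i ≤ n)) : dX n i = 0 := by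
  have := dMk_rel (DRel.X_out (n := n) i h)
  rwa [map_zero] at this

theorem dY_out {i : ℕ} (h : ¬ (1 ≤ i ∧ i ≤ n)) : dY n i = 0 := by
  have := dMk_rel (DRel.Y_out (n := n) i h)
  rwa [map_zero] at this

theorem dT_dX_dT {i : ℕ} (h1 : 1 ≤ i) (h2 : i < n) :
    dT n i * dX n (i + 1) * dT n i = q • dX n i := by
  have := dMk_rel (DRel.T_X_T (n := n) i h1 h2)
  simpa [dT, dX] using this

theorem dT_dY_dT {i : ℕ} (h1 : 1 ≤ i) (h2 : i < n) :
    dT n i * dY n i * dT n i = q • dY n (i + 1) := by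
  have := dMk_rel (DRel.T_Y_T (n := n) i h1 h2)
  simpa [dT, dY] using this

theorem commute_dT_dX {i j : ℕ} (h1 : j ≠ i) (h2 : j ≠ i + 1) : Commute (dT n i) (dX n j) := by
  by_cases hi : 1 ≤ i ∧ i < n
  · by_cases hj : 1 ≤ j ∧ j ≤ n
    · have := dMk_rel (DRel.T_X (n := n) i j hi.1 hi.2 hj.1 hj.2 h1 h2)
      rwa [map_mul, map_mul] at this
    · rw [dX_out n hj]; exact Commute.zero_right _
  · rw [dT_out n hi]; exact Commute.zero_left _

theorem commute_dT_dY {i j : ℕ} (h1 : j ≠ i) (h2 : j ≠ i + 1) : Commute (dT n i) (dY n j) := by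
  by_cases hi : 1 ≤ i ∧ i < n
  · by_cases hj : 1 ≤ j ∧ j ≤ n
    · have := dMk_rel (DRel.T_Y (n := n) i j hi.1 hi.2 hj.1 hj.2 h1 h2)
      rwa [map_mul, map_mul] at this
    · rw [dY_out n hj]; exact Commute.zero_right _
  · rw [dT_out n hi]; exact Commute.zero_left _

theorem commute_dX_dX (i j : ℕ) : Commute (dX n i) (dX n j) := by
  by_cases hi : 1 ≤ i ∧ i ≤ n
  · by_cases hj : 1 ≤ j ∧ j ≤ n
    · have := dMk_rel (DRel.X_X (n := n) i j hi.1 hi.2 hj.1 hj.2)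
      rwa [map_mul, map_mul] at this
    · rw [dX_out n hj]; exact Commute.zero_right _
  · rw [dX_out n hi]; exact Commute.zero_left _

theorem commute_dY_dY (i j : ℕ) : Commute (dY n i) (dY n j) := by
  by_cases hi : 1 ≤ i ∧ i ≤ n
  · by_cases hj : 1 ≤ j ∧ j ≤ n
    · have := dMk_rel (DRel.Y_Y (n := n) i j hi.1 hi.2 hj.1 hj.2)
      rwa [map_mul, map_mul] at this
    · rw [dY_out n hj]; exact Commute.zero_right _
  · rw [dY_out n hi]; exact Commute.zero_left _

theorem commute_dT_dT {i j : ℕ} (h : i + 1 < j ∨ j + 1 < i) : Commute (dT n i) (dT n j) := by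
  by_cases hi : 1 ≤ i ∧ i < n
  · by_cases hj : 1 ≤ j ∧ j < n
    · exact (heckeRelations_dT n).commute i j hi.1 hi.2 hj.1 hj.2 h
    · rw [dT_out n hj]; exact Commute.zero_right _
  · rw [dT_out n hi]; exact Commute.zero_left _

theorem dY_dT_dX (h : 2 ≤ n) : dY n 1 * dT n 1 * dX n 1 = dX n 2 * dY n 1 * dT n 1 := by
  have := dMk_rel (DRel.Y_T_X (n := n) h)
  simpa [dT, dX, dY] using this

theorem dT_mul_dTinv {i : ℕ} (h1 : 1 ≤ i) (h2 : i < n) : dT n i * dTinv n i = 1 :=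
  (heckeRelations_dT n).mul_inv h1 h2

theorem dTinv_mul_dT {i : ℕ} (h1 : 1 ≤ i) (h2 : i < n) : dTinv n i * dT n i = 1 :=
  (heckeRelations_dT n).inv_mul h1 h2

theorem dT_mul_dX_succ {i : ℕ} (h1 : 1 ≤ i) (h2 : i < n) :
    dT n i * dX n (i + 1) = q • (dX n i * dTinv n i) := by
  rw [← smul_mul_assoc, ← dT_dX_dT n h1 h2, mul_assoc _ (dT n i), dT_mul_dTinv n h1 h2, mul_one]

theorem dTinv_mul_dX {i : ℕ} (h1 : 1 ≤ i) (h2 : i < n) :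
    dTinv n i * dX n i = q⁻¹ • (dX n (i + 1) * dT n i) := by
  have h : dTinv n i * (q • dX n i) = dX n (i + 1) * dT n i := by
    rw [← dT_dX_dT n h1 h2, ← mul_assoc, ← mul_assoc, dTinv_mul_dT n h1 h2, one_mul]
  rw [← h, mul_smul_comm, smul_smul, inv_mul_cancel₀ q_ne_zero, one_smul]

theorem q_smul_dTinv (i : ℕ) : q • dTinv n i = dT n i + (q - 1) • (1 : DAHA n) :=
  q_smul_heckeInv _

theorem dT_mul_dX_succ' {i : ℕ} (h1 : 1 ≤ i) (h2 : i < n) :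
    dT n i * dX n (i + 1) = dX n i * dT n i - (1 - q) • dX n i := by
  rw [dT_mul_dX_succ n h1 h2, ← mul_smul_comm, q_smul_dTinv, mul_add, mul_smul_comm, mul_one]
  module

theorem dT_mul_dX {i : ℕ} (h1 : 1 ≤ i) (h2 : i < n) :
    dT n i * dX n i = dX n (i + 1) * dT n i + (1 - q) • dX n i := by
  have h3 : q • (dTinv n i * dX n i) = dX n (i + 1) * dT n i := by
    rw [dTinv_mul_dX n h1 h2, smul_smul, mul_inv_cancel₀ q_ne_zero, one_smul]
  rw [← h3, ← smul_mul_assoc, q_smul_dTinv, add_mul, smul_mul_assoc, one_mul]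
  module

/-- The product X_i X_{i+1} commutes with T_i, because the correction terms of the two Bernstein
relations cancel. For i ≠ k the product X_1⋯X_k contains both variables or neither. -/
theorem commute_dT_prodUpTo_dX {i k : ℕ} (h : i ≠ k) : Commute (dT n i) (prodUpTo (dX n) k) := by
  induction k with
  | zero => exact Commute.one_right _
  | succ k ih =>
    by_cases hi : i = k
    · subst hi
      by_cases hin : 1 ≤ i ∧ i < n
      · obtain ⟨l, rfl⟩ : ∃ l, i = l + 1 := ⟨i - 1, by omega⟩
        have h1 := dT_mul_dX n hin.1 hin.2
        have h2 := dT_mul_dX_succ' n hin.1 hin.2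
        have hx := (commute_dX_dX n (l + 1) (l + 1 + 1)).eq
        have hc : Commute (dT n (l + 1)) (dX n (l + 1) * dX n (l + 1 + 1)) := by
          rw [Commute, SemiconjBy, ← mul_assoc, h1, add_mul, mul_assoc, h2, mul_sub, ← mul_assoc,
            ← hx, smul_mul_assoc, mul_smul_comm, ← hx]
          abel
        rw [prodUpTo, prodUpTo, mul_assoc]
        exact (commute_prodUpTo l fun j h3 h4 =>
          commute_dT_dX n (by omega) (by omega)).mul_right hc
      · rw [dT_out n hin]; exact Commute.zero_left _
    · exact (ih hi).mul_right (commute_dT_dX n (by omega) (by omega))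

/-- Each T_i⁻¹ raises the index of the X to its right by one, turns into T_i and contributes q⁻¹. -/
theorem prodDown_dTinv_mul_dX {k : ℕ} (h1 : 1 ≤ k) (j : ℕ) (h2 : k + j ≤ n) :
    prodDown (dTinv n) k j * dX n k = (q⁻¹ ^ j) • (dX n (k + j) * prodDown (dT n) k j) := by
  induction j with
  | zero => simp [prodDown]
  | succ j ih =>
    rw [prodDown, mul_assoc, ih (by omega), mul_smul_comm, ← mul_assoc,
      dTinv_mul_dX n (by omega) (by omega), smul_mul_assoc, smul_smul, pow_succ, prodDown,
      mul_assoc, add_assoc]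

theorem prodUpTo_dTinv_mul_dY (m : ℕ) (h : m < n) :
    prodUpTo (dTinv n) m * dY n (m + 1) = (q⁻¹ ^ m) • (dY n 1 * prodUpTo (dT n) m) := by
  induction m with
  | zero => simp [prodUpTo]
  | succ m ih =>
    have h1 : dTinv n (m + 1) * dY n (m + 1 + 1) = q⁻¹ • (dY n (m + 1) * dT n (m + 1)) := by
      have h2 := dT_dY_dT n (i := m + 1) (by omega) h
      have h3 : dTinv n (m + 1) * (q • dY n (m + 1 + 1)) = dY n (m + 1) * dT n (m + 1) := by
        rw [← h2, ← mul_assoc, ← mul_assoc, dTinv_mul_dT n (by omega) h, one_mul]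
      rw [← h3, mul_smul_comm, smul_smul, inv_mul_cancel₀ q_ne_zero, one_smul]
    rw [prodUpTo, mul_assoc, h1, mul_smul_comm, ← mul_assoc, ih (by omega), smul_mul_assoc,
      smul_smul, pow_succ', prodUpTo, mul_assoc]

theorem prodDown_dTinv_mul_prodUpTo (m : ℕ) (h : m < n) :
    prodDown (dTinv n) 1 m * prodUpTo (dT n) m = 1 :=
  prodDown_mul_prodUpTo m fun _ h1 h2 => dTinv_mul_dT n h1 (by omega)

theorem prodUpTo_dT_mul_prodDown (m : ℕ) (h : m < n) :
    prodUpTo (dT n) m * prodDown (dTinv n) 1 m = 1 :=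
  prodUpTo_mul_prodDown m fun _ h1 h2 => dT_mul_dTinv n h1 (by omega)

theorem prodDown_dT_mul_prodUpTo (m : ℕ) (h : m < n) :
    prodDown (dT n) 1 m * prodUpTo (dTinv n) m = 1 :=
  prodDown_mul_prodUpTo m fun _ h1 h2 => dT_mul_dTinv n h1 (by omega)

theorem dPi_mul_dT {i : ℕ} (h1 : 1 ≤ i) (h2 : i + 1 < n) :
    dPi n * dT n i = dT n (i + 1) * dPi n := by
  rw [dPi, smul_mul_assoc, mul_assoc,
    (heckeRelations_dT n).braidRelations.prodUpTo_mul h1 (by omega) (by omega), mul_smul_comm,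
    ← mul_assoc, ← mul_assoc, (commute_dT_dY n (by omega) (by omega) :
      Commute (dT n (i + 1)) (dY n 1)).eq]

theorem dPi_mul_dTinv {i : ℕ} (h1 : 1 ≤ i) (h2 : i + 1 < n) :
    dPi n * dTinv n i = dTinv n (i + 1) * dPi n :=
  (SemiconjBy.heckeInv (dPi_mul_dT n h1 h2 : SemiconjBy _ _ _)).eq

/-- The rotation π shifts the T_i cyclically, and this relation crosses the missing affine node. It
encodes the commutation of Y_1 with Y_2, that is, with T_1 Y_1 T_1 up to a scalar. -/
theorem dPi_mul_dPi_mul_dT (h : 2 ≤ n) :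
    dPi n * dPi n * dT n (n - 1) = dT n 1 * (dPi n * dPi n) := by
  obtain ⟨m, rfl⟩ : ∃ m, n = m + 1 + 1 := ⟨n - 2, by omega⟩
  simp only [dPi, smul_mul_assoc, mul_smul_comm, Nat.add_sub_cancel]
  congr 2
  set n := m + 1 + 1 with hn
  have hB := (heckeRelations_dT n).braidRelations
  set R := prodUpTo (dT n) (m + 1)
  set S := prodUpTo (fun i => dT n (i + 1)) m
  have hR : R = dT n 1 * S := prodUpTo_succ_left _ _
  -- Each factor of S = T_2⋯T_{m+1} passes through R with its index lowered, so S R = R T_1⋯T_m, and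
  -- the extra T_{m+1} completes the second R.
  have hSR : S * R * dT n (m + 1) = R * R := by
    have hs : ∀ j, j ≤ m → prodUpTo (fun i => dT n (i + 1)) j * R = R * prodUpTo (dT n) j := by
      intro j hj
      induction j with
      | zero => simp [prodUpTo]
      | succ j ih =>
        rw [prodUpTo, mul_assoc, ← hB.prodUpTo_mul (by omega : 1 ≤ j + 1) (by omega) (by omega),
          ← mul_assoc, ih (by omega), prodUpTo, mul_assoc]
    rw [hs m le_rfl, mul_assoc]
    rfl
  have hc : Commute (dY n 1) S := commute_prodUpTo m fun i h1 h2 =>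
    (commute_dT_dY n (by omega) (by omega)).symm
  have hY : dT n 1 * dY n 1 * dT n 1 * dY n 1 = dY n 1 * (dT n 1 * dY n 1 * dT n 1) := by
    rw [dT_dY_dT n le_rfl (by omega), smul_mul_assoc, mul_smul_comm, (commute_dY_dY n 1 2).eq]
  have e : ∀ x, dY n 1 * R * (dY n 1 * x) = dY n 1 * dT n 1 * dY n 1 * (S * x) := by
    intro x
    rw [hR]
    simp only [mul_assoc]
    rw [← mul_assoc S, ← hc.eq, mul_assoc]
  calc dY n 1 * R * (dY n 1 * R) * dT n (m + 1)
      = dY n 1 * dT n 1 * dY n 1 * (S * R * dT n (m + 1)) := by rw [e]; simp only [mul_assoc]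
    _ = dY n 1 * (dT n 1 * dY n 1 * dT n 1) * (S * R) := by
        rw [hSR]; conv_lhs => rw [hR]
        simp only [mul_assoc]
        rw [← hR]
    _ = dT n 1 * (dY n 1 * R * (dY n 1 * R)) := by
        rw [← hY, e]; simp only [mul_assoc]

theorem dPi_mul_dX_last (h : 1 ≤ n) : dPi n * dX n n = t • (dX n 1 * dPi n) := by
  have := dMk_rel (DRel.pi_X (n := n) h)
  simp only [map_mul, map_smul, map_prodUpTo] at this
  change dY n 1 * prodUpTo (dT n) (n - 1) * dX n n =
    t • (dX n 1 * (dY n 1 * prodUpTo (dT n) (n - 1))) at this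
  rw [dPi, smul_mul_assoc, this, mul_smul_comm, smul_comm]

/-- For i = 1 this is the relation between Y_1 T_1 and X_1; the other cases follow from X_{i+1} = q
T_i⁻¹ X_i T_i⁻¹, since π shifts the T_i⁻¹ as well. -/
theorem dPi_mul_dX {i : ℕ} (h1 : 1 ≤ i) (h2 : i < n) :
    dPi n * dX n i = dX n (i + 1) * dPi n := by
  induction i, h1 using Nat.le_induction with
  | base =>
    obtain ⟨m, hm⟩ : ∃ m, n - 1 = m + 1 := ⟨n - 2, by omega⟩
    have hc : Commute (dX n 1) (prodUpTo (fun i => dT n (i + 1)) m) :=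
      commute_prodUpTo m fun i h1 h2 => (commute_dT_dX n (by omega) (by omega)).symm
    rw [dPi, smul_mul_assoc, mul_smul_comm, hm, prodUpTo_succ_left]
    congr 1
    rw [mul_assoc, mul_assoc, ← hc.eq, ← mul_assoc, ← mul_assoc, ← mul_assoc, ← mul_assoc,
      dY_dT_dX n (by omega), mul_assoc _ (dT n 1), mul_assoc (dX n (1 + 1))]
  | succ i hi ih =>
    have e : ∀ i, 1 ≤ i → i < n →
        dX n (i + 1) = q • (dTinv n i * dX n i * dTinv n i) := by
      intro i h1 h2
      rw [dTinv_mul_dX n h1 h2, smul_mul_assoc, smul_smul, mul_inv_cancel₀ q_ne_zero, one_smul,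
        mul_assoc, dT_mul_dTinv n h1 h2, mul_one]
    rw [e i hi (by omega), e (i + 1) (by omega) (by omega), mul_smul_comm, smul_mul_assoc]
    congr 1
    rw [← mul_assoc, ← mul_assoc, dPi_mul_dTinv n hi h2, mul_assoc _ (dPi n), ih (by omega)]
    simp only [mul_assoc]
    rw [dPi_mul_dTinv n hi h2]

theorem dY_one_eq (h : 1 ≤ n) : dY n 1 = q ^ n • (dPi n * prodDown (dTinv n) 1 (n - 1)) := by
  rw [dPi, smul_mul_assoc, smul_smul, mul_assoc, prodUpTo_dT_mul_prodDown n _ (by omega), mul_one,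
    ← mul_pow, mul_inv_cancel₀ q_ne_zero, one_pow, one_smul]

/-- Here the inverses in Y_1 = q^n π T_{n-1}⁻¹⋯T_1⁻¹ become T_i as X_1 travels up to X_n, which π
returns to X_1. In this form the product ends in T_{n-1}⋯T_1, so that π T_{n-1} appears; this is
what makes Y_1 compatible with the connecting maps on multiples of X_1. -/
theorem dY_mul_dX_one (h : 1 ≤ n) :
    dY n 1 * dX n 1 = (q * t) • (dX n 1 * (dPi n * prodDown (dT n) 1 (n - 1))) := by
  rw [dY_one_eq n h, smul_mul_assoc, mul_assoc, prodDown_dTinv_mul_dX n le_rfl _ (by omega),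
    mul_smul_comm, ← mul_assoc, show 1 + (n - 1) = n by omega, dPi_mul_dX_last n h, smul_smul,
    smul_mul_assoc, smul_smul, mul_assoc (dX n 1)]
  congr 1
  conv_lhs => rw [show q ^ n = q ^ (n - 1) * q by rw [← pow_succ, Nat.sub_add_cancel h]]
  rw [mul_right_comm (q ^ (n - 1)), ← mul_pow, mul_inv_cancel₀ q_ne_zero, one_pow, one_mul]

theorem dY_two_mul_dX_one (h : 2 ≤ n) :
    dY n 2 * dX n 1 = dX n 1 * (dTinv n 1 * dY n 1 * dT n 1) := by
  have e : q • (dY n 2 * dX n 1) = q • (dX n 1 * (dTinv n 1 * dY n 1 * dT n 1)) := by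
    rw [← smul_mul_assoc, ← dT_dY_dT n le_rfl (by omega), mul_assoc, mul_assoc,
      ← mul_assoc (dY n 1), dY_dT_dX n h, ← mul_assoc, ← mul_assoc,
      dT_mul_dX_succ n le_rfl (by omega)]
    simp only [smul_mul_assoc, mul_assoc]
  have := congrArg (fun x => q⁻¹ • x) e
  simpa only [smul_smul, inv_mul_cancel₀ q_ne_zero, one_smul] using this

end DAHARelations

/-! ### The operators `d_+` and `d_-` in the positive double affine Hecke algebra -/

section Operators

open MurnaghanB.DAHASequence (opPlus opMinus)

variable (n : ℕ)

theorem opMinus_eq (k : ℕ) : opMinus n k = (q - 1) • cosetSum n (dT n) k := by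
  unfold opMinus cosetSum
  split_ifs
  · rfl
  · rw [smul_zero]

theorem opPlus_eq {k : ℕ} (h : k + 1 ≤ n) :
    opPlus n k = q ^ k • (dX n 1 * prodUpTo (dTinv n) k) := if_pos h

theorem opPlus_of_lt {k : ℕ} (h : n < k + 1) : opPlus n k = 0 := if_neg (by omega)

theorem commute_dTinv_dX {i j : ℕ} (h1 : j ≠ i) (h2 : j ≠ i + 1) :
    Commute (dTinv n i) (dX n j) := (commute_heckeInv (commute_dT_dX n h1 h2).symm).symm

theorem commute_dTinv_dT {i j : ℕ} (h : i + 1 < j ∨ j + 1 < i) :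
    Commute (dTinv n i) (dT n j) := (commute_heckeInv (commute_dT_dT n h).symm).symm

theorem commute_opPlus_dT {k j : ℕ} (h : k + 1 < j) : Commute (opPlus n k) (dT n j) := by
  unfold opPlus
  split_ifs
  · refine Commute.smul_left (Commute.mul_left (commute_dT_dX n (by omega) (by omega)).symm ?_) _
    exact (commute_prodUpTo k fun i h1 h2 => (commute_dTinv_dT n (by omega)).symm).symm
  · exact Commute.zero_left _

theorem commute_opPlus_cosetSum {k l : ℕ} (h : k + 1 < l) :
    Commute (opPlus n k) (cosetSum n (dT n) l) :=
  commute_cosetSum fun _ h1 _ => commute_opPlus_dT n (by omega)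

theorem opPlus_succ {k : ℕ} (h : k + 2 ≤ n) :
    opPlus n (k + 1) = q • (opPlus n k * dTinv n (k + 1)) := by
  rw [opPlus_eq n (by omega), opPlus_eq n (by omega), prodUpTo, smul_mul_assoc, smul_smul,
    ← pow_succ', mul_assoc]

theorem opPlus_succ_mul_dT {k : ℕ} (h : k + 2 ≤ n) :
    opPlus n (k + 1) * dT n (k + 1) = q • opPlus n k := by
  rw [opPlus_succ n h, smul_mul_assoc, mul_assoc, dTinv_mul_dT n (by omega) (by omega), mul_one]

/-- `[d_+, d_-] = (q - 1) φ`, where `φ` is given by `q^k X_1 T_1⁻¹ ⋯ T_k⁻¹`. -/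
theorem opPlus_opMinus_comm {k : ℕ} (h : k + 1 ≤ n) :
    opPlus n k * opMinus n (k + 1) - opMinus n (k + 2) * opPlus n (k + 1) =
      (q - 1) • opPlus n k := by
  rw [opMinus_eq, opMinus_eq, mul_smul_comm, smul_mul_assoc, ← smul_sub]
  congr 1
  rcases Nat.lt_or_ge n (k + 2) with h1 | h1
  · obtain rfl : n = k + 1 := by omega
    rw [opPlus_of_lt (k + 1) (k := k + 1) (by omega), cosetSum_self, mul_zero, mul_one, sub_zero]
  · rw [cosetSum_eq h, mul_add, mul_one, opPlus_succ n h1, mul_smul_comm, mul_smul_comm,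
      ← mul_assoc, ← mul_assoc, (commute_opPlus_cosetSum n (by omega)).eq]
    exact add_sub_cancel_right _ _

theorem opPlus_mul_dT {k i : ℕ} (h1 : 1 ≤ i) (h2 : i < k) :
    opPlus n k * dT n i = dT n (i + 1) * opPlus n k := by
  unfold opPlus
  split_ifs with h
  · rw [smul_mul_assoc, mul_smul_comm, mul_assoc, ← mul_assoc (dT n (i + 1)),
      (commute_dT_dX n (by omega) (by omega) : Commute (dT n (i + 1)) (dX n 1)).eq, mul_assoc]
    congr 2
    exact (heckeRelations_dT n).prodUpTo_inv_mul h1 h2 (by omega)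
  · rw [zero_mul, mul_zero]

theorem opMinus_mul_dT {k i : ℕ} (h2 : i < k) :
    opMinus n (k + 1) * dT n i = dT n i * opMinus n (k + 1) := by
  rw [opMinus_eq, smul_mul_assoc, mul_smul_comm]
  congr 1
  exact (commute_cosetSum fun j h3 h4 => commute_dT_dT n (by omega)).eq.symm

theorem opMinus_mul_dY {k i : ℕ} (h2 : i ≤ k) :
    opMinus n (k + 1) * dY n i = dY n i * opMinus n (k + 1) := by
  rw [opMinus_eq, smul_mul_assoc, mul_smul_comm]
  congr 1
  exact (commute_cosetSum fun j h3 h4 => (commute_dT_dY n (by omega) (by omega)).symm).eq.symm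

theorem opMinus_opMinus_dT {k : ℕ} (h : k + 2 ≤ n) :
    opMinus n (k + 1) * opMinus n (k + 2) * dT n (k + 1) =
      opMinus n (k + 1) * opMinus n (k + 2) := by
  simp only [opMinus_eq, smul_mul_assoc, mul_smul_comm]
  rw [(heckeRelations_dT n).cosetSum_mul_cosetSum (by omega) (by omega)]

/-- This is q φ d_- = d_- φ T_{k+1} once φ has been replaced by d_+ of one index less. It comes down
to `opPlus n k` commuting with T_j for j > k + 1, hence with the coset sum. -/
theorem q_smul_opPlus_opMinus {k : ℕ} (h : k + 2 ≤ n) :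
    q • (opPlus n k * opMinus n (k + 2)) =
      opMinus n (k + 2) * opPlus n (k + 1) * dT n (k + 1) := by
  rw [mul_assoc, opPlus_succ_mul_dT n h, mul_smul_comm, opMinus_eq, mul_smul_comm, smul_mul_assoc,
    (commute_opPlus_cosetSum n (by omega)).eq]

/-- Up to a scalar the product of the two d_+ is X_2 X_1 T_1 S P, with S = T_2⁻¹⋯T_{k+1}⁻¹ and P =
T_1⁻¹⋯T_k⁻¹. A further T_1 commutes with X_2 X_1, runs through T_1 S P and leaves on the right as
T_{k+1}, which acts trivially on L_k. -/
theorem opPlus_opPlus_aux {k : ℕ} (h : k + 2 ≤ n) :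
    dT n 1 * (opPlus n (k + 1) * opPlus n k) =
      opPlus n (k + 1) * opPlus n k * dT n (k + 1) := by
  have hT := heckeRelations_dT n
  set S := prodUpTo (fun i => dTinv n (i + 1)) k
  set P := prodUpTo (dTinv n) k
  have e1 : prodUpTo (dTinv n) (k + 1) = dTinv n 1 * S := prodUpTo_succ_left _ _
  have e2 : opPlus n (k + 1) * opPlus n k =
      (q ^ (k + 1) * q ^ k * q⁻¹) • (dX n 2 * dX n 1 * (dT n 1 * (S * P))) := by
    rw [opPlus_eq n h, opPlus_eq n (by omega), smul_mul_assoc, mul_smul_comm, smul_smul, e1]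
    have hc : Commute (dX n 1) S := commute_prodUpTo k fun i h1 h2 =>
      (commute_dTinv_dX n (by omega) (by omega)).symm
    have : dX n 1 * (dTinv n 1 * S) * (dX n 1 * P) =
        q⁻¹ • (dX n 2 * dX n 1 * (dT n 1 * (S * P))) := by
      calc dX n 1 * (dTinv n 1 * S) * (dX n 1 * P)
          = dX n 1 * (dTinv n 1 * (S * dX n 1) * P) := by simp only [mul_assoc]
        _ = dX n 1 * ((dTinv n 1 * dX n 1) * (S * P)) := by rw [← hc.eq]; simp only [mul_assoc]
        _ = q⁻¹ • ((dX n 1 * dX n 2) * (dT n 1 * (S * P))) := by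
            rw [dTinv_mul_dX n le_rfl (by omega), smul_mul_assoc, mul_smul_comm]
            simp only [mul_assoc]
        _ = _ := by rw [(commute_dX_dX n 1 2).eq]
    rw [this, smul_smul]
  have hS : ∀ j, j ≤ k → prodUpTo (fun i => dTinv n (i + 1)) j * prodUpTo (dTinv n) (k + 1) =
      prodUpTo (dTinv n) (k + 1) * prodUpTo (dTinv n) j := by
    intro j hj
    induction j with
    | zero => simp [prodUpTo]
    | succ j ih =>
      have := hT.braidRelations_inv.prodUpTo_mul (by omega : 1 ≤ j + 1)
        (by omega : j + 1 < k + 1) (by omega)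
      change prodUpTo (dTinv n) (k + 1) * dTinv n (j + 1) =
        dTinv n (j + 1 + 1) * prodUpTo (dTinv n) (k + 1) at this
      rw [prodUpTo, mul_assoc, ← this, ← mul_assoc, ih (by omega), mul_assoc]
      rfl
  -- With P' = T_1⁻¹⋯T_{k+1}⁻¹ one has P = P' T_{k+1}, S P' = P' P and T_1 P' = S.
  have e3 : dT n 1 * (S * P) = S * P * dT n (k + 1) := by
    have h1 : prodUpTo (dTinv n) (k + 1) * dT n (k + 1) = P := by
      rw [prodUpTo, mul_assoc, dTinv_mul_dT n (by omega) (by omega), mul_one]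
    have h2 : dT n 1 * (prodUpTo (dTinv n) (k + 1) * P) = S * P := by
      rw [e1, ← mul_assoc, ← mul_assoc, dT_mul_dTinv n le_rfl (by omega), one_mul]
    calc dT n 1 * (S * P) = dT n 1 * (S * prodUpTo (dTinv n) (k + 1)) * dT n (k + 1) := by
          rw [mul_assoc, mul_assoc, h1]
      _ = S * P * dT n (k + 1) := by rw [hS k le_rfl, h2]
  have hX : Commute (dT n 1) (dX n 2 * dX n 1) := by
    have := commute_dT_prodUpTo_dX n (i := 1) (k := 2) (by omega)
    simp only [prodUpTo, one_mul] at this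
    rwa [(commute_dX_dX n (0 + 1) (1 + 1)).eq] at this
  rw [e2, mul_smul_comm, smul_mul_assoc]
  congr 1
  rw [← mul_assoc, hX.eq]
  simp only [mul_assoc] at e3 ⊢
  rw [e3]

theorem opPlus_mul_dY_one {k : ℕ} (h : 1 ≤ k) :
    opPlus n k * dY n 1 = dY n 2 * opPlus n k := by
  unfold opPlus
  split_ifs with h1
  · obtain ⟨l, rfl⟩ : ∃ l, k = l + 1 := ⟨k - 1, by omega⟩
    rw [smul_mul_assoc, mul_smul_comm, ← mul_assoc, dY_two_mul_dX_one n (by omega),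
      prodUpTo_succ_left]
    congr 1
    have hc : Commute (dY n 1) (prodUpTo (fun i => dTinv n (i + 1)) l) :=
      commute_prodUpTo l fun i h2 h3 => commute_heckeInv
        (commute_dT_dY n (by omega) (by omega)).symm
    calc dX n 1 * (dTinv n 1 * prodUpTo (fun i => dTinv n (i + 1)) l) * dY n 1
        = dX n 1 * dTinv n 1 * dY n 1 * prodUpTo (fun i => dTinv n (i + 1)) l := by
          rw [mul_assoc, mul_assoc, ← hc.eq]; simp only [mul_assoc]
      _ = dX n 1 * dTinv n 1 * dY n 1 * (dT n 1 * dTinv n 1) *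
          prodUpTo (fun i => dTinv n (i + 1)) l := by
          rw [dT_mul_dTinv n le_rfl (by omega), mul_one]
      _ = _ := by simp only [mul_assoc]
  · rw [zero_mul, mul_zero]

theorem opPlus_mul_dY {k i : ℕ} (h1 : 1 ≤ i) (h2 : i ≤ k) :
    opPlus n k * dY n i = dY n (i + 1) * opPlus n k := by
  rcases Nat.lt_or_ge n (k + 1) with h3 | h3
  · rw [opPlus_of_lt n h3, zero_mul, mul_zero]
  induction i, h1 using Nat.le_induction with
  | base => exact opPlus_mul_dY_one n h2
  | succ i hi ih =>
    have e : ∀ i, 1 ≤ i → i < n → dY n (i + 1) = q⁻¹ • (dT n i * dY n i * dT n i) := by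
      intro i h4 h5
      rw [dT_dY_dT n h4 h5, smul_smul, inv_mul_cancel₀ q_ne_zero, one_smul]
    rw [e i hi (by omega), e (i + 1) (by omega) (by omega), mul_smul_comm, smul_mul_assoc]
    congr 1
    rw [← mul_assoc, ← mul_assoc, opPlus_mul_dT n hi (by omega), mul_assoc _ _ (dY n i),
      ih (by omega), mul_assoc, mul_assoc, opPlus_mul_dT n hi (by omega)]
    simp only [mul_assoc]

end Operators

/-! ### The spaces `L_k` of a single module -/

section FiniteLevel

open MurnaghanB.DAHASequence (opPlus opMinus)

variable {n : ℕ} {V : Type*} [AddCommGroup V] [Module Kqt V] (φ : DAHA n →ₐ[Kqt] Module.End Kqt V)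

/-- The space `X_1 ⋯ X_k ε_k (V)`, for `k ≤ n`. -/
def spaceL (k : ℕ) : Submodule Kqt V :=
  if k ≤ n then LinearMap.range (φ (prodUpTo (dX n) k * dEps n k)) else ⊥

variable {φ}

theorem mem_spaceL {k : ℕ} (h : k ≤ n) {v : V} : v ∈ spaceL φ k ↔
    ∃ w ∈ heckeInvariants φ n (dT n) k, v = φ (prodUpTo (dX n) k) w := by
  rw [spaceL, if_pos h, mem_range_prod_mul_dEps]

theorem eq_zero_of_mem_spaceL {k : ℕ} (h : n < k) {v : V} (hv : v ∈ spaceL φ k) : v = 0 := by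
  rwa [spaceL, if_neg (by omega), Submodule.mem_bot] at hv

theorem spaceL_le_invariants {k : ℕ} (h : k ≤ n) :
    spaceL φ k ≤ heckeInvariants φ n (dT n) k := by
  intro v hv
  obtain ⟨w, hw, rfl⟩ := (mem_spaceL h).mp hv
  exact heckeInvariants_of_commute (fun j h1 h2 => commute_dT_prodUpTo_dX n (by omega)) hw

theorem dT_apply_mem_spaceL {k i : ℕ} (h1 : i < k) {v : V} (hv : v ∈ spaceL φ k) :
    φ (dT n i) v ∈ spaceL φ k := by
  rcases Nat.lt_or_ge n k with h | h
  · rw [eq_zero_of_mem_spaceL h hv, map_zero]; exact Submodule.zero_mem _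
  obtain ⟨w, hw, rfl⟩ := (mem_spaceL h).mp hv
  refine (mem_spaceL h).mpr ⟨φ (dT n i) w, heckeInvariants_of_commute
    (fun j h2 h3 => commute_dT_dT n (by omega)) hw, ?_⟩
  rw [← Module.End.mul_apply, ← map_mul, (commute_dT_prodUpTo_dX n (by omega)).eq, map_mul]
  rfl

/-- Each T_i meets X_{i+1} and yields q X_i T_i⁻¹: the variables are shifted down and the T_i
inverted. This undoes the upward shift of X_2, …, X_k when Y_1 is moved across X_1⋯X_k. -/
theorem prodDown_dT_mul_prodUpTo_dX {k : ℕ} (h : k + 1 ≤ n) :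
    prodDown (dT n) 1 k * prodUpTo (fun i => dX n (i + 1)) k =
      q ^ k • (prodUpTo (dX n) k * prodDown (dTinv n) 1 k) := by
  induction k with
  | zero => simp [prodDown, prodUpTo]
  | succ k ih =>
    have hc1 : Commute (dX n (k + 1 + 1)) (prodDown (dTinv n) 1 k) :=
      commute_prodDown 1 k fun i h1 h2 => (commute_dTinv_dX n (by omega) (by omega)).symm
    have hc2 : Commute (dT n (k + 1)) (prodUpTo (dX n) k) :=
      commute_dT_prodUpTo_dX n (by omega)
    rw [prodDown, prodUpTo, mul_assoc, ← mul_assoc (prodDown (dT n) 1 k), ih (by omega),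
      smul_mul_assoc, mul_smul_comm, add_comm 1 k, mul_assoc (prodUpTo _ k), ← hc1.eq,
      ← mul_assoc, ← mul_assoc, hc2.eq, mul_assoc (prodUpTo _ k), dT_mul_dX_succ n (by omega) h,
      prodUpTo, prodDown, add_comm 1 k]
    simp only [mul_smul_comm, smul_mul_assoc, smul_smul, ← pow_succ, mul_assoc]

/-- The action of `Y_1` on `X_1 ⋯ X_k`. -/
theorem dY_one_mul_prodUpTo_dX {k : ℕ} (h : k + 1 ≤ n) :
    dY n 1 * prodUpTo (dX n) (k + 1) = (q * t * q ^ k) • (prodUpTo (dX n) (k + 1) *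
      (dPi n * prodDown (dT n) (k + 1) (n - (k + 1)) * prodDown (dTinv n) 1 k)) := by
  have hsplit : prodDown (dT n) 1 (n - 1) =
      prodDown (dT n) (k + 1) (n - (k + 1)) * prodDown (dT n) 1 k := by
    rw [show n - 1 = k + (n - (k + 1)) by omega, prodDown_add, add_comm 1 k]
  have hc : Commute (prodDown (dT n) (k + 1) (n - (k + 1))) (prodUpTo (dX n) k) :=
    (commute_prodDown _ _ fun i h1 h2 => (commute_dT_prodUpTo_dX n (by omega)).symm).symm
  have hpi : ∀ j, j < n → dPi n * prodUpTo (dX n) j =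
      prodUpTo (fun i => dX n (i + 1)) j * dPi n := by
    intro j hj
    induction j with
    | zero => simp [prodUpTo]
    | succ j ih =>
      rw [prodUpTo, ← mul_assoc, ih (by omega), mul_assoc, dPi_mul_dX n (by omega) hj, prodUpTo,
        mul_assoc]
  rw [prodUpTo_succ_left, ← mul_assoc, dY_mul_dX_one n (by omega), hsplit, smul_mul_assoc,
    mul_smul (q * t) (q ^ k)]
  congr 1
  simp only [mul_assoc]
  rw [prodDown_dT_mul_prodUpTo_dX h, mul_smul_comm, mul_smul_comm, mul_smul_comm]
  congr 2
  rw [← mul_assoc _ (prodUpTo (dX n) k), hc.eq, mul_assoc, ← mul_assoc (dPi n), hpi k (by omega),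
    mul_assoc]

/-- For i = 1, moving Y_1 across X_1⋯X_k gives an explicit new vector, whose invariance is the
point. The higher Y_i arise from Y_1 by multiplying with T_i on both sides, and for indices i < k
these T_i preserve L_k. -/
theorem dY_apply_mem_spaceL {k i : ℕ} (h1 : 1 ≤ i) (h2 : i ≤ k) {v : V} (hv : v ∈ spaceL φ k) :
    φ (dY n i) v ∈ spaceL φ k := by
  rcases Nat.lt_or_ge n k with h | h
  · rw [eq_zero_of_mem_spaceL h hv, map_zero]; exact Submodule.zero_mem _
  induction i, h1 using Nat.le_induction generalizing v with
  | base =>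
    obtain ⟨w, hw, rfl⟩ := (mem_spaceL h).mp hv
    obtain ⟨l, rfl⟩ : ∃ l, k = l + 1 := ⟨k - 1, by omega⟩
    rw [← Module.End.mul_apply, ← map_mul, dY_one_mul_prodUpTo_dX h, map_smul,
      LinearMap.smul_apply, map_mul, Module.End.mul_apply]
    refine Submodule.smul_mem _ _ ((mem_spaceL h).mpr ⟨_, ?_, rfl⟩)
    have hw1 : φ (prodDown (dTinv n) 1 l) w ∈ heckeInvariants φ n (dT n) (l + 1) :=
      heckeInvariants_of_commute (fun j h3 h4 => commute_prodDown 1 l fun i h5 h6 =>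
        (commute_dTinv_dT n (by omega)).symm) hw
    rw [map_mul, Module.End.mul_apply]
    intro j h3 h4
    obtain ⟨j, rfl⟩ : ∃ j', j = j' + 1 := ⟨j - 1, by omega⟩
    -- Passing π lowers the index of T_{j+1} by one and passing the descending product raises it
    -- again, so T_{j+1} reaches the invariant vector unchanged.
    have e : dT n (j + 1) * (dPi n * prodDown (dT n) (l + 1) (n - (l + 1))) =
        dPi n * prodDown (dT n) (l + 1) (n - (l + 1)) * dT n (j + 1) := by
      rw [← mul_assoc, ← dPi_mul_dT n (by omega) h4, mul_assoc, mul_assoc,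
        (heckeRelations_dT n).braidRelations.mul_prodDown (by omega) (by omega) (by omega)
          (by omega)]
    rw [← Module.End.mul_apply, ← map_mul, e, map_mul, Module.End.mul_apply, hw1 (j + 1) h3 h4]
  | succ i hi ih =>
    have e : dY n (i + 1) = q⁻¹ • (dT n i * (dY n i * dT n i)) := by
      rw [← mul_assoc, dT_dY_dT n hi (by omega), smul_smul, inv_mul_cancel₀ q_ne_zero, one_smul]
    rw [e, map_smul, map_mul, map_mul]
    exact Submodule.smul_mem _ _ (dT_apply_mem_spaceL (by omega)
      (ih (by omega) (dT_apply_mem_spaceL (by omega) hv)))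

/-- Each T_i⁻¹ moves X_i to X_{i+1}; together with X_1 the shifted variables fill X_1⋯X_{k+1}. This
exhibits the image of d_+ inside L_{k+1}. -/
theorem prodUpTo_dTinv_mul_prodUpTo_dX {k : ℕ} (h : k + 1 ≤ n) :
    dX n 1 * prodUpTo (dTinv n) k * prodUpTo (dX n) k =
      (q⁻¹ ^ k) • (prodUpTo (dX n) (k + 1) * prodUpTo (dT n) k) := by
  induction k with
  | zero => simp [prodUpTo]
  | succ k ih =>
    have hc1 : Commute (dTinv n (k + 1)) (prodUpTo (dX n) k) :=
      (commute_heckeInv (commute_dT_prodUpTo_dX n (by omega)).symm).symm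
    have hc2 : Commute (prodUpTo (dT n) k) (dX n (k + 1 + 1)) :=
      (commute_prodUpTo k fun i h1 h2 => (commute_dT_dX n (by omega) (by omega)).symm).symm
    calc dX n 1 * (prodUpTo (dTinv n) k * dTinv n (k + 1)) * (prodUpTo (dX n) k * dX n (k + 1))
        = dX n 1 * prodUpTo (dTinv n) k * (dTinv n (k + 1) * prodUpTo (dX n) k) *
            dX n (k + 1) := by simp only [mul_assoc]
      _ = dX n 1 * prodUpTo (dTinv n) k * prodUpTo (dX n) k *
            (dTinv n (k + 1) * dX n (k + 1)) := by rw [hc1.eq]; simp only [mul_assoc]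
      _ = (q⁻¹ ^ (k + 1)) • (prodUpTo (dX n) (k + 1) *
            (prodUpTo (dT n) k * dX n (k + 1 + 1)) * dT n (k + 1)) := by
          rw [ih (by omega), dTinv_mul_dX n (by omega) (by omega), mul_smul_comm, smul_mul_assoc,
            smul_smul, pow_succ']
          simp only [mul_assoc]
      _ = _ := by rw [hc2.eq]; simp only [prodUpTo, mul_assoc]

theorem opPlus_apply_mem_spaceL {k : ℕ} {v : V} (hv : v ∈ spaceL φ k) :
    φ (opPlus n k) v ∈ spaceL φ (k + 1) := by
  rcases Nat.lt_or_ge n (k + 1) with h | h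
  · rw [opPlus_of_lt n h]; simp
  obtain ⟨w, hw, rfl⟩ := (mem_spaceL (by omega)).mp hv
  rw [← Module.End.mul_apply, ← map_mul, opPlus_eq n h, smul_mul_assoc,
    prodUpTo_dTinv_mul_prodUpTo_dX h, smul_smul, map_smul, map_mul]
  refine Submodule.smul_mem _ _ ((mem_spaceL h).mpr ⟨_, ?_, rfl⟩)
  exact heckeInvariants_of_commute (fun j h1 h2 => commute_prodUpTo k fun i h3 h4 =>
    commute_dT_dT n (by omega)) (heckeInvariants_mono (by omega) hw)

/-- The coset sum commutes with X_1⋯X_k but not with X_{k+1}. The latter is therefore joined to the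
invariant vector, which stays fixed by T_j for j > k + 1, and the coset sum then supplies invariance
under T_{k+1}. -/
theorem opMinus_apply_mem_spaceL {k : ℕ} {v : V} (hv : v ∈ spaceL φ (k + 1)) :
    φ (opMinus n (k + 1)) v ∈ spaceL φ k := by
  rcases Nat.lt_or_ge n (k + 1) with h | h
  · rw [eq_zero_of_mem_spaceL h hv, map_zero]; exact Submodule.zero_mem _
  obtain ⟨w, hw, rfl⟩ := (mem_spaceL h).mp hv
  have hc : Commute (prodUpTo (dX n) k) (cosetSum n (dT n) (k + 1)) :=
    commute_cosetSum fun i h1 h2 => (commute_dT_prodUpTo_dX n (by omega)).symm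
  rw [← Module.End.mul_apply, ← map_mul, opMinus_eq, smul_mul_assoc, prodUpTo, ← mul_assoc,
    ← hc.eq, mul_assoc, map_smul, map_mul, LinearMap.smul_apply]
  refine Submodule.smul_mem _ _ ((mem_spaceL (by omega)).mpr ⟨_, ?_, rfl⟩)
  rw [map_mul, Module.End.mul_apply]
  exact (heckeRelations_dT n).cosetSum_mem (by omega) h (heckeInvariants_of_commute
    (fun j h1 h2 => commute_dT_dX n (by omega) (by omega)) hw)

theorem dT_opPlus_opPlus_apply {k : ℕ} {v : V} (hv : v ∈ spaceL φ k) :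
    φ (dT n 1) (φ (opPlus n (k + 1)) (φ (opPlus n k) v)) =
      φ (opPlus n (k + 1)) (φ (opPlus n k) v) := by
  rcases Nat.lt_or_ge n (k + 2) with h | h
  · rw [opPlus_of_lt n (k := k + 1) (by omega)]; simp
  have := congrArg (fun x => φ x v) (opPlus_opPlus_aux n h)
  simp only [map_mul, Module.End.mul_apply] at this
  rw [this, spaceL_le_invariants (by omega) hv (k + 1) (by omega) (by omega)]

/-- Membership in L_k is not needed here: `opPlus n (k + 1)` is q times `opPlus n k` followed by
T_{k+1}⁻¹, which cancels the T_{k+1} that `opPlus_opPlus_aux` produces on the right. -/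
theorem dT_opPlus_opPlus_succ_apply (k : ℕ) (v : V) :
    φ (dT n 1) (φ (opPlus n (k + 1)) (φ (opPlus n (k + 1)) v)) =
      q • φ (opPlus n (k + 1)) (φ (opPlus n k) v) := by
  rcases Nat.lt_or_ge n (k + 2) with h | h
  · rw [opPlus_of_lt n (k := k + 1) (by omega)]; simp
  have e : dT n 1 * (opPlus n (k + 1) * opPlus n (k + 1)) =
      q • (opPlus n (k + 1) * opPlus n k) := by
    conv_lhs => rw [opPlus_succ n h (k := k)]
    have := opPlus_opPlus_aux n h
    conv_lhs => enter [2, 1]; rw [← opPlus_succ n h]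
    rw [mul_smul_comm, mul_smul_comm]
    congr 1
    rw [← mul_assoc, ← mul_assoc, mul_assoc (dT n 1), this, mul_assoc,
      dT_mul_dTinv n (by omega) (by omega), mul_one]
  have := congrArg (fun x => φ x v) e
  simpa only [map_mul, Module.End.mul_apply, map_smul, LinearMap.smul_apply] using this

theorem prodDown_apply_of_mem {k m l : ℕ} (h : k < l) (hm : l + m ≤ n) {v : V}
    (hv : v ∈ heckeInvariants φ n (dT n) k) : φ (prodDown (dT n) l m) v = v := by
  induction m with
  | zero => simp [prodDown]
  | succ m ih =>
    rw [prodDown, map_mul, Module.End.mul_apply, ih (by omega), hv _ (by omega) (by omega)]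

/-- The relation between `Y_1`, `Y_k` and the operators `d_+`, `d_-`. -/
theorem dY_one_opPlus_apply {k : ℕ} (h : k + 1 ≤ n) {v : V}
    (hv : v ∈ heckeInvariants φ n (dT n) (k + 1)) :
    φ (dY n 1) (φ (opPlus n k) (φ (opMinus n (k + 1)) v + v)) =
      (q * t) • φ (opPlus n k) (φ (dY n (k + 1)) v) := by
  have hT := heckeRelations_dT n
  obtain ⟨m, hn⟩ : ∃ m, n = k + 1 + m := ⟨n - (k + 1), by omega⟩
  set A := prodDown (dTinv n) (k + 1) m with hA
  set B := prodDown (dT n) (k + 1) m with hB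
  have hn1 : n - 1 = k + m := by omega
  have eB : prodDown (dT n) 1 (n - 1) = B * prodDown (dT n) 1 k := by
    rw [hn1, prodDown_add, add_comm 1 k]
  have eA : prodDown (dTinv n) 1 (n - 1) = A * prodDown (dTinv n) 1 k := by
    rw [hn1, prodDown_add, add_comm 1 k]
  -- Y_1 X_1 contributes qt X_1 π T_{n-1}⋯T_1, and the lower part T_k⋯T_1 cancels the inverses in
  -- d_+. In `e2` the same cancellation happens after Y_{k+1} has been carried back to Y_1.
  have e1 : dY n 1 * opPlus n k = (q * t * q ^ k) • (dX n 1 * dPi n * B) := by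
    rw [opPlus_eq n h, mul_smul_comm, ← mul_assoc, dY_mul_dX_one n (by omega), eB,
      smul_mul_assoc, smul_smul, mul_comm (q ^ k)]
    congr 1
    simp only [mul_assoc]
    rw [prodDown_dT_mul_prodUpTo n k (by omega), mul_one]
  have e2 : opPlus n k * dY n (k + 1) = q ^ n • (dX n 1 * dPi n * A) := by
    rw [opPlus_eq n h, smul_mul_assoc, mul_assoc, prodUpTo_dTinv_mul_dY n k (by omega),
      mul_smul_comm, smul_smul, ← mul_pow, mul_inv_cancel₀ q_ne_zero, one_pow, one_smul,
      dY_one_eq n (by omega), eA, smul_mul_assoc, mul_smul_comm]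
    congr 1
    simp only [mul_assoc]
    rw [prodDown_dTinv_mul_prodUpTo n k (by omega), mul_one]
  -- B fixes the coset sum of v, which is invariant under T_{k+1}, …, T_{n-1}, while
  -- `prodDown_apply` expresses B v by the same inverse products. The sums cancel and (q - 1) q^m A
  -- v + q^m A v remains.
  have e3 : φ B (φ (opMinus n (k + 1)) v + v) = q ^ (m + 1) • φ A v := by
    have h1 := hT.prodDown_apply (φ := φ) (by omega : 1 ≤ k + 1) hv m (by omega)
    have h2 : φ B (φ (cosetSum n (dT n) (k + 1)) v) = φ (cosetSum n (dT n) (k + 1)) v :=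
      prodDown_apply_of_mem (by omega) (by omega) (hT.cosetSum_mem (by omega) h hv)
    have h3 : φ (cosetSum n (dT n) (k + 1)) v =
        ∑ j ∈ Finset.range m, q ^ j • φ (prodDown (dTinv n) (k + 1) j) v + q ^ m • φ A v := by
      rw [cosetSum, if_pos h, show n - (k + 1) = m by omega, Finset.sum_range_succ, map_add,
        map_sum, LinearMap.add_apply, LinearMap.sum_apply]
      simp only [map_smul, LinearMap.smul_apply]
      rfl
    rw [opMinus_eq, map_smul, LinearMap.smul_apply, map_add, map_smul, h2, h3]
    change (q - 1) • ∑ j ∈ Finset.range m, q ^ j • φ (prodDown (dTinv n) (k + 1) j) v +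
      φ B v = q ^ m • φ A v at h1
    rw [pow_succ]
    linear_combination (norm := module) h1
  have h1 : φ (dY n 1 * opPlus n k) (φ (opMinus n (k + 1)) v + v) =
      (q * t) • φ (opPlus n k * dY n (k + 1)) v := by
    rw [e1, e2]
    simp only [map_smul, map_mul, LinearMap.smul_apply, Module.End.mul_apply]
    rw [e3, map_smul, map_smul, smul_smul, smul_smul]
    congr 1
    rw [hn]
    ring
  simpa only [map_mul, Module.End.mul_apply] using h1

end FiniteLevel

namespace DAHASequence

/-! ### Compatibility of the operators with the connecting maps -/

namespace IsCompatible

variable {D : DAHASequence}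

/-- Vectors in L_{n+1} of V^(n+1) carry the factor X_{n+1}, which Π kills. This settles the boundary
index k = n + 1, where L_k of V^(n) is zero. -/
theorem proj_eq_zero (hD : D.IsCompatible) {n : ℕ} (hn : D.n₁ ≤ n) {v : D.V (n + 1)}
    (hv : v ∈ D.finiteL (n + 1) (n + 1)) : D.proj n v = 0 := by
  obtain ⟨w, _, rfl⟩ := (mem_spaceL (φ := D.act (n + 1)) le_rfl).mp hv
  have hc : Commute (dX (n + 1) (n + 1)) (prodUpTo (dX (n + 1)) n) :=
    commute_prodUpTo n fun i _ _ => commute_dX_dX _ _ _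
  rw [prodUpTo, ← hc.eq, map_mul]
  exact hD.proj_X_last n hn _

theorem proj_dTinv (hD : D.IsCompatible) {n : ℕ} (hn : D.n₁ ≤ n) {i : ℕ} (h1 : 1 ≤ i) (h2 : i < n)
    (v : D.V (n + 1)) :
    D.proj n (D.act (n + 1) (dTinv (n + 1) i) v) = D.act n (dTinv n i) (D.proj n v) := by
  simp only [dTinv, heckeInv, map_smul, map_add, LinearMap.smul_apply, LinearMap.add_apply,
    hD.proj_T n hn i h1 h2, AlgHom.commutes, Module.algebraMap_end_apply]

theorem proj_prodUpTo_dTinv (hD : D.IsCompatible) {n : ℕ} (hn : D.n₁ ≤ n) {m : ℕ} (h : m < n)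
    (v : D.V (n + 1)) :
    D.proj n (D.act (n + 1) (prodUpTo (dTinv (n + 1)) m) v) =
      D.act n (prodUpTo (dTinv n) m) (D.proj n v) := by
  induction m generalizing v with
  | zero => simp [prodUpTo]
  | succ m ih =>
    rw [prodUpTo, map_mul, Module.End.mul_apply, ih (by omega),
      hD.proj_dTinv hn (by omega) h, prodUpTo, map_mul, Module.End.mul_apply]

theorem proj_prodDown_dTinv (hD : D.IsCompatible) {n : ℕ} (hn : D.n₁ ≤ n) {k m : ℕ} (h1 : 1 ≤ k)
    (h : k + m ≤ n)
    (v : D.V (n + 1)) :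
    D.proj n (D.act (n + 1) (prodDown (dTinv (n + 1)) k m) v) =
      D.act n (prodDown (dTinv n) k m) (D.proj n v) := by
  induction m with
  | zero => simp [prodDown]
  | succ m ih =>
    rw [prodDown, map_mul, Module.End.mul_apply, hD.proj_dTinv hn (by omega) (by omega),
      ih (by omega), prodDown, map_mul, Module.End.mul_apply]

theorem proj_prodDown_dT (hD : D.IsCompatible) {n : ℕ} (hn : D.n₁ ≤ n) {k m : ℕ} (h1 : 1 ≤ k)
    (h : k + m ≤ n)
    (v : D.V (n + 1)) :
    D.proj n (D.act (n + 1) (prodDown (dT (n + 1)) k m) v) =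
      D.act n (prodDown (dT n) k m) (D.proj n v) := by
  induction m with
  | zero => simp [prodDown]
  | succ m ih =>
    rw [prodDown, map_mul, Module.End.mul_apply, hD.proj_T n hn _ (by omega) (by omega),
      ih (by omega), prodDown, map_mul, Module.End.mul_apply]

/-- For k ≤ n this is an axiom of compatibility. For k = n + 1 the index i = n may occur, for which
there is no axiom, but both sides vanish because L_{n+1} is killed. -/
theorem proj_dT_of_mem (hD : D.IsCompatible) {n : ℕ} (hn : D.n₁ ≤ n) {k i : ℕ} (h1 : 1 ≤ i)
    (h2 : i < k)
    {v : D.V (n + 1)} (hv : v ∈ D.finiteL (n + 1) k) :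
    D.proj n (D.act (n + 1) (dT (n + 1) i) v) = D.act n (dT n i) (D.proj n v) := by
  rcases Nat.lt_trichotomy k (n + 1) with h | rfl | h
  · exact hD.proj_T n hn i h1 (by omega) v
  · rw [hD.proj_eq_zero hn (dT_apply_mem_spaceL h2 hv), hD.proj_eq_zero hn hv, map_zero]
  · rw [eq_zero_of_mem_spaceL h hv]; simp

/-- Compatibility prescribes nothing for Y_1 on all of V^(n+1). On multiples of X_1, which contain
L_k for k ≥ 1, Y_1 is expressed by X_1, by π^(n+1) T_n and by T_i with i < n, and the axioms cover
these. The other Y_i follow by multiplying with T_i on both sides inside L_k. -/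
theorem proj_dY_of_mem (hD : D.IsCompatible) {n : ℕ} (hn : D.n₁ ≤ n) {k i : ℕ} (h1 : 1 ≤ i)
    (h2 : i ≤ k)
    {v : D.V (n + 1)} (hv : v ∈ D.finiteL (n + 1) k) :
    D.proj n (D.act (n + 1) (dY (n + 1) i) v) = D.act n (dY n i) (D.proj n v) := by
  have hn1 : 1 ≤ n := hD.one_le.trans hn
  rcases Nat.lt_trichotomy k (n + 1) with h | rfl | h
  · induction i, h1 using Nat.le_induction generalizing v with
    | base =>
      obtain ⟨w, _, rfl⟩ := (mem_spaceL (φ := D.act (n + 1)) h.le).mp hv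
      obtain ⟨l, rfl⟩ : ∃ l, k = l + 1 := ⟨k - 1, by omega⟩
      rw [prodUpTo_succ_left, map_mul, Module.End.mul_apply]
      generalize D.act (n + 1) (prodUpTo (fun i => dX (n + 1) (i + 1)) l) w = x
      have e1 : dY (n + 1) 1 * dX (n + 1) 1 = (q * t) • (dX (n + 1) 1 *
          ((dPi (n + 1) * dT (n + 1) n) * prodDown (dT (n + 1)) 1 (n - 1))) := by
        rw [dY_mul_dX_one _ (by omega), Nat.add_sub_cancel]
        obtain ⟨m, rfl⟩ : ∃ m, n = m + 1 := ⟨n - 1, by omega⟩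
        rw [prodDown, Nat.add_sub_cancel, add_comm 1 m]
        simp only [mul_assoc]
      rw [← Module.End.mul_apply, ← map_mul, e1, map_smul, LinearMap.smul_apply, map_smul,
        map_mul, Module.End.mul_apply, hD.proj_X n hn 1 le_rfl hn1, map_mul, Module.End.mul_apply,
        hD.proj_pi n hn, hD.proj_prodDown_dT hn le_rfl (by omega), hD.proj_X n hn 1 le_rfl hn1,
        ← Module.End.mul_apply (D.act n (dY n 1)), ← map_mul, dY_mul_dX_one n hn1, map_smul,
        LinearMap.smul_apply]
      simp only [map_mul, Module.End.mul_apply]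
    | succ i hi ih =>
      have e : ∀ n, i < n → dY n (i + 1) = q⁻¹ • (dT n i * (dY n i * dT n i)) := by
        intro n h
        rw [← mul_assoc, dT_dY_dT n hi h, smul_smul, inv_mul_cancel₀ q_ne_zero, one_smul]
      have h3 : D.act (n + 1) (dT (n + 1) i) v ∈ D.finiteL (n + 1) k :=
        dT_apply_mem_spaceL (by omega) hv
      have h4 : D.act (n + 1) (dY (n + 1) i) (D.act (n + 1) (dT (n + 1) i) v) ∈
        D.finiteL (n + 1) k := dY_apply_mem_spaceL hi (by omega) h3
      rw [e n (by omega), e (n + 1) (by omega)]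
      simp only [map_smul, map_mul, LinearMap.smul_apply, Module.End.mul_apply]
      rw [hD.proj_dT_of_mem hn hi (by omega) h4, ih (by omega) h3,
        hD.proj_dT_of_mem hn hi (by omega) hv]
  · rw [hD.proj_eq_zero hn (dY_apply_mem_spaceL h1 h2 hv), hD.proj_eq_zero hn hv, map_zero]
  · rw [eq_zero_of_mem_spaceL h hv]; simp

theorem proj_opPlus_of_mem (hD : D.IsCompatible) {n : ℕ} (hn : D.n₁ ≤ n) {k : ℕ} {v : D.V (n + 1)}
    (hv : v ∈ D.finiteL (n + 1) k) :
    D.proj n (D.act (n + 1) (opPlus (n + 1) k) v) = D.act n (opPlus n k) (D.proj n v) := by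
  rcases Nat.lt_trichotomy k n with h | rfl | h
  · rw [opPlus_eq _ (by omega), opPlus_eq _ (by omega)]
    simp only [map_smul, map_mul, LinearMap.smul_apply, Module.End.mul_apply]
    rw [hD.proj_X n hn 1 le_rfl (by omega), hD.proj_prodUpTo_dTinv hn h]
  · rw [hD.proj_eq_zero hn (opPlus_apply_mem_spaceL hv), opPlus_of_lt _ (by omega), map_zero,
      LinearMap.zero_apply]
  · rw [opPlus_of_lt _ (by omega), opPlus_of_lt _ (by omega)]; simp

/-- The coset sum in rank n + 1 has one additional term, T_n⁻¹⋯T_{k+1}⁻¹. It carries the factor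
X_{k+1} of a vector in L_{k+1} to X_{n+1}, so Π kills it. -/
theorem proj_opMinus_of_mem (hD : D.IsCompatible) {n : ℕ} (hn : D.n₁ ≤ n) {k : ℕ} {v : D.V (n + 1)}
    (hv : v ∈ D.finiteL (n + 1) (k + 1)) :
    D.proj n (D.act (n + 1) (opMinus (n + 1) (k + 1)) v) =
      D.act n (opMinus n (k + 1)) (D.proj n v) := by
  rcases Nat.lt_trichotomy k n with h | rfl | h
  · have hX : ∀ m, k + 1 + m = n + 1 →
        D.proj n (D.act (n + 1) (prodDown (dTinv (n + 1)) (k + 1) m) v) = 0 := by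
      intro m hm
      obtain ⟨w, _, rfl⟩ := (mem_spaceL (φ := D.act (n + 1)) (by omega)).mp hv
      have hc : Commute (dX (n + 1) (k + 1)) (prodUpTo (dX (n + 1)) k) :=
        commute_prodUpTo k fun i _ _ => commute_dX_dX _ _ _
      rw [← Module.End.mul_apply, ← map_mul, prodUpTo, ← hc.eq, ← mul_assoc,
        prodDown_dTinv_mul_dX _ (by omega) _ (by omega), hm, smul_mul_assoc, map_smul,
        LinearMap.smul_apply, map_smul, mul_assoc, map_mul, Module.End.mul_apply,
        hD.proj_X_last n hn, smul_zero]
    rw [opMinus, if_pos (by omega), opMinus, if_pos (by omega),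
      show n + 1 - (k + 1) + 1 = (n - (k + 1) + 1) + 1 by omega, Finset.sum_range_succ]
    simp only [map_smul, map_add, map_sum, LinearMap.smul_apply, LinearMap.add_apply,
      LinearMap.sum_apply]
    rw [hX _ (by omega), smul_zero, add_zero]
    congr 1
    refine Finset.sum_congr rfl fun j hj => ?_
    have := Finset.mem_range.mp hj
    rw [hD.proj_prodDown_dTinv hn (by omega) (by omega)]
  -- For k = n the coset sum in rank n + 1 is 1, so d_- is the scalar q - 1 there and both sides are
  -- zero.
  · rw [hD.proj_eq_zero hn hv, opMinus_eq, cosetSum_self, map_smul, map_one, LinearMap.smul_apply,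
      Module.End.one_apply, map_smul, hD.proj_eq_zero hn hv, smul_zero, map_zero]
  · rw [eq_zero_of_mem_spaceL (by omega) hv]; simp

theorem dTinv_mem (hD : D.IsCompatible) {n : ℕ} (hn : D.n₁ ≤ n) (i d : ℕ) {v : D.V n}
    (hv : v ∈ D.gr n d) :
    D.act n (dTinv n i) v ∈ D.gr n d := by
  simp only [dTinv, heckeInv, map_smul, map_add, LinearMap.smul_apply, LinearMap.add_apply,
    AlgHom.commutes, Module.algebraMap_end_apply]
  exact Submodule.smul_mem _ _ (Submodule.add_mem _ (hD.T_mem n hn i d v hv)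
    (Submodule.smul_mem _ _ hv))

theorem opPlus_mem (hD : D.IsCompatible) {n : ℕ} (hn : D.n₁ ≤ n) (k d : ℕ) {v : D.V n}
    (hv : v ∈ D.gr n d) :
    D.act n (opPlus n k) v ∈ D.gr n (d + 1) := by
  unfold opPlus
  split_ifs
  · rw [map_smul, map_mul]
    refine Submodule.smul_mem _ _ (hD.X_mem n hn _ _ _ ?_)
    clear * - hv hD hn
    induction k generalizing v with
    | zero => simpa [prodUpTo] using hv
    | succ k ih =>
      rw [prodUpTo, map_mul]
      exact ih (hD.dTinv_mem hn _ _ hv)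
  · simp

theorem opMinus_mem (hD : D.IsCompatible) {n : ℕ} (hn : D.n₁ ≤ n) (k d : ℕ) {v : D.V n}
    (hv : v ∈ D.gr n d) :
    D.act n (opMinus n k) v ∈ D.gr n d := by
  unfold opMinus
  split_ifs
  · rw [map_smul, map_sum, LinearMap.smul_apply, LinearMap.sum_apply]
    refine Submodule.smul_mem _ _ (Submodule.sum_mem _ fun j hj => ?_)
    clear hj
    rw [map_smul]
    refine Submodule.smul_mem _ _ ?_
    induction j with
    | zero => simpa [prodDown] using hv
    | succ j ih =>
      rw [prodDown, map_mul]
      exact hD.dTinv_mem hn _ _ ih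
  · simp

end IsCompatible

/-! ### The operators on stable sequences -/

variable (D : DAHASequence)

/-- An operator on stable sequences that acts componentwise. -/
def stableMap (a : ∀ n, DAHA n) {k d k' d' : ℕ}
    (hL : ∀ n, D.n₁ ≤ n → ∀ v ∈ D.finiteL n k, D.act n (a n) v ∈ D.finiteL n k')
    (hgr : ∀ n, D.n₁ ≤ n → ∀ v ∈ D.gr n d, D.act n (a n) v ∈ D.gr n d')
    (hproj : ∀ n, D.n₁ ≤ n → ∀ v ∈ D.finiteL (n + 1) k,
      D.proj n (D.act (n + 1) (a (n + 1)) v) = D.act n (a n) (D.proj n v)) :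
    D.stableL k d →ₗ[Kqt] D.stableL k' d' where
  toFun v := ⟨fun n => D.act n.1 (a n.1) (v.1 n),
    fun n => ⟨hL n.1 n.2 _ (v.2.1 n).1, hgr n.1 n.2 _ (v.2.1 n).2⟩, fun n h => by
      rw [hproj n h _ (v.2.1 ⟨n + 1, h.trans n.le_succ⟩).1, v.2.2 n h]⟩
  map_add' v w := Subtype.ext (funext fun n => map_add _ _ _)
  map_smul' c v := Subtype.ext (funext fun n => map_smul _ _ _)

variable {D} in
theorem stableL_ext {k d : ℕ} {v w : D.stableL k d} (h : ∀ n, v.1 n = w.1 n) : v = w :=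
  Subtype.ext (funext h)

theorem stableOf_add (k d : ℕ) (v w : D.stableL k d) :
    D.stableOf k d (v + w) = D.stableOf k d v + D.stableOf k d w := map_add _ _ _

theorem stableOf_sub (k d : ℕ) (v w : D.stableL k d) :
    D.stableOf k d (v - w) = D.stableOf k d v - D.stableOf k d w := by
  rw [eq_sub_iff_add_eq, ← stableOf_add, sub_add_cancel]

theorem stableOf_smul (k d : ℕ) (c : Kqt) (v : D.stableL k d) :
    D.stableOf k d (c • v) = c • D.stableOf k d v := map_smul _ _ _

variable {D} in
theorem stableSpace_ext {f g : Module.End Kqt D.stableSpace}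
    (h : ∀ k d (v : D.stableL k d), f (D.stableOf k d v) = g (D.stableOf k d v)) : f = g :=
  DirectSum.linearMap_ext _ fun p => LinearMap.ext fun v => h p.1 p.2 v

namespace IsCompatible

variable {D} (hD : D.IsCompatible)

/-- The operator `T_i` on `𝔏_k(d)`. -/
def stableT (i k d : ℕ) : D.stableL k d →ₗ[Kqt] D.stableL k d :=
  if h : 1 ≤ i ∧ i < k then
    D.stableMap (fun n => dT n i) (fun _ _ _ hv => dT_apply_mem_spaceL h.2 hv)
      (fun n hn v hv => hD.T_mem n hn i d v hv)
      (fun _ hn _ hv => hD.proj_dT_of_mem hn h.1 h.2 hv)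
  else 0

/-- The operator `z_i` on `𝔏_k(d)`. -/
def stableZ (i k d : ℕ) : D.stableL k d →ₗ[Kqt] D.stableL k d :=
  if h : 1 ≤ i ∧ i ≤ k then
    (q * t)⁻¹ • D.stableMap (fun n => dY n i) (fun _ _ _ hv => dY_apply_mem_spaceL h.1 h.2 hv)
      (fun n hn v hv => hD.Y_mem n hn i d v hv)
      (fun _ hn _ hv => hD.proj_dY_of_mem hn h.1 h.2 hv)
  else 0

/-- The operator `d_+` on `𝔏_k(d)`. -/
def stablePlus (k d : ℕ) : D.stableL k d →ₗ[Kqt] D.stableL (k + 1) (d + 1) :=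
  D.stableMap (fun n => opPlus n k) (fun _ _ _ hv => opPlus_apply_mem_spaceL hv)
    (fun _ hn _ hv => hD.opPlus_mem hn k d hv) (fun _ hn _ hv => hD.proj_opPlus_of_mem hn hv)

/-- The operator `d_-` on `𝔏_{k+1}(d)`. -/
def stableMinus (k d : ℕ) : D.stableL (k + 1) d →ₗ[Kqt] D.stableL k d :=
  D.stableMap (fun n => opMinus n (k + 1)) (fun _ _ _ hv => opMinus_apply_mem_spaceL hv)
    (fun _ hn _ hv => hD.opMinus_mem hn _ d hv) (fun _ hn _ hv => hD.proj_opMinus_of_mem hn hv)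

theorem stableT_val {i k d : ℕ} (h1 : 1 ≤ i) (h2 : i < k) (v : D.stableL k d) (n) :
    (hD.stableT i k d v).1 n = D.act n.1 (dT n.1 i) (v.1 n) := by
  rw [stableT, dif_pos ⟨h1, h2⟩]; rfl

theorem stableZ_val {i k d : ℕ} (h1 : 1 ≤ i) (h2 : i ≤ k) (v : D.stableL k d) (n) :
    (hD.stableZ i k d v).1 n = (q * t)⁻¹ • D.act n.1 (dY n.1 i) (v.1 n) := by
  rw [stableZ, dif_pos ⟨h1, h2⟩]; rfl

theorem stablePlus_val {k d : ℕ} (v : D.stableL k d) (n) :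
    (hD.stablePlus k d v).1 n = D.act n.1 (opPlus n.1 k) (v.1 n) := rfl

theorem stableMinus_val {k d : ℕ} (v : D.stableL (k + 1) d) (n) :
    (hD.stableMinus k d v).1 n = D.act n.1 (opMinus n.1 (k + 1)) (v.1 n) := rfl

/-- The operators on `𝔏_•` by which the generators of `𝔹_{q,t}` act. -/
def genAct : BGen → Module.End Kqt D.stableSpace
  | BGen.e k => DirectSum.toModule Kqt (ℕ × ℕ) _ fun p =>
      if p.1 = k then DirectSum.lof Kqt (ℕ × ℕ) (fun p => D.stableL p.1 p.2) p else 0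
  | BGen.dp k => DirectSum.toModule Kqt (ℕ × ℕ) _ fun p =>
      if p.1 = k then DirectSum.lof Kqt (ℕ × ℕ) (fun p => D.stableL p.1 p.2) (p.1 + 1, p.2 + 1) ∘ₗ
        hD.stablePlus p.1 p.2 else 0
  | BGen.dm k => DirectSum.toModule Kqt (ℕ × ℕ) _ fun p =>
      match p with
      | (0, _) => 0
      | (l + 1, d) => if l = k then
          DirectSum.lof Kqt (ℕ × ℕ) (fun p => D.stableL p.1 p.2) (l, d) ∘ₗ hD.stableMinus l d
          else 0
  | BGen.T k i => DirectSum.toModule Kqt (ℕ × ℕ) _ fun p =>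
      if p.1 = k then DirectSum.lof Kqt (ℕ × ℕ) (fun p => D.stableL p.1 p.2) p ∘ₗ
        hD.stableT i p.1 p.2 else 0
  | BGen.z k i => DirectSum.toModule Kqt (ℕ × ℕ) _ fun p =>
      if p.1 = k then DirectSum.lof Kqt (ℕ × ℕ) (fun p => D.stableL p.1 p.2) p ∘ₗ
        hD.stableZ i p.1 p.2 else 0

theorem genAct_e_self (k d : ℕ) (v : D.stableL k d) :
    hD.genAct (BGen.e k) (D.stableOf k d v) = D.stableOf k d v := by
  rw [stableOf, genAct, DirectSum.toModule_lof, if_pos rfl]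

theorem genAct_e_ne {k l : ℕ} (h : l ≠ k) (d : ℕ) (v : D.stableL l d) :
    hD.genAct (BGen.e k) (D.stableOf l d v) = 0 := by
  rw [stableOf, genAct, DirectSum.toModule_lof, if_neg h, LinearMap.zero_apply]

theorem genAct_dp_self (k d : ℕ) (v : D.stableL k d) :
    hD.genAct (BGen.dp k) (D.stableOf k d v) =
      D.stableOf (k + 1) (d + 1) (hD.stablePlus k d v) := by
  rw [stableOf, genAct, DirectSum.toModule_lof, if_pos rfl]; rfl

theorem genAct_dp_ne {k l : ℕ} (h : l ≠ k) (d : ℕ) (v : D.stableL l d) :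
    hD.genAct (BGen.dp k) (D.stableOf l d v) = 0 := by
  rw [stableOf, genAct, DirectSum.toModule_lof, if_neg h, LinearMap.zero_apply]

theorem genAct_dm_self (k d : ℕ) (v : D.stableL (k + 1) d) :
    hD.genAct (BGen.dm k) (D.stableOf (k + 1) d v) = D.stableOf k d (hD.stableMinus k d v) := by
  rw [stableOf, genAct, DirectSum.toModule_lof]
  simp only [if_true]
  rfl

theorem genAct_dm_ne {k l : ℕ} (h : l ≠ k + 1) (d : ℕ) (v : D.stableL l d) :
    hD.genAct (BGen.dm k) (D.stableOf l d v) = 0 := by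
  rw [stableOf, genAct, DirectSum.toModule_lof]
  cases l with
  | zero => rfl
  | succ l => simp only [if_neg (show l ≠ k by omega), LinearMap.zero_apply]

theorem genAct_T_self (k i d : ℕ) (v : D.stableL k d) :
    hD.genAct (BGen.T k i) (D.stableOf k d v) = D.stableOf k d (hD.stableT i k d v) := by
  rw [stableOf, genAct, DirectSum.toModule_lof, if_pos rfl]; rfl

theorem genAct_T_ne {k l : ℕ} (h : l ≠ k) (i d : ℕ) (v : D.stableL l d) :
    hD.genAct (BGen.T k i) (D.stableOf l d v) = 0 := by
  rw [stableOf, genAct, DirectSum.toModule_lof, if_neg h, LinearMap.zero_apply]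

theorem genAct_z_self (k i d : ℕ) (v : D.stableL k d) :
    hD.genAct (BGen.z k i) (D.stableOf k d v) = D.stableOf k d (hD.stableZ i k d v) := by
  rw [stableOf, genAct, DirectSum.toModule_lof, if_pos rfl]; rfl

theorem genAct_z_ne {k l : ℕ} (h : l ≠ k) (i d : ℕ) (v : D.stableL l d) :
    hD.genAct (BGen.z k i) (D.stableOf l d v) = 0 := by
  rw [stableOf, genAct, DirectSum.toModule_lof, if_neg h, LinearMap.zero_apply]

end IsCompatible

end DAHASequence

namespace DAHASequence

namespace IsCompatible

variable {D : DAHASequence} (hD : D.IsCompatible)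

/-! ### The relations of `𝔹_{q,t}` -/

theorem q_sub_one_ne_zero : q - 1 ≠ 0 := by
  rw [← neg_sub]; exact neg_ne_zero.mpr one_sub_q_ne_zero

theorem lift_be (k : ℕ) : FreeAlgebra.lift Kqt hD.genAct (be k) = hD.genAct (BGen.e k) :=
  FreeAlgebra.lift_ι_apply _ _

theorem lift_bp (k : ℕ) : FreeAlgebra.lift Kqt hD.genAct (bp k) = hD.genAct (BGen.dp k) :=
  FreeAlgebra.lift_ι_apply _ _

theorem lift_bm (k : ℕ) : FreeAlgebra.lift Kqt hD.genAct (bm k) = hD.genAct (BGen.dm k) :=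
  FreeAlgebra.lift_ι_apply _ _

theorem lift_bT (k i : ℕ) : FreeAlgebra.lift Kqt hD.genAct (bT k i) = hD.genAct (BGen.T k i) :=
  FreeAlgebra.lift_ι_apply _ _

theorem lift_bz (k i : ℕ) : FreeAlgebra.lift Kqt hD.genAct (bz k i) = hD.genAct (BGen.z k i) :=
  FreeAlgebra.lift_ι_apply _ _

theorem lift_sub_apply (x y : BFree) (w : D.stableSpace) :
    FreeAlgebra.lift Kqt hD.genAct (x - y) w =
      FreeAlgebra.lift Kqt hD.genAct x w - FreeAlgebra.lift Kqt hD.genAct y w := by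
  rw [eq_sub_iff_add_eq, ← LinearMap.add_apply, ← map_add, sub_add_cancel]

theorem val_add {k d : ℕ} (v w : D.stableL k d) (n) : (v + w).1 n = v.1 n + w.1 n := rfl

theorem val_sub {k d : ℕ} (v w : D.stableL k d) (n) : (v - w).1 n = v.1 n - w.1 n := rfl

theorem val_smul {k d : ℕ} (c : Kqt) (v : D.stableL k d) (n) : (c • v).1 n = c • v.1 n := rfl

theorem val_eq_zero {k d : ℕ} (v : D.stableL k d) {n : {n : ℕ // D.n₁ ≤ n}} (h : n.1 < k) :
    v.1 n = 0 := eq_zero_of_mem_spaceL (φ := D.act n.1) h (v.2.1 n).1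

theorem val_mem_invariants {k d : ℕ} (v : D.stableL k d) {n : {n : ℕ // D.n₁ ≤ n}}
    (h : k ≤ n.1) : v.1 n ∈ heckeInvariants (D.act n.1) n.1 (dT n.1) k :=
  spaceL_le_invariants (φ := D.act n.1) h (v.2.1 n).1

/-- The operator `φ` on `𝔏_{k+1}(d)`. -/
def stablePhi (k d : ℕ) (v : D.stableL (k + 1) d) : D.stableL (k + 1) (d + 1) :=
  (q - 1)⁻¹ • (hD.stablePlus k d (hD.stableMinus k d v) -
    hD.stableMinus (k + 1) (d + 1) (hD.stablePlus (k + 1) d v))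

/-- By the commutator formula φ at the vertex k + 1 acts through the element that defines d_+ at the
vertex k. In ranks n ≤ k the formula is not available, but the component vanishes. -/
theorem stablePhi_val {k d : ℕ} (v : D.stableL (k + 1) d) (n) :
    (hD.stablePhi k d v).1 n = D.act n.1 (opPlus n.1 k) (v.1 n) := by
  rw [stablePhi, val_smul, val_sub, stablePlus_val, stableMinus_val, stableMinus_val,
    stablePlus_val]
  rcases Nat.lt_or_ge n.1 (k + 1) with h | h
  · rw [val_eq_zero v h]; simp
  · have := congrArg (fun x => D.act n.1 x (v.1 n)) (opPlus_opMinus_comm n.1 h)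
    simp only [map_sub, map_mul, map_smul, LinearMap.sub_apply, LinearMap.smul_apply,
      Module.End.mul_apply] at this
    rw [this, smul_smul, inv_mul_cancel₀ q_sub_one_ne_zero, one_smul]

theorem lift_bphi_self (k d : ℕ) (v : D.stableL (k + 1) d) :
    FreeAlgebra.lift Kqt hD.genAct (bphi k) (D.stableOf (k + 1) d v) =
      D.stableOf (k + 1) (d + 1) (hD.stablePhi k d v) := by
  simp only [bphi, map_smul, hD.lift_sub_apply, map_mul, lift_bp, lift_bm, LinearMap.smul_apply,
    Module.End.mul_apply, genAct_dp_self, genAct_dm_self]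
  rw [stablePhi, stableOf_smul, stableOf_sub]

theorem lift_bphi_ne {k l : ℕ} (h : l ≠ k + 1) (d : ℕ) (v : D.stableL l d) :
    FreeAlgebra.lift Kqt hD.genAct (bphi k) (D.stableOf l d v) = 0 := by
  simp only [bphi, map_smul, hD.lift_sub_apply, map_mul, lift_bp, lift_bm, LinearMap.smul_apply,
    Module.End.mul_apply, hD.genAct_dm_ne h, hD.genAct_dp_ne h, map_zero,
    sub_zero, smul_zero]

variable {n : ℕ} {a b : DAHA n}

theorem act_congr (h : a = b) (v : D.V n) : D.act n a v = D.act n b v := by rw [h]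

theorem genAct_quad (k i : ℕ) (h1 : 1 ≤ i) (h2 : i < k) :
    FreeAlgebra.lift Kqt hD.genAct ((bT k i - be k) * (bT k i + q • be k)) = 0 := by
  refine stableSpace_ext fun l d v => ?_
  simp only [map_mul, hD.lift_sub_apply, map_add, map_smul, lift_be, lift_bT, Module.End.mul_apply,
    LinearMap.add_apply, LinearMap.smul_apply, LinearMap.zero_apply]
  obtain rfl | h := eq_or_ne l k
  · simp only [genAct_e_self, genAct_T_self, ← stableOf_add, ← stableOf_smul, ← stableOf_sub]
    have e : hD.stableT i l d (hD.stableT i l d v) + q • hD.stableT i l d v -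
        (hD.stableT i l d v + q • v) = 0 := by
      refine stableL_ext fun n => ?_
      simp only [val_sub, val_add, val_smul, hD.stableT_val h1 h2]
      rcases Nat.lt_or_ge i n.1 with h3 | h3
      · have := act_congr ((heckeRelations_dT n.1).mul_self h1 h3) (v.1 n)
        simp only [map_mul, map_add, map_smul, map_one, Module.End.mul_apply,
          LinearMap.add_apply, LinearMap.smul_apply, Module.End.one_apply] at this
        rw [this]
        change _ = (0 : D.V n.1)
        module
      · rw [val_eq_zero v (by omega)]
        simp
    rw [e]
    exact (DirectSum.lof Kqt _ _ _).map_zero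
  · simp only [hD.genAct_T_ne h, hD.genAct_e_ne h, map_zero, smul_zero, add_zero, sub_zero]

/-- Write q d_+ d_- - d_- d_+ = (q - 1) d_+ d_- + [d_+, d_-]. By the commutator formula this is q -
1 times `opPlus n k` applied to d_- + 1, and `dY_one_opPlus_apply` moves Y_1 across it as qt
Y_{k+1}. -/
theorem genAct_z_one (k : ℕ) :
    FreeAlgebra.lift Kqt hD.genAct (bz (k + 1) 1 * (q • (bp k * bm k) - bm (k + 1) * bp (k + 1))) =
      FreeAlgebra.lift Kqt hD.genAct
        ((q * t) • ((bp k * bm k - bm (k + 1) * bp (k + 1)) * bz (k + 1) (k + 1))) := by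
  refine stableSpace_ext fun l d v => ?_
  simp only [map_mul, map_smul, hD.lift_sub_apply, lift_bz, lift_bp, lift_bm, Module.End.mul_apply,
    LinearMap.smul_apply]
  obtain rfl | h := eq_or_ne l (k + 1)
  · simp only [genAct_z_self, genAct_dp_self, genAct_dm_self, ← stableOf_smul, ← stableOf_sub]
    congr 1
    refine stableL_ext fun n => ?_
    simp only [val_smul, val_sub, hD.stableZ_val le_rfl (by omega : 1 ≤ k + 1),
      hD.stableZ_val (by omega : 1 ≤ k + 1) le_rfl, stablePlus_val, stableMinus_val, map_smul,
      map_sub]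
    rcases Nat.lt_or_ge n.1 (k + 1) with h3 | h3
    · rw [val_eq_zero v h3]; simp
    · have hc : ∀ w, D.act n.1 (opPlus n.1 k) (D.act n.1 (opMinus n.1 (k + 1)) w) -
          D.act n.1 (opMinus n.1 (k + 2)) (D.act n.1 (opPlus n.1 (k + 1)) w) =
            (q - 1) • D.act n.1 (opPlus n.1 k) w := by
        intro w
        have := act_congr (opPlus_opMinus_comm n.1 h3) w
        simpa only [map_sub, map_mul, map_smul, LinearMap.sub_apply, LinearMap.smul_apply,
          Module.End.mul_apply] using this
      have hc1 : D.act n.1 (dY n.1 1) (D.act n.1 (opPlus n.1 k)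
            (D.act n.1 (opMinus n.1 (k + 1)) (v.1 n))) -
          D.act n.1 (dY n.1 1) (D.act n.1 (opMinus n.1 (k + 2))
            (D.act n.1 (opPlus n.1 (k + 1)) (v.1 n))) =
          (q - 1) • D.act n.1 (dY n.1 1) (D.act n.1 (opPlus n.1 k) (v.1 n)) := by
        rw [← map_sub, hc, map_smul]
      have hc2 := hc (D.act n.1 (dY n.1 (k + 1)) (v.1 n))
      have h4 := dY_one_opPlus_apply h3 (val_mem_invariants v h3)
      simp only [map_add] at h4
      linear_combination (norm := module) (q * t)⁻¹ • hc1 + ((q * t)⁻¹ * (q - 1)) • h4 -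
        (q * t * (q * t)⁻¹) • hc2
  · simp only [hD.genAct_z_ne h, hD.genAct_dp_ne h, hD.genAct_dm_ne h, map_zero, smul_zero,
      sub_zero]

-- Each relation is tested on elements of a single 𝔏_l(d). If l is not the source of the path both
-- sides vanish; otherwise the relation is compared rank by rank. The identities that require n to
-- be large are needed only there, because for n smaller than the source vertex the component is
-- zero.
set_option maxHeartbeats 1000000 in
theorem genAct_rel {x y : BFree} (h : BRel x y) :
    FreeAlgebra.lift Kqt hD.genAct x = FreeAlgebra.lift Kqt hD.genAct y := by
  cases h with
  | e_e k =>
    refine stableSpace_ext fun l d v => ?_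
    simp only [map_mul, lift_be, Module.End.mul_apply]
    obtain rfl | h := eq_or_ne l k
    · simp only [genAct_e_self]
    · simp only [hD.genAct_e_ne h, map_zero]
  | e_ne j k hjk =>
    refine stableSpace_ext fun l d v => ?_
    simp only [map_mul, lift_be, Module.End.mul_apply, map_zero, LinearMap.zero_apply]
    obtain rfl | h := eq_or_ne l k
    · rw [genAct_e_self, hD.genAct_e_ne hjk.symm]
    · simp only [hD.genAct_e_ne h, map_zero]
  | dp_left k =>
    refine stableSpace_ext fun l d v => ?_
    simp only [map_mul, lift_be, lift_bp, Module.End.mul_apply]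
    obtain rfl | h := eq_or_ne l k
    · simp only [genAct_dp_self, genAct_e_self]
    · simp only [hD.genAct_dp_ne h, map_zero]
  | dp_right k =>
    refine stableSpace_ext fun l d v => ?_
    simp only [map_mul, lift_be, lift_bp, Module.End.mul_apply]
    obtain rfl | h := eq_or_ne l k
    · simp only [genAct_e_self]
    · simp only [hD.genAct_dp_ne h, hD.genAct_e_ne h, map_zero]
  | dm_left k =>
    refine stableSpace_ext fun l d v => ?_
    simp only [map_mul, lift_be, lift_bm, Module.End.mul_apply]
    obtain rfl | h := eq_or_ne l (k + 1)
    · simp only [genAct_dm_self, genAct_e_self]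
    · simp only [hD.genAct_dm_ne h, map_zero]
  | dm_right k =>
    refine stableSpace_ext fun l d v => ?_
    simp only [map_mul, lift_be, lift_bm, Module.End.mul_apply]
    obtain rfl | h := eq_or_ne l (k + 1)
    · simp only [genAct_e_self]
    · simp only [hD.genAct_dm_ne h, hD.genAct_e_ne h, map_zero]
  | T_left k i =>
    refine stableSpace_ext fun l d v => ?_
    simp only [map_mul, lift_be, lift_bT, Module.End.mul_apply]
    obtain rfl | h := eq_or_ne l k
    · simp only [genAct_T_self, genAct_e_self]
    · simp only [hD.genAct_T_ne h, map_zero]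
  | T_right k i =>
    refine stableSpace_ext fun l d v => ?_
    simp only [map_mul, lift_be, lift_bT, Module.End.mul_apply]
    obtain rfl | h := eq_or_ne l k
    · simp only [genAct_e_self]
    · simp only [hD.genAct_T_ne h, hD.genAct_e_ne h, map_zero]
  | z_left k i =>
    refine stableSpace_ext fun l d v => ?_
    simp only [map_mul, lift_be, lift_bz, Module.End.mul_apply]
    obtain rfl | h := eq_or_ne l k
    · simp only [genAct_z_self, genAct_e_self]
    · simp only [hD.genAct_z_ne h, map_zero]
  | z_right k i =>
    refine stableSpace_ext fun l d v => ?_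
    simp only [map_mul, lift_be, lift_bz, Module.End.mul_apply]
    obtain rfl | h := eq_or_ne l k
    · simp only [genAct_e_self]
    · simp only [hD.genAct_z_ne h, hD.genAct_e_ne h, map_zero]
  | T_out k i hi =>
    refine stableSpace_ext fun l d v => ?_
    simp only [lift_bT, map_zero, LinearMap.zero_apply]
    obtain rfl | h := eq_or_ne l k
    · rw [genAct_T_self, stableT, dif_neg hi, LinearMap.zero_apply]
      exact (DirectSum.lof Kqt _ _ _).map_zero
    · rw [hD.genAct_T_ne h]
  | z_out k i hi =>
    refine stableSpace_ext fun l d v => ?_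
    simp only [lift_bz, map_zero, LinearMap.zero_apply]
    obtain rfl | h := eq_or_ne l k
    · rw [genAct_z_self, stableZ, dif_neg hi, LinearMap.zero_apply]
      exact (DirectSum.lof Kqt _ _ _).map_zero
    · rw [hD.genAct_z_ne h]
  | quad k i h1 h2 => rw [hD.genAct_quad k i h1 h2, map_zero]
  | braid k i h1 h2 =>
    refine stableSpace_ext fun l d v => ?_
    simp only [map_mul, lift_bT, Module.End.mul_apply]
    obtain rfl | h := eq_or_ne l k
    · simp only [genAct_T_self]
      congr 1
      refine stableL_ext fun n => ?_
      simp only [hD.stableT_val h1 (by omega : i < l), hD.stableT_val (by omega : 1 ≤ i + 1) h2]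
      rcases Nat.lt_or_ge n.1 l with h3 | h3
      · rw [val_eq_zero v h3]; simp
      · simpa only [map_mul, Module.End.mul_apply] using
          act_congr ((heckeRelations_dT n.1).braid i h1 (by omega)) (v.1 n)
    · simp only [hD.genAct_T_ne h, map_zero]
  | T_T k i j h1 h2 h3 =>
    refine stableSpace_ext fun l d v => ?_
    simp only [map_mul, lift_bT, Module.End.mul_apply]
    obtain rfl | h := eq_or_ne l k
    · simp only [genAct_T_self]
      congr 1
      refine stableL_ext fun n => ?_
      simp only [hD.stableT_val h1 (by omega : i < l), hD.stableT_val (by omega : 1 ≤ j) h3]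
      simpa only [map_mul, Module.End.mul_apply] using
        act_congr (commute_dT_dT n.1 (Or.inl h2)).eq (v.1 n)
    · simp only [hD.genAct_T_ne h, map_zero]
  | T_z_T k i h1 h2 =>
    refine stableSpace_ext fun l d v => ?_
    simp only [map_mul, map_smul, lift_bT, lift_bz, Module.End.mul_apply, LinearMap.smul_apply]
    obtain rfl | h := eq_or_ne l k
    · simp only [genAct_T_self, genAct_z_self, ← stableOf_smul]
      congr 1
      refine stableL_ext fun n => ?_
      simp only [val_smul, hD.stableT_val h1 h2, hD.stableZ_val h1 h2.le,
        hD.stableZ_val (by omega : 1 ≤ i + 1) h2, map_smul]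
      rw [smul_comm q]
      congr 1
      rcases Nat.lt_or_ge n.1 l with h3 | h3
      · rw [val_eq_zero v h3]; simp
      · simpa only [map_mul, map_smul, LinearMap.smul_apply, Module.End.mul_apply] using
          act_congr (dT_dY_dT n.1 h1 (by omega)) (v.1 n)
    · simp only [hD.genAct_T_ne h, hD.genAct_z_ne h, map_zero, smul_zero]
  | z_T k i j h1 h2 h3 h4 h5 h6 =>
    refine stableSpace_ext fun l d v => ?_
    simp only [map_mul, lift_bT, lift_bz, Module.End.mul_apply]
    obtain rfl | h := eq_or_ne l k
    · simp only [genAct_T_self, genAct_z_self]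
      congr 1
      refine stableL_ext fun n => ?_
      simp only [hD.stableT_val h3 h4, hD.stableZ_val h1 h2, map_smul]
      congr 1
      simpa only [map_mul, Module.End.mul_apply] using
        act_congr (commute_dT_dY n.1 h5 h6).eq.symm (v.1 n)
    · simp only [hD.genAct_T_ne h, hD.genAct_z_ne h, map_zero]
  | z_z k i j h1 h2 h3 h4 =>
    refine stableSpace_ext fun l d v => ?_
    simp only [map_mul, lift_bz, Module.End.mul_apply]
    obtain rfl | h := eq_or_ne l k
    · simp only [genAct_z_self]
      congr 1
      refine stableL_ext fun n => ?_
      simp only [hD.stableZ_val h3 h4, hD.stableZ_val h1 h2, map_smul]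
      congr 2
      simpa only [map_mul, Module.End.mul_apply] using
        act_congr (commute_dY_dY n.1 i j).eq (v.1 n)
    · simp only [hD.genAct_z_ne h, map_zero]
  | dm_dm_T k =>
    refine stableSpace_ext fun l d v => ?_
    simp only [map_mul, lift_bT, lift_bm, Module.End.mul_apply]
    obtain rfl | h := eq_or_ne l (k + 2)
    · simp only [genAct_T_self, genAct_dm_self]
      congr 1
      refine stableL_ext fun n => ?_
      simp only [hD.stableT_val (by omega : 1 ≤ k + 1) (by omega : k + 1 < k + 2), stableMinus_val]
      rcases Nat.lt_or_ge n.1 (k + 2) with h3 | h3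
      · rw [val_eq_zero v h3]; simp
      · simpa only [map_mul, Module.End.mul_apply] using
          act_congr (opMinus_opMinus_dT n.1 h3) (v.1 n)
    · simp only [hD.genAct_T_ne h, hD.genAct_dm_ne h, map_zero]
  | dm_T k i h1 h2 =>
    refine stableSpace_ext fun l d v => ?_
    simp only [map_mul, lift_bT, lift_bm, Module.End.mul_apply]
    obtain rfl | h := eq_or_ne l (k + 1)
    · simp only [genAct_T_self, genAct_dm_self]
      congr 1
      refine stableL_ext fun n => ?_
      simp only [hD.stableT_val h1 (by omega : i < k + 1), hD.stableT_val h1 h2, stableMinus_val]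
      simpa only [map_mul, Module.End.mul_apply] using
        act_congr (opMinus_mul_dT n.1 h2) (v.1 n)
    · simp only [hD.genAct_T_ne h, hD.genAct_dm_ne h, map_zero]
  | T_dp_dp k =>
    refine stableSpace_ext fun l d v => ?_
    simp only [map_mul, lift_bT, lift_bp, Module.End.mul_apply]
    obtain rfl | h := eq_or_ne l k
    · simp only [genAct_T_self, genAct_dp_self]
      congr 1
      refine stableL_ext fun n => ?_
      simp only [hD.stableT_val le_rfl (by omega : 1 < l + 1 + 1), stablePlus_val]
      exact dT_opPlus_opPlus_apply (v.2.1 n).1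
    · simp only [hD.genAct_dp_ne h, map_zero]
  | dp_T k i h1 h2 =>
    refine stableSpace_ext fun l d v => ?_
    simp only [map_mul, lift_bT, lift_bp, Module.End.mul_apply]
    obtain rfl | h := eq_or_ne l k
    · simp only [genAct_T_self, genAct_dp_self]
      congr 1
      refine stableL_ext fun n => ?_
      simp only [hD.stableT_val h1 h2, hD.stableT_val (by omega : 1 ≤ i + 1)
        (by omega : i + 1 < l + 1), stablePlus_val]
      simpa only [map_mul, Module.End.mul_apply] using
        act_congr (opPlus_mul_dT n.1 h1 h2) (v.1 n)
    · simp only [hD.genAct_T_ne h, hD.genAct_dp_ne h, map_zero]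
  | phi_dm k =>
    refine stableSpace_ext fun l d v => ?_
    simp only [map_mul, map_smul, lift_bT, lift_bm, Module.End.mul_apply, LinearMap.smul_apply]
    obtain rfl | h := eq_or_ne l (k + 2)
    · simp only [genAct_T_self, genAct_dm_self, lift_bphi_self, ← stableOf_smul]
      congr 1
      refine stableL_ext fun n => ?_
      simp only [val_smul, hD.stableT_val (by omega : 1 ≤ k + 1) (by omega : k + 1 < k + 2),
        stableMinus_val, stablePhi_val]
      rcases Nat.lt_or_ge n.1 (k + 2) with h3 | h3
      · rw [val_eq_zero v h3]; simp
      · simpa only [map_mul, map_smul, LinearMap.smul_apply, Module.End.mul_apply] using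
          act_congr (q_smul_opPlus_opMinus n.1 h3) (v.1 n)
    · simp only [hD.genAct_T_ne h, hD.genAct_dm_ne h, map_zero, smul_zero]
  | phi_dp k =>
    refine stableSpace_ext fun l d v => ?_
    simp only [map_mul, map_smul, lift_bT, lift_bp, Module.End.mul_apply, LinearMap.smul_apply]
    obtain rfl | h := eq_or_ne l (k + 1)
    · simp only [genAct_dp_self, lift_bphi_self, genAct_T_self, ← stableOf_smul]
      congr 1
      refine stableL_ext fun n => ?_
      simp only [val_smul, hD.stableT_val le_rfl (by omega : 1 < k + 1 + 1), stablePlus_val,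
        stablePhi_val]
      exact dT_opPlus_opPlus_succ_apply k (v.1 n)
    · simp only [hD.genAct_dp_ne h, hD.lift_bphi_ne h, map_zero, smul_zero]
  | z_dm k i h1 h2 =>
    refine stableSpace_ext fun l d v => ?_
    simp only [map_mul, lift_bz, lift_bm, Module.End.mul_apply]
    obtain rfl | h := eq_or_ne l (k + 1)
    · simp only [genAct_z_self, genAct_dm_self]
      congr 1
      refine stableL_ext fun n => ?_
      simp only [hD.stableZ_val h1 (by omega : i ≤ k + 1), hD.stableZ_val h1 h2, stableMinus_val,
        map_smul]
      congr 1
      simpa only [map_mul, Module.End.mul_apply] using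
        act_congr (opMinus_mul_dY n.1 h2).symm (v.1 n)
    · simp only [hD.genAct_z_ne h, hD.genAct_dm_ne h, map_zero]
  | dp_z k i h1 h2 =>
    refine stableSpace_ext fun l d v => ?_
    simp only [map_mul, lift_bz, lift_bp, Module.End.mul_apply]
    obtain rfl | h := eq_or_ne l k
    · simp only [genAct_z_self, genAct_dp_self]
      congr 1
      refine stableL_ext fun n => ?_
      simp only [hD.stableZ_val h1 h2, hD.stableZ_val (by omega : 1 ≤ i + 1)
        (by omega : i + 1 ≤ l + 1), stablePlus_val, map_smul]
      congr 1
      simpa only [map_mul, Module.End.mul_apply] using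
        act_congr (opPlus_mul_dY n.1 h1 h2) (v.1 n)
    · simp only [hD.genAct_z_ne h, hD.genAct_dp_ne h, map_zero]
  | z_one k => exact hD.genAct_z_one k

/-! ### Existence and uniqueness of the action of 𝔹_{q,t} -/

/-- The action of `𝔹_{q,t}` on `𝔏_•`. -/
def bAct : Bqt →ₐ[Kqt] Module.End Kqt D.stableSpace :=
  RingQuot.liftAlgHom Kqt ⟨FreeAlgebra.lift Kqt hD.genAct, fun _ _ h => hD.genAct_rel h⟩

theorem bAct_bMk (x : BFree) : hD.bAct (bMk x) = FreeAlgebra.lift Kqt hD.genAct x :=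
  RingQuot.liftAlgHom_mkAlgHom_apply Kqt _ (fun _ _ h => hD.genAct_rel h) x

theorem isBAction_bAct : D.IsBAction hD.bAct where
  e_self k d v := by rw [bAct_bMk, lift_be, genAct_e_self]
  e_ne j k d v h := by rw [bAct_bMk, lift_be, hD.genAct_e_ne h.symm]
  T k d v i h1 h2 := ⟨hD.stableT i k d v, fun n => hD.stableT_val h1 h2 _ _, by
    rw [bAct_bMk, lift_bT, genAct_T_self]⟩
  z k d v i h1 h2 := ⟨hD.stableZ i k d v, fun n => hD.stableZ_val h1 h2 _ _, by
    rw [bAct_bMk, lift_bz, genAct_z_self]⟩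
  dp k d v := ⟨hD.stablePlus k d v, fun n => hD.stablePlus_val _ _, by
    rw [bAct_bMk, lift_bp, genAct_dp_self]⟩
  dm k d v := ⟨hD.stableMinus k d v, fun n => hD.stableMinus_val _ _, by
    rw [bAct_bMk, lift_bm, genAct_dm_self]⟩

theorem bMk_rel {x y : BFree} (h : BRel x y) : bMk x = bMk y := RingQuot.mkAlgHom_rel Kqt h

/-- `IsBAction` prescribes an arrow only on its source. On the other 𝔏_l the arrow is forced to
vanish by x = x e_k, which is what uniqueness requires. -/
theorem eq_zero_of_mul_be {ρ : Bqt →ₐ[Kqt] Module.End Kqt D.stableSpace} (hρ : D.IsBAction ρ)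
    {x : BFree} {k l : ℕ} (hx : BRel (x * be k) x) (h : l ≠ k) (d : ℕ) (v : D.stableL l d) :
    ρ (bMk x) (D.stableOf l d v) = 0 := by
  rw [← bMk_rel hx, map_mul, map_mul, Module.End.mul_apply, hρ.e_ne k l d v h.symm, map_zero]

theorem eq_bAct {ρ : Bqt →ₐ[Kqt] Module.End Kqt D.stableSpace} (hρ : D.IsBAction ρ) :
    ρ = hD.bAct := by
  refine RingQuot.ringQuot_ext' (S := Kqt) _ _ (FreeAlgebra.hom_ext (funext fun g => ?_))
  change ρ (bMk (FreeAlgebra.ι Kqt g)) = hD.bAct (bMk (FreeAlgebra.ι Kqt g))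
  rw [bAct_bMk]
  refine stableSpace_ext fun l d v => ?_
  rw [FreeAlgebra.lift_ι_apply]
  cases g with
  | e k =>
    obtain rfl | h := eq_or_ne l k
    · exact (hρ.e_self l d v).trans (hD.genAct_e_self l d v).symm
    · exact (hρ.e_ne k l d v h.symm).trans (hD.genAct_e_ne h d v).symm
  | dp k =>
    obtain rfl | h := eq_or_ne l k
    · obtain ⟨w, hw, e⟩ := hρ.dp l d v
      refine e.trans (Eq.trans ?_ (hD.genAct_dp_self l d v).symm)
      exact congrArg _ (stableL_ext fun n => (hw n).trans (hD.stablePlus_val v n).symm)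
    · exact (eq_zero_of_mul_be hρ (BRel.dp_right k) h d v).trans (hD.genAct_dp_ne h d v).symm
  | dm k =>
    obtain rfl | h := eq_or_ne l (k + 1)
    · obtain ⟨w, hw, e⟩ := hρ.dm k d v
      refine e.trans (Eq.trans ?_ (hD.genAct_dm_self k d v).symm)
      exact congrArg _ (stableL_ext fun n => (hw n).trans (hD.stableMinus_val v n).symm)
    · exact (eq_zero_of_mul_be hρ (BRel.dm_right k) h d v).trans (hD.genAct_dm_ne h d v).symm
  | T k i =>
    obtain rfl | h := eq_or_ne l k
    · by_cases hi : 1 ≤ i ∧ i < l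
      · obtain ⟨w, hw, e⟩ := hρ.T l d v i hi.1 hi.2
        refine e.trans (Eq.trans ?_ (hD.genAct_T_self l i d v).symm)
        exact congrArg _ (stableL_ext fun n => (hw n).trans (hD.stableT_val hi.1 hi.2 v n).symm)
      · have e1 := bMk_rel (BRel.T_out l i hi)
        have e2 := hD.genAct_rel (BRel.T_out l i hi)
        rw [lift_bT] at e2
        change ρ (bMk (bT l i)) _ = _
        rw [e1, e2, map_zero, map_zero, map_zero]
    · exact (eq_zero_of_mul_be hρ (BRel.T_right k i) h d v).trans (hD.genAct_T_ne h i d v).symm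
  | z k i =>
    obtain rfl | h := eq_or_ne l k
    · by_cases hi : 1 ≤ i ∧ i ≤ l
      · obtain ⟨w, hw, e⟩ := hρ.z l d v i hi.1 hi.2
        refine e.trans (Eq.trans ?_ (hD.genAct_z_self l i d v).symm)
        exact congrArg _ (stableL_ext fun n => (hw n).trans (hD.stableZ_val hi.1 hi.2 v n).symm)
      · have e1 := bMk_rel (BRel.z_out l i hi)
        have e2 := hD.genAct_rel (BRel.z_out l i hi)
        rw [lift_bz] at e2
        change ρ (bMk (bz l i)) _ = _
        rw [e1, e2, map_zero, map_zero, map_zero]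
    · exact (eq_zero_of_mul_be hρ (BRel.z_right k i) h d v).trans (hD.genAct_z_ne h i d v).symm

theorem existsUnique_isBAction (hD : D.IsCompatible) : ∃! ρ, D.IsBAction ρ :=
  ⟨hD.bAct, hD.isBAction_bAct, fun _ hρ => hD.eq_bAct hρ⟩

end IsCompatible

end DAHASequence

/-! ### The presentation of `𝒟_n⁺` with generators `T_i`, `X_i`, `π` -/

section Presentation

variable {R : Type*} [Ring R] [Algebra Kqt R]

/-- Elements `T_1, …, T_{n-1}`, `X_1, …, X_n`, `π` that satisfy the defining relations of `𝒟_n⁺`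
with respect to these generators. -/
structure DoubleAffineRelations (n : ℕ) (T X : ℕ → R) (P : R) : Prop where
  hecke : HeckeRelations n T
  T_X_succ : ∀ i, 1 ≤ i → i < n → T i * X (i + 1) = X i * T i - (1 - q) • X i
  T_X : ∀ i j, 1 ≤ i → i < n → 1 ≤ j → j ≤ n → j ≠ i → j ≠ i + 1 → Commute (T i) (X j)
  T_X_self : ∀ i, 1 ≤ i → i < n → T i * X i = X (i + 1) * T i + (1 - q) • X i
  X_X : ∀ i j, 1 ≤ i → i ≤ n → 1 ≤ j → j ≤ n → Commute (X i) (X j)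
  pi_T : ∀ i, 1 ≤ i → i + 1 < n → P * T i = T (i + 1) * P
  pi_pi_T : 2 ≤ n → P * P * T (n - 1) = T 1 * (P * P)
  pi_X : ∀ i, 1 ≤ i → i < n → P * X i = X (i + 1) * P
  pi_X_last : 1 ≤ n → P * X n = t • (X 1 * P)

/-- The elements `Y_i`, expressed by `T_1, …, T_{n-1}` and `π`. -/
def yElem (n : ℕ) (T : ℕ → R) (P : R) : ℕ → R
  | 0 => 0
  | 1 => q ^ n • (P * prodDown (fun i => heckeInv (T i)) 1 (n - 1))
  | i + 2 => q⁻¹ • (T (i + 1) * yElem n T P (i + 1) * T (i + 1))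

theorem yElem_succ {n : ℕ} {T : ℕ → R} {P : R} {i : ℕ} (h : 1 ≤ i) :
    yElem n T P (i + 1) = q⁻¹ • (T i * yElem n T P i * T i) := by
  obtain ⟨m, rfl⟩ : ∃ m, i = m + 1 := ⟨i - 1, by omega⟩
  rfl

namespace DoubleAffineRelations

variable {n : ℕ} {T X : ℕ → R} {P : R}

theorem T_yElem_T {i : ℕ} (h1 : 1 ≤ i) :
    T i * yElem n T P i * T i = q • yElem n T P (i + 1) := by
  rw [yElem_succ h1, smul_smul, mul_inv_cancel₀ q_ne_zero, one_smul]

/-- Passing π lowers the index of T_i by one and passing T_{n-1}⁻¹⋯T_1⁻¹ raises it again. -/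
theorem commute_T_yElem_one (h : DoubleAffineRelations n T X P) {i : ℕ} (h1 : 2 ≤ i) (h2 : i < n) :
    Commute (T i) (yElem n T P 1) := by
  obtain ⟨j, rfl⟩ : ∃ j, i = j + 1 := ⟨i - 1, by omega⟩
  refine Commute.smul_right ?_ _
  have e1 := h.pi_T j (by omega) h2
  have e2 := h.hecke.mul_prodDown_inv (i := j) (k := 1) (j := n - 1) le_rfl (by omega) (by omega)
    (by omega)
  rw [Commute, SemiconjBy, ← mul_assoc, ← e1, mul_assoc, e2, mul_assoc]

theorem commute_T_yElem_lower (h : DoubleAffineRelations n T X P) {i j : ℕ} (h1 : 1 ≤ j)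
    (h2 : j < i) (h3 : i < n) :
    Commute (T i) (yElem n T P j) := by
  induction j, h1 using Nat.le_induction with
  | base => exact h.commute_T_yElem_one h2 h3
  | succ j hj ih =>
    rw [yElem_succ hj]
    have e := h.hecke.commute i j (by omega) h3 hj (by omega) (Or.inr (by omega))
    exact ((e.mul_right (ih (by omega))).mul_right e).smul_right _

/-- In T_{i+1} T_i Y_i T_i T_{i+1} a braid move turns an incoming T_i into T_{i+1}, which commutes
with Y_i, and a second braid move turns it back. -/
theorem commute_T_yElem_upper (h : DoubleAffineRelations n T X P) {i j : ℕ} (h1 : 1 ≤ i)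
    (h2 : i + 2 ≤ j) (h3 : j ≤ n) :
    Commute (T i) (yElem n T P j) := by
  induction j, h2 using Nat.le_induction with
  | base =>
    rw [yElem_succ (by omega), yElem_succ h1, mul_smul_comm, smul_mul_assoc]
    refine Commute.smul_right (Commute.smul_right ?_ _) _
    have b := h.hecke.braid i h1 (by omega)
    have c := (h.commute_T_yElem_lower h1 (Nat.lt_succ_self i) (by omega)).eq
    simp only [Nat.succ_eq_add_one] at c
    set y := yElem n T P i
    calc T i * (T (i + 1) * (T i * y * T i) * T (i + 1))
        = (T i * T (i + 1) * T i) * y * T i * T (i + 1) := by noncomm_ring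
      _ = T (i + 1) * T i * (T (i + 1) * y) * T i * T (i + 1) := by rw [b]; noncomm_ring
      _ = T (i + 1) * T i * y * (T (i + 1) * T i * T (i + 1)) := by rw [c]; noncomm_ring
      _ = _ := by rw [← b]; noncomm_ring
  | succ j hj ih =>
    rw [yElem_succ (by omega)]
    have e := h.hecke.commute i j h1 (by omega) (by omega) (by omega) (Or.inl (by omega))
    exact ((e.mul_right (ih (by omega))).mul_right e).smul_right _

/-- Here π² T_{n-1} = T_1 π² is used. With Q = T_{n-1}⁻¹⋯T_1⁻¹ the claim is that π Q and T_1 π Q T_1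
commute. Let Q1 be Q without its last factor T_1⁻¹ and Q2 be Q without its first factor T_{n-1}⁻¹.
Then Q1 π = π Q2 and Q2 Q = Q Q1, which brings both sides to expressions in π² T_{n-1} and T_1 π².
-/
theorem commute_yElem_one_two (h : DoubleAffineRelations n T X P) (hn : 2 ≤ n) :
    Commute (yElem n T P 1) (yElem n T P 2) := by
  obtain ⟨m, rfl⟩ : ∃ m, n = m + 2 := ⟨n - 2, by omega⟩
  rw [yElem_succ le_rfl, yElem]
  simp only [mul_smul_comm, smul_mul_assoc]
  refine Commute.smul_right (Commute.smul_left (Commute.smul_right ?_ _) _) _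
  set V : ℕ → R := fun i => heckeInv (T i)
  have e0 : prodDown V 1 (m + 2 - 1) = prodDown V 2 m * V 1 := by
    rw [show m + 2 - 1 = m + 1 by omega, prodDown_succ_right]
  have e0' : prodDown V 1 (m + 2 - 1) = V (m + 1) * prodDown V 1 m := by
    rw [show m + 2 - 1 = m + 1 by omega, prodDown, add_comm 1 m]
  have e1 : V 1 * T 1 = 1 := h.hecke.inv_mul le_rfl (by omega)
  have e2 : T (m + 1) * V (m + 1) = 1 := h.hecke.mul_inv (by omega) (by omega)
  have e3 : ∀ j ≤ m, prodDown V 2 j * P = P * prodDown V 1 j := by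
    intro j hj
    induction j with
    | zero => simp [prodDown]
    | succ j ih =>
      have := (SemiconjBy.heckeInv (h.pi_T (1 + j) (by omega) (by omega) : SemiconjBy _ _ _)).eq
      rw [prodDown, prodDown, mul_assoc, ih (by omega), ← mul_assoc, ← mul_assoc,
        show 2 + j = 1 + j + 1 by omega]
      exact congrArg (· * prodDown V 1 j) this.symm
  have e3 := e3 m le_rfl
  have e4 : ∀ j ≤ m, prodDown V 1 j * prodDown V 1 (m + 2 - 1) =
      prodDown V 1 (m + 2 - 1) * prodDown V 2 j := by
    intro j hj
    induction j with
    | zero => simp [prodDown]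
    | succ j ih =>
      have := h.hecke.braidRelations_inv.mul_prodDown (i := 1 + j) (k := 1) (j := m + 2 - 1)
        le_rfl (by omega) (by omega) (by omega)
      change V (1 + j) * prodDown V 1 (m + 2 - 1) = prodDown V 1 (m + 2 - 1) * V (1 + j + 1) at this
      rw [prodDown, mul_assoc, ih (by omega), ← mul_assoc, this, mul_assoc,
        show 1 + j + 1 = 2 + j by omega, prodDown]
  have e4 := e4 m le_rfl
  have e5 := h.pi_pi_T hn
  rw [show m + 2 - 1 = m + 1 by omega] at e5 e0 e0' e4 ⊢
  set Q := prodDown V 1 (m + 1)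
  set Q1 := prodDown V 2 m
  set Q2 := prodDown V 1 m
  have e6 : Q * T 1 = Q1 := by rw [e0, mul_assoc, e1, mul_one]
  have e7 : T (m + 1) * Q = Q2 := by rw [e0', ← mul_assoc, e2, one_mul]
  change P * Q * (T 1 * (P * Q) * T 1) = T 1 * (P * Q) * T 1 * (P * Q)
  calc P * Q * (T 1 * (P * Q) * T 1) = P * ((Q * T 1) * P) * (Q * T 1) := by noncomm_ring
    _ = P * P * Q2 * Q1 := by rw [e6, e3]; noncomm_ring
    _ = P * P * (T (m + 1) * Q * Q1) := by rw [e7]; noncomm_ring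
    _ = (P * P * T (m + 1)) * (Q2 * Q) := by rw [e4]; noncomm_ring
    _ = T 1 * P * (P * Q2) * Q := by rw [e5]; noncomm_ring
    _ = T 1 * P * ((Q * T 1) * P) * Q := by rw [e6, e3]
    _ = _ := by noncomm_ring

/-- Only j = 2 is a genuine case: beyond it Y_{j+1} is Y_j multiplied on both sides by T_j, and T_j
commutes with Y_1. -/
theorem commute_yElem_one (h : DoubleAffineRelations n T X P) {j : ℕ} (h1 : 1 ≤ j) (h2 : j ≤ n) :
    Commute (yElem n T P 1) (yElem n T P j) := by
  induction j, h1 using Nat.le_induction with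
  | base => exact Commute.refl _
  | succ j hj ih =>
    obtain rfl | hj1 := hj.eq_or_lt
    · exact h.commute_yElem_one_two h2
    · rw [yElem_succ hj]
      have e := (h.commute_T_yElem_one hj1 (by omega)).symm
      exact ((e.mul_right (ih (by omega))).mul_right e).smul_right _

theorem commute_yElem_of_le (h : DoubleAffineRelations n T X P) {i j : ℕ} (h1 : 1 ≤ i)
    (h2 : i ≤ j) (h3 : j ≤ n) :
    Commute (yElem n T P i) (yElem n T P j) := by
  induction i, h1 using Nat.le_induction with
  | base => exact h.commute_yElem_one h2 h3
  | succ i hi ih =>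
    obtain rfl | hj := h2.eq_or_lt
    · exact Commute.refl _
    · rw [yElem_succ hi]
      have e := h.commute_T_yElem_upper hi hj h3
      exact ((e.mul_left (ih (by omega))).mul_left e).smul_left _

theorem T_X_T (h : DoubleAffineRelations n T X P) {i : ℕ} (h1 : 1 ≤ i) (h2 : i < n) :
    T i * X (i + 1) * T i = q • X i := by
  rw [h.T_X_succ i h1 h2, sub_mul, mul_assoc, h.hecke.mul_self h1 h2, mul_add, mul_smul_comm,
    mul_smul_comm, mul_one, smul_mul_assoc]
  abel

theorem commute_T_prodUpTo_X (h : DoubleAffineRelations n T X P) {i : ℕ} (h1 : 1 ≤ i) (h2 : i < n) :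
    Commute (T i) (prodUpTo X n) := by
  have key : ∀ k ≤ n, i ≠ k → Commute (T i) (prodUpTo X k) := by
    intro k hk
    induction k using Nat.strong_induction_on with
    | _ k ih =>
      intro hik
      rcases k with _ | k
      · exact Commute.one_right _
      by_cases hk1 : i = k
      · subst hk1
        obtain ⟨m, rfl⟩ : ∃ m, i = m + 1 := ⟨i - 1, by omega⟩
        rw [prodUpTo, prodUpTo, mul_assoc]
        refine (ih m (by omega) (by omega) (by omega)).mul_right ?_
        have e := (h.X_X (m + 1) (m + 1 + 1) h1 h2.le (by omega) h2).eq
        rw [Commute, SemiconjBy, ← mul_assoc, h.T_X_self _ h1 h2, add_mul, mul_assoc,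
          h.T_X_succ _ h1 h2, mul_sub, ← mul_assoc, ← e, smul_mul_assoc, mul_smul_comm, e]
        abel
      · rw [prodUpTo]
        exact (ih k (by omega) (by omega) hk1).mul_right
          (h.T_X i (k + 1) h1 h2 (by omega) hk (Ne.symm hik) (by omega))
  exact key n le_rfl h2.ne

theorem pi_mul_prodUpTo_X (h : DoubleAffineRelations n T X P) (hn : 1 ≤ n) :
    P * prodUpTo X n = t • (prodUpTo X n * P) := by
  obtain ⟨m, rfl⟩ : ∃ m, n = m + 1 := ⟨n - 1, by omega⟩
  have e1 : ∀ k ≤ m, P * prodUpTo X k = prodUpTo (fun i => X (i + 1)) k * P := by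
    intro k hk
    induction k with
    | zero => simp [prodUpTo]
    | succ k ih =>
      rw [prodUpTo, ← mul_assoc, ih (by omega), mul_assoc, h.pi_X _ (by omega) (by omega),
        ← mul_assoc]
      rfl
  have e2 : Commute (X 1) (prodUpTo (fun i => X (i + 1)) m) :=
    commute_prodUpTo m fun i h1 h2 => h.X_X _ _ le_rfl (by omega) (by omega) (by omega)
  conv_lhs => rw [prodUpTo, ← mul_assoc, e1 m le_rfl, mul_assoc, h.pi_X_last hn]
  rw [prodUpTo_succ_left, e2.eq, mul_smul_comm, mul_assoc]

/-- The values of the generators of `𝒟_n⁺`. -/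
def gen (n : ℕ) (T X : ℕ → R) (P : R) : DGen → R
  | DGen.T i => if 1 ≤ i ∧ i < n then T i else 0
  | DGen.X i => if 1 ≤ i ∧ i ≤ n then X i else 0
  | DGen.Y i => if 1 ≤ i ∧ i ≤ n then yElem n T P i else 0

theorem lift_fT (n i : ℕ) (T X : ℕ → R) (P : R) :
    FreeAlgebra.lift Kqt (gen n T X P) (fT i) = if 1 ≤ i ∧ i < n then T i else 0 :=
  FreeAlgebra.lift_ι_apply _ _

theorem lift_fX (n i : ℕ) (T X : ℕ → R) (P : R) :
    FreeAlgebra.lift Kqt (gen n T X P) (fX i) = if 1 ≤ i ∧ i ≤ n then X i else 0 :=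
  FreeAlgebra.lift_ι_apply _ _

theorem lift_fY (n i : ℕ) (T X : ℕ → R) (P : R) :
    FreeAlgebra.lift Kqt (gen n T X P) (fY i) = if 1 ≤ i ∧ i ≤ n then yElem n T P i else 0 :=
  FreeAlgebra.lift_ι_apply _ _

theorem lift_prodUpTo_fX (n : ℕ) (T X : ℕ → R) (P : R) :
    FreeAlgebra.lift Kqt (gen n T X P) (prodUpTo fX n) = prodUpTo X n := by
  rw [map_prodUpTo]
  exact prodUpTo_congr n fun i h1 h2 => by rw [lift_fX, if_pos ⟨h1, h2⟩]

theorem lift_prodUpTo_fT (n : ℕ) (T X : ℕ → R) (P : R) :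
    FreeAlgebra.lift Kqt (gen n T X P) (prodUpTo fT (n - 1)) = prodUpTo T (n - 1) := by
  rw [map_prodUpTo]
  exact prodUpTo_congr _ fun i h1 h2 => by rw [lift_fT, if_pos ⟨h1, by omega⟩]

theorem yElem_one_mul_prodUpTo_T (h : DoubleAffineRelations n T X P) :
    yElem n T P 1 * prodUpTo T (n - 1) = q ^ n • P := by
  rw [yElem, smul_mul_assoc, mul_assoc, prodDown_mul_prodUpTo (n - 1) fun i h1 h2 =>
    h.hecke.inv_mul h1 (by omega), mul_one]

theorem gen_rel (h : DoubleAffineRelations n T X P) {x y : DFree} (hxy : DRel n x y) :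
    FreeAlgebra.lift Kqt (gen n T X P) x = FreeAlgebra.lift Kqt (gen n T X P) y := by
  cases hxy with
  | T_out i hi => rw [lift_fT, if_neg hi, map_zero]
  | X_out i hi => rw [lift_fX, if_neg hi, map_zero]
  | Y_out i hi => rw [lift_fY, if_neg hi, map_zero]
  | quad i h1 h2 =>
    rw [map_mul, map_sub, map_add, lift_fT, if_pos ⟨h1, h2⟩, map_one, map_zero, AlgHom.commutes]
    exact h.hecke.quad i h1 h2
  | braid i h1 h2 =>
    simp only [map_mul]
    rw [lift_fT, lift_fT, if_pos ⟨h1, by omega⟩, if_pos ⟨by omega, h2⟩]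
    exact h.hecke.braid i h1 h2
  | T_T i j h1 h2 h3 =>
    simp only [map_mul]
    rw [lift_fT, lift_fT, if_pos ⟨h1, by omega⟩, if_pos ⟨by omega, h3⟩]
    exact h.hecke.comm i j h1 h2 h3
  | T_X_T i h1 h2 =>
    simp only [map_mul, map_smul]
    rw [lift_fT, lift_fX, lift_fX, if_pos ⟨h1, h2⟩, if_pos ⟨by omega, h2⟩, if_pos ⟨h1, h2.le⟩]
    exact h.T_X_T h1 h2
  | T_X i j h1 h2 h3 h4 h5 h6 =>
    simp only [map_mul]
    rw [lift_fT, lift_fX, if_pos ⟨h1, h2⟩, if_pos ⟨h3, h4⟩]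
    exact h.T_X i j h1 h2 h3 h4 h5 h6
  | X_X i j h1 h2 h3 h4 =>
    simp only [map_mul]
    rw [lift_fX, lift_fX, if_pos ⟨h1, h2⟩, if_pos ⟨h3, h4⟩]
    exact h.X_X i j h1 h2 h3 h4
  | T_Y_T i h1 h2 =>
    simp only [map_mul, map_smul]
    rw [lift_fT, lift_fY, lift_fY, if_pos ⟨h1, h2⟩, if_pos ⟨h1, h2.le⟩, if_pos ⟨by omega, h2⟩]
    exact T_yElem_T h1
  | T_Y i j h1 h2 h3 h4 h5 h6 =>
    simp only [map_mul]
    rw [lift_fT, lift_fY, if_pos ⟨h1, h2⟩, if_pos ⟨h3, h4⟩]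
    rcases Nat.lt_or_gt_of_ne h5 with h7 | h7
    · exact h.commute_T_yElem_lower h3 h7 h2
    · exact h.commute_T_yElem_upper h1 (by omega) h4
  | Y_Y i j h1 h2 h3 h4 =>
    simp only [map_mul]
    rw [lift_fY, lift_fY, if_pos ⟨h1, h2⟩, if_pos ⟨h3, h4⟩]
    rcases Nat.le_total i j with h5 | h5
    · exact h.commute_yElem_of_le h1 h5 h4
    · exact (h.commute_yElem_of_le h3 h5 h2).symm
  | Y_T_X hn =>
    simp only [map_mul]
    rw [lift_fT, lift_fY, lift_fX, lift_fX, if_pos ⟨le_rfl, by omega⟩, if_pos ⟨le_rfl, by omega⟩,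
      if_pos ⟨le_rfl, by omega⟩, if_pos ⟨by omega, hn⟩]
    obtain ⟨m, rfl⟩ : ∃ m, n = m + 2 := ⟨n - 2, by omega⟩
    -- In Y_1 T_1 the factor T_1⁻¹ disappears. The remaining T_i⁻¹ have i ≥ 2 and commute with X_1,
    -- so π alone moves X_1 to X_2.
    have e1 : yElem (m + 2) T P 1 * T 1 =
        q ^ (m + 2) • (P * prodDown (fun i => heckeInv (T i)) 2 m) := by
      rw [yElem, show m + 2 - 1 = m + 1 by omega, prodDown_succ_right, smul_mul_assoc, mul_assoc,
        mul_assoc, h.hecke.inv_mul le_rfl (by omega), mul_one]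
    have e2 : Commute (X 1) (prodDown (fun i => heckeInv (T i)) 2 m) :=
      commute_prodDown 2 m fun i h1 h2 => commute_heckeInv
        (h.T_X i 1 (by omega) (by omega) le_rfl (by omega) (by omega) (by omega)).symm
    rw [e1, mul_assoc, e1, smul_mul_assoc, mul_assoc, ← e2.eq, ← mul_assoc,
      h.pi_X 1 le_rfl (by omega), mul_smul_comm, mul_assoc]
  | Y_X hn =>
    simp only [map_mul, map_smul]
    rw [lift_prodUpTo_fX, lift_fY, if_pos ⟨le_rfl, hn⟩]
    have e : Commute (prodUpTo X n) (prodDown (fun i => heckeInv (T i)) 1 (n - 1)) :=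
      commute_prodDown _ _ fun i h1 h2 => commute_heckeInv
        (h.commute_T_prodUpTo_X h1 (by omega)).symm
    rw [yElem, smul_mul_assoc, mul_assoc, ← e.eq, ← mul_assoc, h.pi_mul_prodUpTo_X hn,
      mul_smul_comm, smul_mul_assoc, smul_comm, mul_assoc]
  | pi_X hn =>
    simp only [map_mul, map_smul]
    rw [lift_prodUpTo_fT, lift_fX, lift_fX, lift_fY, if_pos ⟨le_rfl, hn⟩, if_pos ⟨hn, le_rfl⟩,
      if_pos ⟨le_rfl, hn⟩, h.yElem_one_mul_prodUpTo_T, smul_mul_assoc, h.pi_X_last hn,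
      mul_smul_comm, smul_comm]

/-- The homomorphism from `𝒟_n⁺` given by elements that satisfy the relations. -/
def hom (h : DoubleAffineRelations n T X P) : DAHA n →ₐ[Kqt] R :=
  RingQuot.liftAlgHom Kqt ⟨FreeAlgebra.lift Kqt (gen n T X P), fun _ _ hxy => h.gen_rel hxy⟩

theorem hom_dMk (h : DoubleAffineRelations n T X P) (x : DFree) : h.hom
    (dMk n x) = FreeAlgebra.lift Kqt (gen n T X P) x :=
  RingQuot.liftAlgHom_mkAlgHom_apply Kqt _ (fun _ _ hxy => h.gen_rel hxy) x

theorem hom_dT (h : DoubleAffineRelations n T X P) {i : ℕ} (h1 : 1 ≤ i) (h2 : i < n) :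
    h.hom (dT n i) = T i := by
  rw [dT, hom_dMk, lift_fT, if_pos ⟨h1, h2⟩]

theorem hom_dX (h : DoubleAffineRelations n T X P) {i : ℕ} (h1 : 1 ≤ i) (h2 : i ≤ n) :
    h.hom (dX n i) = X i := by
  rw [dX, hom_dMk, lift_fX, if_pos ⟨h1, h2⟩]

theorem hom_dPi (h : DoubleAffineRelations n T X P) (hn : 1 ≤ n) : h.hom (dPi n) = P := by
  have e1 : h.hom (dY n 1) = yElem n T P 1 := by rw [dY, hom_dMk, lift_fY, if_pos ⟨le_rfl, hn⟩]
  have e2 : prodUpTo (fun i => h.hom (dT n i)) (n - 1) = prodUpTo T (n - 1) :=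
    prodUpTo_congr _ fun i h1 h2 => h.hom_dT h1 (by omega)
  rw [dPi, map_smul, map_mul, map_prodUpTo, e1, e2, h.yElem_one_mul_prodUpTo_T, smul_smul, ← mul_pow,
    inv_mul_cancel₀ q_ne_zero, one_pow, one_smul]

end DoubleAffineRelations

end Presentation

/-! ### Divided differences -/

section DividedDifference

variable {K : Type*} [Field K]

/-- The polynomial ring in `X_0, X_1, …`. -/
abbrev Poly (K : Type*) [Field K] : Type _ := MvPolynomial ℕ K

/-- The algebra automorphism that exchanges `X_i` and `X_{i+1}`. -/
def swapVars (i : ℕ) : Poly K →ₐ[K] Poly K := MvPolynomial.rename (Equiv.swap i (i + 1))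

theorem swapVars_X_self (i : ℕ) :
    swapVars i (MvPolynomial.X i : Poly K) = MvPolynomial.X (i + 1) := by
  rw [swapVars, MvPolynomial.rename_X, Equiv.swap_apply_left]

theorem swapVars_X_succ (i : ℕ) :
    swapVars i (MvPolynomial.X (i + 1) : Poly K) = MvPolynomial.X i := by
  rw [swapVars, MvPolynomial.rename_X, Equiv.swap_apply_right]

theorem swapVars_X_of_ne {i j : ℕ} (h1 : j ≠ i) (h2 : j ≠ i + 1) :
    swapVars i (MvPolynomial.X j : Poly K) = MvPolynomial.X j := by
  rw [swapVars, MvPolynomial.rename_X, Equiv.swap_apply_of_ne_of_ne h1 h2]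

/-- The map f ↦ f - s_i f is a twisted derivation, so divisibility need only be seen on the
variables. -/
theorem X_sub_X_dvd (i : ℕ) (f : Poly K) :
    (MvPolynomial.X i - MvPolynomial.X (i + 1) : Poly K) ∣ f - swapVars i f := by
  induction f using MvPolynomial.induction_on with
  | C a => rw [swapVars, MvPolynomial.rename_C, sub_self]; exact dvd_zero _
  | add f g hf hg =>
    rw [map_add, add_sub_add_comm]
    exact dvd_add hf hg
  | mul_X f j hf =>
    have e : f * MvPolynomial.X j - swapVars i (f * MvPolynomial.X j) =
        (f - swapVars i f) * MvPolynomial.X j +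
          swapVars i f * (MvPolynomial.X j - swapVars i (MvPolynomial.X j)) := by
      rw [map_mul]; ring
    rw [e]
    refine dvd_add (hf.mul_right _) (Dvd.dvd.mul_left ?_ _)
    by_cases h1 : j = i
    · rw [h1, swapVars_X_self]
    by_cases h2 : j = i + 1
    · rw [h2, swapVars_X_succ, ← neg_sub]
      exact neg_dvd.mpr dvd_rfl
    · rw [swapVars_X_of_ne h1 h2, sub_self]
      exact dvd_zero _

theorem X_sub_X_ne_zero (i : ℕ) : (MvPolynomial.X i - MvPolynomial.X (i + 1) : Poly K) ≠ 0 :=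
  sub_ne_zero.mpr fun h => by
    have := MvPolynomial.X_injective (R := K) h
    omega

/-- The divided difference `(f - s_i f) / (X_i - X_{i+1})`. -/
def divDiff (i : ℕ) : Poly K →ₗ[K] Poly K where
  -- The chosen quotient is unique because the polynomial ring is a domain, and linearity follows by
  -- cancelling X_i - X_{i+1}.
  toFun f := (X_sub_X_dvd i f).choose
  map_add' f g := by
    refine mul_left_cancel₀ (X_sub_X_ne_zero i) ?_
    rw [mul_add, ← (X_sub_X_dvd i f).choose_spec, ← (X_sub_X_dvd i g).choose_spec,
      ← (X_sub_X_dvd i (f + g)).choose_spec, map_add]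
    ring
  map_smul' c f := by
    refine mul_left_cancel₀ (X_sub_X_ne_zero i) ?_
    rw [RingHom.id_apply, mul_smul_comm, ← (X_sub_X_dvd i f).choose_spec,
      ← (X_sub_X_dvd i (c • f)).choose_spec, map_smul, smul_sub]

theorem mul_divDiff (i : ℕ) (f : Poly K) :
    (MvPolynomial.X i - MvPolynomial.X (i + 1)) * divDiff i f = f - swapVars i f :=
  (X_sub_X_dvd i f).choose_spec.symm

theorem divDiff_eq {i : ℕ} {f g : Poly K}
    (h : (MvPolynomial.X i - MvPolynomial.X (i + 1)) * g = f - swapVars i f) :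
    divDiff i f = g :=
  mul_left_cancel₀ (X_sub_X_ne_zero i) ((mul_divDiff i f).trans h.symm)

theorem divDiff_one (i : ℕ) : divDiff i (1 : Poly K) = 0 :=
  divDiff_eq (by rw [map_one, sub_self, mul_zero])

theorem divDiff_X_self_mul (i : ℕ) (f : Poly K) :
    divDiff i (MvPolynomial.X i * f) = MvPolynomial.X (i + 1) * divDiff i f + f :=
  divDiff_eq (by
    rw [map_mul, swapVars_X_self]
    linear_combination MvPolynomial.X (i + 1) * mul_divDiff i f)

theorem divDiff_X_succ_mul (i : ℕ) (f : Poly K) :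
    divDiff i (MvPolynomial.X (i + 1) * f) = MvPolynomial.X i * divDiff i f - f :=
  divDiff_eq (by
    rw [map_mul, swapVars_X_succ]
    linear_combination MvPolynomial.X i * mul_divDiff i f)

theorem divDiff_X_mul_of_ne {i j : ℕ} (h1 : j ≠ i) (h2 : j ≠ i + 1) (f : Poly K) :
    divDiff i (MvPolynomial.X j * f) = MvPolynomial.X j * divDiff i f :=
  divDiff_eq (by
    rw [map_mul, swapVars_X_of_ne h1 h2]
    linear_combination MvPolynomial.X j * mul_divDiff i f)

/-- The cyclic substitution `X_i ↦ X_{i+1}` for `1 ≤ i < n`, `X_n ↦ t X_1`. -/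
def cycleVars (t : K) (n : ℕ) : Poly K →ₐ[K] Poly K :=
  MvPolynomial.aeval fun i =>
    if 1 ≤ i ∧ i < n then MvPolynomial.X (i + 1)
    else if i = n then t • MvPolynomial.X 1 else MvPolynomial.X i

theorem cycleVars_X (t : K) {n i : ℕ} (h1 : 1 ≤ i) (h2 : i < n) :
    cycleVars t n (MvPolynomial.X i) = MvPolynomial.X (i + 1) := by
  rw [cycleVars, MvPolynomial.aeval_X, if_pos ⟨h1, h2⟩]

theorem cycleVars_X_last (t : K) (n : ℕ) :
    cycleVars t n (MvPolynomial.X n) = t • MvPolynomial.X 1 := by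
  rw [cycleVars, MvPolynomial.aeval_X, if_neg (by omega), if_pos rfl]

theorem cycleVars_X_out (t : K) {n i : ℕ} (h : ¬ (1 ≤ i ∧ i ≤ n)) (hn : 1 ≤ n) :
    cycleVars t n (MvPolynomial.X i) = MvPolynomial.X i := by
  rw [cycleVars, MvPolynomial.aeval_X, if_neg (by omega), if_neg (by omega)]

end DividedDifference

/-! ### The polynomial model of the induced module -/

section Model

variable {K : Type*} [Field K]
variable {U : Type*} [AddCommGroup U] [Module K U]

/-- Multiplication by `X_j`. -/
def modelX (K : Type*) [Field K] (U : Type*) [AddCommGroup U] [Module K U] (j : ℕ) : Module.End K (Poly K ⊗[K] U) :=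
  TensorProduct.map (LinearMap.mulLeft K (MvPolynomial.X j)) LinearMap.id

/-- The Demazure–Lusztig operator `T_i`, for an operator `A` on the space of coefficients. -/
def modelT (q : K) (i : ℕ) (A : Module.End K U) : Module.End K (Poly K ⊗[K] U) :=
  TensorProduct.map (swapVars i).toLinearMap A +
    (1 - q) • (modelX K U i * TensorProduct.map (divDiff i) LinearMap.id)

/-- The operator `π`, for an operator `A` on the space of coefficients. -/
def modelPi (t : K) (n : ℕ) (A : Module.End K U) : Module.End K (Poly K ⊗[K] U) :=
  TensorProduct.map (cycleVars t n).toLinearMap A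

theorem modelX_tmul (j : ℕ) (f : Poly K) (u : U) :
    modelX K U j (f ⊗ₜ u) = (MvPolynomial.X j * f) ⊗ₜ u := rfl

theorem modelT_tmul (q : K) (i : ℕ) (A : Module.End K U) (f : Poly K) (u : U) :
    modelT q i A (f ⊗ₜ u) = swapVars i f ⊗ₜ A u +
      (1 - q) • ((MvPolynomial.X i * divDiff i f) ⊗ₜ u) := rfl

theorem modelPi_tmul (t : K) (n : ℕ) (A : Module.End K U) (f : Poly K) (u : U) :
    modelPi t n A (f ⊗ₜ u) = cycleVars t n f ⊗ₜ A u := rfl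

theorem modelT_one (q : K) (i : ℕ) (A : Module.End K U) (u : U) :
    modelT q i A (1 ⊗ₜ u) = 1 ⊗ₜ A u := by
  rw [modelT_tmul, divDiff_one, mul_zero, TensorProduct.zero_tmul, smul_zero, add_zero, map_one]

theorem modelPi_one (t : K) (n : ℕ) (A : Module.End K U) (u : U) :
    modelPi t n A (1 ⊗ₜ u) = 1 ⊗ₜ A u := by rw [modelPi_tmul, map_one]

theorem modelX_comm (i j : ℕ) (w : Poly K ⊗[K] U) :
    modelX K U i (modelX K U j w) = modelX K U j (modelX K U i w) := by
  induction w with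
  | zero => simp only [map_zero]
  | add w₁ w₂ h₁ h₂ => simp only [map_add, h₁, h₂]
  | tmul f u => simp only [modelX_tmul, mul_left_comm]

/-- The twisted Leibniz rule for divided differences becomes a Bernstein relation. The operator A on
coefficients is arbitrary, so these relations do not depend on the module U. -/
theorem modelT_modelX_self (q : K) (i : ℕ) (A : Module.End K U) (w : Poly K ⊗[K] U) :
    modelT q i A (modelX K U i w) = modelX K U (i + 1) (modelT q i A w) + (1 - q) • modelX K U i w := by
  induction w with
  | zero => simp only [map_zero, smul_zero, add_zero]
  | add w₁ w₂ h₁ h₂ => simp only [map_add, h₁, h₂, smul_add]; abel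
  | tmul f u =>
    simp only [modelX_tmul, modelT_tmul, map_add, map_smul, map_mul, swapVars_X_self,
      divDiff_X_self_mul, mul_add, TensorProduct.add_tmul, smul_add, ← add_assoc,
      mul_left_comm (MvPolynomial.X i)]

theorem modelT_modelX_succ (q : K) (i : ℕ) (A : Module.End K U) (w : Poly K ⊗[K] U) :
    modelT q i A (modelX K U (i + 1) w) = modelX K U i (modelT q i A w) - (1 - q) • modelX K U i w := by
  induction w with
  | zero => simp only [map_zero, smul_zero, sub_self]
  | add w₁ w₂ h₁ h₂ => simp only [map_add, h₁, h₂, smul_add]; abel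
  | tmul f u =>
    simp only [modelX_tmul, modelT_tmul, map_add, map_smul, map_mul, swapVars_X_succ,
      divDiff_X_succ_mul, mul_sub, TensorProduct.sub_tmul, smul_sub, ← add_sub_assoc]

theorem modelT_modelX_of_ne (q : K) {i j : ℕ} (h1 : j ≠ i) (h2 : j ≠ i + 1) (A : Module.End K U)
    (w : Poly K ⊗[K] U) : modelT q i A (modelX K U j w) = modelX K U j (modelT q i A w) := by
  induction w with
  | zero => simp only [map_zero]
  | add w₁ w₂ h₁ h₂ => simp only [map_add, h₁, h₂]
  | tmul f u =>
    simp only [modelX_tmul, modelT_tmul, map_add, map_smul, map_mul, swapVars_X_of_ne h1 h2,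
      divDiff_X_mul_of_ne h1 h2, mul_left_comm (MvPolynomial.X i)]

theorem modelPi_modelX (t : K) {n i : ℕ} (h1 : 1 ≤ i) (h2 : i < n) (A : Module.End K U)
    (w : Poly K ⊗[K] U) : modelPi t n A (modelX K U i w) = modelX K U (i + 1) (modelPi t n A w) := by
  induction w with
  | zero => simp only [map_zero]
  | add w₁ w₂ h₁ h₂ => simp only [map_add, h₁, h₂]
  | tmul f u => simp only [modelX_tmul, modelPi_tmul, map_mul, cycleVars_X t h1 h2]

theorem modelPi_modelX_last (t : K) (n : ℕ) (A : Module.End K U) (w : Poly K ⊗[K] U) :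
    modelPi t n A (modelX K U n w) = t • modelX K U 1 (modelPi t n A w) := by
  induction w with
  | zero => simp only [map_zero, smul_zero]
  | add w₁ w₂ h₁ h₂ => simp only [map_add, h₁, h₂, smul_add]
  | tmul f u =>
    simp only [modelX_tmul, modelPi_tmul, map_mul, cycleVars_X_last, smul_mul_assoc,
      TensorProduct.smul_tmul']

theorem modelPi_modelX_out (t : K) {n i : ℕ} (h : ¬ (1 ≤ i ∧ i ≤ n)) (hn : 1 ≤ n)
    (A : Module.End K U)
    (w : Poly K ⊗[K] U) : modelPi t n A (modelX K U i w) = modelX K U i (modelPi t n A w) := by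
  induction w with
  | zero => simp only [map_zero]
  | add w₁ w₂ h₁ h₂ => simp only [map_add, h₁, h₂]
  | tmul f u => simp only [modelX_tmul, modelPi_tmul, map_mul, cycleVars_X_out t h hn]

theorem model_induction {N : Submodule K (Poly K ⊗[K] U)} (h1 : ∀ u : U, 1 ⊗ₜ u ∈ N)
    (hX : ∀ j, ∀ w ∈ N, modelX K U j w ∈ N) (w : Poly K ⊗[K] U) : w ∈ N := by
  induction w with
  | zero => exact N.zero_mem
  | add w₁ w₂ h₁ h₂ => exact N.add_mem h₁ h₂
  | tmul f u =>
    induction f using MvPolynomial.induction_on with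
    | C a =>
      rw [← mul_one (MvPolynomial.C a), ← MvPolynomial.smul_eq_C_mul, TensorProduct.smul_tmul]
      exact h1 _
    | add f g hf hg => rw [TensorProduct.add_tmul]; exact N.add_mem hf hg
    | mul_X f j hf => rw [mul_comm]; exact hX j _ hf

/-- All relations among the model operators are proved this way: on 1 ⊗ U they are relations of the
coefficient operators, and the Bernstein relations carry them from w to X_j w. In particular no
braid relation for divided differences has to be computed. -/
theorem model_hom_ext {A B : Module.End K (Poly K ⊗[K] U)}
    (h1 : ∀ u : U, A (1 ⊗ₜ u) = B (1 ⊗ₜ u))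
    (hX : ∀ j w, A w = B w → A (modelX K U j w) = B (modelX K U j w)) : A = B :=
  LinearMap.ext fun w => model_induction (N := LinearMap.eqLocus A B) h1 hX w

variable {q t : K} {n i j : ℕ} {A B P : Module.End K U}

theorem modelT_quad (hA : A * A = (1 - q) • A + q • (1 : Module.End K U)) (i : ℕ) :
    modelT q i A * modelT q i A =
      (1 - q) • modelT q i A + q • (1 : Module.End K (Poly K ⊗[K] U)) := by
  refine model_hom_ext (fun u => ?_) fun j w hw => ?_
  · have := congrArg (fun A : Module.End K U => (1 : Poly K) ⊗ₜ[K] A u) hA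
    simp only [Module.End.mul_apply, LinearMap.add_apply, LinearMap.smul_apply,
      Module.End.one_apply, TensorProduct.tmul_add, TensorProduct.tmul_smul] at this
    simpa only [Module.End.mul_apply, LinearMap.add_apply, LinearMap.smul_apply,
      Module.End.one_apply, modelT_one] using this
  · simp only [Module.End.mul_apply, LinearMap.add_apply, LinearMap.smul_apply,
      Module.End.one_apply] at hw ⊢
    by_cases e1 : j = i
    · subst e1
      have := congrArg (modelX K U j) hw
      simp only [map_add, map_smul] at this
      simp only [modelT_modelX_self, modelT_modelX_succ, map_add, map_smul]
      linear_combination (norm := module) this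
    by_cases e2 : j = i + 1
    · subst e2
      have := congrArg (modelX K U (i + 1)) hw
      simp only [map_add, map_smul] at this
      simp only [modelT_modelX_self, modelT_modelX_succ, map_sub, map_smul]
      linear_combination (norm := module) this
    · simp only [modelT_modelX_of_ne _ e1 e2, hw, map_add, map_smul]

theorem modelT_braid (hA : A * A = (1 - q) • A + q • (1 : Module.End K U))
    (hB : B * B = (1 - q) • B + q • (1 : Module.End K U)) (h : A * B * A = B * A * B) (i : ℕ) :
    modelT q i A * modelT q (i + 1) B * modelT q i A =
      modelT q (i + 1) B * modelT q i A * modelT q (i + 1) B := by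
  refine model_hom_ext (fun u => ?_) fun j w hw => ?_
  · have := congrArg (fun A : Module.End K U => (1 : Poly K) ⊗ₜ[K] A u) h
    simpa only [Module.End.mul_apply, modelT_one] using this
  · have qa : ∀ w, modelT q i A (modelT q i A w) = (1 - q) • modelT q i A w + q • w :=
      fun w => LinearMap.congr_fun (modelT_quad hA i) w
    have qb : ∀ w, modelT q (i + 1) B (modelT q (i + 1) B w) =
        (1 - q) • modelT q (i + 1) B w + q • w :=
      fun w => LinearMap.congr_fun (modelT_quad hB (i + 1)) w
    have az : ∀ w, modelT q i A (modelX K U (i + 1 + 1) w) =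
        modelX K U (i + 1 + 1) (modelT q i A w) :=
      modelT_modelX_of_ne q (by omega) (by omega) A
    have bx : ∀ w, modelT q (i + 1) B (modelX K U i w) = modelX K U i (modelT q (i + 1) B w) :=
      modelT_modelX_of_ne q (by omega) (by omega) B
    simp only [Module.End.mul_apply] at hw ⊢
    by_cases e1 : j = i
    · subst e1
      -- The leading term moves X_i all the way to X_{i+2}, where the relation for w applies. The
      -- lower terms of the two sides agree by the quadratic relations.
      have := congrArg (modelX K U (j + 1 + 1)) hw
      simp only [modelT_modelX_self, modelT_modelX_succ, az, bx, map_add, map_smul, qa, qb]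
      linear_combination (norm := module) this
    by_cases e2 : j = i + 1
    · subst e2
      have := congrArg (modelX K U (i + 1)) hw
      simp only [modelT_modelX_self, modelT_modelX_succ, az, bx, map_add, map_sub, map_smul]
      linear_combination (norm := module) this
    by_cases e3 : j = i + 1 + 1
    · subst e3
      have := congrArg (modelX K U i) hw
      simp only [modelT_modelX_succ, az, bx, map_add, map_sub, map_smul, qa, qb]
      linear_combination (norm := module) this
    · simp only [modelT_modelX_of_ne _ e1 e2, modelT_modelX_of_ne _ e2 e3, hw]

theorem modelT_comm (h : A * B = B * A) (hij : i + 1 < j) :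
    modelT q i A * modelT q j B = modelT q j B * modelT q i A := by
  refine model_hom_ext (fun u => ?_) fun k w hw => ?_
  · have := congrArg (fun A : Module.End K U => (1 : Poly K) ⊗ₜ[K] A u) h
    simpa only [Module.End.mul_apply, modelT_one] using this
  · have ej : ∀ w, modelT q j B (modelX K U i w) = modelX K U i (modelT q j B w) :=
      modelT_modelX_of_ne q (by omega) (by omega) B
    have ej' : ∀ w, modelT q j B (modelX K U (i + 1) w) = modelX K U (i + 1) (modelT q j B w) :=
      modelT_modelX_of_ne q (by omega) (by omega) B
    have ei : ∀ w, modelT q i A (modelX K U j w) = modelX K U j (modelT q i A w) :=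
      modelT_modelX_of_ne q (by omega) (by omega) A
    have ei' : ∀ w, modelT q i A (modelX K U (j + 1) w) = modelX K U (j + 1) (modelT q i A w) :=
      modelT_modelX_of_ne q (by omega) (by omega) A
    simp only [Module.End.mul_apply] at hw ⊢
    by_cases e1 : k = i
    · subst e1
      simp only [modelT_modelX_self, ej, ej', map_add, map_smul, hw]
    by_cases e2 : k = i + 1
    · subst e2
      simp only [modelT_modelX_succ, ej, ej', map_sub, map_smul, hw]
    by_cases e3 : k = j
    · subst e3
      simp only [modelT_modelX_self, ei, ei', map_add, map_smul, hw]
    by_cases e4 : k = j + 1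
    · subst e4
      simp only [modelT_modelX_succ, ei, ei', map_sub, map_smul, hw]
    · simp only [modelT_modelX_of_ne _ e1 e2, modelT_modelX_of_ne _ e3 e4, hw]

theorem modelPi_modelT (h : P * A = B * P) (h1 : 1 ≤ i) (h2 : i + 1 < n) :
    modelPi t n P * modelT q i A = modelT q (i + 1) B * modelPi t n P := by
  refine model_hom_ext (fun u => ?_) fun j w hw => ?_
  · have := congrArg (fun A : Module.End K U => (1 : Poly K) ⊗ₜ[K] A u) h
    simpa only [Module.End.mul_apply, modelT_one, modelPi_one] using this
  · have p0 : ∀ w, modelPi t n P (modelX K U i w) = modelX K U (i + 1) (modelPi t n P w) :=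
      modelPi_modelX t h1 (by omega) P
    have p1 : ∀ w, modelPi t n P (modelX K U (i + 1) w) =
        modelX K U (i + 1 + 1) (modelPi t n P w) :=
      modelPi_modelX t (by omega) h2 P
    simp only [Module.End.mul_apply] at hw ⊢
    by_cases e1 : j = i
    · subst e1
      simp only [modelT_modelX_self, p0, p1, map_add, map_smul, hw]
    by_cases e2 : j = i + 1
    · subst e2
      simp only [modelT_modelX_succ, p0, p1, map_sub, map_smul, hw]
    rw [modelT_modelX_of_ne q e1 e2]
    by_cases e3 : 1 ≤ j ∧ j ≤ n
    · rcases e3.2.lt_or_eq with e4 | rfl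
      · rw [modelPi_modelX t e3.1 e4, modelPi_modelX t e3.1 e4, hw,
          modelT_modelX_of_ne q (by omega) (by omega)]
      · rw [modelPi_modelX_last, modelPi_modelX_last, hw, map_smul,
          modelT_modelX_of_ne q (by omega) (by omega)]
    · rw [modelPi_modelX_out t e3 (by omega), modelPi_modelX_out t e3 (by omega), hw,
        modelT_modelX_of_ne q (by omega) (by omega)]

theorem modelPi_modelPi_modelT (m : ℕ) (h : P * P * A = B * (P * P)) :
    modelPi t (m + 1 + 1) P * modelPi t (m + 1 + 1) P * modelT q (m + 1) A =
      modelT q 1 B * (modelPi t (m + 1 + 1) P * modelPi t (m + 1 + 1) P) := by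
  refine model_hom_ext (fun u => ?_) fun j w hw => ?_
  · have := congrArg (fun A : Module.End K U => (1 : Poly K) ⊗ₜ[K] A u) h
    simpa only [Module.End.mul_apply, modelT_one, modelPi_one] using this
  · have p0 : ∀ w, modelPi t (m + 1 + 1) P (modelX K U (m + 1) w) =
        modelX K U (m + 1 + 1) (modelPi t (m + 1 + 1) P w) :=
      modelPi_modelX t (by omega) (by omega) P
    have p1 : ∀ w, modelPi t (m + 1 + 1) P (modelX K U 1 w) =
        modelX K U (1 + 1) (modelPi t (m + 1 + 1) P w) :=
      modelPi_modelX t (by omega) (by omega) P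
    have p2 := modelPi_modelX_last t (m + 1 + 1) P
    simp only [Module.End.mul_apply] at hw ⊢
    by_cases e1 : j = m + 1
    · subst e1
      -- π² sends X_{n-1} to t X_1 and X_n to t X_2, so the Bernstein relation at n - 1 becomes the
      -- one at 1 with the common factor t.
      simp only [modelT_modelX_self, p0, p1, p2, map_add, map_smul, hw, smul_add]
      rw [smul_comm t (1 - q)]
    by_cases e2 : j = m + 1 + 1
    · subst e2
      simp only [modelT_modelX_succ, p0, p1, p2, map_sub, map_smul, hw, smul_sub]
      rw [smul_comm t (1 - q)]
    rw [modelT_modelX_of_ne q e1 e2]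
    by_cases e3 : 1 ≤ j ∧ j ≤ m + 1 + 1
    · rw [modelPi_modelX t e3.1 (by omega), modelPi_modelX t (by omega) (by omega),
        modelPi_modelX t e3.1 (by omega), modelPi_modelX t (by omega) (by omega), hw,
        modelT_modelX_of_ne q (by omega) (by omega)]
    · rw [modelPi_modelX_out t e3 (by omega), modelPi_modelX_out t e3 (by omega),
        modelPi_modelX_out t e3 (by omega), modelPi_modelX_out t e3 (by omega), hw,
        modelT_modelX_of_ne q (by omega) (by omega)]

end Model

section

variable {R S : Type*} [Ring R] [Algebra Kqt R] [Ring S] [Algebra Kqt S]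

theorem HeckeRelations.map {n : ℕ} {T : ℕ → R} (h : HeckeRelations n T) (f : R →ₐ[Kqt] S) :
    HeckeRelations n fun i => f (T i) where
  quad i h1 h2 := by
    have := congrArg f (h.quad i h1 h2)
    simpa only [map_mul, map_sub, map_add, map_one, map_zero, AlgHom.commutes] using this
  braid i h1 h2 := by simpa only [map_mul] using congrArg f (h.braid i h1 h2)
  comm i j h1 h2 h3 := by simpa only [map_mul] using congrArg f (h.comm i j h1 h2 h3)

end

/-! ### The generators T_i and π of 𝒜_n, and generation of 𝒟_n⁺ by T_i, X_i, π -/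

section AffineHecke

theorem heckeRelations_aT (n : ℕ) : HeckeRelations n (aT n) where
  quad i h1 h2 := Subtype.ext ((heckeRelations_dT n).quad i h1 h2)
  braid i h1 h2 := Subtype.ext ((heckeRelations_dT n).braid i h1 h2)
  comm i j h1 h2 h3 := Subtype.ext ((heckeRelations_dT n).comm i j h1 h2 h3)

theorem aPi_mul_aT (n : ℕ) {i : ℕ} (h1 : 1 ≤ i) (h2 : i + 1 < n) :
    aPi n * aT n i = aT n (i + 1) * aPi n :=
  Subtype.ext (dPi_mul_dT n h1 h2)

theorem aPi_mul_aPi_mul_aT {n : ℕ} (h : 2 ≤ n) :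
    aPi n * aPi n * aT n (n - 1) = aT n 1 * (aPi n * aPi n) :=
  Subtype.ext (dPi_mul_dPi_mul_dT n h)

theorem aT_out {n i : ℕ} (h : ¬ (1 ≤ i ∧ i < n)) : aT n i = 0 := Subtype.ext (dT_out n h)

theorem dY_succ_eq (n : ℕ) {i : ℕ} (h1 : 1 ≤ i) (h2 : i < n) :
    dY n (i + 1) = q⁻¹ • (dT n i * dY n i * dT n i) := by
  rw [dT_dY_dT n h1 h2, smul_smul, inv_mul_cancel₀ q_ne_zero, one_smul]

theorem prodDown_mem {R : Type*} [Ring R] [Algebra Kqt R] (S : Subalgebra Kqt R) {f : ℕ → R}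
    (k j : ℕ) (h : ∀ i, k ≤ i → i < k + j → f i ∈ S) : prodDown f k j ∈ S := by
  induction j with
  | zero => exact S.one_mem
  | succ j ih =>
    exact S.mul_mem (h _ (by omega) (by omega)) (ih fun i h1 h2 => h i h1 (by omega))

/-- The elements `Y_i` lie in every subalgebra that contains the `T_i` and `π`. -/
theorem dY_mem_of_dPi_mem {n : ℕ} {S : Subalgebra Kqt (DAHA n)} (hT : ∀ i, dT n i ∈ S)
    (hP : dPi n ∈ S) (i : ℕ) : dY n i ∈ S := by
  by_cases hi : 1 ≤ i ∧ i ≤ n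
  · obtain ⟨h1, h2⟩ := hi
    induction i, h1 using Nat.le_induction with
    | base =>
      rw [dY_one_eq n h2]
      exact S.smul_mem (S.mul_mem hP (prodDown_mem S _ _ fun i _ _ => heckeInv_mem S (hT i))) _
    | succ i h1 ih =>
      rw [dY_succ_eq n h1 h2]
      exact S.smul_mem (S.mul_mem (S.mul_mem (hT i) (ih (by omega))) (hT i)) _
  · rw [dY_out n hi]
    exact S.zero_mem

theorem AHA_le {n : ℕ} {S : Subalgebra Kqt (DAHA n)} (hT : ∀ i, dT n i ∈ S) (hP : dPi n ∈ S) :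
    AHA n ≤ S := by
  refine Algebra.adjoin_le ?_
  rintro x (⟨i, rfl⟩ | ⟨i, rfl⟩)
  · exact hT i
  · exact dY_mem_of_dPi_mem hT hP i

theorem eq_top_of_gen_mem {n : ℕ} {S : Subalgebra Kqt (DAHA n)} (hT : ∀ i, dT n i ∈ S)
    (hX : ∀ i, dX n i ∈ S) (hP : dPi n ∈ S) : S = ⊤ := by
  refine eq_top_iff.mpr fun x _ => ?_
  obtain ⟨y, rfl⟩ := RingQuot.mkAlgHom_surjective Kqt (DRel n) x
  change dMk n y ∈ S
  induction y using FreeAlgebra.induction with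
  | grade0 r => rw [AlgHom.commutes]; exact S.algebraMap_mem r
  | grade1 g =>
    cases g with
    | T i => exact hT i
    | X i => exact hX i
    | Y i => exact dY_mem_of_dPi_mem hT hP i
  | mul a b ha hb => rw [map_mul]; exact S.mul_mem (ha trivial) (hb trivial)
  | add a b ha hb => rw [map_add]; exact S.add_mem (ha trivial) (hb trivial)

end AffineHecke

/-! ### The map from the induced module to the polynomial model -/

section Model

/-- The space `ℚ(q,t)[X_0, X_1, …] ⊗ U`. -/
def Model (U : Type) [AddCommGroup U] [Module Kqt U] : Type := Poly Kqt ⊗[Kqt] U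

variable {U : Type} [AddCommGroup U] [Module Kqt U]

instance : AddCommGroup (Model U) := (TensorProduct.addCommGroup : AddCommGroup (Poly Kqt ⊗[Kqt] U))

instance : Module Kqt (Model U) := inferInstanceAs (Module Kqt (Poly Kqt ⊗[Kqt] U))

/-- The element `f ⊗ u` of the model. -/
def Model.tmul (f : Poly Kqt) (u : U) : Model U := f ⊗ₜ[Kqt] u

variable {n : ℕ} (act : AHA n →ₐ[Kqt] Module.End Kqt U)

/-- The operators `T_i`, `X_i`, `π` on the model. -/
def Model.opT (i : ℕ) : Module.End Kqt (Model U) := modelT q i (act (aT n i))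

/-- The operator `X_i` on the model. -/
def Model.opX (U : Type) [AddCommGroup U] [Module Kqt U] (i : ℕ) : Module.End Kqt (Model U) :=
  modelX Kqt U i

/-- The operator `π` on the model. -/
def Model.opPi : Module.End Kqt (Model U) := modelPi t n (act (aPi n))

/-- The model requires of the coefficients only the relations among T_i and π that hold in 𝒜_n.
Hence every 𝒜_n-module extends to an action of 𝒟_n⁺ on polynomials with coefficients in it. -/
theorem Model.relations :
    DoubleAffineRelations n (Model.opT act) (Model.opX U) (Model.opPi act) := by
  have hT := (heckeRelations_aT n).map act
  refine
    { hecke := ⟨fun i h1 h2 => ?_, fun i h1 h2 => ?_, fun i j h1 h2 h3 => ?_⟩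
      T_X_succ := fun i _ _ => LinearMap.ext fun w => modelT_modelX_succ q i (act (aT n i)) w
      T_X := fun i j _ _ _ _ h5 h6 =>
        LinearMap.ext fun w => modelT_modelX_of_ne q h5 h6 (act (aT n i)) w
      T_X_self := fun i _ _ => LinearMap.ext fun w => modelT_modelX_self q i (act (aT n i)) w
      X_X := fun i j _ _ _ _ => LinearMap.ext fun w => modelX_comm i j w
      pi_T := fun i h1 h2 => ?_
      pi_pi_T := fun hn => ?_
      pi_X := fun i h1 h2 => LinearMap.ext fun w => modelPi_modelX t h1 h2 (act (aPi n)) w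
      pi_X_last := fun _ => LinearMap.ext fun w => modelPi_modelX_last t n (act (aPi n)) w }
  · have e : Model.opT act i * Model.opT act i = (1 - q) • Model.opT act i + q • 1 :=
      modelT_quad (hT.mul_self h1 h2) i
    have : (Model.opT act i - 1) * (Model.opT act i + algebraMap Kqt _ q) =
        Model.opT act i * Model.opT act i - ((1 - q) • Model.opT act i + q • 1) := by
      rw [Algebra.algebraMap_eq_smul_one, sub_mul, mul_add, mul_smul_comm, mul_one, one_mul]
      module
    rw [this, e, sub_self]
  · exact modelT_braid (hT.mul_self h1 (by omega)) (hT.mul_self (by omega) h2) (hT.braid i h1 h2) i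
  · exact modelT_comm (hT.comm i j h1 h2 h3) h2
  · refine modelPi_modelT ?_ h1 h2
    rw [← map_mul, aPi_mul_aT n h1 h2, map_mul]
  · obtain ⟨m, rfl⟩ : ∃ m, n = m + 1 + 1 := ⟨n - 2, by omega⟩
    refine modelPi_modelPi_modelT m ?_
    have := aPi_mul_aPi_mul_aT hn
    rw [← map_mul, ← map_mul, this, map_mul, map_mul]

/-- The action of `𝒟_n⁺` on the model. -/
def Model.action : DAHA n →ₐ[Kqt] Module.End Kqt (Model U) := (Model.relations act).hom

theorem Model.action_T_one (i : ℕ) (u : U) :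
    Model.action act (dT n i) (Model.tmul 1 u) = Model.tmul 1 (act (aT n i) u) := by
  by_cases h : 1 ≤ i ∧ i < n
  · rw [Model.action, (Model.relations act).hom_dT h.1 h.2]
    exact modelT_one q i (act (aT n i)) u
  · rw [dT_out n h, aT_out h, map_zero, map_zero]
    exact (TensorProduct.tmul_zero U (1 : Poly Kqt)).symm

theorem Model.action_Pi_one (hn : 1 ≤ n) (u : U) :
    Model.action act (dPi n) (Model.tmul 1 u) = Model.tmul 1 (act (aPi n) u) := by
  rw [Model.action, (Model.relations act).hom_dPi hn]
  exact modelPi_one t n (act (aPi n)) u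

theorem Model.action_X {i : ℕ} (h1 : 1 ≤ i) (h2 : i ≤ n) (f : Poly Kqt) (u : U) :
    Model.action act (dX n i) (Model.tmul f u) = Model.tmul (MvPolynomial.X i * f) u := by
  rw [Model.action, (Model.relations act).hom_dX h1 h2]
  exact modelX_tmul i f u

end Model

section Ind

variable {U : Type} [AddCommGroup U] [Module Kqt U] {n : ℕ}
  (act : AHA n →ₐ[Kqt] Module.End Kqt U)

/-! ### The induced module -/

theorem indTensor_add (d : DAHA n) (u v : U) :
    indTensor act d (u + v) = indTensor act d u + indTensor act d v := by
  rw [indTensor, TensorProduct.tmul_add]; rfl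

theorem indTensor_smul (c : Kqt) (d : DAHA n) (u : U) :
    indTensor act d (c • u) = c • indTensor act d u := by
  rw [indTensor, TensorProduct.tmul_smul]; rfl

theorem smul_indTensor (a d : DAHA n) (u : U) :
    a • indTensor act d u = indTensor act (a * d) u := rfl

theorem indTensor_mul (d : DAHA n) (a : AHA n) (u : U) :
    indTensor act (d * a) u = indTensor act d (act a u) :=
  (Submodule.Quotient.eq _).mpr (Submodule.subset_span ⟨d, a, u, rfl⟩)

theorem indTensor_coe (a : AHA n) (u : U) :
    (a : DAHA n) • indTensor act 1 u = indTensor act 1 (act a u) := by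
  rw [smul_indTensor, mul_one, ← indTensor_mul, one_mul]

/-- `d ⊗ u` as a linear function of `u`. -/
def indTensorHom (d : DAHA n) : U →ₗ[Kqt] IndSpace n act where
  toFun := indTensor act d
  map_add' := indTensor_add act d
  map_smul' c := indTensor_smul act c d

theorem ind_hom_ext_tensor {N : Submodule Kqt (IndSpace n act)}
    (h : ∀ d u, indTensor act d u ∈ N) (x : IndSpace n act) : x ∈ N := by
  obtain ⟨y, rfl⟩ := Submodule.Quotient.mk_surjective _ x
  induction y with
  | zero => exact N.zero_mem
  | add a b ha hb => exact N.add_mem ha hb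
  | tmul d u => exact h d u

/-- Linear maps on the induced module. -/
def indLift {M : Type*} [AddCommGroup M] [Module Kqt M] (φ : DAHA n →ₐ[Kqt] Module.End Kqt M)
    (f : U →ₗ[Kqt] M) (h : ∀ (a : AHA n) u, φ (a : DAHA n) (f u) = f (act a u)) :
    IndSpace n act →ₗ[Kqt] M :=
  ((indRel n act).restrictScalars Kqt).liftQ
      (TensorProduct.lift (φ.toLinearMap.compl₂ f)) (by
    intro x hx
    change x ∈ indRel n act at hx
    change TensorProduct.lift (φ.toLinearMap.compl₂ f) x = 0
    induction hx using Submodule.span_induction with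
    | mem x hx =>
      obtain ⟨d, a, u, rfl⟩ := hx
      rw [map_sub, TensorProduct.lift.tmul, TensorProduct.lift.tmul]
      simp only [LinearMap.compl₂_apply, AlgHom.toLinearMap_apply, map_mul, Module.End.mul_apply, h,
        sub_self]
    | zero => exact map_zero _
    | add x y _ _ hx hy => rw [map_add, hx, hy, add_zero]
    | smul a x _ hx =>
      -- The relations generate a 𝒟_n⁺-submodule while the lifted map is only linear over the field.
      -- Its equivariance, with 𝒟_n⁺ acting on M through φ, shows that the kernel is stable under
      -- 𝒟_n⁺.
      have : ∀ y, TensorProduct.lift (φ.toLinearMap.compl₂ f) (a • y) =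
          φ a (TensorProduct.lift (φ.toLinearMap.compl₂ f) y) := by
        intro y
        induction y with
        | zero => rw [smul_zero, map_zero, map_zero]
        | add y z hy hz => rw [smul_add, map_add, map_add, hy, hz, map_add]
        | tmul d u =>
          rw [TensorProduct.smul_tmul', TensorProduct.lift.tmul, TensorProduct.lift.tmul]
          simp only [LinearMap.compl₂_apply, AlgHom.toLinearMap_apply, smul_eq_mul, map_mul,
            Module.End.mul_apply]
      rw [this, hx, map_zero]) ∘ₗ
    (Submodule.Quotient.restrictScalarsEquiv Kqt (indRel n act)).symm.toLinearMap

/-! ### Generation of the induced module by monomials -/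

theorem prodUpTo_smul_mem {M : Type*} [AddCommGroup M] [Module Kqt M] [Module (DAHA n) M]
    {N : ℕ → Submodule Kqt M} (hX : ∀ d j, ∀ x ∈ N d, dX n j • x ∈ N (d + 1)) (α : ℕ → ℕ) (m : ℕ)
    {d : ℕ} {x : M} (hx : x ∈ N d) :
    prodUpTo (fun i => dX n i ^ α i) m • x ∈ N ((∑ i ∈ Finset.Icc 1 m, α i) + d) := by
  have hpow : ∀ (j a d : ℕ) (x : M), x ∈ N d → dX n j ^ a • x ∈ N (a + d) := by
    intro j a
    induction a with
    | zero => intro d x hx; rw [pow_zero, one_smul, zero_add]; exact hx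
    | succ a ih =>
      intro d x hx
      rw [pow_succ, mul_smul, show a + 1 + d = a + (d + 1) by omega]
      exact ih (d + 1) _ (hX d j x hx)
  induction m generalizing d x with
  | zero => simpa [prodUpTo] using hx
  | succ m ih =>
    rw [prodUpTo, mul_smul, Finset.sum_Icc_succ_top (by omega), add_assoc]
    exact ih (hpow _ _ _ _ hx)

theorem dMonomial_smul_mem {M : Type*} [AddCommGroup M] [Module Kqt M] [Module (DAHA n) M]
    {N : ℕ → Submodule Kqt M} (hX : ∀ d j, ∀ x ∈ N d, dX n j • x ∈ N (d + 1)) (α : ℕ → ℕ)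
    {d : ℕ} {x : M} (hx : x ∈ N d) :
    dMonomial n α • x ∈ N ((∑ i ∈ Finset.Icc 1 n, α i) + d) := prodUpTo_smul_mem hX α n hx

theorem dMonomial_zero (n : ℕ) : dMonomial n (fun _ => 0) = 1 := by
  have : ∀ m, prodUpTo (fun i => dX n i ^ 0) m = 1 := by
    intro m
    induction m with
    | zero => rfl
    | succ m ih => rw [prodUpTo, ih, pow_zero, one_mul]
  exact this n

theorem dMonomial_congr {α β : ℕ → ℕ} (h : ∀ i, 1 ≤ i → i ≤ n → α i = β i) :
    dMonomial n α = dMonomial n β :=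
  prodUpTo_congr n fun i h1 h2 => by rw [h i h1 h2]

theorem dX_mul_dMonomial {j : ℕ} (h1 : 1 ≤ j) (h2 : j ≤ n) (α : ℕ → ℕ) :
    dX n j * dMonomial n α = dMonomial n (Function.update α j (α j + 1)) := by
  have key : ∀ m, j ≤ m → dX n j * prodUpTo (fun i => dX n i ^ α i) m =
      prodUpTo (fun i => dX n i ^ Function.update α j (α j + 1) i) m := by
    intro m hm
    induction m, hm using Nat.le_induction with
    | base =>
      obtain ⟨k, rfl⟩ : ∃ k, j = k + 1 := ⟨j - 1, by omega⟩
      have e1 : Commute (dX n (k + 1)) (prodUpTo (fun i => dX n i ^ α i) k) :=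
        commute_prodUpTo k fun i _ _ => (commute_dX_dX n _ _).pow_right _
      rw [prodUpTo, ← mul_assoc, e1.eq, mul_assoc, ← pow_succ', prodUpTo, Function.update_self]
      congr 1
      exact prodUpTo_congr k fun i h1 h2 => by rw [Function.update_of_ne (by omega)]
    | succ m hm ih => rw [prodUpTo, ← mul_assoc, ih, prodUpTo, Function.update_of_ne (by omega)]
  exact key n h2

theorem sum_update {j : ℕ} (h1 : 1 ≤ j) (h2 : j ≤ n) (α : ℕ → ℕ) :
    ∑ i ∈ Finset.Icc 1 n, Function.update α j (α j + 1) i = (∑ i ∈ Finset.Icc 1 n, α i) + 1 := by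
  have hj : j ∈ Finset.Icc 1 n := Finset.mem_Icc.mpr ⟨h1, h2⟩
  rw [Finset.sum_update_of_mem hj, ← Finset.add_sum_erase _ _ hj, Finset.sdiff_singleton_eq_erase]
  omega

theorem dT_smul_dX_smul {M : Type*} [AddCommGroup M] [Module Kqt M] [Module (DAHA n) M]
    [IsScalarTower Kqt (DAHA n) M] {i j : ℕ} (x : M) :
    dT n i • dX n j • x =
      if 1 ≤ i ∧ i < n then
        if j = i then dX n (i + 1) • dT n i • x + (1 - q) • dX n i • x
        else if j = i + 1 then dX n i • dT n i • x - (1 - q) • dX n i • x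
        else dX n j • dT n i • x
      else 0 := by
  split_ifs with h1 h2 h3
  · rw [h2, ← mul_smul, dT_mul_dX n h1.1 h1.2, add_smul, mul_smul, smul_assoc]
  · rw [h3, ← mul_smul, dT_mul_dX_succ' n h1.1 h1.2, sub_smul, mul_smul, smul_assoc]
  · rw [← mul_smul, (commute_dT_dX n h2 h3).eq, mul_smul]
  · rw [dT_out n h1, zero_smul]

theorem dPi_smul_dX_smul {M : Type*} [AddCommGroup M] [Module Kqt M] [Module (DAHA n) M]
    [IsScalarTower Kqt (DAHA n) M] {j : ℕ} (x : M) :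
    dPi n • dX n j • x =
      if 1 ≤ j ∧ j < n then dX n (j + 1) • dPi n • x
      else if 1 ≤ j ∧ j = n then t • dX n 1 • dPi n • x
      else 0 := by
  split_ifs with h1 h2
  · rw [← mul_smul, dPi_mul_dX n h1.1 h1.2, mul_smul]
  · obtain ⟨h3, rfl⟩ := h2
    rw [← mul_smul, dPi_mul_dX_last j h3, smul_assoc, mul_smul]
  · rw [dX_out n (by omega), zero_smul, smul_zero]

/-- A submodule of the induced module is everything if it contains the `1 ⊗ u` and is stable under
the `X_j`. -/
theorem ind_induction {N : Submodule Kqt (IndSpace n act)} (h1 : ∀ u, indTensor act 1 u ∈ N)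
    (hX : ∀ j, ∀ x ∈ N, dX n j • x ∈ N) (x : IndSpace n act) : x ∈ N := by
  -- The smallest subspace that contains 1 ⊗ U and is stable under the X_j. Once S is stable under
  -- T_i and π as well, it is stable under all of 𝒟_n⁺ and hence everything.
  let S : Submodule Kqt (IndSpace n act) :=
    sInf {N | (∀ u, indTensor act 1 u ∈ N) ∧ ∀ j, ∀ x ∈ N, dX n j • x ∈ N}
  have hS1 : ∀ u, indTensor act 1 u ∈ S := fun u =>
    Submodule.mem_sInf.mpr fun N hN => hN.1 u
  have hSX : ∀ j, ∀ x ∈ S, dX n j • x ∈ S := fun j x hx =>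
    Submodule.mem_sInf.mpr fun N hN => hN.2 j x (Submodule.mem_sInf.mp hx N hN)
  let L := Algebra.lsmul Kqt Kqt (IndSpace n act) (A := DAHA n)
  -- The vectors of S that all T_i and π keep in S. This subspace contains 1 ⊗ U and is stable under
  -- the X_j by the commutation formulas, so minimality of S gives `S ≤ N'`.
  let N' : Submodule Kqt (IndSpace n act) :=
    S ⊓ (⨅ i, S.comap (L (dT n i))) ⊓ S.comap (L (dPi n))
  have hN' : S ≤ N' := by
    refine sInf_le ⟨fun u => ⟨⟨hS1 u, ?_⟩, ?_⟩, fun j x hx => ?_⟩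
    · rw [SetLike.mem_coe, Submodule.mem_iInf]
      intro i
      change dT n i • indTensor act 1 u ∈ S
      exact (indTensor_coe act (aT n i) u) ▸ hS1 _
    · change dPi n • indTensor act 1 u ∈ S
      exact (indTensor_coe act (aPi n) u) ▸ hS1 _
    · obtain ⟨⟨hx1, hx2⟩, hx3⟩ := hx
      rw [SetLike.mem_coe, Submodule.mem_iInf] at hx2
      have hx2 : ∀ i, dT n i • x ∈ S := hx2
      have hx3 : dPi n • x ∈ S := hx3
      refine ⟨⟨hSX j x hx1, ?_⟩, ?_⟩
      · rw [SetLike.mem_coe, Submodule.mem_iInf]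
        intro i
        change dT n i • dX n j • x ∈ S
        rw [dT_smul_dX_smul]
        split_ifs
        · exact S.add_mem (hSX _ _ (hx2 i)) (S.smul_mem _ (hSX _ _ hx1))
        · exact S.sub_mem (hSX _ _ (hx2 i)) (S.smul_mem _ (hSX _ _ hx1))
        · exact hSX _ _ (hx2 i)
        · exact S.zero_mem
      · change dPi n • dX n j • x ∈ S
        rw [dPi_smul_dX_smul]
        split_ifs
        · exact hSX _ _ hx3
        · exact S.smul_mem _ (hSX _ _ hx3)
        · exact S.zero_mem
  have hST : ∀ i, ∀ x ∈ S, dT n i • x ∈ S := by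
    intro i x hx
    have := (hN' hx).1.2
    rw [SetLike.mem_coe, Submodule.mem_iInf] at this
    exact this i
  have hSP : ∀ x ∈ S, dPi n • x ∈ S := fun x hx => (hN' hx).2
  let B : Subalgebra Kqt (DAHA n) :=
    { carrier := {a | ∀ x ∈ S, a • x ∈ S}
      mul_mem' := fun {a b} ha hb x hx => by rw [mul_smul]; exact ha _ (hb x hx)
      add_mem' := fun {a b} ha hb x hx => by rw [add_smul]; exact S.add_mem (ha x hx) (hb x hx)
      algebraMap_mem' := fun c x hx => by rw [algebraMap_smul]; exact S.smul_mem c hx }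
  have hB : B = ⊤ := eq_top_of_gen_mem hST hSX hSP
  have hle : S ≤ N := sInf_le ⟨h1, hX⟩
  refine hle (ind_hom_ext_tensor act (N := S) (fun d u => ?_) x)
  have : d ∈ B := hB ▸ Algebra.mem_top
  have := this _ (hS1 u)
  rwa [smul_indTensor, mul_one] at this

theorem ind_hom_ext {M : Type*} [AddCommGroup M] [Module Kqt M] {f g : IndSpace n act →ₗ[Kqt] M}
    (h1 : ∀ u, f (indTensor act 1 u) = g (indTensor act 1 u))
    (hX : ∀ j x, f x = g x → f (dX n j • x) = g (dX n j • x)) : f = g :=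
  LinearMap.ext fun x => ind_induction act (N := LinearMap.eqLocus f g) h1 hX x

theorem span_indTensor_dMonomial :
    Submodule.span Kqt {x | ∃ (α : ℕ → ℕ) (u : U), x = indTensor act (dMonomial n α) u} = ⊤ := by
  refine eq_top_iff.mpr fun x _ => ind_induction act (fun u => ?_) (fun j x hx => ?_) x
  · exact Submodule.subset_span ⟨fun _ => 0, u, by rw [dMonomial_zero]⟩
  · induction hx using Submodule.span_induction with
    | mem x hx =>
      obtain ⟨α, u, rfl⟩ := hx
      rw [smul_indTensor]
      by_cases hj : 1 ≤ j ∧ j ≤ n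
      · exact Submodule.subset_span ⟨_, u, by rw [dX_mul_dMonomial hj.1 hj.2]⟩
      · rw [dX_out n hj, ← smul_indTensor, zero_smul]
        exact Submodule.zero_mem _
    | zero => rw [smul_zero]; exact Submodule.zero_mem _
    | add x y _ _ hx hy => rw [smul_add]; exact Submodule.add_mem _ hx hy
    | smul c x _ hx => rw [smul_comm]; exact Submodule.smul_mem _ _ hx

theorem ind_hom_ext_dMonomial {M : Type*} [AddCommGroup M] [Module Kqt M]
    {f g : IndSpace n act →ₗ[Kqt] M}
    (h : ∀ α u, f (indTensor act (dMonomial n α) u) = g (indTensor act (dMonomial n α) u)) :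
    f = g := by
  refine LinearMap.ext_on (span_indTensor_dMonomial act) ?_
  rintro x ⟨α, u, rfl⟩
  exact h α u

/-! ### The monomial basis of the induced module -/

/-- The elements of 𝒜_n with this property form a subalgebra that contains the T_i and π. It is the
compatibility that a map out of the induced module requires. -/
theorem Model.action_one (hn : 1 ≤ n) (a : AHA n) (u : U) :
    Model.action act (a : DAHA n) (Model.tmul 1 u) = Model.tmul 1 (act a u) := by
  let A : Subalgebra Kqt (DAHA n) :=
    ({ carrier := {a : AHA n | ∀ u, Model.action act (a : DAHA n) (Model.tmul 1 u) =
          Model.tmul 1 (act a u)}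
       mul_mem' := fun {a b} ha hb u => by
        change Model.action act ((a : DAHA n) * (b : DAHA n)) _ = _
        rw [map_mul, Module.End.mul_apply, hb, ha, map_mul, Module.End.mul_apply]
       add_mem' := fun {a b} ha hb u => by
        change Model.action act ((a : DAHA n) + (b : DAHA n)) _ = _
        rw [map_add, LinearMap.add_apply, hb, ha, map_add, LinearMap.add_apply]
        exact (TensorProduct.tmul_add (1 : Poly Kqt) _ _).symm
       algebraMap_mem' := fun c u => by
        change Model.action act (algebraMap Kqt (DAHA n) c) _ = _
        rw [AlgHom.commutes, AlgHom.commutes, Module.algebraMap_end_apply,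
          Module.algebraMap_end_apply]
        exact (TensorProduct.tmul_smul c (1 : Poly Kqt) u).symm } :
      Subalgebra Kqt (AHA n)).map (AHA n).val
  have hA : AHA n ≤ A := AHA_le
    (fun i => ⟨aT n i, fun u => Model.action_T_one act i u, rfl⟩)
    ⟨aPi n, fun u => Model.action_Pi_one act hn u, rfl⟩
  obtain ⟨b, hb, hab⟩ := hA a.2
  obtain rfl : b = a := Subtype.ext hab
  exact hb u

/-- The map from the induced module to the polynomial model. -/
def indToModel (hn : 1 ≤ n) : IndSpace n act →ₗ[Kqt] Model U :=
  indLift act (Model.action act) (TensorProduct.mk Kqt (Poly Kqt) U 1)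
    (fun a u => Model.action_one act hn a u)

/-- The exponents `α_1, …, α_n`. -/
def truncExp (n : ℕ) (α : ℕ → ℕ) : ℕ →₀ ℕ :=
  Finsupp.onFinset (Finset.Icc 1 n) (fun i => if 1 ≤ i ∧ i ≤ n then α i else 0) fun i hi => by
    by_contra h
    rw [Finset.mem_Icc] at h
    exact hi (if_neg h)

theorem truncExp_apply {α : ℕ → ℕ} {i : ℕ} (h1 : 1 ≤ i) (h2 : i ≤ n) : truncExp n α i = α i := by
  rw [truncExp, Finsupp.onFinset_apply, if_pos ⟨h1, h2⟩]

theorem prod_X_pow_eq (n : ℕ) (α : ℕ → ℕ) :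
    ∏ i ∈ Finset.Icc 1 n, (MvPolynomial.X i : Poly Kqt) ^ α i =
      MvPolynomial.monomial (truncExp n α) 1 := by
  rw [MvPolynomial.monomial_eq, MvPolynomial.C_1, one_mul,
    Finsupp.prod_of_support_subset (truncExp n α) (s := Finset.Icc 1 n)
      Finsupp.support_onFinset_subset _
      (fun i _ => pow_zero _)]
  exact Finset.prod_congr rfl fun i hi => by
    rw [truncExp_apply (Finset.mem_Icc.mp hi).1 (Finset.mem_Icc.mp hi).2]

theorem Model.action_prodUpTo (α : ℕ → ℕ) (m : ℕ) (hm : m ≤ n) (f : Poly Kqt) (u : U) :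
    Model.action act (prodUpTo (fun i => dX n i ^ α i) m) (Model.tmul f u) =
      Model.tmul ((∏ i ∈ Finset.Icc 1 m, MvPolynomial.X i ^ α i) * f) u := by
  have hpow : ∀ j a, 1 ≤ j → j ≤ n → ∀ f, Model.action act (dX n j ^ a) (Model.tmul f u) =
      Model.tmul (MvPolynomial.X j ^ a * f) u := by
    intro j a h1 h2
    induction a with
    | zero => intro f; rw [pow_zero, map_one, pow_zero, one_mul]; rfl
    | succ a ih =>
      intro f
      rw [pow_succ, map_mul, Module.End.mul_apply, Model.action_X act h1 h2, ih, pow_succ, mul_assoc]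
  induction m generalizing f with
  | zero => rw [prodUpTo, map_one]; simp
  | succ m ih =>
    rw [prodUpTo, map_mul, Module.End.mul_apply, hpow _ _ (by omega) hm, ih (by omega),
      Finset.prod_Icc_succ_top (by omega), mul_assoc]

/-- This is the Poincaré–Birkhoff–Witt statement for induced modules: the X^α ⊗ u go to honest
monomials with coefficient u, so no hidden relation among them exists. -/
theorem indToModel_dMonomial (hn : 1 ≤ n) (α : ℕ → ℕ) (u : U) :
    indToModel act hn (indTensor act (dMonomial n α) u) =
      Model.tmul (MvPolynomial.monomial (truncExp n α) 1) u := by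
  refine (Model.action_prodUpTo act α n le_rfl 1 u).trans ?_
  rw [mul_one, prod_X_pow_eq]

/-- The linear map on the model with `X^m ⊗ u ↦ g m u`. -/
def modelLift {M : Type*} [AddCommGroup M] [Module Kqt M] (g : (ℕ →₀ ℕ) → U →ₗ[Kqt] M) :
    Model U →ₗ[Kqt] M :=
  TensorProduct.lift ((MvPolynomial.basisMonomials ℕ Kqt).constr Kqt g)

theorem modelLift_monomial {M : Type*} [AddCommGroup M] [Module Kqt M]
    (g : (ℕ →₀ ℕ) → U →ₗ[Kqt] M) (m : ℕ →₀ ℕ) (u : U) :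
    modelLift g (Model.tmul (MvPolynomial.monomial m 1) u) = g m u := by
  refine (TensorProduct.lift.tmul _ _).trans ?_
  exact LinearMap.congr_fun ((MvPolynomial.basisMonomials ℕ Kqt).constr_basis Kqt g m) u

/-- The linear map on the induced module with `X^α ⊗ u ↦ g α u`, where `g` depends only on the
exponents `α_1, …, α_n`. -/
def indMonomialLift {M : Type*} [AddCommGroup M] [Module Kqt M] (hn : 1 ≤ n)
    (g : (ℕ → ℕ) → U →ₗ[Kqt] M) : IndSpace n act →ₗ[Kqt] M :=
  modelLift (fun m => g m) ∘ₗ indToModel act hn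

theorem indMonomialLift_dMonomial {M : Type*} [AddCommGroup M] [Module Kqt M] (hn : 1 ≤ n)
    (g : (ℕ → ℕ) → U →ₗ[Kqt] M)
    (hg : ∀ α β : ℕ → ℕ, (∀ i, 1 ≤ i → i ≤ n → α i = β i) → g α = g β) (α : ℕ → ℕ) (u : U) :
    indMonomialLift act hn g (indTensor act (dMonomial n α) u) = g α u := by
  rw [indMonomialLift, LinearMap.comp_apply, indToModel_dMonomial, modelLift_monomial,
    hg _ α fun i h1 h2 => truncExp_apply h1 h2]

end Ind

/-! ### Internal gradings and projections -/

section Internal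

variable {V : Type*} [AddCommGroup V] [Module Kqt V] {A : ℕ → Submodule Kqt V}

/-- With the converse `isInternal_of_proj`, this reduces the grading of the induced module to
constructing the projections onto its components. -/
theorem exists_proj_of_isInternal (h : DirectSum.IsInternal A) :
    ∃ p : ℕ → V →ₗ[Kqt] V, (∀ d, ∀ x ∈ A d, p d x = x) ∧
      ∀ d e, d ≠ e → ∀ x ∈ A e, p d x = 0 := by
  let E := LinearEquiv.ofBijective (DirectSum.coeLinearMap A) h
  have hE : ∀ e (x : A e), E.symm (x : V) = DirectSum.lof Kqt ℕ (fun d => A d) e x := by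
    intro e x
    rw [LinearEquiv.symm_apply_eq]
    exact (DirectSum.coeLinearMap_lof A e x).symm
  refine ⟨fun d => (A d).subtype ∘ₗ DirectSum.component Kqt ℕ (fun d => A d) d ∘ₗ
    E.symm.toLinearMap, fun d x hx => ?_, fun d e hde x hx => ?_⟩
  · have := hE d ⟨x, hx⟩
    simp only [LinearMap.comp_apply, LinearEquiv.coe_coe]
    rw [this, DirectSum.component.lof_self]
    rfl
  · have := hE e ⟨x, hx⟩
    simp only [LinearMap.comp_apply, LinearEquiv.coe_coe]
    rw [this, DirectSum.component.of, dif_neg (Ne.symm hde), map_zero]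

theorem isInternal_of_proj (p : ℕ → V →ₗ[Kqt] V) (h1 : ∀ d, ∀ x ∈ A d, p d x = x)
    (h2 : ∀ d e, d ≠ e → ∀ x ∈ A e, p d x = 0) (h3 : ⨆ d, A d = ⊤) : DirectSum.IsInternal A := by
  refine (DirectSum.isInternal_submodule_iff_iSupIndep_and_iSup_eq_top A).mpr ⟨?_, h3⟩
  rw [iSupIndep_def]
  intro d
  rw [Submodule.disjoint_def]
  intro x hx hx'
  have : ⨆ e, ⨆ (_ : e ≠ d), A e ≤ LinearMap.ker (p d) :=
    iSup_le fun e => iSup_le fun he x hx => h2 d e (Ne.symm he) x hx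
  rw [← h1 d x hx]
  exact this hx'

end Internal

/-! ### The sequence of induced modules -/

namespace AHASequence

variable {C : AHASequence}

/-- Existence: a linear map may be prescribed freely on the X^α ⊗ u as long as it depends only on
α_1, …, α_{n+1} and is linear in u. Uniqueness: these elements span. -/
theorem existsUnique_isIndMap (C : AHASequence) (n : ℕ) : ∃! p, C.IsIndMap n p := by
  classical
  refine ⟨indMonomialLift (C.act (n + 1)) (by omega) (fun α => if α (n + 1) = 0 then
    indTensorHom (C.act n) (dMonomial n α) ∘ₗ C.κ n else 0), fun α u => ?_, fun p hp => ?_⟩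
  · rw [indMonomialLift_dMonomial]
    · split_ifs <;> rfl
    · intro α β h
      rw [h (n + 1) (by omega) le_rfl, dMonomial_congr fun i h1 h2 => h i h1 (by omega)]
  · refine ind_hom_ext_dMonomial _ fun α u => ?_
    rw [hp, indMonomialLift_dMonomial]
    · split_ifs <;> rfl
    · intro α β h
      rw [h (n + 1) (by omega) le_rfl, dMonomial_congr fun i h1 h2 => h i h1 (by omega)]

/-! ### The grading of the induced modules -/

section Grading

/-- The homogeneous components of the induced modules. -/
def indGr (C : AHASequence) (n d : ℕ) : Submodule Kqt (IndSpace n (C.act n)) :=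
  Submodule.span Kqt
    {x | ∃ (α : ℕ → ℕ) (e : ℕ) (u : C.U n), u ∈ C.gr n e ∧ (∑ i ∈ Finset.Icc 1 n, α i) + e = d ∧
      x = indTensor (C.act n) (dMonomial n α) u}

theorem mem_indGr {n d e : ℕ} {α : ℕ → ℕ} {u : C.U n} (hu : u ∈ C.gr n e)
    (h : (∑ i ∈ Finset.Icc 1 n, α i) + e = d) :
    indTensor (C.act n) (dMonomial n α) u ∈ C.indGr n d :=
  Submodule.subset_span ⟨α, e, u, hu, h, rfl⟩

theorem dX_smul_mem_indGr (n d j : ℕ) : ∀ x ∈ C.indGr n d, dX n j • x ∈ C.indGr n (d + 1) := by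
  intro x hx
  by_cases hj : 1 ≤ j ∧ j ≤ n
  · have : C.indGr n d ≤ (C.indGr n (d + 1)).comap
        (Algebra.lsmul Kqt Kqt (IndSpace n (C.act n)) (dX n j)) := by
      refine Submodule.span_le.mpr ?_
      rintro x ⟨α, e, u, hu, hd, rfl⟩
      change indTensor (C.act n) (dX n j * dMonomial n α) u ∈ C.indGr n (d + 1)
      rw [dX_mul_dMonomial hj.1 hj.2]
      exact mem_indGr hu (by rw [sum_update hj.1 hj.2]; omega)
    exact this hx
  · rw [dX_out n hj, zero_smul]
    exact Submodule.zero_mem _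

theorem indGr_le {n : ℕ} {N : ℕ → Submodule Kqt (IndSpace n (C.act n))}
    (h1 : ∀ e, ∀ u ∈ C.gr n e, indTensor (C.act n) 1 u ∈ N e)
    (hX : ∀ d j, ∀ x ∈ N d, dX n j • x ∈ N (d + 1)) (d : ℕ) : C.indGr n d ≤ N d := by
  refine Submodule.span_le.mpr ?_
  rintro x ⟨α, e, u, hu, rfl, rfl⟩
  have := dMonomial_smul_mem hX α (h1 e u hu)
  rwa [smul_indTensor, mul_one] at this

theorem indTensor_one_mem_indGr {n e : ℕ} {u : C.U n} (hu : u ∈ C.gr n e) :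
    indTensor (C.act n) 1 u ∈ C.indGr n e := by
  rw [← dMonomial_zero]
  exact mem_indGr hu (by simp)

theorem indGr_stable {n : ℕ}
    (hact : ∀ (a : AHA n) (d : ℕ), ∀ u ∈ C.gr n d, C.act n a u ∈ C.gr n d) (d : ℕ)
    {x : IndSpace n (C.act n)} (hx : x ∈ C.indGr n d) :
    (∀ i, dT n i • x ∈ C.indGr n d) ∧ dPi n • x ∈ C.indGr n d := by
  let G : ℕ → Submodule Kqt (IndSpace n (C.act n)) := C.indGr n
  have hGX : ∀ d j, ∀ x ∈ G d, dX n j • x ∈ G (d + 1) := fun d j => dX_smul_mem_indGr n d j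
  let L := Algebra.lsmul Kqt Kqt (IndSpace n (C.act n)) (A := DAHA n)
  -- Stability is put into the family itself: `N d` contains the vectors of degree d that all T_i
  -- and π keep in degree d. It contains 1 ⊗ u for u of degree d and is raised by the X_j, hence it
  -- exhausts the component.
  let N : ℕ → Submodule Kqt (IndSpace n (C.act n)) := fun d =>
    G d ⊓ (⨅ i, (G d).comap (L (dT n i))) ⊓ (G d).comap (L (dPi n))
  have hN : ∀ d (x : IndSpace n (C.act n)), x ∈ N d ↔
      (x ∈ G d ∧ ∀ i, dT n i • x ∈ G d) ∧ dPi n • x ∈ G d := by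
    intro d x
    change ((x ∈ G d ∧ x ∈ ⨅ i, (G d).comap (L (dT n i))) ∧ dPi n • x ∈ G d) ↔ _
    rw [Submodule.mem_iInf]
    rfl
  have key : G d ≤ N d := by
    refine indGr_le (N := N) (fun e u hu => ?_) (fun d j x hx => ?_) d
    · rw [hN]
      refine ⟨⟨indTensor_one_mem_indGr hu, fun i => ?_⟩, ?_⟩
      · exact (indTensor_coe (C.act n) (aT n i) u) ▸ indTensor_one_mem_indGr (hact _ _ _ hu)
      · exact (indTensor_coe (C.act n) (aPi n) u) ▸ indTensor_one_mem_indGr (hact _ _ _ hu)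
    · rw [hN] at hx ⊢
      obtain ⟨⟨hx1, hx2⟩, hx3⟩ := hx
      refine ⟨⟨hGX _ _ _ hx1, fun i => ?_⟩, ?_⟩
      · rw [dT_smul_dX_smul]
        split_ifs
        · exact Submodule.add_mem _ (hGX _ _ _ (hx2 i)) (Submodule.smul_mem _ _ (hGX _ _ _ hx1))
        · exact Submodule.sub_mem _ (hGX _ _ _ (hx2 i)) (Submodule.smul_mem _ _ (hGX _ _ _ hx1))
        · exact hGX _ _ _ (hx2 i)
        · exact Submodule.zero_mem _
      · rw [dPi_smul_dX_smul]
        split_ifs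
        · exact hGX _ _ _ hx3
        · exact Submodule.smul_mem _ _ (hGX _ _ _ hx3)
        · exact Submodule.zero_mem _
  have := (hN d x).mp (key hx)
  exact ⟨this.1.2, this.2⟩

theorem smul_mem_indGr {n : ℕ}
    (hact : ∀ (a : AHA n) (d : ℕ), ∀ u ∈ C.gr n d, C.act n a u ∈ C.gr n d) (d : ℕ) (a : AHA n)
    {x : IndSpace n (C.act n)} (hx : x ∈ C.indGr n d) :
    (a : DAHA n) • x ∈ C.indGr n d := by
  let G : Submodule Kqt (IndSpace n (C.act n)) := C.indGr n d
  let B : Subalgebra Kqt (DAHA n) :=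
    { carrier := {a | ∀ x ∈ G, a • x ∈ G}
      mul_mem' := fun {a b} ha hb x hx => by rw [mul_smul]; exact ha _ (hb x hx)
      add_mem' := fun {a b} ha hb x hx => by rw [add_smul]; exact G.add_mem (ha x hx) (hb x hx)
      algebraMap_mem' := fun c x hx => by rw [algebraMap_smul]; exact G.smul_mem c hx }
  have hB : AHA n ≤ B := AHA_le (fun i x hx => (indGr_stable hact d hx).1 i)
    (fun x hx => (indGr_stable hact d hx).2)
  exact hB a.2 x hx

theorem indGr_isInternal {n : ℕ} (hn : 1 ≤ n) (h : DirectSum.IsInternal (C.gr n)) :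
    DirectSum.IsInternal (C.indGr n) := by
  classical
  obtain ⟨P, hP1, hP2⟩ := exists_proj_of_isInternal h
  -- The projection onto degree d sends X^α ⊗ u to X^α tensored with the component of u of degree d
  -- - |α|. The case distinction guards against truncated subtraction when |α| > d.
  let g : ℕ → (ℕ → ℕ) → C.U n →ₗ[Kqt] IndSpace n (C.act n) := fun d α =>
    if ∑ i ∈ Finset.Icc 1 n, α i ≤ d then
      indTensorHom (C.act n) (dMonomial n α) ∘ₗ P (d - ∑ i ∈ Finset.Icc 1 n, α i) else 0
  have hg : ∀ d (α β : ℕ → ℕ), (∀ i, 1 ≤ i → i ≤ n → α i = β i) → g d α = g d β := by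
    intro d α β hab
    have e : ∑ i ∈ Finset.Icc 1 n, α i = ∑ i ∈ Finset.Icc 1 n, β i :=
      Finset.sum_congr rfl fun i hi => hab i (Finset.mem_Icc.mp hi).1 (Finset.mem_Icc.mp hi).2
    simp only [g, e, dMonomial_congr hab]
  have hval : ∀ d α u, indMonomialLift (C.act n) hn (g d) (indTensor (C.act n) (dMonomial n α) u) =
      g d α u := fun d α u => indMonomialLift_dMonomial _ hn _ (hg d) α u
  refine isInternal_of_proj (fun d => indMonomialLift (C.act n) hn (g d)) (fun d x hx => ?_)
    (fun d e hde x hx => ?_) (eq_top_iff.mpr ?_)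
  · induction hx using Submodule.span_induction with
    | mem x hx =>
      obtain ⟨α, e, u, hu, rfl, rfl⟩ := hx
      rw [hval]
      simp only [g]
      rw [if_pos (by omega), LinearMap.comp_apply, Nat.add_sub_cancel_left, hP1 e u hu]
      rfl
    | zero => exact map_zero _
    | add x y _ _ hx hy => rw [map_add, hx, hy]
    | smul c x _ hx => rw [map_smul, hx]
  · induction hx using Submodule.span_induction with
    | mem x hx =>
      obtain ⟨α, e, u, hu, rfl, rfl⟩ := hx
      rw [hval]
      simp only [g]
      split_ifs with h1
      · rw [LinearMap.comp_apply, hP2 _ e (by omega) u hu, map_zero]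
      · rfl
    | zero => exact map_zero _
    | add x y _ _ hx hy => rw [map_add, hx, hy, add_zero]
    | smul c x _ hx => rw [map_smul, hx, smul_zero]
  · rw [← span_indTensor_dMonomial]
    refine Submodule.span_le.mpr ?_
    rintro x ⟨α, u, rfl⟩
    have hu : u ∈ ⨆ d, C.gr n d := by rw [h.submodule_iSup_eq_top]; exact Submodule.mem_top
    have : ⨆ d, C.gr n d ≤ (⨆ d, C.indGr n d).comap
        (indTensorHom (C.act n) (dMonomial n α)) := by
      refine iSup_le fun e u hu => ?_
      exact Submodule.mem_iSup_of_mem ((∑ i ∈ Finset.Icc 1 n, α i) + e) (mem_indGr hu rfl)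
    exact this hu

end Grading

/-! ### Compatibility of the induced sequence -/

section Maps

variable {n : ℕ} {p : IndSpace (n + 1) (C.act (n + 1)) →ₗ[Kqt] IndSpace n (C.act n)}

theorem IsIndMap.apply_one (hp : C.IsIndMap n p) (u : C.U (n + 1)) :
    p (indTensor (C.act (n + 1)) 1 u) = indTensor (C.act n) 1 (C.κ n u) := by
  have := hp (fun _ => 0) u
  rwa [dMonomial_zero, dMonomial_zero, if_pos rfl] at this

/-- Note that `X_{n+1}` is zero in `𝒟_n⁺`. -/
theorem IsIndMap.apply_dX_smul (hp : C.IsIndMap n p) (j : ℕ)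
    (x : IndSpace (n + 1) (C.act (n + 1))) : p (dX (n + 1) j • x) = dX n j • p x := by
  by_cases hj : 1 ≤ j ∧ j ≤ n + 1
  · have key : p ∘ₗ (Algebra.lsmul Kqt Kqt (IndSpace (n + 1) (C.act (n + 1))) (dX (n + 1) j)) =
        (Algebra.lsmul Kqt Kqt (IndSpace n (C.act n)) (dX n j)) ∘ₗ p := by
      refine ind_hom_ext_dMonomial _ fun α u => ?_
      change p (indTensor (C.act (n + 1)) (dX (n + 1) j * dMonomial (n + 1) α) u) =
        dX n j • p (indTensor (C.act (n + 1)) (dMonomial (n + 1) α) u)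
      rw [dX_mul_dMonomial hj.1 hj.2, hp, hp]
      rcases hj.2.lt_or_eq with h | rfl
      · rw [Function.update_of_ne (by omega)]
        split_ifs
        · rw [smul_indTensor, dX_mul_dMonomial hj.1 (by omega)]
        · rw [smul_zero]
      · rw [Function.update_self, if_neg (by omega), dX_out n (by omega), zero_smul]
    exact LinearMap.congr_fun key x
  · rw [dX_out (n + 1) hj, dX_out n (by omega), zero_smul, zero_smul, map_zero]

/-- On 1 ⊗ u this is the linearity of κ. For i < n the formula for moving T_i past X_j is the same
in ranks n and n + 1, also for j = n + 1, where X_j becomes zero in rank n. -/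
theorem IsIndMap.apply_dT_smul (hp : C.IsIndMap n p)
    (hκ : ∀ i, 1 ≤ i → i < n → ∀ u,
      C.κ n (C.act (n + 1) (aT (n + 1) i) u) = C.act n (aT n i) (C.κ n u))
    {i : ℕ} (h1 : 1 ≤ i) (h2 : i < n) (x : IndSpace (n + 1) (C.act (n + 1))) :
    p (dT (n + 1) i • x) = dT n i • p x := by
  have key : p ∘ₗ (Algebra.lsmul Kqt Kqt (IndSpace (n + 1) (C.act (n + 1))) (dT (n + 1) i)) =
      (Algebra.lsmul Kqt Kqt (IndSpace n (C.act n)) (dT n i)) ∘ₗ p := by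
    refine ind_hom_ext _ (fun u => ?_) (fun j x hx => ?_)
    · change p (dT (n + 1) i • indTensor _ 1 u) = dT n i • p (indTensor _ 1 u)
      rw [hp.apply_one]
      refine (congrArg p (indTensor_coe (C.act (n + 1)) (aT (n + 1) i) u)).trans ?_
      rw [hp.apply_one, hκ i h1 h2]
      exact (indTensor_coe (C.act n) (aT n i) _).symm
    · change p (dT (n + 1) i • x) = dT n i • p x at hx
      change p (dT (n + 1) i • dX (n + 1) j • x) = dT n i • p (dX (n + 1) j • x)
      rw [hp.apply_dX_smul, dT_smul_dX_smul, dT_smul_dX_smul,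
        if_pos (show 1 ≤ i ∧ i < n + 1 from ⟨h1, by omega⟩),
        if_pos (show 1 ≤ i ∧ i < n from ⟨h1, h2⟩)]
      split_ifs
      · rw [map_add, p.map_smul, hp.apply_dX_smul, hp.apply_dX_smul, hx]
      · rw [map_sub, p.map_smul, hp.apply_dX_smul, hp.apply_dX_smul, hx]
      · rw [hp.apply_dX_smul, hx]
  exact LinearMap.congr_fun key x

theorem IsIndMap.apply_dPi_smul (hp : C.IsIndMap n p) (hn : 1 ≤ n)
    (hκ : ∀ u, C.κ n (C.act (n + 1) (aPi (n + 1) * aT (n + 1) n) u) = C.act n (aPi n) (C.κ n u))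
    (x : IndSpace (n + 1) (C.act (n + 1))) :
    p ((dPi (n + 1) * dT (n + 1) n) • x) = dPi n • p x := by
  have key : p ∘ₗ (Algebra.lsmul Kqt Kqt (IndSpace (n + 1) (C.act (n + 1)))
      (dPi (n + 1) * dT (n + 1) n)) = (Algebra.lsmul Kqt Kqt (IndSpace n (C.act n)) (dPi n)) ∘ₗ p := by
    refine ind_hom_ext _ (fun u => ?_) (fun j x hx => ?_)
    · change p ((dPi (n + 1) * dT (n + 1) n) • indTensor _ 1 u) = dPi n • p (indTensor _ 1 u)
      rw [hp.apply_one]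
      refine (congrArg p (indTensor_coe (C.act (n + 1)) (aPi (n + 1) * aT (n + 1) n) u)).trans ?_
      rw [hp.apply_one, hκ]
      exact (indTensor_coe (C.act n) (aPi n) _).symm
    · change p ((dPi (n + 1) * dT (n + 1) n) • x) = dPi n • p x at hx
      change p ((dPi (n + 1) * dT (n + 1) n) • dX (n + 1) j • x) = dPi n • p (dX (n + 1) j • x)
      rw [mul_smul] at hx ⊢
      have hX0 : dX n (n + 1) = 0 := dX_out n (by omega)
      rw [hp.apply_dX_smul, dT_smul_dX_smul, if_pos (show 1 ≤ n ∧ n < n + 1 from ⟨hn, by omega⟩)]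
      by_cases e1 : j = n
      -- Case j = n: T_n turns X_n into X_{n+1}, which π^(n+1) returns as t X_1, as π^(n) does with
      -- X_n in rank n. The correction term becomes a multiple of X_{n+1} under π and is killed.
      · subst e1
        rw [if_pos rfl, smul_add, smul_comm (dPi (j + 1)) (1 - q), dPi_smul_dX_smul,
          dPi_smul_dX_smul, dPi_smul_dX_smul, if_neg (show ¬ (1 ≤ j + 1 ∧ j + 1 < j + 1) by omega),
          if_pos (show 1 ≤ j + 1 ∧ j + 1 = j + 1 by omega),
          if_pos (show 1 ≤ j ∧ j < j + 1 by omega), if_neg (show ¬ (1 ≤ j ∧ j < j) by omega),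
          if_pos (show 1 ≤ j ∧ j = j by omega), map_add, p.map_smul, p.map_smul, hp.apply_dX_smul,
          hp.apply_dX_smul, hx, hX0, zero_smul, smul_zero, add_zero]
      by_cases e2 : j = n + 1
      -- Case j = n + 1: both terms of T_n X_{n+1} carry X_n on the left, which π moves to X_{n+1},
      -- so everything is killed.
      · subst e2
        rw [if_neg (by omega), if_pos rfl, smul_sub, smul_comm (dPi (n + 1)) (1 - q),
          dPi_smul_dX_smul, dPi_smul_dX_smul, if_pos (show 1 ≤ n ∧ n < n + 1 by omega),
          if_pos (show 1 ≤ n ∧ n < n + 1 by omega), map_sub, p.map_smul, hp.apply_dX_smul,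
          hp.apply_dX_smul, hX0, zero_smul, zero_smul, zero_smul, smul_zero, smul_zero, sub_zero]
      rw [if_neg e1, if_neg e2, dPi_smul_dX_smul, dPi_smul_dX_smul]
      by_cases e3 : 1 ≤ j ∧ j < n
      · rw [if_pos (show 1 ≤ j ∧ j < n + 1 by omega), if_pos e3, hp.apply_dX_smul, hx]
      · rw [if_neg (show ¬ (1 ≤ j ∧ j < n + 1) by omega), if_neg e3,
          if_neg (show ¬ (1 ≤ j ∧ j = n + 1) by omega), if_neg (show ¬ (1 ≤ j ∧ j = n) by omega),
          map_zero]
  exact LinearMap.congr_fun key x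

end Maps

theorem IsPreCompatible.ind_isCompatible (hC : C.IsPreCompatible)
    {p : ∀ n, IndSpace (n + 1) (C.act (n + 1)) →ₗ[Kqt] IndSpace n (C.act n)}
    (hp : ∀ n, C.n₀ ≤ n → C.IsIndMap n (p n)) : (C.ind p).IsCompatible where
  one_le := hC.one_le
  internal n hn := indGr_isInternal (hC.one_le.trans hn) (hC.internal n hn)
  T_mem n hn i d _ hv := smul_mem_indGr (hC.act_mem n hn) d (aT n i) hv
  Y_mem n hn i d _ hv := smul_mem_indGr (hC.act_mem n hn) d (aY n i) hv
  X_mem n _ i d v hv := dX_smul_mem_indGr n d i v hv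
  proj_mem n hn d v hv := by
    have : C.indGr (n + 1) d ≤ (C.indGr n d).comap (p n) := by
      refine Submodule.span_le.mpr ?_
      rintro x ⟨α, e, u, hu, hd, rfl⟩
      change p n _ ∈ C.indGr n d
      rw [hp n hn]
      split_ifs with h
      · rw [Finset.sum_Icc_succ_top (by omega), h, add_zero] at hd
        exact mem_indGr (hC.κ_mem n hn e u hu) hd
      · exact Submodule.zero_mem _
    exact this hv
  proj_T n hn _ h1 h2 v := (hp n hn).apply_dT_smul (hC.κ_T n hn) h1 h2 v
  proj_X n hn i _ _ v := (hp n hn).apply_dX_smul i v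
  proj_X_last n hn v := by
    refine ((hp n hn).apply_dX_smul (n + 1) v).trans ?_
    rw [dX_out n (by omega)]
    exact zero_smul (DAHA n) (p n v)
  proj_pi n hn v := (hp n hn).apply_dPi_smul (hC.one_le.trans hn) (hC.κ_pi n hn) v

end AHASequence

/-! ### Fillings and their restrictions -/

section Fillings

variable {μ : YoungDiagram} {n : ℕ}

/-- Standardness is expressed through the positions of the entries alone, which allows tableaux of
different shapes to be compared. -/
theorem monotone_iff_cellOf (f : Filling μ n) : Monotone f ↔
    ∀ i j, 1 ≤ i → i ≤ n → 1 ≤ j → j ≤ n → cellOf f i ≤ cellOf f j → i ≤ j := by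
  constructor
  · intro hf i j h1 h2 h3 h4 hle
    by_contra hlt
    exact not_cell_le hf h3 (by omega) h2 hle
  · intro h x y hxy
    have hx := Finset.mem_Icc.mp (f x).2
    have hy := Finset.mem_Icc.mp (f y).2
    refine h _ _ hx.1 hx.2 hy.1 hy.2 ?_
    rw [cellOf_apply, cellOf_apply]
    exact hxy

theorem hom_ext_basisVec {M : Type*} [AddCommGroup M] [Module Kqt M]
    {φ ψ : SpechtSpace μ n →ₗ[Kqt] M}
    (h : ∀ f : Filling μ n, Monotone f → φ (basisVec f) = ψ (basisVec f)) : φ = ψ := by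
  refine Finsupp.lhom_ext' fun τ => LinearMap.ext_ring ?_
  have := h τ.fill τ.mono
  rw [basisVec, dif_pos τ.mono] at this
  exact this

theorem exists_filling (hμ : μ.card = n) (c : ℕ → ℕ × ℕ)
    (h1 : ∀ i, 1 ≤ i → i ≤ n → c i ∈ μ.cells)
    (h2 : ∀ i j, 1 ≤ i → i ≤ n → 1 ≤ j → j ≤ n → c i = c j → i = j) :
    ∃ f : Filling μ n, ∀ i, 1 ≤ i → i ≤ n → cellOf f i = c i := by
  let g : {m : ℕ // m ∈ Finset.Icc 1 n} → {c : ℕ × ℕ // c ∈ μ.cells} := fun i =>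
    ⟨c i.1, h1 i.1 (Finset.mem_Icc.mp i.2).1 (Finset.mem_Icc.mp i.2).2⟩
  have hg : Function.Bijective g := by
    rw [Fintype.bijective_iff_injective_and_card]
    refine ⟨fun i j hij => Subtype.ext ?_, ?_⟩
    · have hi := Finset.mem_Icc.mp i.2
      have hj := Finset.mem_Icc.mp j.2
      exact h2 _ _ hi.1 hi.2 hj.1 hj.2 (congrArg Subtype.val hij)
    · rw [Fintype.card_coe, Fintype.card_coe, Nat.card_Icc]
      change n + 1 - 1 = μ.card
      omega
  refine ⟨(Equiv.ofBijective g hg).symm, fun i hi hi' => ?_⟩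
  rw [cellOf, dif_pos (Finset.mem_Icc.mpr ⟨hi, hi'⟩)]
  rfl

/-- Every Young diagram has a standard tableau. -/
theorem exists_standard_filling (μ : YoungDiagram) : ∃ f : Filling μ μ.card, Monotone f := by
  -- Boxes are numbered in the lexicographic order, which refines the product order.
  let s : Finset (ℕ ×ₗ ℕ) := μ.cells.map toLex.toEmbedding
  have hs : s.card = μ.card := Finset.card_map _
  let e := s.orderEmbOfFin hs
  have he : ∀ i, ofLex (e i) ∈ μ.cells := by
    intro i
    have := s.orderEmbOfFin_mem hs i
    rw [Finset.mem_map] at this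
    obtain ⟨x, hx, hx'⟩ := this
    have : ofLex (e i) = x := by
      change ofLex (s.orderEmbOfFin hs i) = x
      rw [← hx']
      rfl
    rwa [this]
  let c : ℕ → ℕ × ℕ := fun i => if h : i - 1 < μ.card then ofLex (e ⟨i - 1, h⟩) else (0, 0)
  have hc : ∀ i, 1 ≤ i → i ≤ μ.card → ∃ h : i - 1 < μ.card, c i = ofLex (e ⟨i - 1, h⟩) :=
    fun i h1 h2 => ⟨by omega, dif_pos (by omega)⟩
  have hmono : ∀ i j, 1 ≤ i → i ≤ μ.card → 1 ≤ j → j ≤ μ.card → c i ≤ c j → i ≤ j := by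
    intro i j h1 h2 h3 h4 hij
    obtain ⟨a, ha⟩ := hc i h1 h2
    obtain ⟨b, hb⟩ := hc j h3 h4
    rw [ha, hb] at hij
    have h5 : e ⟨i - 1, a⟩ ≤ e ⟨j - 1, b⟩ := Prod.Lex.toLex_mono hij
    rw [e.le_iff_le, Fin.mk_le_mk] at h5
    omega
  obtain ⟨f, hf⟩ := exists_filling (μ := μ) rfl c
    (fun i h1 h2 => by obtain ⟨a, ha⟩ := hc i h1 h2; rw [ha]; exact he _)
    (fun i j h1 h2 h3 h4 h => le_antisymm (hmono i j h1 h2 h3 h4 h.le)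
      (hmono j i h3 h4 h1 h2 h.ge))
  refine ⟨f, (monotone_iff_cellOf f).mpr fun i j h1 h2 h3 h4 h => ?_⟩
  rw [hf i h1 h2, hf j h3 h4] at h
  exact hmono i j h1 h2 h3 h4 h

end Fillings

/-! ### Restriction of fillings from λ^(n+1) to λ^(n), and linearity of κ -/

section Lam

variable {lam : YoungDiagram} {n : ℕ}

theorem card_lamDiagram (hn : lam.card + lam.rowLen 0 ≤ n) : (lamDiagram lam n).card = n := by
  change (lamDiagram lam n).cells.card = n
  have hcard : lam.cells.card = lam.card := rfl
  rw [lamDiagram, Finset.card_union_of_disjoint, Finset.card_image_of_injective,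
    Finset.card_image_of_injective, Finset.card_range, hcard]
  · omega
  · rintro ⟨a, b⟩ ⟨c, d⟩ h
    simpa using h
  · intro a b h
    simpa using h
  · rw [Finset.disjoint_left]
    intro x hx hx'
    obtain ⟨j, -, rfl⟩ := Finset.mem_image.mp hx
    obtain ⟨c, -, h⟩ := Finset.mem_image.mp hx'
    simp at h

theorem lamDiagram_mono {m : ℕ} (h : m ≤ n) {c : ℕ × ℕ} (hc : c ∈ (lamDiagram lam m).cells) :
    c ∈ (lamDiagram lam n).cells := by
  rw [mem_lamDiagram] at hc ⊢
  rcases hc with hc | hc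
  · left; omega
  · exact Or.inr hc

theorem corner_notMem (hn : lam.card + lam.rowLen 0 ≤ n) {j : ℕ} (hj : n - lam.card ≤ j)
    {c : ℕ × ℕ} (hc : (0, j) ≤ c) : c ∉ (lamDiagram lam n).cells := by
  intro h
  have h0 : (0, j) ∈ (lamDiagram lam n).cells := (lamDiagram lam n).isLowerSet hc h
  rw [mem_lamDiagram] at h0
  simp only at h0
  omega

theorem mem_lamDiagram_of_ne (hn : lam.card + lam.rowLen 0 ≤ n) {c : ℕ × ℕ}
    (hc : c ∈ (lamDiagram lam (n + 1)).cells) (hne : c ≠ (0, n - lam.card)) :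
    c ∈ (lamDiagram lam n).cells := by
  obtain ⟨a, b⟩ := c
  rw [mem_lamDiagram] at hc ⊢
  rcases hc with hc | hc
  · simp only [ne_eq, Prod.mk.injEq] at hc hne ⊢
    left; omega
  · exact Or.inr hc

/-- `g` is the restriction of the filling `f` to its boxes with entries at most `n`. -/
def RestrictsTo (f : Filling (lamDiagram lam (n + 1)) (n + 1)) (g : Filling (lamDiagram lam n) n) :
    Prop := ∀ i, 1 ≤ i → i ≤ n → cellOf g i = cellOf f i

theorem exists_restrictsTo (hn : lam.card + lam.rowLen 0 ≤ n)
    {f : Filling (lamDiagram lam (n + 1)) (n + 1)} (h : cellOf f (n + 1) = (0, n - lam.card)) :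
    ∃ g, RestrictsTo f g :=
  exists_filling (card_lamDiagram hn) (cellOf f)
    (fun i h1 h2 => mem_lamDiagram_of_ne hn (cellOf_mem f h1 (by omega)) fun h' => by
      have := cellOf_inj f h1 (by omega) (by omega) le_rfl (h'.trans h.symm)
      omega)
    (fun i j h1 h2 h3 h4 h => cellOf_inj f h1 (by omega) h3 (by omega) h)

/-- The box with entry n + 1 imposes no condition: its entry is the largest, and no box of λ^(n)
lies weakly to the right of it and below it. -/
theorem RestrictsTo.monotone_iff (hn : lam.card + lam.rowLen 0 ≤ n)
    {f : Filling (lamDiagram lam (n + 1)) (n + 1)} {g : Filling (lamDiagram lam n) n}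
    (h : cellOf f (n + 1) = (0, n - lam.card)) (hg : RestrictsTo f g) :
    Monotone g ↔ Monotone f := by
  rw [monotone_iff_cellOf, monotone_iff_cellOf]
  constructor
  · intro H i j h1 h2 h3 h4 hle
    by_cases hj : j = n + 1
    · omega
    by_cases hi : i = n + 1
    · rw [hi, h, ← hg j h3 (by omega)] at hle
      exact absurd (cellOf_mem g h3 (by omega)) (corner_notMem hn le_rfl hle)
    · rw [← hg i h1 (by omega), ← hg j h3 (by omega)] at hle
      exact H i j h1 (by omega) h3 (by omega) hle
  · intro H i j h1 h2 h3 h4 hle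
    rw [hg i h1 h2, hg j h3 h4] at hle
    exact H i j h1 (by omega) h3 (by omega) hle

/-- The rule for κ is extended to all fillings; for nonstandard ones both basis vectors are zero.
Linearity can then be checked without asking whether s_i f is standard. -/
theorem kappaLam_of_eq (hn : lam.card + lam.rowLen 0 ≤ n)
    {f : Filling (lamDiagram lam (n + 1)) (n + 1)} {g : Filling (lamDiagram lam n) n}
    (h : cellOf f (n + 1) = (0, n - lam.card)) (hg : RestrictsTo f g) :
    kappaLam lam n (basisVec f) = basisVec g := by
  by_cases hf : Monotone f
  · have hg' := (hg.monotone_iff hn h).mpr hf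
    rw [basisVec, dif_pos hf, kappaLam, Finsupp.linearCombination_single, one_smul]
    have hex : ∃ σ : SYT (lamDiagram lam n) n, IsRestriction (⟨f, hf⟩ : SYT _ _) σ :=
      ⟨⟨g, hg'⟩, hg⟩
    have hspec := hex.choose_spec
    have heq : hex.choose.fill = g := filling_ext fun j h1 h2 =>
      (hspec j h1 h2).trans (hg j h1 h2).symm
    rw [dif_pos (show _ ∧ _ from ⟨h, hex⟩), basisVec, dif_pos hg']
    congr 1
    revert heq
    generalize hex.choose = σ
    obtain ⟨s, hs⟩ := σ
    rintro rfl
    rfl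
  · have hg' := fun h' => hf ((hg.monotone_iff hn h).mp h')
    rw [basisVec, dif_neg hf, map_zero, basisVec, dif_neg hg']

theorem kappaLam_of_ne {f : Filling (lamDiagram lam (n + 1)) (n + 1)}
    (h : cellOf f (n + 1) ≠ (0, n - lam.card)) : kappaLam lam n (basisVec f) = 0 := by
  by_cases hf : Monotone f
  · rw [basisVec, dif_pos hf, kappaLam, Finsupp.linearCombination_single, one_smul,
      dif_neg fun h' => h h'.1]
  · rw [basisVec, dif_neg hf, map_zero]

theorem RestrictsTo.content_eq {f : Filling (lamDiagram lam (n + 1)) (n + 1)}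
    {g : Filling (lamDiagram lam n) n} (hg : RestrictsTo f g) {i : ℕ} (h1 : 1 ≤ i) (h2 : i ≤ n) :
    content f i = content g i := by
  rw [content, content, hg i h1 h2]

theorem RestrictsTo.swapFilling {f : Filling (lamDiagram lam (n + 1)) (n + 1)}
    {g : Filling (lamDiagram lam n) n} (hg : RestrictsTo f g) {i : ℕ} (h1 : 1 ≤ i) (h2 : i < n) :
    RestrictsTo (swapFilling i f) (swapFilling i g) := by
  intro j h3 h4
  by_cases a : j = i
  · subst a
    rw [cellOf_swap_left _ h1 h2, cellOf_swap_left _ h1 (by omega), hg _ (by omega) (by omega)]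
  by_cases b : j = i + 1
  · subst b
    rw [cellOf_swap_right _ h1 h2, cellOf_swap_right _ h1 (by omega), hg _ (by omega) (by omega)]
  rw [cellOf_swap_of_ne _ a b, cellOf_swap_of_ne _ a b, hg _ h3 h4]

/-- The map `κ_λ^(n)` is `ℋ_n`-linear. -/
theorem kappaLam_seminormalT (hn : lam.card + lam.rowLen 0 ≤ n) {i : ℕ} (h1 : 1 ≤ i) (h2 : i < n) :
    kappaLam lam n ∘ₗ seminormalT (lamDiagram lam (n + 1)) (n + 1) i =
      seminormalT (lamDiagram lam n) n i ∘ₗ kappaLam lam n := by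
  refine hom_ext_basisVec fun f _ => ?_
  rw [LinearMap.comp_apply, LinearMap.comp_apply, seminormalT_basisVec f h1 (by omega), map_add,
    map_smul, map_smul]
  -- For i < n the exchange leaves the entry n + 1 in place, so f and s_i f fall into the same case
  -- of κ. If they restrict, the contents of i and i + 1, and with them the coefficients, are
  -- unchanged.
  have hs : cellOf (swapFilling i f) (n + 1) = cellOf f (n + 1) :=
    cellOf_swap_of_ne f (by omega) (by omega)
  by_cases h : cellOf f (n + 1) = (0, n - lam.card)
  · obtain ⟨g, hg⟩ := exists_restrictsTo hn h
    rw [kappaLam_of_eq hn h hg, kappaLam_of_eq hn (hs.trans h) (hg.swapFilling h1 h2),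
      seminormalT_basisVec g h1 h2, hg.content_eq h1 h2.le, hg.content_eq (by omega) h2]
  · rw [kappaLam_of_ne h, kappaLam_of_ne (hs ▸ h), map_zero, smul_zero, smul_zero, add_zero]

end Lam

/-! ### The sequence `C_λ` is pre-compatible -/

section SeqLam

variable {lam : YoungDiagram} {n : ℕ}

theorem seqLam_act_T {i : ℕ} (h1 : 1 ≤ i) (h2 : i < n) :
    (seqLam lam).act n (aT n i) = seminormalT (lamDiagram lam n) n i := by
  have h : rho n (aT n i) = ⟨dT n i, dT_mem_Hecke n i⟩ := Subtype.ext (rho_T n i h1 h2)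
  change spechtAct (lamDiagram lam n) n (rho n (aT n i)) = _
  rw [h, spechtAct_T]

/-- The factor T_n cancels the last inverse in ρ(π^(n+1)). What remains has the same form as
ρ(π^(n)), so the condition on π reduces to ℋ_n-linearity of κ. -/
theorem rho_aPi_mul_aT (hn : 1 ≤ n) :
    (rho (n + 1) (aPi (n + 1) * aT (n + 1) n) : DAHA (n + 1)) =
      prodUpTo (dTinv (n + 1)) (n - 1) := by
  rw [map_mul, MulMemClass.coe_mul, rho_pi _ (by omega), rho_T _ _ hn (by omega)]
  obtain ⟨m, rfl⟩ := Nat.exists_eq_add_of_le' hn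
  rw [Nat.add_sub_cancel, Nat.add_sub_cancel, prodUpTo, mul_assoc,
    dTinv_mul_dT _ (by omega) (by omega), mul_one]

theorem spechtAct_prodUpTo (μ : YoungDiagram) {m : ℕ} {x : Hecke n}
    (hx : (x : DAHA n) = prodUpTo (dTinv n) m) :
    spechtAct μ n x = prodUpTo
      (fun i => heckeInv (seminormalT μ n i : Module.End Kqt (SpechtSpace μ n))) m := by
  have h : x = prodUpTo (fun i => heckeInv (⟨dT n i, dT_mem_Hecke n i⟩ : Hecke n)) m := by
    refine Subtype.ext (hx.trans ?_)
    change _ = (Hecke n).val _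
    rw [map_prodUpTo]
    congr 1
  rw [h, map_prodUpTo]
  congr 1
  funext i
  exact (map_heckeInv (spechtAct μ n) _).trans 
    (congrArg (heckeInv (R := Module.End Kqt (SpechtSpace μ n))) (spechtAct_T μ n i))

theorem kappaLam_prodUpTo_inv (hn : lam.card + lam.rowLen 0 ≤ n) (m : ℕ) (hm : m < n)
    (u : SpechtSpace (lamDiagram lam (n + 1)) (n + 1)) :
    kappaLam lam n (prodUpTo (fun i => heckeInv (seminormalT (lamDiagram lam (n + 1)) (n + 1) i :
        Module.End Kqt _)) m u) =
      prodUpTo (fun i => heckeInv (seminormalT (lamDiagram lam n) n i : Module.End Kqt _)) m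
        (kappaLam lam n u) := by
  induction m generalizing u with
  | zero => rfl
  | succ m ih =>
    rw [prodUpTo, prodUpTo, Module.End.mul_apply, Module.End.mul_apply, ih (by omega)]
    congr 1
    have h := LinearMap.congr_fun (kappaLam_seminormalT hn (by omega : 1 ≤ m + 1) hm) u
    rw [LinearMap.comp_apply, LinearMap.comp_apply] at h
    simp only [heckeInv, Algebra.algebraMap_eq_smul_one, LinearMap.smul_apply, LinearMap.add_apply,
      Module.End.one_apply, map_smul, map_add, h]

theorem map_mem_ite_top {V W : Type*} [AddCommGroup V] [Module Kqt V] [AddCommGroup W]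
    [Module Kqt W] (f : V →ₗ[Kqt] W) {P : Prop} [Decidable P] {u : V}
    (hu : u ∈ if P then (⊤ : Submodule Kqt V) else ⊥) :
    f u ∈ if P then (⊤ : Submodule Kqt W) else ⊥ := by
  split_ifs at hu ⊢
  · trivial
  · rw [Submodule.mem_bot] at hu ⊢
    rw [hu, map_zero]

theorem isInternal_ite_top (V : Type*) [AddCommGroup V] [Module Kqt V] :
    DirectSum.IsInternal fun d : ℕ => if d = 0 then (⊤ : Submodule Kqt V) else ⊥ := by
  refine isInternal_of_proj (fun d => if d = 0 then LinearMap.id else 0) ?_ ?_ ?_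
  · intro d x hx
    by_cases hd : d = 0
    · rw [if_pos hd, LinearMap.id_apply]
    · rw [if_neg hd, Submodule.mem_bot] at hx
      rw [hx, map_zero]
  · intro d e hde x hx
    by_cases hd : d = 0
    · rw [if_neg (by omega), Submodule.mem_bot] at hx
      rw [hx, map_zero]
    · rw [if_neg hd, LinearMap.zero_apply]
  · exact top_le_iff.mp
      (le_iSup (fun d : ℕ => if d = 0 then (⊤ : Submodule Kqt V) else ⊥) 0)

theorem seqLam_isPreCompatible (lam : YoungDiagram) : (seqLam lam).IsPreCompatible where
  one_le := le_max_left _ _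
  internal n _ := isInternal_ite_top (SpechtSpace (lamDiagram lam n) n)
  act_mem n _ a _ _ hu := map_mem_ite_top ((seqLam lam).act n a) hu
  κ_mem n _ _ _ hu := map_mem_ite_top (kappaLam lam n) hu
  κ_T n hn i h1 h2 u := by
    rw [seqLam_act_T h1 h2, seqLam_act_T h1 (by omega)]
    exact LinearMap.congr_fun (kappaLam_seminormalT ((le_max_right _ _).trans hn) h1 h2) u
  κ_pi n hn u := by
    have hn' : 1 ≤ n := (le_max_left _ _).trans hn
    change kappaLam lam n (spechtAct (lamDiagram lam (n + 1)) (n + 1) (rho (n + 1) _) u) =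
      spechtAct (lamDiagram lam n) n (rho n (aPi n)) (kappaLam lam n u)
    rw [spechtAct_prodUpTo _ (rho_aPi_mul_aT hn'), spechtAct_prodUpTo _ (rho_pi n hn')]
    exact kappaLam_prodUpTo_inv ((le_max_right _ _).trans hn) (n - 1) (by omega) u

end SeqLam

/-! ### A nonzero element of `𝔏_•` -/

/-- Compatible standard tableaux of the shapes `λ^(n)`: the entries beyond the first index lie in the
first row. -/
theorem exists_stable_filling (lam : YoungDiagram) : ∃ c : ℕ → ℕ × ℕ,
    (∀ n, (seqLam lam).n₀ ≤ n → ∃ f : Filling (lamDiagram lam n) n,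
      Monotone f ∧ ∀ i, 1 ≤ i → i ≤ n → cellOf f i = c i) ∧
    ∀ i, (seqLam lam).n₀ < i → c i = (0, i - 1 - lam.card) := by
  set N := (seqLam lam).n₀ with hN
  have hle : lam.card + lam.rowLen 0 ≤ N := le_max_right _ _
  obtain ⟨f, hf⟩ : ∃ f : Filling (lamDiagram lam N) N, Monotone f := by
    have := exists_standard_filling (lamDiagram lam N)
    rwa [card_lamDiagram hle] at this
  rw [monotone_iff_cellOf] at hf
  -- A standard tableau of shape λ^(N), continued by putting each i > N into the box of
  -- λ^(i)/λ^(i-1); in the first row this is the column i - 1 - |λ|, counted from zero.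
  let c : ℕ → ℕ × ℕ := fun i => if i ≤ N then cellOf f i else (0, i - 1 - lam.card)
  have h1 : ∀ i, i ≤ N → c i = cellOf f i := fun i h => if_pos h
  have h2 : ∀ i, N < i → c i = (0, i - 1 - lam.card) := fun i h => if_neg (by omega)
  have hmono : ∀ i j, 1 ≤ i → 1 ≤ j → c i ≤ c j → i ≤ j := by
    intro i j hi hj h
    rcases le_or_gt i N with hiN | hiN <;> rcases le_or_gt j N with hjN | hjN
    · rw [h1 i hiN, h1 j hjN] at h
      exact hf i j hi hiN hj hjN h
    · omega
    · rw [h2 i hiN, h1 j hjN] at h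
      exact absurd (cellOf_mem f hj hjN) (corner_notMem hle (by omega) h)
    · rw [h2 i hiN, h2 j hjN] at h
      have := h.2
      simp only at this
      omega
  refine ⟨c, fun n hn => ?_, h2⟩
  obtain ⟨g, hg⟩ := exists_filling (card_lamDiagram (hle.trans hn)) c
    (fun i hi hi' => by
      rcases le_or_gt i N with hiN | hiN
      · rw [h1 i hiN]
        exact lamDiagram_mono hn (cellOf_mem f hi hiN)
      · rw [h2 i hiN, mem_lamDiagram]
        exact Or.inl ⟨rfl, lt_max_of_lt_left (show i - 1 - lam.card < n - lam.card by omega)⟩)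
    (fun i j hi _ hj _ h => le_antisymm (hmono i j hi hj h.le) (hmono j i hj hi h.ge))
  refine ⟨g, (monotone_iff_cellOf g).mpr fun i j hi hi' hj hj' h => ?_, hg⟩
  rw [hg i hi hi', hg j hj hj'] at h
  exact hmono i j hi hj h

theorem seminormalT_of_same_row {μ : YoungDiagram} {n : ℕ} {f : Filling μ n} (hf : Monotone f)
    {i : ℕ} (h1 : 1 ≤ i) (h2 : i < n) (h : (cellOf f i).1 = (cellOf f (i + 1)).1) :
    seminormalT μ n i (basisVec f) = basisVec f := by
  conv_lhs => rw [basisVec, dif_pos hf, seminormalT, if_pos ⟨h1, h2⟩,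
    Finsupp.linearCombination_single, one_smul]
  exact if_pos h

theorem basisVec_ne_zero {μ : YoungDiagram} {n : ℕ} {f : Filling μ n} (hf : Monotone f) :
    basisVec f ≠ 0 := by
  rw [basisVec, dif_pos hf]
  exact Finsupp.single_ne_zero.mpr one_ne_zero

theorem prodUpTo_dX_eq_dMonomial {n k : ℕ} (h : k ≤ n) :
    prodUpTo (dX n) k = dMonomial n (fun i => if i ≤ k then 1 else 0) := by
  have : ∀ m, k ≤ m → prodUpTo (dX n) k =
      prodUpTo (fun i => dX n i ^ (if i ≤ k then 1 else 0)) m := by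
    intro m hm
    induction m, hm using Nat.le_induction with
    | base => exact prodUpTo_congr _ fun i _ h2 => by rw [if_pos h2, pow_one]
    | succ m hm ih =>
      rw [prodUpTo, ← ih, if_neg (by omega), pow_zero, mul_one]
  exact this n h

theorem sum_ite_le_eq {n k : ℕ} (h : k ≤ n) :
    ∑ i ∈ Finset.Icc 1 n, (if i ≤ k then 1 else 0) = k := by
  rw [← Finset.sum_filter, Finset.sum_const, smul_eq_mul, mul_one]
  have : (Finset.Icc 1 n).filter (fun i => i ≤ k) = Finset.Icc 1 k := by
    ext i
    simp only [Finset.mem_filter, Finset.mem_Icc]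
    omega
  rw [this, Nat.card_Icc, Nat.add_sub_cancel]

/-- The monomial structure yields a linear map that sends every X^β ⊗ u to u. -/
theorem indTensor_dMonomial_ne_zero {n : ℕ} (hn : 1 ≤ n) {U : Type} [AddCommGroup U] [Module Kqt U]
    (act : AHA n →ₐ[Kqt] Module.End Kqt U) (α : ℕ → ℕ) {u : U} (hu : u ≠ 0) :
    indTensor act (dMonomial n α) u ≠ 0 := by
  intro h
  apply hu
  have := indMonomialLift_dMonomial act hn (fun _ => LinearMap.id) (fun _ _ _ => rfl) α u
  rw [h, map_zero] at this
  exact this.symm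

theorem stableOf_ne_zero (D : DAHASequence) {k d : ℕ} {v : D.stableL k d} (hv : v ≠ 0) :
    D.stableOf k d v ≠ 0 := by
  intro h
  apply hv
  have := DirectSum.component.lof_self Kqt (ι := ℕ × ℕ) (M := fun p => D.stableL p.1 p.2) (k, d) v
  rw [← this]
  change DirectSum.component Kqt _ _ _ (D.stableOf k d v) = 0
  rw [h, map_zero]

/-- The witness lies in 𝔏_N(N) with N = n_λ and has the components X_1⋯X_N ⊗ e_{τ_n}. The exponent
of X_{n+1} is zero for n ≥ N, so Π acts only through κ, which sends e_{τ_{n+1}} to e_{τ_n}. -/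
theorem seqLam_stableSpace_nontrivial (lam : YoungDiagram)
    {p : ∀ n, IndSpace (n + 1) ((seqLam lam).act (n + 1)) →ₗ[Kqt] IndSpace n ((seqLam lam).act n)}
    (hp : ∀ n, (seqLam lam).n₀ ≤ n → (seqLam lam).IsIndMap n (p n)) :
    Nontrivial ((seqLam lam).ind p).stableSpace := by
  obtain ⟨c, hc, hc'⟩ := exists_stable_filling lam
  set N := (seqLam lam).n₀ with hN
  choose f hf hfc using hc
  have hN1 : 1 ≤ N := le_max_left _ _
  have hle : lam.card + lam.rowLen 0 ≤ N := le_max_right _ _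
  let α : ℕ → ℕ := fun i => if i ≤ N then 1 else 0
  let e : ∀ n, N ≤ n → (seqLam lam).U n := fun n h => basisVec (f n h)
  let w : ∀ n, N ≤ n → IndSpace n ((seqLam lam).act n) := fun n h =>
    indTensor ((seqLam lam).act n) (dMonomial n α) (e n h)
  have hκ : ∀ n h, (seqLam lam).κ n (e (n + 1) (Nat.le_succ_of_le h)) = e n h := by
    intro n h
    refine kappaLam_of_eq (hle.trans h) ?_ fun i h1 h2 => ?_
    · rw [hfc _ _ _ (by omega) le_rfl, hc' _ (by omega), Nat.add_sub_cancel]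
    · rw [hfc _ _ i h1 h2, hfc _ _ i h1 (by omega)]
  have hw : ∀ n h, w n h ∈ ((seqLam lam).ind p).finiteL n N := by
    intro n h
    refine (mem_spaceL (φ := ((seqLam lam).ind p).act n) h).mpr
      ⟨indTensor ((seqLam lam).act n) 1 (e n h), fun j h1 h2 => ?_, ?_⟩
    · have hT : (seqLam lam).act n (aT n j) (e n h) = e n h := by
        rw [seqLam_act_T (by omega) h2]
        -- Invariance of 1 ⊗ e_{τ_n}: for j > N both j and j + 1 lie in the first row, so T_j fixes
        -- e_{τ_n}.
        refine seminormalT_of_same_row (hf n h) (by omega) h2 ?_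
        rw [hfc n h j (by omega) h2.le, hfc n h (j + 1) (by omega) h2, hc' j h1, hc' _ (by omega)]
      exact (indTensor_coe _ (aT n j) (e n h)).trans (congrArg _ hT)
    · refine Eq.trans ?_ (smul_indTensor _ (prodUpTo (dX n) N) 1 (e n h)).symm
      rw [mul_one, prodUpTo_dX_eq_dMonomial h]
  have hgr : ∀ n h, w n h ∈ ((seqLam lam).ind p).gr n N := fun n h =>
    AHASequence.mem_indGr (C := seqLam lam) (e := 0) (u := e n h)
      (Submodule.mem_top (R := Kqt) (M := SpechtSpace (lamDiagram lam n) n)) (sum_ite_le_eq h)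
  have hproj : ∀ n h, p n (w (n + 1) (Nat.le_succ_of_le h)) = w n h := by
    intro n h
    refine (hp n h α _).trans ?_
    rw [if_pos (if_neg (by omega)), hκ n h]
  let v : ((seqLam lam).ind p).stableL N N :=
    ⟨fun n => w n.1 n.2, fun n => ⟨hw n.1 n.2, hgr n.1 n.2⟩, fun n h => hproj n h⟩
  have hv : v ≠ 0 := fun h0 =>
    indTensor_dMonomial_ne_zero hN1 ((seqLam lam).act N) α
      (basisVec_ne_zero (hf N le_rfl) : e N le_rfl ≠ 0)
      (congrFun (congrArg Subtype.val h0) ⟨N, le_rfl⟩)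
  exact ⟨_, _, stableOf_ne_zero _ hv⟩

end MurnaghanB

end

theorem mainTheorem3 (lam : YoungDiagram) :
    (seqLam lam).IsPreCompatible ∧
    (∀ n, (seqLam lam).n₀ ≤ n → ∃! p, (seqLam lam).IsIndMap n p) ∧
    ∀ p : (∀ n, IndSpace (n + 1) ((seqLam lam).act (n + 1)) →ₗ[Kqt] IndSpace n ((seqLam lam).act n)),
      (∀ n, (seqLam lam).n₀ ≤ n → (seqLam lam).IsIndMap n (p n)) →
        ((seqLam lam).ind p).IsCompatible ∧
        (∃! ρ, ((seqLam lam).ind p).IsBAction ρ) ∧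
        Nontrivial ((seqLam lam).ind p).stableSpace := by
  have hC := seqLam_isPreCompatible lam
  exact ⟨hC, fun n _ => (seqLam lam).existsUnique_isIndMap n, fun p hp =>
    ⟨hC.ind_isCompatible hp, (hC.ind_isCompatible hp).existsUnique_isBAction,
      seqLam_stableSpace_nontrivial lam hp⟩⟩
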